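/- Let $M$ be a smooth (Hausdorff) $n$-manifold, $r\in\mathbb N$, and $HM=\mathrm{Lor}(M)\times_M(M\times\mathbb R^2)$ the bundle whose sections are $h=(g,m^2,\kappa)$, $g$ a Lorentzian metric (locally of the form $\mathrm{diag}(-1,1,\dots,1)$) and $m^2,\kappa$ real functions. $J^rHM$ is the bundle of $r$-jets of local smooth sections, with canonical coordinates $(x^\mu,g_{\mu\nu,\Lambda},m^2_{\Lambda},\kappa_{\Lambda})$, $|\Lambda|\le r$, over every chart of $M$. Let $\Gamma^\alpha_{\mu\nu}$ be the Christoffel symbols, $\nabla$ the Levi-Civita connection and $R^\alpha{}_{\beta\mu\nu}=\partial_\mu\Gamma^\alpha_{\beta\nu}+\Gamma^\alpha_{\sigma\mu}\Gamma^\sigma_{\beta\nu}-\partial_\nu\Gamma^\alpha_{\beta\mu}-\Gamma^\alpha_{\sigma\nu}\Gamma^\sigma_{\beta\mu}$ the Riemann tensor of $g$; round brackets denote symmetrization. **(A) Coordinates.** Over every chart of $M$ with image $U\subseteq\mathbb R^n$, the canonical coordinates are related by a smooth, smoothly invertible transformation to $$\bigl(x^\mu,\ g_{\mu\nu},\ S^\alpha_{\lambda_1\dots\lambda_k\beta\mu}=\partial_{(\lambda_1\cdots\lambda_k}\Gamma^\alpha_{\beta\mu)}\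 (k\le r-1),\ Q^\alpha_{\lambda_1\dots\lambda_k\beta\mu\nu}=\nabla_{(\lambda_1\cdots\lambda_k}R^\alpha{}_{\beta\mu)\nu}\ (k\le r-2),\ \nabla_{(\Lambda)}m^2,\ \nabla_{(\Lambda)}\kappa\ (|\Lambda|\le r)\bigr).$$ The range of these coordinates is exactly the set of all arrays with $x\in U$, $g$ Lorentzian, $S$, $\nabla m^2$, $\nabla\kappa$ symmetric in all lower indices, $Q$ symmetric in all lower indices but $\nu$, $g_{\alpha\rho}Q^\rho_{\dots\nu}$ symmetric in $\alpha,\nu$, and the symmetrization of $Q^\alpha_{\dots\nu}$ over all lower indices equal to $0$. The transformation and its inverse extend smoothly to open neighbourhoods, in the spaces of all arrays, of the respective ranges. **(B) Covariance identities.** Let $f:J^rHM\to\mathbb R$ be smooth and diffeomorphism covariant: $f(j^r_x(\chi^*h))=f(j^r_{\chi(x)}h)$ for all $\chi\in\mathrm{Diff}(M)$, $x\in M$ and local sections $h$ near $\chi(x)$. Over every chart, $f$ is a smooth function $F$ of the coordinates in (A), and for every such $F$ (smooth on an open set of arrays containing the range), at every point of the range: (i) $\partial F/\partial x^\sigma=0$;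 (ii) $\partial F/\partial S^\alpha_{\lambda_1\dots\lambda_k\beta\mu}=0$ for all $k\le r-1$ (derivatives in the directions of arrays symmetric in the lower indices); (iii) for all $\sigma,\rho$, with summation over all values of the other indices, $$\begin{aligned}0={}&\frac{\partial F}{\partial g_{\mu\nu}}\bigl(\delta^\sigma_\mu g_{\rho\nu}+\delta^\sigma_\nu g_{\mu\rho}\bigr)+\sum_{k\le r-2}\frac{\partial F}{\partial Q^\alpha_{l_1\dots l_{k+3}}}\Bigl(-\delta^\alpha_\rho Q^\sigma_{l_1\dots l_{k+3}}+\sum_{s}\delta^\sigma_{l_s}Q^\alpha_{l_1\dots\rho\dots l_{k+3}}\Bigr)\\&+\sum_{k\le r}\frac{\partial F}{\partial\nabla_{\theta_1\dots\theta_k}m^2}\sum_s\delta^\sigma_{\theta_s}\nabla_{\theta_1\dots\rho\dots\theta_k}m^2+\sum_{k\le r}\frac{\partial F}{\partial\nabla_{\theta_1\dots\theta_k}\kappa}\sum_s\delta^\sigma_{\theta_s}\nabla_{\theta_1\dots\rho\dots\theta_k}\kappa,\end{aligned}$$ where $\rho$ replaces the $s$-th index. The same holds (existence of $F$, and (i)–(iii)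 for every such $F$ at all values taken by the coordinates) if the coordinates $Q$ are replaced by the whole tensors $\nabla_{(\lambda_1\cdots\lambda_k)}R^\alpha{}_{\beta\mu\nu}$, $k\le r-2$. **(C)** Consequently, over every chart with connected domain, $f$ is a function of covariant scalars: $f=\Theta(g,Q,\nabla m^2,\nabla\kappa)$, with $\Theta$ smooth on an open neighbourhood of the set $\mathcal T$ of the tensorial arrays $(g,Q,\nabla m^2,\nabla\kappa)$ satisfying the conditions in (A); the tensor action of every $A\in GL(n,\mathbb R)$ with $\det A>0$ preserves $\mathcal T$, and $\Theta(A\cdot t)=\Theta(t)$ for $t\in\mathcal T$. -/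

import Mathlib

open scoped Manifold ContDiff Topology

noncomputable section

namespace BackgroundJets

/-- The model space `ℝⁿ`. -/
abbrev Model (n : ℕ) : Type := EuclideanSpace ℝ (Fin n)

/-! ### Index arrays and symmetrization -/

/-- The permutations of `k` slots that move only the first `m` slots. -/
def permsFirst (m k : ℕ) : Finset (Equiv.Perm (Fin k)) :=
  Finset.univ.filter fun s => ∀ i : Fin k, m ≤ (i : ℕ) → s i = i

/-- Symmetrization (with weight `1 / m!`) over the first `m` of the `k` slots of an array. -/
def symFirst {n k : ℕ} (m : ℕ) (T : (Fin k → Fin n) → ℝ) (l : Fin k → Fin n) : ℝ :=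
  (∑ s ∈ permsFirst m k, T (l ∘ s)) / (Nat.factorial m : ℝ)

/-- The array is symmetric in its first `m` slots. -/
def IsSymFirst {n k : ℕ} (m : ℕ) (T : (Fin k → Fin n) → ℝ) : Prop :=
  ∀ s ∈ permsFirst m k, ∀ l, T (l ∘ s) = T l

/-- The Kronecker symbol. -/
def kron {n : ℕ} (a b : Fin n) : ℝ := if a = b then 1 else 0

/-- The diagonal entries `(-1, 1, …, 1)` of the standard Lorentzian form. -/
def eta {n : ℕ} (a : Fin n) : ℝ := if (a : ℕ) = 0 then -1 else 1

/-- Symmetric matrices congruent to `diag(-1, 1, …, 1)`. -/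
def IsLorentzMatrix {n : ℕ} (G : Fin n → Fin n → ℝ) : Prop :=
  ∃ P : Matrix (Fin n) (Fin n) ℝ, IsUnit P.det ∧ ∀ i j, G i j = ∑ a, eta a * P a i * P a j

/-! ### Tensor calculus in a chart -/

/-- The partial derivative `∂_μ φ`. -/
def pd {n : ℕ} (μ : Fin n) (φ : Model n → ℝ) (u : Model n) : ℝ :=
  fderiv ℝ φ u (EuclideanSpace.single μ 1)

/-- The iterated partial derivative `∂_{l 0} ∂_{l 1} ⋯ ∂_{l (k-1)} φ`. -/
def iterPd {n : ℕ} : (k : ℕ) → (Model n → ℝ) → (Fin k → Fin n) → Model n → ℝ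
  | 0, φ, _ => φ
  | k + 1, φ, l => pd (l 0) (iterPd k φ (Fin.tail l))

/-- The Christoffel symbols `Γ^α_{μν}` of a matrix-valued function. -/
def christoffel {n : ℕ} (G : Model n → Fin n → Fin n → ℝ) (α μ ν : Fin n) (u : Model n) : ℝ :=
  1 / 2 * ∑ β, (Matrix.of (G u))⁻¹ α β *
    (pd μ (fun v => G v ν β) u + pd ν (fun v => G v β μ) u - pd β (fun v => G v μ ν) u)

/-- `R^α_{βμν} = ∂_μ Γ^α_{βν} + Γ^α_{σμ} Γ^σ_{βν} - ∂_ν Γ^α_{βμ} - Γ^α_{σν} Γ^σ_{βμ}`. -/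
def riemann {n : ℕ} (G : Model n → Fin n → Fin n → ℝ) (α β μ ν : Fin n) (u : Model n) : ℝ :=
  pd μ (christoffel G α β ν) u
    + ∑ σ, christoffel G α σ μ u * christoffel G σ β ν u
    - pd ν (christoffel G α β μ) u
    - ∑ σ, christoffel G α σ ν u * christoffel G σ β μ u

/-- The iterated covariant derivatives of the Riemann tensor,
`∇_{λ₁} ⋯ ∇_{λ_k} R^α_{βμν}`; the lower indices are listed in the order
`(λ₁, …, λ_k, β, μ, ν)`. -/
def nablaRiemann {n : ℕ} (G : Model n → Fin n → Fin n → ℝ) :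
    (k : ℕ) → Fin n → (Fin (k + 3) → Fin n) → Model n → ℝ
  | 0, α, l, u => riemann G α (l 0) (l 1) (l 2) u
  | k + 1, α, l, u =>
      pd (l 0) (nablaRiemann G k α (Fin.tail l)) u
        + ∑ τ, christoffel G α (l 0) τ u * nablaRiemann G k τ (Fin.tail l) u
        - ∑ s : Fin (k + 3), ∑ τ, christoffel G τ (l 0) (Fin.tail l s) u *
            nablaRiemann G k α (Function.update (Fin.tail l) s τ) u

/-- The iterated covariant derivatives `∇_{λ₁} ⋯ ∇_{λ_k} φ` of a scalar function. -/
def nablaScalar {n : ℕ} (G : Model n → Fin n → Fin n → ℝ) (φ : Model n → ℝ) :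
    (k : ℕ) → (Fin k → Fin n) → Model n → ℝ
  | 0, _, u => φ u
  | k + 1, l, u =>
      pd (l 0) (nablaScalar G φ k (Fin.tail l)) u
        - ∑ s : Fin k, ∑ τ, christoffel G τ (l 0) (Fin.tail l s) u *
            nablaScalar G φ k (Function.update (Fin.tail l) s τ) u

/-- The derivatives `∂_{λ₁} ⋯ ∂_{λ_k} Γ^α_{βμ}`; lower indices in the order
`(λ₁, …, λ_k, β, μ)`. -/
def dChristoffel {n : ℕ} (G : Model n → Fin n → Fin n → ℝ) (k : ℕ) (α : Fin n)
    (l : Fin (k + 2) → Fin n) (u : Model n) : ℝ :=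
  iterPd k (christoffel G α (l (Fin.natAdd k 0)) (l (Fin.natAdd k 1)))
    (fun i => l (Fin.castAdd 2 i)) u

/-! ### Coordinate spaces -/

/-- Arrays `φ_{λ₁ … λ_k}`, `0 ≤ k ≤ r`. -/
abbrev ScalarArrays (n r : ℕ) : Type := (k : Fin (r + 1)) → (Fin (k : ℕ) → Fin n) → ℝ

/-- Arrays `g_{μν, λ₁ … λ_k}`, `0 ≤ k ≤ r`. -/
abbrev MetricArrays (n r : ℕ) : Type :=
  (k : Fin (r + 1)) → (Fin (k : ℕ) → Fin n) → Fin n → Fin n → ℝ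

/-- The space of the canonical jet coordinates `(x^μ, g_{μν,Λ}, m²_Λ, κ_Λ)`, `|Λ| ≤ r`. -/
abbrev JetCoord (n r : ℕ) : Type :=
  Model n × MetricArrays n r × ScalarArrays n r × ScalarArrays n r

/-- Arrays `S^α_{λ₁ … λ_k β μ}`, `0 ≤ k ≤ r - 1`. -/
abbrev SArrays (n r : ℕ) : Type :=
  (k : Fin r) → Fin n → (Fin ((k : ℕ) + 2) → Fin n) → ℝ

/-- Arrays of type `(1, k + 3)`, for `0 ≤ k ≤ r - 2`. -/
abbrev RArrays (n r : ℕ) : Type :=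
  (k : Fin (r - 1)) → Fin n → (Fin ((k : ℕ) + 3) → Fin n) → ℝ

/-- The space of the tensorial coordinates: metric, curvature, `m²` and `κ` parts. -/
abbrev TensorCoord (n r : ℕ) : Type :=
  (Fin n → Fin n → ℝ) × RArrays n r × ScalarArrays n r × ScalarArrays n r

/-- The space of all the covariant coordinates: point, `S`-part, tensorial part. -/
abbrev CovCoord (n r : ℕ) : Type := Model n × SArrays n r × TensorCoord n r

/-- The fully symmetric scalar arrays. -/
def SymScalar {n r : ℕ} (φ : ScalarArrays n r) : Prop :=
  ∀ k : Fin (r + 1), IsSymFirst (k : ℕ) (φ k)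

/-- The `S`-arrays symmetric in all the lower indices. -/
def SymS {n r : ℕ} (S : SArrays n r) : Prop :=
  ∀ (k : Fin r) (α : Fin n), IsSymFirst ((k : ℕ) + 2) (S k α)

/-- The range of the canonical jet coordinates over an open set `U ⊆ ℝⁿ`. -/
def jetDomain {n : ℕ} (r : ℕ) (U : Set (Model n)) : Set (JetCoord n r) :=
  {c | c.1 ∈ U ∧ (∀ l, IsLorentzMatrix (c.2.1 0 l)) ∧
    (∀ k l μ ν, c.2.1 k l μ ν = c.2.1 k l ν μ) ∧
    (∀ (k : Fin (r + 1)) (μ ν : Fin n), IsSymFirst (k : ℕ) (fun l => c.2.1 k l μ ν)) ∧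
    SymScalar c.2.2.1 ∧ SymScalar c.2.2.2}

/-- The algebraic constraints on the tensorial coordinates: `g` is Lorentzian;
`Q^α_{λ₁ … λ_{k+2} ν}` is symmetric in the `λ`'s, its lowered version
`g_{αρ} Q^ρ_{λ₁ … λ_{k+2} ν}` is symmetric in `α, ν`, its symmetrization over all the
lower indices vanishes; the scalar arrays are symmetric. -/
def tensorDomain (n r : ℕ) : Set (TensorCoord n r) :=
  {t | IsLorentzMatrix t.1 ∧
    (∀ (k : Fin (r - 1)) (α : Fin n), IsSymFirst ((k : ℕ) + 2) (t.2.1 k α)) ∧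
    (∀ (k : Fin (r - 1)) (α ν : Fin n) (l : Fin ((k : ℕ) + 2) → Fin n),
      ∑ ρ, t.1 α ρ * t.2.1 k ρ (Fin.snoc (α := fun _ => Fin n) l ν)
        = ∑ ρ, t.1 ν ρ * t.2.1 k ρ (Fin.snoc (α := fun _ => Fin n) l α)) ∧
    (∀ (k : Fin (r - 1)) (α : Fin n) (l : Fin ((k : ℕ) + 3) → Fin n),
      symFirst ((k : ℕ) + 3) (t.2.1 k α) l = 0) ∧
    SymScalar t.2.2.1 ∧ SymScalar t.2.2.2}

/-- The range of the covariant coordinates over an open set `U ⊆ ℝⁿ`. -/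
def covDomain {n : ℕ} (r : ℕ) (U : Set (Model n)) : Set (CovCoord n r) :=
  {c | c.1 ∈ U ∧ SymS c.2.1 ∧ c.2.2 ∈ tensorDomain n r}

/-! ### Partial derivatives in the covariant coordinates -/

section Derivatives

variable {n r : ℕ} (F : CovCoord n r → ℝ) (c : CovCoord n r)

/-- `∂F/∂g_{μν}`. -/
def dMetric (μ ν : Fin n) : ℝ :=
  fderiv ℝ F c (0, 0, Pi.single μ (Pi.single ν 1), 0, 0, 0)

/-- `∂F/∂Q^α_l`, for the curvature array of order `k`. -/
def dCurv (k : Fin (r - 1)) (α : Fin n) (l : Fin ((k : ℕ) + 3) → Fin n) : ℝ :=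
  fderiv ℝ F c (0, 0, 0, Pi.single k (Pi.single α (Pi.single l 1)), 0, 0)

/-- `∂F/∂(∇_l m²)`. -/
def dMass (k : Fin (r + 1)) (l : Fin (k : ℕ) → Fin n) : ℝ :=
  fderiv ℝ F c (0, 0, 0, 0, Pi.single k (Pi.single l 1), 0)

/-- `∂F/∂(∇_l κ)`. -/
def dKappa (k : Fin (r + 1)) (l : Fin (k : ℕ) → Fin n) : ℝ :=
  fderiv ℝ F c (0, 0, 0, 0, 0, Pi.single k (Pi.single l 1))

/-- `∂F/∂x^σ = 0` for all `σ`. -/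
def NoPointDependence : Prop :=
  ∀ σ : Fin n, fderiv ℝ F c (EuclideanSpace.single σ 1, 0, 0) = 0

/-- `∂F/∂S = 0` for all the `S`-coordinates: these are symmetric in their lower indices, so
the derivative of `F` is taken in the direction of any array with that symmetry. -/
def NoSDependence : Prop :=
  ∀ T : SArrays n r, SymS T → fderiv ℝ F c (0, T, 0) = 0

/-- The infinitesimal `GL(n)`-invariance identity, for all `σ, ρ`. -/
def GLIdentity : Prop :=
  ∀ σ ρ : Fin n,
    (∑ μ, ∑ ν, dMetric F c μ ν * (kron σ μ * c.2.2.1 ρ ν + kron σ ν * c.2.2.1 μ ρ))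
    + (∑ k, ∑ α, ∑ l, dCurv F c k α l *
        (-(kron α ρ * c.2.2.2.1 k σ l)
          + ∑ s, kron σ (l s) * c.2.2.2.1 k α (Function.update l s ρ)))
    + (∑ k, ∑ l, dMass F c k l *
        ∑ s, kron σ (l s) * c.2.2.2.2.1 k (Function.update l s ρ))
    + (∑ k, ∑ l, dKappa F c k l *
        ∑ s, kron σ (l s) * c.2.2.2.2.2 k (Function.update l s ρ)) = 0

end Derivatives

/-- The action of a matrix `A` with inverse `A⁻¹` on tensorial coordinates (the tensor
transformation law): lower indices are contracted with `A`, upper ones with `A⁻¹`. -/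
def glAct {n r : ℕ} (A : Matrix (Fin n) (Fin n) ℝ) (t : TensorCoord n r) : TensorCoord n r :=
  (fun μ ν => ∑ a, ∑ b, A a μ * A b ν * t.1 a b,
   fun k α l => ∑ τ, ∑ p : Fin ((k : ℕ) + 3) → Fin n,
     A⁻¹ α τ * (∏ s, A (p s) (l s)) * t.2.1 k τ p,
   fun k l => ∑ p : Fin (k : ℕ) → Fin n, (∏ s, A (p s) (l s)) * t.2.2.1 k p,
   fun k l => ∑ p : Fin (k : ℕ) → Fin n, (∏ s, A (p s) (l s)) * t.2.2.2 k p)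

/-! ### Local background geometries and their jets -/

section Manifold

variable {n : ℕ} {M : Type*} [TopologicalSpace M] [ChartedSpace (Model n) M]

/-- The components `g_{μν}(u) = g(∂_μ, ∂_ν)` in the chart `e`, at the point with
coordinates `u`. -/
def metricComp (e : OpenPartialHomeomorph M (Model n))
    (g : ∀ y : M, TangentSpace (𝓡 n) y →L[ℝ] TangentSpace (𝓡 n) y →L[ℝ] ℝ)
    (u : Model n) (μ ν : Fin n) : ℝ :=
  g (e.symm u)
    (mfderiv (𝓡 n) (𝓡 n) e.symm u (EuclideanSpace.single μ (1 : ℝ) : Model n))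
    (mfderiv (𝓡 n) (𝓡 n) e.symm u (EuclideanSpace.single ν (1 : ℝ) : Model n))

/-- A smooth section `h = (g, m², κ)` of `HM = Lor(M) ×_M (M × ℝ²)` on an open neighbourhood
`dom` of `x` (the values outside `dom` are irrelevant). -/
structure LocalGeometry (x : M) where
  /-- the domain of the section -/
  dom : Set M
  isOpen_dom : IsOpen dom
  mem_dom : x ∈ dom
  /-- the metric -/
  g : ∀ y : M, TangentSpace (𝓡 n) y →L[ℝ] TangentSpace (𝓡 n) y →L[ℝ] ℝ
  /-- the squared mass -/
  msq : M → ℝ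
  /-- the coupling to the curvature -/
  kappa : M → ℝ
  lorentz : ∀ y ∈ dom, ∃ b : Module.Basis (Fin n) ℝ (TangentSpace (𝓡 n) y),
    ∀ i j, g y (b i) (b j) = if i = j then eta i else 0
  smooth_g : ∀ e ∈ IsManifold.maximalAtlas (𝓡 n) ∞ M,
    ContDiffOn ℝ ∞ (metricComp e g) (e.target ∩ e.symm ⁻¹' dom)
  smooth_msq : ContMDiffOn (𝓡 n) 𝓘(ℝ, ℝ) ∞ msq dom
  smooth_kappa : ContMDiffOn (𝓡 n) 𝓘(ℝ, ℝ) ∞ kappa dom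

variable (r : ℕ) (e : OpenPartialHomeomorph M (Model n)) {x : M}

/-- The canonical coordinates `(x^μ, g_{μν,Λ}, m²_Λ, κ_Λ)` of the `r`-jet at `x` of a section,
in the chart `e`. -/
def jetCoord (h : LocalGeometry (n := n) x) : JetCoord n r :=
  (e x,
   fun k l μ ν => iterPd k (fun u => metricComp e h.g u μ ν) l (e x),
   fun k l => iterPd k (h.msq ∘ e.symm) l (e x),
   fun k l => iterPd k (h.kappa ∘ e.symm) l (e x))

/-- The `S`-coordinates `∂_{(λ₁ ⋯ λ_k} Γ^α_{β μ)}`, `k ≤ r - 1`. -/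
def sCoord (h : LocalGeometry (n := n) x) : SArrays n r :=
  fun k α => symFirst ((k : ℕ) + 2) fun l => dChristoffel (metricComp e h.g) k α l (e x)

/-- The symmetrized covariant derivatives `∇_{(λ₁ ⋯ λ_k)} φ`, `k ≤ r`, of a scalar. -/
def scalarCoord (h : LocalGeometry (n := n) x) (φ : M → ℝ) : ScalarArrays n r :=
  fun k => symFirst (k : ℕ) fun l => nablaScalar (metricComp e h.g) (φ ∘ e.symm) k l (e x)

/-- The tensorial coordinates `(g_{μν}, ∇_{(Λ} R^α_{βμ)ν}, ∇_{(Λ)} m², ∇_{(Λ)} κ)`. -/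
def tensorCoord (h : LocalGeometry (n := n) x) : TensorCoord n r :=
  (metricComp e h.g (e x),
   fun k α => symFirst ((k : ℕ) + 2) fun l => nablaRiemann (metricComp e h.g) k α l (e x),
   scalarCoord r e h h.msq,
   scalarCoord r e h h.kappa)

/-- The covariant coordinates
`(x^μ, g_{μν}, ∂_{(Λ} Γ^α_{βμ)}, ∇_{(Λ} R^α_{βμ)ν}, ∇_{(Λ)} m², ∇_{(Λ)} κ)`. -/
def covCoord (h : LocalGeometry (n := n) x) : CovCoord n r :=
  (e x, sCoord r e h, tensorCoord r e h)

/-- The variant of the covariant coordinates with the whole tensors `∇_{(Λ)} R^α_{βμν}`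
(symmetrized only over the derivative indices `Λ`) in place of `∇_{(Λ} R^α_{βμ)ν}`. -/
def fullCovCoord (h : LocalGeometry (n := n) x) : CovCoord n r :=
  (e x, sCoord r e h, metricComp e h.g (e x),
   fun k α => symFirst (k : ℕ) fun l => nablaRiemann (metricComp e h.g) k α l (e x),
   scalarCoord r e h h.msq,
   scalarCoord r e h h.kappa)

variable (n M)

/-- Two local sections have the same `r`-jet: they are based at the same point, and there, in
every chart, the partial derivatives up to order `r` of their components agree. -/
def jetSetoid : Setoid (Σ x : M, LocalGeometry (n := n) x) where
  r p q := p.1 = q.1 ∧ ∀ e ∈ IsManifold.maximalAtlas (𝓡 n) ∞ M, p.1 ∈ e.source →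
    jetCoord r e p.2 = jetCoord r e q.2
  iseqv :=
    { refl := fun _ => ⟨rfl, fun _ _ _ => rfl⟩
      symm := fun h => ⟨h.1.symm, fun e he hx => (h.2 e he (h.1 ▸ hx)).symm⟩
      trans := fun h h' => ⟨h.1.trans h'.1, fun e he hx =>
        (h.2 e he hx).trans (h'.2 e he (h.1 ▸ hx))⟩ }

/-- The jet bundle `J^r HM`. -/
def JetBundle : Type _ := Quotient (jetSetoid n M r)

variable {n M}

/-- The jet `j^r_x h`. -/
def jet (h : LocalGeometry (n := n) x) : JetBundle n M r := Quotient.mk (jetSetoid n M r) ⟨x, h⟩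

variable {r}

/-- `F` represents `f` over the chart `e`, in the coordinates `C` of the jets: `F` is smooth on
an open set that contains all the values of `C`, and `f (j^r_x h) = F (C h)`. -/
def Represents {V : Type*} [NormedAddCommGroup V] [NormedSpace ℝ V] (f : JetBundle n M r → ℝ)
    (C : ∀ {x : M}, LocalGeometry (n := n) x → V) (F : V → ℝ) : Prop :=
  ∃ U : Set V, IsOpen U ∧ ContDiffOn ℝ ∞ F U ∧
    ∀ x ∈ e.source, ∀ h : LocalGeometry (n := n) x, C h ∈ U ∧ f (jet r h) = F (C h)

/-- `f` is smooth on `J^r HM`: in every chart it is a smooth function of the canonical jet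
coordinates. -/
def SmoothOnJets (f : JetBundle n M r → ℝ) : Prop :=
  ∀ e ∈ IsManifold.maximalAtlas (𝓡 n) ∞ M, ∃ F, Represents e f (jetCoord r e) F

/-- `h' = χ^* h` near `x`. -/
def IsPullback (χ : M → M) {x : M} (h : LocalGeometry (n := n) (χ x))
    (h' : LocalGeometry (n := n) x) : Prop :=
  ∀ᶠ y in 𝓝 x,
    (∀ v w, h'.g y v w = h.g (χ y) (mfderiv (𝓡 n) (𝓡 n) χ y v) (mfderiv (𝓡 n) (𝓡 n) χ y w)) ∧
    h'.msq y = h.msq (χ y) ∧ h'.kappa y = h.kappa (χ y)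

/-- `f` is diffeomorphism covariant: `f (j^r_x (χ^* h)) = f (j^r_{χ x} h)` for every
diffeomorphism `χ` of `M`. -/
def DiffCovariant (f : JetBundle n M r → ℝ) : Prop :=
  ∀ (χ : M ≃ₘ^∞⟮𝓡 n, 𝓡 n⟯ M) (x : M) (h : LocalGeometry (n := n) (χ x))
    (h' : LocalGeometry (n := n) x), IsPullback χ h h' → f (jet r h') = f (jet r h)

end Manifold

end BackgroundJets

end

open BackgroundJets

/-!
The theorem has three parts: coordinates on jets, the effect of diffeomorphisms on them, and the
consequences for covariant functions.

**Coordinates.** The coordinates `S`, `Q`, `∇m²`, `∇κ` of a jet are computed on its polynomial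
representative (`covOfJet`). They are triangular in the order of the jet: if two metrics agree at a
point below order `k + 1`, the difference of their `S`-coordinates of order `k`, and of their
curvature coordinates of order `k - 1`, is linear in the difference of the derivatives of order
`k + 1`, and the lower coordinates agree (`polyEval_sOf_sub`, `polyEval_curvOf_sub`); the scalars
behave likewise. Reading symmetric arrays as homogeneous polynomials turns this linear map, with
the upper index lowered, into the two differential expressions `symbolS` and `symbolQ`, and Euler's
relation shows that it has an explicit inverse, `metricOfSymbol`, on the arrays that satisfy the
algebraic constraints (`metricOfSymbol_symbol`, `symbolS_metricOfSymbol`). Hence the coordinates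
determine the jet, order by order (`injOn_covOfJet`), and Newton's method for `covOfJet c = d`, with
this inverse as approximate inverse derivative, gains one order in every step
(`agreeBelow_newtonStep`). It ends after `r + 1` steps, so its result `jetOfCov` is a smooth inverse
(`jetOfCov_spec`), defined wherever the metric is nondegenerate. That the coordinates satisfy the
constraints is the pair symmetry and the antisymmetry of the curvature (`MetricOn.curvature_symm`,
`MetricOn.curvature_symFirst_eq_zero`).

**Diffeomorphisms.** A smooth contraction `W` with compact support in the image of a chart gives
a diffeomorphism of the manifold that reads `u ↦ u + W u` in the chart (`exists_diffeomorph`).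
Locally it can be every affine map near the identity (`eventually_exists_affine`), or the identity
plus any homogeneous polynomial of degree at least two (`exists_polynomial_perturbation`). Under
the former, the base point moves and the tensorial coordinates transform by the tensor action of the
linear part (`tensorOf_pull`). Under the latter, with a polynomial of degree `k + 2`, the
`S`-coordinates of order `k` are shifted by its derivatives and neither the lower ones nor the
tensorial coordinates change (`sOf_pull`, `sOf_pull_of_lt`); order by order, the `S`-coordinates can
be given any symmetric values (`exists_sCoord_eq`).

**Covariant functions.** A function `F` that represents a covariant function in the coordinates
therefore satisfies `F (x', S', A · t) = F (x, S, t)` for all symmetric `S'`, and all `x'` near `x`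
and `A` near the identity (`eventually_apply_eq`). Differentiation along curves gives the three
identities (`noPointDependence`, `noSDependence`, `glIdentity`); the same argument covers the whole
covariant derivatives of the curvature, which are also tensors and of which `Q` is a
symmetrization. Over a connected chart, `Θ t = F (x₀, 0, t)` represents the function, since its
values do not depend on the choice of `x₀` (`exists_invariant_function`). Its invariance near the
identity extends to all matrices with positive determinant, because they are products of matrices
that are joined to the identity by a segment of invertible matrices
(`matrix_induction_of_det_pos`, `glAct_invariant`).
-/

open scoped Manifold ContDiff Topology

noncomputable section

namespace BackgroundJets

/-! ### Symmetric arrays, symmetrization and polarization -/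

/-- The array is invariant under all permutations of its slots. -/
def Sym {n k : ℕ} (T : (Fin k → Fin n) → ℝ) : Prop :=
  ∀ (s : Equiv.Perm (Fin k)) l, T (l ∘ s) = T l

lemma isSymFirst_self_iff {n k : ℕ} {T : (Fin k → Fin n) → ℝ} : IsSymFirst k T ↔ Sym T := by
  refine ⟨fun h s l => h s ?_ l, fun h s _ l => h s l⟩
  simp only [permsFirst, Finset.mem_filter, Finset.mem_univ, true_and]
  exact fun i hi => absurd i.2 (by omega)

lemma mem_permsFirst {m k : ℕ} {s : Equiv.Perm (Fin k)} :
    s ∈ permsFirst m k ↔ ∀ i : Fin k, m ≤ (i : ℕ) → s i = i := by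
  simp [permsFirst]

lemma permsFirst_mul {m k : ℕ} {s t : Equiv.Perm (Fin k)} (hs : s ∈ permsFirst m k)
    (ht : t ∈ permsFirst m k) : s * t ∈ permsFirst m k := by
  rw [mem_permsFirst] at *
  intro i hi
  rw [Equiv.Perm.mul_apply, ht i hi, hs i hi]

lemma permsFirst_inv {m k : ℕ} {s : Equiv.Perm (Fin k)} (hs : s ∈ permsFirst m k) :
    s⁻¹ ∈ permsFirst m k := by
  rw [mem_permsFirst] at *
  intro i hi
  rw [Equiv.Perm.inv_eq_iff_eq, hs i hi]

lemma permsFirst_mono {m m' k : ℕ} (h : m ≤ m') : permsFirst m k ⊆ permsFirst m' k := by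
  intro s hs
  rw [mem_permsFirst] at *
  exact fun i hi => hs i (h.trans hi)

lemma card_permsFirst {m k : ℕ} (h : m ≤ k) : (permsFirst m k).card = m.factorial := by
  have e := Equiv.Perm.subtypeEquivSubtypePerm (fun i : Fin k => (i : ℕ) < m)
  have h1 : Fintype.card {i : Fin k // (i : ℕ) < m} = m := by
    rw [Fintype.card_subtype]
    have : (Finset.univ.filter fun i : Fin k => (i : ℕ) < m) =
        Finset.univ.map (Fin.castLEEmb h) := by
      ext i
      simp only [Finset.mem_filter, Finset.mem_univ, true_and, Finset.mem_map,
        Fin.castLEEmb_apply]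
      exact ⟨fun hi => ⟨⟨i, hi⟩, rfl⟩, fun ⟨j, hj⟩ => hj ▸ j.2⟩
    rw [this]; simp
  have h2 : Fintype.card (Equiv.Perm {i : Fin k // (i : ℕ) < m}) = m.factorial := by
    rw [Fintype.card_perm, h1]
  rw [← h2, Fintype.card_congr e, Fintype.card_subtype]
  congr 1
  ext s
  simp [permsFirst]

lemma sum_permsFirst_mul_right {m k : ℕ} {t : Equiv.Perm (Fin k)} (ht : t ∈ permsFirst m k)
    (f : Equiv.Perm (Fin k) → ℝ) :
    ∑ s ∈ permsFirst m k, f (s * t) = ∑ s ∈ permsFirst m k, f s := by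
  refine Finset.sum_bij' (fun s _ => s * t) (fun s _ => s * t⁻¹)
    (fun s hs => permsFirst_mul hs ht) (fun s hs => permsFirst_mul hs (permsFirst_inv ht))
    (fun s _ => by simp) (fun s _ => by simp) (fun s _ => rfl)

lemma sum_permsFirst_mul_left {m k : ℕ} {t : Equiv.Perm (Fin k)} (ht : t ∈ permsFirst m k)
    (f : Equiv.Perm (Fin k) → ℝ) :
    ∑ s ∈ permsFirst m k, f (t * s) = ∑ s ∈ permsFirst m k, f s := by
  refine Finset.sum_bij' (fun s _ => t * s) (fun s _ => t⁻¹ * s)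
    (fun s hs => permsFirst_mul ht hs) (fun s hs => permsFirst_mul (permsFirst_inv ht) hs)
    (fun s _ => by simp) (fun s _ => by simp) (fun s _ => rfl)

lemma isSymFirst_symFirst {n k : ℕ} (m : ℕ) (T : (Fin k → Fin n) → ℝ) :
    IsSymFirst m (symFirst m T) := by
  intro t ht l
  unfold symFirst
  congr 1
  exact sum_permsFirst_mul_left ht (fun s => T (l ∘ s))

lemma symFirst_of_isSymFirst {n k m : ℕ} (h : m ≤ k) {T : (Fin k → Fin n) → ℝ}
    (hT : IsSymFirst m T) : symFirst m T = T := by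
  funext l
  unfold symFirst
  rw [Finset.sum_congr rfl (fun s hs => hT s hs l), Finset.sum_const, card_permsFirst h,
    nsmul_eq_mul]
  field_simp

lemma symFirst_symFirst {n k m m' : ℕ} (h : m ≤ m') (h' : m' ≤ k) (T : (Fin k → Fin n) → ℝ) :
    symFirst m' (symFirst m T) = symFirst m' T := by
  funext l
  unfold symFirst
  congr 1
  rw [← Finset.sum_div, Finset.sum_comm]
  have : ∀ t ∈ permsFirst m k, ∑ s ∈ permsFirst m' k, T ((l ∘ s) ∘ t) =
      ∑ s ∈ permsFirst m' k, T (l ∘ s) := fun t ht =>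
    sum_permsFirst_mul_right (permsFirst_mono h ht) (fun s => T (l ∘ s))
  rw [Finset.sum_congr rfl this, Finset.sum_const, card_permsFirst (h.trans h'), nsmul_eq_mul]
  field_simp

lemma symFirst_add {n k m : ℕ} (T T' : (Fin k → Fin n) → ℝ) (l : Fin k → Fin n) :
    symFirst m (fun l => T l + T' l) l = symFirst m T l + symFirst m T' l := by
  simp [symFirst, Finset.sum_add_distrib, add_div]

lemma symFirst_sub {n k m : ℕ} (T T' : (Fin k → Fin n) → ℝ) (l : Fin k → Fin n) :
    symFirst m (fun l => T l - T' l) l = symFirst m T l - symFirst m T' l := by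
  simp [symFirst, Finset.sum_sub_distrib, sub_div]

lemma symFirst_const_mul {n k m : ℕ} (c : ℝ) (T : (Fin k → Fin n) → ℝ) (l : Fin k → Fin n) :
    symFirst m (fun l => c * T l) l = c * symFirst m T l := by
  simp only [symFirst, ← Finset.mul_sum, mul_div_assoc]

lemma symFirst_sum {n k m : ℕ} {ι : Type*} (s : Finset ι) (T : ι → (Fin k → Fin n) → ℝ)
    (l : Fin k → Fin n) :
    symFirst m (fun l => ∑ i ∈ s, T i l) l = ∑ i ∈ s, symFirst m (T i) l := by
  simp only [symFirst]
  rw [Finset.sum_comm, Finset.sum_div]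

/-- Symmetrizing an array that is antisymmetric under a permutation of the symmetrized slots
gives zero. -/
lemma symFirst_eq_zero_of_antisymm {n k m : ℕ} {T : (Fin k → Fin n) → ℝ} {t : Equiv.Perm (Fin k)}
    (ht : t ∈ permsFirst m k) (hT : ∀ l, T (l ∘ t) = - T l) (l : Fin k → Fin n) :
    symFirst m T l = 0 := by
  have h := sum_permsFirst_mul_right ht (fun s => T (l ∘ s))
  have h2 : ∀ s : Equiv.Perm (Fin k), T (l ∘ (s * t : Equiv.Perm (Fin k))) = - T (l ∘ s) :=
    fun s => hT (l ∘ s)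
  simp only [h2, Finset.sum_neg_distrib] at h
  unfold symFirst
  rw [show ∑ s ∈ permsFirst m k, T (l ∘ s) = 0 by linarith, zero_div]

/-- The extension of a permutation of `k` slots by a fixed last slot. -/
def extendLast {k : ℕ} (s : Equiv.Perm (Fin k)) : Equiv.Perm (Fin (k + 1)) :=
  (finSuccEquivLast.trans (Equiv.optionCongr s)).trans finSuccEquivLast.symm

lemma extendLast_castSucc {k : ℕ} (s : Equiv.Perm (Fin k)) (i : Fin k) :
    extendLast s i.castSucc = (s i).castSucc := by
  simp [extendLast]

lemma extendLast_last {k : ℕ} (s : Equiv.Perm (Fin k)) :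
    extendLast s (Fin.last k) = Fin.last k := by
  simp [extendLast]

lemma extendLast_injective {k : ℕ} :
    Function.Injective (extendLast : Equiv.Perm (Fin k) → Equiv.Perm (Fin (k + 1))) := by
  intro s t h
  ext i
  have := congrArg (fun p : Equiv.Perm (Fin (k + 1)) => p i.castSucc) h
  simp only [extendLast_castSucc] at this
  exact congrArg Fin.val (Fin.castSucc_injective _ this)

lemma snoc_comp_extendLast {k : ℕ} {α : Type*} (s : Equiv.Perm (Fin k)) (l : Fin k → α) (a : α) :
    (Fin.snoc (α := fun _ => α) l a) ∘ extendLast s = Fin.snoc (α := fun _ => α) (l ∘ s) a := by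
  funext i
  refine Fin.lastCases ?_ (fun i => ?_) i
  · simp [extendLast_last]
  · simp [extendLast_castSucc]

lemma permsFirst_succ_eq {k : ℕ} :
    permsFirst k (k + 1) = Finset.univ.map ⟨extendLast, extendLast_injective⟩ := by
  symm
  refine Finset.eq_of_subset_of_card_le ?_ ?_
  · intro s hs
    simp only [Finset.mem_map, Finset.mem_univ, true_and, Function.Embedding.coeFn_mk] at hs
    obtain ⟨t, rfl⟩ := hs
    rw [mem_permsFirst]
    intro i hi
    have : i = Fin.last k := Fin.ext (by simp; omega)
    rw [this, extendLast_last]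
  · rw [card_permsFirst (Nat.le_succ k), Finset.card_map, Finset.card_univ, Fintype.card_perm,
      Fintype.card_fin]

/-- Symmetrizing all slots but the last commutes with fixing the last slot. -/
lemma symFirst_snoc {n k : ℕ} (T : (Fin (k + 1) → Fin n) → ℝ) (l : Fin k → Fin n) (a : Fin n) :
    symFirst k T (Fin.snoc (α := fun _ => Fin n) l a) =
      symFirst k (fun l => T (Fin.snoc (α := fun _ => Fin n) l a)) l := by
  unfold symFirst
  rw [permsFirst_succ_eq, Finset.sum_map]
  congr 1
  have : permsFirst k k = Finset.univ := by
    ext s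
    simp only [mem_permsFirst, Finset.mem_univ, iff_true]
    exact fun i hi => absurd i.2 (by omega)
  rw [this]
  refine Finset.sum_congr rfl fun s _ => ?_
  simp only [Function.Embedding.coeFn_mk]
  rw [snoc_comp_extendLast]

lemma isSymFirst_succ_iff {n k : ℕ} {T : (Fin (k + 1) → Fin n) → ℝ} :
    IsSymFirst k T ↔ ∀ a, Sym (fun l => T (Fin.snoc (α := fun _ => Fin n) l a)) := by
  constructor
  · intro h a s l
    have := h (extendLast s) (by
      rw [permsFirst_succ_eq]; exact Finset.mem_map.2 ⟨s, Finset.mem_univ _, rfl⟩)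
      (Fin.snoc (α := fun _ => Fin n) l a)
    rw [snoc_comp_extendLast] at this
    exact this
  · intro h s hs l
    rw [permsFirst_succ_eq] at hs
    obtain ⟨t, -, rfl⟩ := Finset.mem_map.1 hs
    have hl : l = Fin.snoc (α := fun _ => Fin n) (Fin.init l) (l (Fin.last k)) :=
      (Fin.snoc_init_self l).symm
    rw [hl]
    simp only [Function.Embedding.coeFn_mk]
    rw [snoc_comp_extendLast]
    exact h _ t _

lemma Sym.symFirst_eq {n k : ℕ} {T : (Fin k → Fin n) → ℝ} (h : Sym T) : symFirst k T = T :=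
  symFirst_of_isSymFirst le_rfl (isSymFirst_self_iff.2 h)

/-! Slots added at the front. -/

lemma cons_comp_decomposeFin {k : ℕ} {α : Type*} (s : Equiv.Perm (Fin k)) (l : Fin k → α) (a : α) :
    (Fin.cons (α := fun _ => α) a l) ∘ (Equiv.Perm.decomposeFin.symm ((0 : Fin (k + 1)), s)) =
      Fin.cons (α := fun _ => α) a (l ∘ s) := by
  funext i
  refine Fin.cases ?_ (fun i => ?_) i
  · simp
  · simp

lemma Sym.cons {n k : ℕ} {T : (Fin (k + 1) → Fin n) → ℝ} (h : Sym T) (a : Fin n) :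
    Sym (fun l => T (Fin.cons (α := fun _ => Fin n) a l)) := by
  intro s l
  have := h (Equiv.Perm.decomposeFin.symm ((0 : Fin (k + 1)), s)) (Fin.cons (α := fun _ => Fin n) a l)
  rwa [cons_comp_decomposeFin] at this

lemma Sym.cons_cons {n k : ℕ} {T : (Fin (k + 2) → Fin n) → ℝ} (h : Sym T) (a b : Fin n)
    (l : Fin k → Fin n) :
    T (Fin.cons (α := fun _ => Fin n) a (Fin.cons (α := fun _ => Fin n) b l)) =
      T (Fin.cons (α := fun _ => Fin n) b (Fin.cons (α := fun _ => Fin n) a l)) := by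
  rw [← h (Equiv.swap 0 1)]
  congr 1
  funext i
  refine Fin.cases ?_ (fun i => ?_) i
  · simp
  · refine Fin.cases ?_ (fun i => ?_) i
    · simp
    · have : (Equiv.swap (0 : Fin (k + 2)) 1) i.succ.succ = i.succ.succ :=
        Equiv.swap_apply_of_ne_of_ne (Fin.succ_ne_zero _) (by
          rw [← Fin.succ_zero_eq_one]; exact fun h => Fin.succ_ne_zero _ (Fin.succ_injective _ h))
      simp [this]

lemma cons_comp_finRotate {k : ℕ} {α : Type*} (l : Fin k → α) (a : α) :
    (Fin.cons (α := fun _ => α) a l) ∘ finRotate (k + 1) = Fin.snoc (α := fun _ => α) l a := by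
  exact (Fin.snoc_eq_cons_rotate _ _).symm

lemma Sym.snoc_eq_cons {n k : ℕ} {T : (Fin (k + 1) → Fin n) → ℝ} (h : Sym T) (a : Fin n)
    (l : Fin k → Fin n) :
    T (Fin.snoc (α := fun _ => Fin n) l a) = T (Fin.cons (α := fun _ => Fin n) a l) := by
  rw [← cons_comp_finRotate, h]

lemma sum_cons {n k : ℕ} (f : (Fin (k + 1) → Fin n) → ℝ) :
    ∑ l, f l = ∑ a, ∑ l : Fin k → Fin n, f (Fin.cons (α := fun _ => Fin n) a l) := by
  rw [← Fintype.sum_prod_type']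
  exact (Fintype.sum_equiv (Fin.consEquiv fun _ => Fin n) _ _ fun p => rfl).symm

lemma sum_snoc {n k : ℕ} (f : (Fin (k + 1) → Fin n) → ℝ) :
    ∑ l, f l = ∑ a, ∑ l : Fin k → Fin n, f (Fin.snoc (α := fun _ => Fin n) l a) := by
  rw [← Fintype.sum_prod_type']
  exact (Fintype.sum_equiv (Fin.snocEquiv fun _ => Fin n) _ _ fun p => rfl).symm

/-- The homogeneous polynomial `∑ T_{l₁ … l_k} ξ^{l₁} ⋯ ξ^{l_k}` of an array. -/
def polyEval {n k : ℕ} (T : (Fin k → Fin n) → ℝ) (ξ : Model n) : ℝ :=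
  ∑ l, T l * ∏ i, ξ (l i)

/-- The polynomial of an array sees only its symmetrization. -/
lemma polyEval_symFirst {n k : ℕ} (T : (Fin k → Fin n) → ℝ) (ξ : Model n) :
    polyEval (symFirst k T) ξ = polyEval T ξ := by
  have key : ∀ s : Equiv.Perm (Fin k), ∑ l : Fin k → Fin n, T (l ∘ s) * ∏ i, ξ (l i) =
      ∑ l, T l * ∏ i, ξ (l i) := by
    intro s
    refine Fintype.sum_equiv (Equiv.arrowCongr s.symm (Equiv.refl _)) _ _ fun l => ?_
    have h1 : (Equiv.arrowCongr s.symm (Equiv.refl (Fin n))) l = l ∘ s := by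
      funext i; simp [Equiv.arrowCongr]
    rw [h1]
    congr 1
    exact (Equiv.prod_comp s (fun i => ξ (l i))).symm
  unfold polyEval symFirst
  simp only [div_mul_eq_mul_div, Finset.sum_mul]
  rw [← Finset.sum_div, Finset.sum_comm, Finset.sum_congr rfl (fun s _ => key s), Finset.sum_const,
    card_permsFirst le_rfl, nsmul_eq_mul]
  field_simp

lemma polyEval_zero_slots {n : ℕ} (T : (Fin 0 → Fin n) → ℝ) (ξ : Model n) :
    polyEval T ξ = T Fin.elim0 := by
  simp [polyEval, Subsingleton.elim (default : Fin 0 → Fin n) Fin.elim0]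

lemma polyEval_succ {n k : ℕ} (T : (Fin (k + 1) → Fin n) → ℝ) (ξ : Model n) :
    polyEval T ξ = ∑ a, ξ a * polyEval (fun l => T (Fin.cons (α := fun _ => Fin n) a l)) ξ := by
  unfold polyEval
  rw [sum_cons]
  refine Finset.sum_congr rfl fun a _ => ?_
  rw [Finset.mul_sum]
  refine Finset.sum_congr rfl fun l _ => ?_
  rw [Fin.prod_univ_succ]
  simp only [Fin.cons_zero, Fin.cons_succ]
  ring

lemma polyEval_succ_last {n k : ℕ} (T : (Fin (k + 1) → Fin n) → ℝ) (ξ : Model n) :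
    polyEval T ξ = ∑ a, ξ a * polyEval (fun l => T (Fin.snoc (α := fun _ => Fin n) l a)) ξ := by
  unfold polyEval
  rw [sum_snoc]
  refine Finset.sum_congr rfl fun a _ => ?_
  rw [Finset.mul_sum]
  refine Finset.sum_congr rfl fun l _ => ?_
  rw [Fin.prod_univ_castSucc]
  simp only [Fin.snoc_castSucc, Fin.snoc_last]
  ring

lemma polyEval_add {n k : ℕ} (T T' : (Fin k → Fin n) → ℝ) (ξ : Model n) :
    polyEval (fun l => T l + T' l) ξ = polyEval T ξ + polyEval T' ξ := by
  simp [polyEval, add_mul, Finset.sum_add_distrib]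

lemma polyEval_sub {n k : ℕ} (T T' : (Fin k → Fin n) → ℝ) (ξ : Model n) :
    polyEval (fun l => T l - T' l) ξ = polyEval T ξ - polyEval T' ξ := by
  simp [polyEval, sub_mul, Finset.sum_sub_distrib]

lemma polyEval_const_mul {n k : ℕ} (c : ℝ) (T : (Fin k → Fin n) → ℝ) (ξ : Model n) :
    polyEval (fun l => c * T l) ξ = c * polyEval T ξ := by
  simp [polyEval, mul_assoc, Finset.mul_sum]

lemma polyEval_sum {n k : ℕ} {ι : Type*} (s : Finset ι) (T : ι → (Fin k → Fin n) → ℝ)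
    (ξ : Model n) : polyEval (fun l => ∑ i ∈ s, T i l) ξ = ∑ i ∈ s, polyEval (T i) ξ := by
  simp only [polyEval, Finset.sum_mul]
  exact Finset.sum_comm

lemma contDiff_polyEval {n k : ℕ} (T : (Fin k → Fin n) → ℝ) : ContDiff ℝ ∞ (polyEval T) := by
  unfold polyEval
  fun_prop

/-! ### Partial derivatives -/

section PartialDerivatives

variable {n : ℕ} {Ω : Set (Model n)} {f g : Model n → ℝ} {u x : Model n}

lemma differentiableAt_of_contDiffOn {E F : Type*} [NormedAddCommGroup E] [NormedSpace ℝ E]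
    [NormedAddCommGroup F] [NormedSpace ℝ F] {s : Set E} {f : E → F} {u : E}
    (hs : IsOpen s) (hf : ContDiffOn ℝ ∞ f s) (hu : u ∈ s) : DifferentiableAt ℝ f u :=
  (hf.contDiffAt (hs.mem_nhds hu)).differentiableAt (by simp)

lemma pd_add (hf : DifferentiableAt ℝ f u) (hg : DifferentiableAt ℝ g u) (μ : Fin n) :
    pd μ (fun v => f v + g v) u = pd μ f u + pd μ g u := by
  unfold pd; rw [fderiv_fun_add hf hg]; rfl

lemma pd_sub (hf : DifferentiableAt ℝ f u) (hg : DifferentiableAt ℝ g u) (μ : Fin n) :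
    pd μ (fun v => f v - g v) u = pd μ f u - pd μ g u := by
  unfold pd; rw [fderiv_fun_sub hf hg]; rfl

lemma pd_sub_sub {h : Model n → ℝ} (hf : DifferentiableAt ℝ f u) (hg : DifferentiableAt ℝ g u)
    (hh : DifferentiableAt ℝ h u) (μ : Fin n) :
    pd μ (fun v => f v - g v - h v) u = pd μ f u - pd μ g u - pd μ h u := by
  rw [pd_sub (f := fun v => f v - g v) (hf.sub hg) hh, pd_sub hf hg]

lemma pd_mul (hf : DifferentiableAt ℝ f u) (hg : DifferentiableAt ℝ g u) (μ : Fin n) :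
    pd μ (fun v => f v * g v) u = pd μ f u * g u + f u * pd μ g u := by
  unfold pd; rw [fderiv_fun_mul hf hg]; simp; ring

lemma pd_const_mul (hf : DifferentiableAt ℝ f u) (c : ℝ) (μ : Fin n) :
    pd μ (fun v => c * f v) u = c * pd μ f u := by
  unfold pd; rw [fderiv_const_mul hf]; rfl

lemma pd_sum {ι : Type*} {s : Finset ι} {f : ι → Model n → ℝ}
    (hf : ∀ i ∈ s, DifferentiableAt ℝ (f i) u) (μ : Fin n) :
    pd μ (fun v => ∑ i ∈ s, f i v) u = ∑ i ∈ s, pd μ (f i) u := by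
  unfold pd; rw [fderiv_fun_sum hf]; simp

lemma pd_const (c : ℝ) (μ : Fin n) : pd μ (fun _ : Model n => c) u = 0 := by
  simp [pd]

lemma pd_coord (i μ : Fin n) : pd μ (fun v : Model n => v i) u = kron i μ := by
  have h : HasFDerivAt (fun v : Model n => v i) (EuclideanSpace.proj (𝕜 := ℝ) i) u :=
    (EuclideanSpace.proj (𝕜 := ℝ) i : Model n →L[ℝ] ℝ).hasFDerivAt
  simp [pd, h.fderiv, kron]

lemma pd_congr_of_eventuallyEq (h : f =ᶠ[𝓝 u] g) (μ : Fin n) : pd μ f u = pd μ g u := by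
  unfold pd; rw [h.fderiv_eq]

lemma eqOn_pd (hΩ : IsOpen Ω) (h : Set.EqOn f g Ω) (μ : Fin n) :
    Set.EqOn (pd μ f) (pd μ g) Ω := fun _ hu =>
  pd_congr_of_eventuallyEq (Filter.eventuallyEq_of_mem (hΩ.mem_nhds hu) h) μ

lemma contDiffOn_pd (hΩ : IsOpen Ω) (hf : ContDiffOn ℝ ∞ f Ω) (μ : Fin n) :
    ContDiffOn ℝ ∞ (pd μ f) Ω :=
  (hf.fderiv_of_isOpen hΩ (by simp)).clm_apply contDiffOn_const

lemma pd_comm (hf : ContDiffAt ℝ ∞ f u) (μ ν : Fin n) :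
    pd μ (pd ν f) u = pd ν (pd μ f) u := by
  have hs : IsSymmSndFDerivAt ℝ f u :=
    hf.isSymmSndFDerivAt (by simp [minSmoothness_of_isRCLikeNormedField]; exact WithTop.coe_le_coe.2 (le_top : (2 : ℕ∞) ≤ ⊤))
  have hd : DifferentiableAt ℝ (fderiv ℝ f) u :=
    (hf.fderiv_right (m := ∞) (by simp)).differentiableAt (by simp)
  unfold pd
  have h : ∀ v w : Model n, fderiv ℝ (fun y => fderiv ℝ f y v) u w =
      fderiv ℝ (fderiv ℝ f) u w v := fun v w => by
    rw [fderiv_clm_apply hd (differentiableAt_const v)]; simp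
  change fderiv ℝ (fun y => fderiv ℝ f y _) u _ = fderiv ℝ (fun y => fderiv ℝ f y _) u _
  rw [h, h]
  exact hs _ _

lemma fderiv_eq_sum_pd (v : Model n) : fderiv ℝ f u v = ∑ a, v a * pd a f u := by
  have hv : v = ∑ a, v a • EuclideanSpace.single a (1 : ℝ) := by
    ext i
    simp [Finset.sum_apply, Pi.single_apply]
  conv_lhs => rw [hv]
  simp [pd]

lemma pd_comp {X : Model n → Model n} (hf : DifferentiableAt ℝ f (X u))
    (hX : DifferentiableAt ℝ X u) (μ : Fin n) :
    pd μ (fun v => f (X v)) u = ∑ a, pd μ (fun v => X v a) u * pd a f (X u) := by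
  have h1 : ∀ a, pd μ (fun v => X v a) u = (fderiv ℝ X u (EuclideanSpace.single μ 1)) a := by
    intro a
    have := ((EuclideanSpace.proj (𝕜 := ℝ) a : Model n →L[ℝ] ℝ).hasFDerivAt.comp u
      hX.hasFDerivAt).fderiv
    unfold pd
    change fderiv ℝ ((EuclideanSpace.proj (𝕜 := ℝ) a : Model n →L[ℝ] ℝ) ∘ X) u _ = _
    rw [this]; rfl
  simp only [h1]
  rw [← fderiv_eq_sum_pd]
  unfold pd
  change fderiv ℝ (f ∘ X) u _ = _
  rw [fderiv_comp u hf hX]; rfl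

lemma iterPd_congr (hΩ : IsOpen Ω) (h : Set.EqOn f g Ω) (k : ℕ) (l : Fin k → Fin n) :
    Set.EqOn (iterPd k f l) (iterPd k g l) Ω := by
  induction k with
  | zero => exact h
  | succ k ih => exact eqOn_pd hΩ (ih _) _

lemma contDiffOn_iterPd (hΩ : IsOpen Ω) (hf : ContDiffOn ℝ ∞ f Ω) (k : ℕ) (l : Fin k → Fin n) :
    ContDiffOn ℝ ∞ (iterPd k f l) Ω := by
  induction k with
  | zero => exact hf
  | succ k ih => exact contDiffOn_pd hΩ (ih _) _

/-- The innermost derivative can be split off instead of the outermost one. -/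
lemma iterPd_snoc (k : ℕ) (f : Model n → ℝ) (l : Fin k → Fin n) (a : Fin n) :
    iterPd (k + 1) f (Fin.snoc (α := fun _ => Fin n) l a) = iterPd k (pd a f) l := by
  induction k with
  | zero =>
    funext v
    simp [iterPd, Fin.snoc]
  | succ k ih =>
    have h1 : Fin.tail (Fin.snoc (α := fun _ => Fin n) l a) =
        Fin.snoc (α := fun _ => Fin n) (Fin.tail l) a := by
      funext i
      refine Fin.lastCases ?_ (fun i => ?_) i
      · rw [Fin.tail, Fin.succ_last, Fin.snoc_last, Fin.snoc_last]
      · simp [Fin.tail, ← Fin.castSucc_succ]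
    have h2 : (Fin.snoc (α := fun _ => Fin n) l a : Fin (k + 2) → Fin n) 0 = l 0 := by
      rw [← Fin.castSucc_zero, Fin.snoc_castSucc]
    change pd ((Fin.snoc (α := fun _ => Fin n) l a : Fin (k + 2) → Fin n) 0) (iterPd (k + 1) f
      (Fin.tail (Fin.snoc (α := fun _ => Fin n) l a))) = pd (l 0) (iterPd k (pd a f) (Fin.tail l))
    rw [h1, h2, ih]

lemma iterPd_const_mul (hΩ : IsOpen Ω) (hf : ContDiffOn ℝ ∞ f Ω) (c : ℝ) (k : ℕ)
    (l : Fin k → Fin n) :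
    Set.EqOn (iterPd k (fun v => c * f v) l) (fun v => c * iterPd k f l v) Ω := by
  induction k with
  | zero => exact fun _ _ => rfl
  | succ k ih =>
    intro u hu
    change pd _ _ u = _
    rw [eqOn_pd hΩ (ih _) _ hu,
      pd_const_mul (differentiableAt_of_contDiffOn hΩ (contDiffOn_iterPd hΩ hf _ _) hu)]
    rfl

lemma iterPd_add (hΩ : IsOpen Ω) (hf : ContDiffOn ℝ ∞ f Ω) (hg : ContDiffOn ℝ ∞ g Ω) (k : ℕ)
    (l : Fin k → Fin n) :
    Set.EqOn (iterPd k (fun v => f v + g v) l) (fun v => iterPd k f l v + iterPd k g l v) Ω := by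
  induction k with
  | zero => exact fun _ _ => rfl
  | succ k ih =>
    intro u hu
    change pd _ _ u = _
    rw [eqOn_pd hΩ (ih _) _ hu,
      pd_add (differentiableAt_of_contDiffOn hΩ (contDiffOn_iterPd hΩ hf _ _) hu)
        (differentiableAt_of_contDiffOn hΩ (contDiffOn_iterPd hΩ hg _ _) hu)]
    rfl

lemma iterPd_sub (hΩ : IsOpen Ω) (hf : ContDiffOn ℝ ∞ f Ω) (hg : ContDiffOn ℝ ∞ g Ω) (k : ℕ)
    (l : Fin k → Fin n) :
    Set.EqOn (iterPd k (fun v => f v - g v) l) (fun v => iterPd k f l v - iterPd k g l v) Ω := by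
  induction k with
  | zero => exact fun _ _ => rfl
  | succ k ih =>
    intro u hu
    change pd _ _ u = _
    rw [eqOn_pd hΩ (ih _) _ hu,
      pd_sub (differentiableAt_of_contDiffOn hΩ (contDiffOn_iterPd hΩ hf _ _) hu)
        (differentiableAt_of_contDiffOn hΩ (contDiffOn_iterPd hΩ hg _ _) hu)]
    rfl

lemma iterPd_sum (hΩ : IsOpen Ω) {ι : Type*} (s : Finset ι) {f : ι → Model n → ℝ}
    (hf : ∀ i ∈ s, ContDiffOn ℝ ∞ (f i) Ω) (k : ℕ) (l : Fin k → Fin n) :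
    Set.EqOn (iterPd k (fun v => ∑ i ∈ s, f i v) l) (fun v => ∑ i ∈ s, iterPd k (f i) l v) Ω := by
  induction k with
  | zero => exact fun _ _ => rfl
  | succ k ih =>
    intro u hu
    change pd _ _ u = _
    rw [eqOn_pd hΩ (ih _) _ hu, pd_sum (fun i hi =>
      differentiableAt_of_contDiffOn hΩ (contDiffOn_iterPd hΩ (hf i hi) _ _) hu)]
    rfl

end PartialDerivatives

/-- Adjacent transpositions and invariance under them give invariance under all permutations:
an array invariant under permutations of all slots but the first and under the exchange of the
first two slots is symmetric. -/
lemma sym_of_cons_of_swap {n k : ℕ} {T : (Fin (k + 2) → Fin n) → ℝ}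
    (h1 : ∀ a, Sym (fun l => T (Fin.cons (α := fun _ => Fin n) a l)))
    (h2 : ∀ a b l, T (Fin.cons (α := fun _ => Fin n) a (Fin.cons (α := fun _ => Fin n) b l)) =
      T (Fin.cons (α := fun _ => Fin n) b (Fin.cons (α := fun _ => Fin n) a l))) : Sym T := by
  have hswap : ∀ l : Fin (k + 2) → Fin n, T (l ∘ Equiv.swap 0 1) = T l := by
    intro l
    have hl : l = Fin.cons (α := fun _ => Fin n) (l 0)
        (Fin.cons (α := fun _ => Fin n) (l 1) (Fin.tail (Fin.tail l))) := by
      funext i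
      refine Fin.cases rfl (fun i => ?_) i
      exact Fin.cases rfl (fun i => rfl) i
    have hl' : l ∘ Equiv.swap 0 1 = Fin.cons (α := fun _ => Fin n) (l 1)
        (Fin.cons (α := fun _ => Fin n) (l 0) (Fin.tail (Fin.tail l))) := by
      funext i
      refine Fin.cases (by simp) (fun i => ?_) i
      refine Fin.cases (by simp) (fun i => ?_) i
      have : (Equiv.swap (0 : Fin (k + 2)) 1) i.succ.succ = i.succ.succ :=
        Equiv.swap_apply_of_ne_of_ne (Fin.succ_ne_zero _) (by
          rw [← Fin.succ_zero_eq_one]; exact fun h => Fin.succ_ne_zero _ (Fin.succ_injective _ h))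
      simp [this, Fin.tail]
    rw [hl', h2, ← hl]
  -- permutations fixing the first slot
  have hfix : ∀ s : Equiv.Perm (Fin (k + 2)), s 0 = 0 → ∀ l, T (l ∘ s) = T l := by
    intro s hs l
    obtain ⟨⟨p, t⟩, rfl⟩ := Equiv.Perm.decomposeFin.symm.surjective s
    have hp : p = 0 := by simpa using hs
    subst hp
    rw [← Fin.cons_self_tail l, cons_comp_decomposeFin]
    exact h1 _ t _
  -- any permutation is a product of swaps `(0 i)` and a permutation fixing the first slot
  have hs0 : ∀ (i : Fin (k + 2)) (l : Fin (k + 2) → Fin n), T (l ∘ Equiv.swap 0 i) = T l := by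
    intro i l
    by_cases hi0 : i = 0
    · subst hi0; simp
    by_cases hi1 : i = 1
    · subst hi1; exact hswap l
    have h01 : (0 : Fin (k + 2)) ≠ 1 := by simp
    have e : Equiv.swap 0 i = Equiv.swap 1 i * Equiv.swap 0 1 * Equiv.swap 1 i := by
      rw [Equiv.swap_mul_swap_mul_swap h01 (Ne.symm hi0), Equiv.swap_comm]
    have f1 : (Equiv.swap 1 i) (0 : Fin (k + 2)) = 0 :=
      Equiv.swap_apply_of_ne_of_ne h01 (Ne.symm hi0)
    rw [e]
    calc T (l ∘ (Equiv.swap 1 i * Equiv.swap 0 1 * Equiv.swap 1 i : Equiv.Perm _))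
        = T (((l ∘ Equiv.swap 1 i) ∘ Equiv.swap 0 1) ∘ Equiv.swap 1 i) := rfl
      _ = T l := by rw [hfix _ f1, hswap, hfix _ f1]
  intro s l
  have e : s = Equiv.swap 0 (s 0) * (Equiv.swap 0 (s 0) * s) := by
    rw [← mul_assoc, Equiv.swap_mul_self, one_mul]
  rw [e]
  change T ((l ∘ Equiv.swap 0 (s 0)) ∘ (Equiv.swap 0 (s 0) * s : Equiv.Perm _)) = T l
  rw [hfix _ (by simp), hs0]

lemma sym_of_le_one {n k : ℕ} (hk : k ≤ 1) (T : (Fin k → Fin n) → ℝ) : Sym T := by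
  have : Subsingleton (Fin k) := by
    rw [Fin.subsingleton_iff_le_one]; exact hk
  intro s l
  rw [Subsingleton.elim s 1]; rfl

/-- Iterated partial derivatives of a smooth function are symmetric. -/
lemma sym_iterPd {n : ℕ} {Ω : Set (Model n)} (hΩ : IsOpen Ω) {f : Model n → ℝ}
    (hf : ContDiffOn ℝ ∞ f Ω) (k : ℕ) {u : Model n} (hu : u ∈ Ω) :
    Sym (fun l => iterPd k f l u) := by
  induction k using Nat.strong_induction_on generalizing u with
  | _ k ih =>
    match k, ih with
    | 0, _ => exact sym_of_le_one (by omega) _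
    | 1, _ => exact sym_of_le_one (by omega) _
    | k + 2, ih =>
      refine sym_of_cons_of_swap (fun a s l => ?_) (fun a b l => ?_)
      · change pd a (iterPd (k + 1) f (l ∘ s)) u = pd a (iterPd (k + 1) f l) u
        exact eqOn_pd hΩ (fun v hv => ih (k + 1) (by omega) hv s l) a hu
      · change pd a (pd b (iterPd k f l)) u = pd b (pd a (iterPd k f l)) u
        exact pd_comm ((contDiffOn_iterPd hΩ hf k l).contDiffAt (hΩ.mem_nhds hu)) a b

/-! ### Homogeneous polynomials of symmetric arrays -/

section Polarization

variable {n : ℕ}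

/-- Euler's rule `∂_m (T_{l₁ … l_{k+1}} ξ^{l₁} ⋯) = (k + 1) T_{m l₁ … l_k} ξ^{l₁} ⋯`. -/
lemma pd_polyEval {k : ℕ} {T : (Fin (k + 1) → Fin n) → ℝ} (hT : Sym T) (m : Fin n) (ξ : Model n) :
    pd m (polyEval T) ξ =
      (k + 1) * polyEval (fun l => T (Fin.cons (α := fun _ => Fin n) m l)) ξ := by
  have hd : ∀ {j : ℕ} (T : (Fin j → Fin n) → ℝ) (ξ : Model n), DifferentiableAt ℝ (polyEval T) ξ :=
    fun T ξ => (contDiff_polyEval T).differentiable (by simp) ξ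
  have hc : ∀ a : Fin n, DifferentiableAt ℝ (fun v : Model n => v a) ξ := fun a => by fun_prop
  have step : ∀ {j : ℕ} (T : (Fin (j + 1) → Fin n) → ℝ), pd m (polyEval T) ξ =
      polyEval (fun l => T (Fin.cons (α := fun _ => Fin n) m l)) ξ +
      ∑ a, ξ a * pd m (polyEval (fun l => T (Fin.cons (α := fun _ => Fin n) a l))) ξ := by
    intro j T
    have : polyEval T = fun v => ∑ a, v a * polyEval
        (fun l => T (Fin.cons (α := fun _ => Fin n) a l)) v := funext fun v => polyEval_succ T v
    rw [this, pd_sum (f := fun a v => v a * polyEval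
      (fun l => T (Fin.cons (α := fun _ => Fin n) a l)) v) (fun a _ => (hc a).mul (hd _ _))]
    simp only [pd_mul (hc _) (hd _ _), pd_coord, Finset.sum_add_distrib]
    simp [kron]
  induction k with
  | zero =>
    rw [step]
    have : ∀ a, pd m (polyEval (fun l : Fin 0 → Fin n =>
        T (Fin.cons (α := fun _ => Fin n) a l))) ξ = 0 := by
      intro a
      rw [show polyEval (fun l : Fin 0 → Fin n => T (Fin.cons (α := fun _ => Fin n) a l)) =
        fun _ => T (Fin.cons (α := fun _ => Fin n) a Fin.elim0) from
        funext fun v => polyEval_zero_slots _ v]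
      exact pd_const _ _
    simp [this]
  | succ k ih =>
    rw [step]
    have h : ∀ a, pd m (polyEval (fun l => T (Fin.cons (α := fun _ => Fin n) a l))) ξ =
        (k + 1) * polyEval (fun l => T (Fin.cons (α := fun _ => Fin n) m
          (Fin.cons (α := fun _ => Fin n) a l))) ξ := by
      intro a
      rw [ih (hT.cons a)]
      simp only [hT.cons_cons a m]
    simp only [h]
    rw [polyEval_succ (fun l => T (Fin.cons (α := fun _ => Fin n) m l)), Finset.mul_sum,
      ← Finset.sum_add_distrib]
    refine Finset.sum_congr rfl fun a _ => ?_
    push_cast; ring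

/-- Polarization: a symmetric array whose polynomial vanishes is zero. -/
lemma Sym.eq_zero_of_polyEval {k : ℕ} {T : (Fin k → Fin n) → ℝ} (hT : Sym T)
    (h : ∀ ξ, polyEval T ξ = 0) (l : Fin k → Fin n) : T l = 0 := by
  induction k with
  | zero =>
    have := h 0
    rwa [polyEval_zero_slots, Subsingleton.elim Fin.elim0 l] at this
  | succ k ih =>
    rw [← Fin.cons_self_tail l]
    refine ih (T := fun l' => T (Fin.cons (α := fun _ => Fin n) (l 0) l')) (hT.cons _)
      (fun ξ => ?_) _
    have h1 := pd_polyEval hT (l 0) ξ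
    rw [show polyEval T = fun _ => 0 from funext h, pd_const] at h1
    have : ((k : ℝ) + 1) ≠ 0 := by positivity
    exact (mul_eq_zero.1 h1.symm).resolve_left this

lemma Sym.sub {k : ℕ} {T T' : (Fin k → Fin n) → ℝ} (hT : Sym T) (hT' : Sym T') :
    Sym (fun l => T l - T' l) := fun s l => by
  simp only [hT s l, hT' s l]

lemma Sym.add {k : ℕ} {T T' : (Fin k → Fin n) → ℝ} (hT : Sym T) (hT' : Sym T') :
    Sym (fun l => T l + T' l) := fun s l => by
  simp only [hT s l, hT' s l]

lemma Sym.const_mul {k : ℕ} {T : (Fin k → Fin n) → ℝ} (hT : Sym T) (c : ℝ) :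
    Sym (fun l => c * T l) := fun s l => by
  simp only [hT s l]

lemma Sym.sum {k : ℕ} {ι : Type*} {s : Finset ι} {T : ι → (Fin k → Fin n) → ℝ}
    (hT : ∀ i, Sym (T i)) : Sym (fun l => ∑ i ∈ s, T i l) := fun t l => by
  simp only [hT _ t l]

lemma Sym.ext_polyEval {k : ℕ} {T T' : (Fin k → Fin n) → ℝ} (hT : Sym T) (hT' : Sym T')
    (h : ∀ ξ, polyEval T ξ = polyEval T' ξ) : T = T' := by
  funext l
  have := (hT.sub hT').eq_zero_of_polyEval (fun ξ => by rw [polyEval_sub, h, sub_self]) l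
  linarith

/-! ### Polynomials with prescribed jets -/

/-- The polynomial `∑_{k < N} (1 / k!) p_{l₁ … l_k} ξ^{l₁} ⋯ ξ^{l_k}` with coefficients `p`. -/
def taylorPoly (N : ℕ) (p : (k : ℕ) → (Fin k → Fin n) → ℝ) (ξ : Model n) : ℝ :=
  ∑ k ∈ Finset.range N, polyEval (p k) ξ / (k.factorial : ℝ)

lemma contDiff_taylorPoly (N : ℕ) (p : (k : ℕ) → (Fin k → Fin n) → ℝ) :
    ContDiff ℝ ∞ (taylorPoly N p) :=
  ContDiff.sum fun _ _ => (contDiff_polyEval _).div_const _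

lemma pd_taylorPoly_succ {N : ℕ} {p : (k : ℕ) → (Fin k → Fin n) → ℝ} (hp : ∀ k, Sym (p k))
    (m : Fin n) : pd m (taylorPoly (N + 1) p) =
      taylorPoly N (fun k l => p (k + 1) (Fin.cons (α := fun _ => Fin n) m l)) := by
  funext ξ
  have hd : ∀ {j : ℕ} (T : (Fin j → Fin n) → ℝ) (ξ : Model n), DifferentiableAt ℝ (polyEval T) ξ :=
    fun T ξ => (contDiff_polyEval T).differentiable (by simp) ξ
  have h0 : taylorPoly (N + 1) p = fun ξ => ∑ k ∈ Finset.range (N + 1),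
      ((k.factorial : ℝ)⁻¹) * polyEval (p k) ξ := by
    funext ξ; unfold taylorPoly
    exact Finset.sum_congr rfl fun k _ => by rw [div_eq_inv_mul]
  rw [h0, pd_sum (fun k _ => (hd _ _).const_mul _), Finset.sum_range_succ']
  have h1 : pd m (fun v => ((Nat.factorial 0 : ℝ)⁻¹) * polyEval (p 0) v) ξ = 0 := by
    simp only [polyEval_zero_slots]; exact pd_const _ _
  rw [h1, add_zero]
  unfold taylorPoly
  refine Finset.sum_congr rfl fun k _ => ?_
  rw [pd_const_mul (hd _ _), pd_polyEval (hp _), Nat.factorial_succ]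
  push_cast
  field_simp

lemma taylorPoly_zero_apply {N : ℕ} (hN : 0 < N) (p : (k : ℕ) → (Fin k → Fin n) → ℝ) :
    taylorPoly N p 0 = p 0 Fin.elim0 := by
  obtain ⟨N, rfl⟩ := Nat.exists_eq_succ_of_ne_zero hN.ne'
  unfold taylorPoly
  rw [Finset.sum_range_succ', Finset.sum_eq_zero (fun k _ => ?_)]
  · simp [polyEval_zero_slots]
  · rw [polyEval_succ]; simp

/-- The jet at the origin of a Taylor polynomial is the array of its coefficients. -/
lemma iterPd_taylorPoly_zero {N : ℕ} {p : (k : ℕ) → (Fin k → Fin n) → ℝ} (hp : ∀ k, Sym (p k))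
    {j : ℕ} (hj : j < N) (l : Fin j → Fin n) : iterPd j (taylorPoly N p) l 0 = p j l := by
  induction j generalizing N p with
  | zero =>
    change taylorPoly N p 0 = _
    rw [taylorPoly_zero_apply hj, Subsingleton.elim Fin.elim0 l]
  | succ j ih =>
    obtain ⟨N, rfl⟩ := Nat.exists_eq_succ_of_ne_zero (Nat.ne_zero_of_lt hj)
    conv_lhs => rw [← Fin.snoc_init_self l]
    rw [iterPd_snoc, pd_taylorPoly_succ hp, ih (fun k => (hp _).cons _) (by omega),
      ← (hp _).snoc_eq_cons, Fin.snoc_init_self]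

lemma pd_comp_sub_const (f : Model n → ℝ) (x : Model n) (m : Fin n) :
    pd m (fun u => f (u - x)) = fun u => pd m f (u - x) := by
  funext u
  unfold pd
  rw [fderiv_comp_sub]

lemma iterPd_comp_sub_const (f : Model n → ℝ) (x : Model n) (k : ℕ) (l : Fin k → Fin n) :
    iterPd k (fun u => f (u - x)) l = fun u => iterPd k f l (u - x) := by
  induction k with
  | zero => rfl
  | succ k ih =>
    change pd _ (iterPd k _ _) = _
    rw [ih, pd_comp_sub_const]; rfl

lemma iterPd_taylorPoly {N : ℕ} {p : (k : ℕ) → (Fin k → Fin n) → ℝ} (hp : ∀ k, Sym (p k))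
    {j : ℕ} (hj : j < N) (x : Model n) (l : Fin j → Fin n) :
    iterPd j (fun u => taylorPoly N p (u - x)) l x = p j l := by
  rw [iterPd_comp_sub_const]
  simp only [sub_self]
  exact iterPd_taylorPoly_zero hp hj l

end Polarization

/-! ### Smooth dependence of the tensor calculus on parameters -/

section Families

variable {n : ℕ} {E : Type*} [NormedAddCommGroup E] [NormedSpace ℝ E] {W : Set (E × Model n)}

/-- A family of functions on `ℝⁿ` that depends smoothly on a parameter, jointly on `W`. -/
def SmoothFamily (W : Set (E × Model n)) (φ : E → Model n → ℝ) : Prop :=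
  ContDiffOn ℝ ∞ (fun p : E × Model n => φ p.1 p.2) W

/-- A smooth family of nondegenerate matrix-valued functions. -/
structure MetricFamily (W : Set (E × Model n)) (G : E → Model n → Fin n → Fin n → ℝ) : Prop where
  isOpen : IsOpen W
  smooth : ∀ μ ν, SmoothFamily W (fun c u => G c u μ ν)
  det_ne : ∀ p ∈ W, (Matrix.of (G p.1 p.2)).det ≠ 0

lemma SmoothFamily.pd (hW : IsOpen W) {φ : E → Model n → ℝ} (hφ : SmoothFamily W φ) (μ : Fin n) :
    SmoothFamily W (fun c => BackgroundJets.pd μ (φ c)) := by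
  have h1 : ContDiffOn ℝ ∞ (fun p => fderiv ℝ (fun p : E × Model n => φ p.1 p.2) p
      ((0 : E), (EuclideanSpace.single μ (1 : ℝ) : Model n))) W :=
    (hφ.fderiv_of_isOpen hW (by simp)).clm_apply contDiffOn_const
  refine h1.congr fun p hp => ?_
  have h2 := (differentiableAt_of_contDiffOn hW hφ hp).hasFDerivAt
  have h3 : HasFDerivAt (fun u : Model n => (p.1, u))
      (ContinuousLinearMap.inr ℝ E (Model n)) p.2 := hasFDerivAt_prodMk_right p.1 p.2
  have h4 : HasFDerivAt (φ p.1) _ p.2 := HasFDerivAt.comp (g := fun p : E × Model n => φ p.1 p.2)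
    (f := fun u : Model n => (p.1, u)) p.2 h2 h3
  change fderiv ℝ (φ p.1) p.2 _ = _
  rw [h4.fderiv]; rfl

lemma SmoothFamily.iterPd (hW : IsOpen W) {φ : E → Model n → ℝ} (hφ : SmoothFamily W φ) (k : ℕ)
    (l : Fin k → Fin n) : SmoothFamily W (fun c => BackgroundJets.iterPd k (φ c) l) := by
  induction k with
  | zero => exact hφ
  | succ k ih => exact (ih _).pd hW _

lemma contDiffOn_det {F : Type*} [NormedAddCommGroup F] [NormedSpace ℝ F] {s : Set F} {m : ℕ}
    {A : F → Matrix (Fin m) (Fin m) ℝ} (hA : ∀ i j, ContDiffOn ℝ ∞ (fun p => A p i j) s) :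
    ContDiffOn ℝ ∞ (fun p => (A p).det) s := by
  simp only [Matrix.det_apply']
  exact ContDiffOn.sum fun σ _ => contDiffOn_const.mul (contDiffOn_prod fun i _ => hA _ _)

lemma contDiffOn_matrix_inv {F : Type*} [NormedAddCommGroup F] [NormedSpace ℝ F] {s : Set F}
    {m : ℕ} {A : F → Matrix (Fin m) (Fin m) ℝ} (hA : ∀ i j, ContDiffOn ℝ ∞ (fun p => A p i j) s)
    (hd : ∀ p ∈ s, (A p).det ≠ 0) (i j : Fin m) : ContDiffOn ℝ ∞ (fun p => (A p)⁻¹ i j) s := by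
  have h : ∀ p, (A p)⁻¹ i j = ((A p).det)⁻¹ * ((A p).updateRow j (Pi.single i 1)).det := by
    intro p
    rw [Matrix.inv_def, Matrix.smul_apply, Matrix.adjugate_apply, Ring.inverse_eq_inv', smul_eq_mul]
  simp only [h]
  refine ((contDiffOn_det hA).inv hd).mul (contDiffOn_det fun a b => ?_)
  by_cases hab : a = j
  · subst hab; simp only [Matrix.updateRow_self]; exact contDiffOn_const
  · simp only [Matrix.updateRow_ne hab]; exact hA a b

variable {G : E → Model n → Fin n → Fin n → ℝ}

lemma MetricFamily.inv (hG : MetricFamily W G) (α β : Fin n) :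
    SmoothFamily W (fun c u => (Matrix.of (G c u))⁻¹ α β) :=
  contDiffOn_matrix_inv (A := fun p : E × Model n => Matrix.of (G p.1 p.2)) hG.smooth hG.det_ne α β

lemma MetricFamily.christoffel (hG : MetricFamily W G) (α μ ν : Fin n) :
    SmoothFamily W (fun c => christoffel (G c) α μ ν) := by
  have hp : ∀ a b c, ContDiffOn ℝ ∞
      (fun p : E × Model n => BackgroundJets.pd a (fun v => G p.1 v b c) p.2) W :=
    fun a b c => (hG.smooth b c).pd hG.isOpen a
  exact contDiffOn_const.mul (ContDiffOn.sum fun β _ => (hG.inv α β).mul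
    (((hp μ ν β).add (hp ν β μ)).sub (hp β μ ν)))

lemma MetricFamily.riemann (hG : MetricFamily W G) (α β μ ν : Fin n) :
    SmoothFamily W (fun c => riemann (G c) α β μ ν) := by
  have hp : ∀ a b c d, ContDiffOn ℝ ∞
      (fun p : E × Model n => BackgroundJets.pd a (BackgroundJets.christoffel (G p.1) b c d) p.2) W :=
    fun a b c d => (hG.christoffel b c d).pd hG.isOpen a
  exact (((hp _ _ _ _).add (ContDiffOn.sum fun σ _ =>
    (hG.christoffel _ _ _).mul (hG.christoffel _ _ _))).sub (hp _ _ _ _)).sub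
    (ContDiffOn.sum fun σ _ => (hG.christoffel _ _ _).mul (hG.christoffel _ _ _))

lemma MetricFamily.nablaRiemann (hG : MetricFamily W G) (k : ℕ) (α : Fin n)
    (l : Fin (k + 3) → Fin n) : SmoothFamily W (fun c => nablaRiemann (G c) k α l) := by
  induction k generalizing α with
  | zero => exact hG.riemann _ _ _ _
  | succ k ih =>
    exact (((ih α _).pd hG.isOpen (l 0)).add
      (ContDiffOn.sum fun τ _ => (hG.christoffel _ _ _).mul (ih τ _))).sub
      (ContDiffOn.sum fun s _ => ContDiffOn.sum fun τ _ => (hG.christoffel _ _ _).mul (ih α _))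

lemma MetricFamily.nablaScalar (hG : MetricFamily W G) {φ : E → Model n → ℝ}
    (hφ : SmoothFamily W φ) (k : ℕ) (l : Fin k → Fin n) :
    SmoothFamily W (fun c => nablaScalar (G c) (φ c) k l) := by
  induction k with
  | zero => exact hφ
  | succ k ih =>
    exact ((ih _).pd hG.isOpen (l 0)).sub
      (ContDiffOn.sum fun s _ => ContDiffOn.sum fun τ _ => (hG.christoffel _ _ _).mul (ih _))

lemma MetricFamily.dChristoffel (hG : MetricFamily W G) (k : ℕ) (α : Fin n)
    (l : Fin (k + 2) → Fin n) : SmoothFamily W (fun c => dChristoffel (G c) k α l) :=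
  (hG.christoffel _ _ _).iterPd hG.isOpen _ _

lemma SmoothFamily.symFirst {k : ℕ} {φ : E → Model n → (Fin k → Fin n) → ℝ}
    (hφ : ∀ l, SmoothFamily W (fun c u => φ c u l)) (m : ℕ) (l : Fin k → Fin n) :
    SmoothFamily W (fun c u => symFirst m (φ c u) l) :=
  (ContDiffOn.sum fun _ _ => hφ _).div_const _

end Families

/-! ### Metrics on an open set -/

/-- The entries of the inverse of a matrix. -/
def ginv {n : ℕ} (A : Fin n → Fin n → ℝ) (a b : Fin n) : ℝ := (Matrix.of A)⁻¹ a b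

/-- The components of a smooth nondegenerate symmetric bilinear form on an open set of `ℝⁿ`. -/
structure MetricOn {n : ℕ} (Ω : Set (Model n)) (G : Model n → Fin n → Fin n → ℝ) : Prop where
  isOpen : IsOpen Ω
  smooth : ∀ μ ν, ContDiffOn ℝ ∞ (fun u => G u μ ν) Ω
  symm : ∀ u ∈ Ω, ∀ μ ν, G u μ ν = G u ν μ
  det_ne : ∀ u ∈ Ω, (Matrix.of (G u)).det ≠ 0

section MetricOn

variable {n : ℕ} {Ω : Set (Model n)} {G : Model n → Fin n → Fin n → ℝ}

lemma smoothFamily_const {f : Model n → ℝ} (hf : ContDiffOn ℝ ∞ f Ω) :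
    SmoothFamily ((Set.univ : Set ℝ) ×ˢ Ω) (fun _ => f) :=
  hf.comp contDiffOn_snd fun _ hp => hp.2

lemma SmoothFamily.contDiffOn {φ : ℝ → Model n → ℝ}
    (h : SmoothFamily ((Set.univ : Set ℝ) ×ˢ Ω) φ) (c : ℝ) : ContDiffOn ℝ ∞ (φ c) Ω :=
  ContDiffOn.comp (g := fun p : ℝ × Model n => φ p.1 p.2) (f := fun u : Model n => (c, u)) h
    (contDiffOn_const.prodMk contDiffOn_id) fun _ hu => ⟨trivial, hu⟩

/-- A single metric as a family with constant parameter: the smoothness results for families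
specialize. -/
lemma MetricOn.family (hG : MetricOn Ω G) :
    MetricFamily ((Set.univ : Set ℝ) ×ˢ Ω) (fun _ => G) where
  isOpen := isOpen_univ.prod hG.isOpen
  smooth μ ν := smoothFamily_const (hG.smooth μ ν)
  det_ne _ hp := hG.det_ne _ hp.2

lemma MetricOn.inv (hG : MetricOn Ω G) (α β : Fin n) :
    ContDiffOn ℝ ∞ (fun u => ginv (G u) α β) Ω := (hG.family.inv α β).contDiffOn 0

lemma christoffel_eq (G : Model n → Fin n → Fin n → ℝ) (α μ ν : Fin n) (u : Model n) :
    BackgroundJets.christoffel G α μ ν u = 1 / 2 * ∑ β, ginv (G u) α β *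
      (pd μ (fun v => G v ν β) u + pd ν (fun v => G v β μ) u - pd β (fun v => G v μ ν) u) := rfl

lemma sum_mul_ginv {A : Fin n → Fin n → ℝ} (hA : (Matrix.of A).det ≠ 0) (a b : Fin n) :
    ∑ c, A a c * ginv A c b = kron a b := by
  have := congrFun (congrFun (Matrix.mul_nonsing_inv (Matrix.of A) hA.isUnit) a) b
  rw [Matrix.mul_apply] at this
  simpa [ginv, kron, Matrix.one_apply] using this

lemma sum_ginv_mul {A : Fin n → Fin n → ℝ} (hA : (Matrix.of A).det ≠ 0) (a b : Fin n) :
    ∑ c, ginv A a c * A c b = kron a b := by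
  have := congrFun (congrFun (Matrix.nonsing_inv_mul (Matrix.of A) hA.isUnit) a) b
  rw [Matrix.mul_apply] at this
  simpa [ginv, kron, Matrix.one_apply] using this

lemma MetricOn.christoffel (hG : MetricOn Ω G) (α μ ν : Fin n) :
    ContDiffOn ℝ ∞ (christoffel G α μ ν) Ω := (hG.family.christoffel α μ ν).contDiffOn 0

lemma MetricOn.nablaRiemann (hG : MetricOn Ω G) (k : ℕ) (α : Fin n) (l : Fin (k + 3) → Fin n) :
    ContDiffOn ℝ ∞ (nablaRiemann G k α l) Ω := (hG.family.nablaRiemann k α l).contDiffOn 0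

lemma MetricOn.nablaScalar (hG : MetricOn Ω G) {φ : Model n → ℝ} (hφ : ContDiffOn ℝ ∞ φ Ω) (k : ℕ)
    (l : Fin k → Fin n) : ContDiffOn ℝ ∞ (nablaScalar G φ k l) Ω :=
  (hG.family.nablaScalar (smoothFamily_const hφ) k l).contDiffOn 0

end MetricOn

/-! ### Functions that vanish to a given order -/

section Flat

variable {n : ℕ} {Ω : Set (Model n)} {x : Model n} {f g : Model n → ℝ}

/-- `f` is smooth on `Ω` and its derivatives of order less than `k` vanish at `x`. -/
def Flat (Ω : Set (Model n)) (x : Model n) : ℕ → (Model n → ℝ) → Prop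
  | 0, f => ContDiffOn ℝ ∞ f Ω
  | k + 1, f => ContDiffOn ℝ ∞ f Ω ∧ f x = 0 ∧ ∀ μ, Flat Ω x k (pd μ f)

lemma Flat.contDiffOn {k : ℕ} (h : Flat Ω x k f) : ContDiffOn ℝ ∞ f Ω := by
  cases k with
  | zero => exact h
  | succ k => exact h.1

lemma Flat.pd_sub_one (hΩ : IsOpen Ω) {k : ℕ} (h : Flat Ω x k f) (μ : Fin n) :
    Flat Ω x (k - 1) (pd μ f) := by
  cases k with
  | zero => exact contDiffOn_pd hΩ h.contDiffOn μ
  | succ k => exact h.2.2 μ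

lemma Flat.congr (hΩ : IsOpen Ω) (hx : x ∈ Ω) {k : ℕ} (h : Flat Ω x k f)
    (hfg : Set.EqOn g f Ω) : Flat Ω x k g := by
  induction k generalizing f g with
  | zero => exact ContDiffOn.congr h hfg
  | succ k ih =>
    exact ⟨h.1.congr hfg, (hfg hx).trans h.2.1, fun μ => ih (h.2.2 μ) (eqOn_pd hΩ hfg μ)⟩

lemma Flat.mono {k m : ℕ} (h : Flat Ω x k f) (hm : m ≤ k) : Flat Ω x m f := by
  induction m generalizing f k with
  | zero => exact h.contDiffOn
  | succ m ih =>
    obtain ⟨k, rfl⟩ := Nat.exists_eq_succ_of_ne_zero (by omega : k ≠ 0)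
    exact ⟨h.1, h.2.1, fun μ => ih (h.2.2 μ) (by omega)⟩

lemma Flat.add (hΩ : IsOpen Ω) (hx : x ∈ Ω) {k : ℕ} (hf : Flat Ω x k f) (hg : Flat Ω x k g) :
    Flat Ω x k (fun u => f u + g u) := by
  induction k generalizing f g with
  | zero => exact ContDiffOn.add hf hg
  | succ k ih =>
    refine ⟨hf.1.add hg.1, by simp [hf.2.1, hg.2.1], fun μ =>
      (ih (hf.2.2 μ) (hg.2.2 μ)).congr hΩ hx fun u hu => ?_⟩
    exact pd_add (differentiableAt_of_contDiffOn hΩ hf.1 hu)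
      (differentiableAt_of_contDiffOn hΩ hg.1 hu) μ

lemma flat_zero (hx : x ∈ Ω) (hΩ : IsOpen Ω) (k : ℕ) : Flat Ω x k (fun _ => 0) := by
  induction k with
  | zero => exact contDiffOn_const
  | succ k ih =>
    exact ⟨contDiffOn_const, rfl, fun μ => ih.congr hΩ hx fun u _ => pd_const 0 μ⟩

lemma Flat.sum (hΩ : IsOpen Ω) (hx : x ∈ Ω) {k : ℕ} {ι : Type*} (s : Finset ι)
    {f : ι → Model n → ℝ} (hf : ∀ i, Flat Ω x k (f i)) :
    Flat Ω x k (fun u => ∑ i ∈ s, f i u) := by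
  classical
  induction s using Finset.induction_on with
  | empty => simpa using flat_zero hx hΩ k
  | insert i s hi ih =>
    simp only [Finset.sum_insert hi]
    exact (hf i).add hΩ hx ih

lemma Flat.mul (hΩ : IsOpen Ω) (hx : x ∈ Ω) {a b : ℕ} (hf : Flat Ω x a f) (hg : Flat Ω x b g) :
    Flat Ω x (a + b) (fun u => f u * g u) := by
  generalize hN : a + b = N
  induction N generalizing a b f g with
  | zero => exact hf.contDiffOn.mul hg.contDiffOn
  | succ N ih =>
    refine ⟨hf.contDiffOn.mul hg.contDiffOn, ?_, fun μ => ?_⟩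
    · rcases Nat.eq_zero_or_pos a with ha | ha
      · obtain ⟨b, rfl⟩ := Nat.exists_eq_succ_of_ne_zero (by omega : b ≠ 0)
        simp [hg.2.1]
      · obtain ⟨a, rfl⟩ := Nat.exists_eq_succ_of_ne_zero (by omega : a ≠ 0)
        simp [hf.2.1]
    · have e : Set.EqOn (pd μ fun u => f u * g u) (fun u => pd μ f u * g u + f u * pd μ g u) Ω :=
        fun u hu => pd_mul (differentiableAt_of_contDiffOn hΩ hf.contDiffOn hu)
          (differentiableAt_of_contDiffOn hΩ hg.contDiffOn hu) μ
      refine Flat.congr hΩ hx (Flat.add hΩ hx ?_ ?_) e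
      · rcases Nat.eq_zero_or_pos a with ha | ha
        · exact ih (a := 0) (b := N) (contDiffOn_pd hΩ hf.contDiffOn μ)
            (hg.mono (by omega)) (by omega)
        · exact ih (hf.pd_sub_one hΩ μ) hg (by omega)
      · rcases Nat.eq_zero_or_pos b with hb | hb
        · exact ih (a := N) (b := 0) (hf.mono (by omega))
            (contDiffOn_pd hΩ hg.contDiffOn μ) (by omega)
        · exact ih hf (hg.pd_sub_one hΩ μ) (by omega)

lemma Flat.smooth_mul (hΩ : IsOpen Ω) (hx : x ∈ Ω) {k : ℕ} (hf : ContDiffOn ℝ ∞ f Ω)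
    (hg : Flat Ω x k g) : Flat Ω x k (fun u => f u * g u) := by
  simpa using Flat.mul hΩ hx (a := 0) hf hg

lemma Flat.mul_smooth (hΩ : IsOpen Ω) (hx : x ∈ Ω) {k : ℕ} (hf : Flat Ω x k f)
    (hg : ContDiffOn ℝ ∞ g Ω) : Flat Ω x k (fun u => f u * g u) :=
  Flat.mul hΩ hx (b := 0) hf hg

lemma Flat.const_mul (hΩ : IsOpen Ω) (hx : x ∈ Ω) {k : ℕ} (c : ℝ) (hg : Flat Ω x k g) :
    Flat Ω x k (fun u => c * g u) := Flat.smooth_mul hΩ hx contDiffOn_const hg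

lemma Flat.sub (hΩ : IsOpen Ω) (hx : x ∈ Ω) {k : ℕ} (hf : Flat Ω x k f) (hg : Flat Ω x k g) :
    Flat Ω x k (fun u => f u - g u) :=
  (hf.add hΩ hx (hg.const_mul hΩ hx (-1))).congr hΩ hx fun u _ => by ring

lemma Flat.iterPd_eq_zero {k j : ℕ} (h : Flat Ω x k f) (hj : j < k) (l : Fin j → Fin n) :
    iterPd j f l x = 0 := by
  induction j generalizing k f with
  | zero =>
    obtain ⟨k, rfl⟩ := Nat.exists_eq_succ_of_ne_zero (by omega : k ≠ 0)
    exact h.2.1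
  | succ j ih =>
    obtain ⟨k, rfl⟩ := Nat.exists_eq_succ_of_ne_zero (by omega : k ≠ 0)
    rw [← Fin.snoc_init_self l, iterPd_snoc]
    exact ih (h.2.2 _) (by omega) _

lemma Flat.apply_eq_zero {k : ℕ} (h : Flat Ω x k f) (hk : 0 < k) : f x = 0 :=
  h.iterPd_eq_zero hk Fin.elim0

lemma flat_of_iterPd (hΩ : IsOpen Ω) {k : ℕ} (hf : ContDiffOn ℝ ∞ f Ω)
    (h : ∀ j < k, ∀ l : Fin j → Fin n, iterPd j f l x = 0) : Flat Ω x k f := by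
  induction k generalizing f with
  | zero => exact hf
  | succ k ih =>
    refine ⟨hf, h 0 (by omega) Fin.elim0, fun μ => ih (contDiffOn_pd hΩ hf μ) fun j hj l => ?_⟩
    rw [← iterPd_snoc]
    exact h (j + 1) (by omega) _

lemma Flat.iterPd (hΩ : IsOpen Ω) {k : ℕ} (h : Flat Ω x k f) (j : ℕ) (l : Fin j → Fin n) :
    Flat Ω x (k - j) (iterPd j f l) := by
  induction j with
  | zero => exact h
  | succ j ih =>
    rw [Nat.sub_succ]
    exact (ih _).pd_sub_one hΩ _

end Flat

/-! ### The leading part of the covariant coordinates -/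

section Symbol

variable {n : ℕ} {Ω : Set (Model n)} {x : Model n} {G G' : Model n → Fin n → Fin n → ℝ}

/-- The linearized Christoffel symbols of a perturbation `D` of the metric, the inverse metric
being frozen to the constant matrix `c`. -/
def linChr (c : Fin n → Fin n → ℝ) (D : Model n → Fin n → Fin n → ℝ) (α μ ν : Fin n)
    (u : Model n) : ℝ :=
  1 / 2 * ∑ β, c α β *
    (pd μ (fun v => D v ν β) u + pd ν (fun v => D v β μ) u - pd β (fun v => D v μ ν) u)

/-- The linearized Riemann tensor of a perturbation `D` of the metric. -/
def linRiem (c : Fin n → Fin n → ℝ) (D : Model n → Fin n → Fin n → ℝ) (α β μ ν : Fin n)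
    (u : Model n) : ℝ :=
  pd μ (linChr c D α β ν) u - pd ν (linChr c D α β μ) u

/-- `B⁻¹ - A⁻¹ = -B⁻¹ (B - A) A⁻¹` in components. -/
lemma ginv_sub_ginv {A B : Fin n → Fin n → ℝ} (hA : (Matrix.of A).det ≠ 0)
    (hB : (Matrix.of B).det ≠ 0) (α β : Fin n) :
    ginv B α β - ginv A α β = -1 * ∑ γ, ∑ ε, ginv B α γ * ((B γ ε - A γ ε) * ginv A ε β) := by
  have e : ∀ γ ε, ginv B α γ * ((B γ ε - A γ ε) * ginv A ε β) =
      (ginv B α γ * B γ ε) * ginv A ε β - ginv B α γ * (A γ ε * ginv A ε β) := fun γ ε => by ring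
  have h1 : ∑ γ, ∑ ε, (ginv B α γ * B γ ε) * ginv A ε β = ginv A α β := by
    rw [Finset.sum_comm]
    simp only [← Finset.sum_mul, sum_ginv_mul hB]
    simp [kron]
  have h2 : ∑ γ, ∑ ε, ginv B α γ * (A γ ε * ginv A ε β) = ginv B α β := by
    simp only [← Finset.mul_sum, sum_mul_ginv hA]
    simp [kron]
  simp only [e, Finset.sum_sub_distrib, h1, h2]
  ring

lemma flat_inv_sub (hG : MetricOn Ω G) (hG' : MetricOn Ω G') (hx : x ∈ Ω) {K : ℕ}
    (hδ : ∀ μ ν, Flat Ω x K (fun u => G' u μ ν - G u μ ν)) (α β : Fin n) :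
    Flat Ω x K (fun u => ginv (G' u) α β - ginv (G u) α β) :=
  (Flat.const_mul hG.isOpen hx (-1) (Flat.sum hG.isOpen hx Finset.univ fun γ =>
    Flat.sum hG.isOpen hx Finset.univ fun ε => Flat.smooth_mul hG.isOpen hx (hG'.inv α γ)
      ((hδ γ ε).mul_smooth hG.isOpen hx (hG.inv ε β)))).congr hG.isOpen hx fun u hu =>
    ginv_sub_ginv (hG.det_ne u hu) (hG'.det_ne u hu) α β

variable (hG : MetricOn Ω G) (hG' : MetricOn Ω G') (hx : x ∈ Ω) {K : ℕ}
include hG hG' hx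

/-- If the metrics agree below order `K + 1`, the change of the Christoffel symbols is the
linearized one up to an error that vanishes below order `K + 1`. The error has two parts: the change
of the inverse metric times derivatives of `G'`, and `G⁻¹ - G⁻¹(x)` times derivatives of the
perturbation, where the first factor vanishes at `x` and the second below order `K`. -/
lemma flat_christoffel_sub_sub (hδ : ∀ μ ν, Flat Ω x (K + 1) (fun u => G' u μ ν - G u μ ν))
    (α μ ν : Fin n) :
    Flat Ω x (K + 1) (fun u => christoffel G' α μ ν u - christoffel G α μ ν u -
      linChr (ginv (G x)) (fun u μ ν => G' u μ ν - G u μ ν) α μ ν u) := by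
  have hΩ := hG.isOpen
  have d1 : ∀ a b, ∀ u ∈ Ω, DifferentiableAt ℝ (fun v => G v a b) u := fun a b u hu =>
    differentiableAt_of_contDiffOn hΩ (hG.smooth a b) hu
  have d2 : ∀ a b, ∀ u ∈ Ω, DifferentiableAt ℝ (fun v => G' v a b) u := fun a b u hu =>
    differentiableAt_of_contDiffOn hΩ (hG'.smooth a b) hu
  have hc : ∀ a b, Flat Ω x 1 (fun u => ginv (G u) a b - ginv (G x) a b) :=
    fun a b => ⟨(hG.inv a b).sub contDiffOn_const, sub_self _, fun μ =>
      contDiffOn_pd hΩ ((hG.inv a b).sub contDiffOn_const) μ⟩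
  have hsm : ∀ a b c, ContDiffOn ℝ ∞ (pd a (fun v => G' v b c)) Ω := fun a b c =>
    contDiffOn_pd hΩ (hG'.smooth b c) a
  have hpd : ∀ a b c, Flat Ω x K (pd a (fun v => G' v b c - G v b c)) := fun a b c =>
    (hδ b c).pd_sub_one hΩ a
  have key : Flat Ω x (K + 1) (fun u => 1 / 2 * ∑ β,
      ((ginv (G' u) α β - ginv (G u) α β) *
        (pd μ (fun v => G' v ν β) u + pd ν (fun v => G' v β μ) u - pd β (fun v => G' v μ ν) u) +
      (ginv (G u) α β - ginv (G x) α β) *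
        (pd μ (fun v => G' v ν β - G v ν β) u + pd ν (fun v => G' v β μ - G v β μ) u
          - pd β (fun v => G' v μ ν - G v μ ν) u))) := by
    refine Flat.const_mul hΩ hx _ (Flat.sum hΩ hx _ fun β => Flat.add hΩ hx ?_ ?_)
    · exact (flat_inv_sub hG hG' hx hδ α β).mul_smooth hΩ hx
        (((hsm _ _ _).add (hsm _ _ _)).sub (hsm _ _ _))
    · rw [add_comm K 1]
      exact (hc α β).mul hΩ hx (((hpd _ _ _).add hΩ hx (hpd _ _ _)).sub hΩ hx (hpd _ _ _))
  refine key.congr hΩ hx fun u hu => ?_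
  simp only [christoffel_eq, linChr, pd_sub (d2 _ _ u hu) (d1 _ _ u hu)]
  rw [← mul_sub, ← mul_sub, ← Finset.sum_sub_distrib, ← Finset.sum_sub_distrib]
  congr 1
  refine Finset.sum_congr rfl fun β _ => ?_
  ring

omit hG' in
lemma flat_linChr {D : Model n → Fin n → Fin n → ℝ} (c : Fin n → Fin n → ℝ)
    (hδ : ∀ μ ν, Flat Ω x K (fun u => D u μ ν))
    (α μ ν : Fin n) : Flat Ω x (K - 1) (linChr c D α μ ν) := by
  have hΩ := hG.isOpen
  have hpd : ∀ a b c, Flat Ω x (K - 1) (pd a (fun v => D v b c)) := fun a b c =>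
    (hδ b c).pd_sub_one hΩ a
  exact Flat.const_mul hΩ hx _ (Flat.sum hΩ hx _ fun β => Flat.const_mul hΩ hx _
    (((hpd _ _ _).add hΩ hx (hpd _ _ _)).sub hΩ hx (hpd _ _ _)))

lemma flat_christoffel_sub (hδ : ∀ μ ν, Flat Ω x (K + 1) (fun u => G' u μ ν - G u μ ν))
    (α μ ν : Fin n) :
    Flat Ω x K (fun u => christoffel G' α μ ν u - christoffel G α μ ν u) := by
  have h1 := (flat_christoffel_sub_sub hG hG' hx hδ α μ ν).mono (Nat.le_succ K)
  have h2 := flat_linChr hG hx (ginv (G x)) (D := fun u μ ν => G' u μ ν - G u μ ν) hδ α μ ν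
  exact (h1.add hG.isOpen hx h2).congr hG.isOpen hx fun u _ => by ring

omit hG' in
/-- `a' b' - a b = (a' - a) b' + a (b' - b)`. -/
lemma flat_mul_sub_mul {a b a' b' : Model n → ℝ} {k : ℕ} (ha : ContDiffOn ℝ ∞ a Ω)
    (hb' : ContDiffOn ℝ ∞ b' Ω) (h1 : Flat Ω x k (fun u => a' u - a u))
    (h2 : Flat Ω x k (fun u => b' u - b u)) : Flat Ω x k (fun u => a' u * b' u - a u * b u) :=
  ((h1.mul_smooth hG.isOpen hx hb').add hG.isOpen hx (h2.smooth_mul hG.isOpen hx ha)).congr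
    hG.isOpen hx fun u _ => by ring

/-- The terms of the curvature that are quadratic in the Christoffel symbols change only to
higher order than the derivatives of the Christoffel symbols. -/
lemma flat_riemann_sub_sub (hδ : ∀ μ ν, Flat Ω x (K + 2) (fun u => G' u μ ν - G u μ ν))
    (α β μ ν : Fin n) :
    Flat Ω x (K + 1) (fun u => riemann G' α β μ ν u - riemann G α β μ ν u -
      linRiem (ginv (G x)) (fun u μ ν => G' u μ ν - G u μ ν) α β μ ν u) := by
  have hΩ := hG.isOpen
  set c := ginv (G x)
  set D : Model n → Fin n → Fin n → ℝ := fun u μ ν => G' u μ ν - G u μ ν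
  have hΓ := flat_christoffel_sub hG hG' hx hδ
  have hE := flat_christoffel_sub_sub hG hG' hx hδ
  have hlin := flat_linChr hG hx c (D := D) hδ
  have hp : ∀ a b d e, Flat Ω x (K + 1) (pd e (fun u => christoffel G' a b d u - christoffel G a b d u -
      linChr c D a b d u)) := fun a b d e => (hE a b d).pd_sub_one hΩ e
  have hm : ∀ a b d a' b' d', Flat Ω x (K + 1) (fun u => christoffel G' a b d u *
      christoffel G' a' b' d' u - christoffel G a b d u * christoffel G a' b' d' u) :=
    fun a b d a' b' d' => flat_mul_sub_mul hG hx (hG.christoffel _ _ _) (hG'.christoffel _ _ _)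
      (hΓ _ _ _) (hΓ _ _ _)
  have key := ((hp α β ν μ).sub hΩ hx (hp α β μ ν)).add hΩ hx
    ((Flat.sum hΩ hx Finset.univ fun σ => hm α σ μ σ β ν).sub hΩ hx
      (Flat.sum hΩ hx Finset.univ fun σ => hm α σ ν σ β μ))
  refine key.congr hΩ hx fun u hu => ?_
  have dl : ∀ a b d, DifferentiableAt ℝ (linChr c D a b d) u := fun a b d =>
    differentiableAt_of_contDiffOn hΩ (hlin a b d).contDiffOn hu
  have d1 : ∀ a b d, DifferentiableAt ℝ (christoffel G a b d) u := fun a b d =>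
    differentiableAt_of_contDiffOn hΩ (hG.christoffel _ _ _) hu
  have d2 : ∀ a b d, DifferentiableAt ℝ (christoffel G' a b d) u := fun a b d =>
    differentiableAt_of_contDiffOn hΩ (hG'.christoffel _ _ _) hu
  have hpd : ∀ a b d e, pd e (fun u => christoffel G' a b d u - christoffel G a b d u -
      linChr c D a b d u) u = pd e (christoffel G' a b d) u - pd e (christoffel G a b d) u -
      pd e (linChr c D a b d) u := fun a b d e => by
    rw [pd_sub_sub (d2 _ _ _) (d1 _ _ _) (dl _ _ _)]
  simp only [hpd, riemann, linRiem, Finset.sum_sub_distrib]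
  ring

omit hG' in
lemma flat_linRiem {D : Model n → Fin n → Fin n → ℝ} (c : Fin n → Fin n → ℝ)
    (hδ : ∀ μ ν, Flat Ω x (K + 2) (fun u => D u μ ν))
    (α β μ ν : Fin n) : Flat Ω x K (linRiem c D α β μ ν) :=
  ((flat_linChr hG hx c hδ α β ν).pd_sub_one hG.isOpen μ).sub hG.isOpen hx
    ((flat_linChr hG hx c hδ α β μ).pd_sub_one hG.isOpen ν)

/-- The change of the covariant derivatives of the curvature is the partial derivative of the
linearized curvature, up to an error of higher order: the connection terms contain one derivative
less. -/
lemma flat_nablaRiemann_sub_sub (hδ : ∀ μ ν, Flat Ω x (K + 2) (fun u => G' u μ ν - G u μ ν))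
    (j : ℕ) (α : Fin n) (l : Fin (j + 3) → Fin n) :
    Flat Ω x (K + 1 - j) (fun u => nablaRiemann G' j α l u - nablaRiemann G j α l u -
      iterPd j (linRiem (ginv (G x)) (fun u μ ν => G' u μ ν - G u μ ν)
        α (l ⟨j, by omega⟩) (l ⟨j + 1, by omega⟩) (l ⟨j + 2, by omega⟩))
        (fun i => l (Fin.castAdd 3 i)) u) := by
  have hΩ := hG.isOpen
  set c := ginv (G x)
  set D : Model n → Fin n → Fin n → ℝ := fun u μ ν => G' u μ ν - G u μ ν
  have hlin := flat_linRiem hG hx c (D := D) hδ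
  induction j generalizing α with
  | zero => exact flat_riemann_sub_sub hG hG' hx hδ _ _ _ _
  | succ j ih =>
    have hdiff : ∀ α (l : Fin (j + 3) → Fin n), Flat Ω x (K - j)
        (fun u => nablaRiemann G' j α l u - nablaRiemann G j α l u) := by
      intro α l
      exact (((ih α l).mono (by omega)).add hΩ hx ((hlin α (l ⟨j, by omega⟩) (l ⟨j + 1, by omega⟩)
        (l ⟨j + 2, by omega⟩)).iterPd hΩ j (fun i => l (Fin.castAdd 3 i)))).congr hΩ hx
        fun u _ => by ring
    have hΓ : ∀ a b d, Flat Ω x (K - j)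
        (fun u => christoffel G' a b d u - christoffel G a b d u) := fun a b d =>
      (flat_christoffel_sub hG hG' hx (K := K + 1) hδ a b d).mono (by omega)
    have hm : ∀ a b d α (l : Fin (j + 3) → Fin n), Flat Ω x (K - j)
        (fun u => christoffel G' a b d u * nablaRiemann G' j α l u
          - christoffel G a b d u * nablaRiemann G j α l u) := fun a b d α l =>
      flat_mul_sub_mul hG hx (hG.christoffel _ _ _) (hG'.nablaRiemann _ _ _) (hΓ _ _ _)
        (hdiff _ _)
    rw [show K + 1 - (j + 1) = K - j by omega]
    have h0 : Flat Ω x (K - j) (pd (l 0) (fun u => nablaRiemann G' j α (Fin.tail l) u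
        - nablaRiemann G j α (Fin.tail l) u -
      iterPd j (linRiem c D α (Fin.tail l ⟨j, by omega⟩) (Fin.tail l ⟨j + 1, by omega⟩)
        (Fin.tail l ⟨j + 2, by omega⟩)) (fun i => Fin.tail l (Fin.castAdd 3 i)) u)) := by
      have := (ih α (Fin.tail l)).pd_sub_one hΩ (l 0)
      rwa [show K + 1 - j - 1 = K - j by omega] at this
    have key := (h0.add hΩ hx
      (Flat.sum hΩ hx Finset.univ fun τ => hm α (l 0) τ τ (Fin.tail l))).sub hΩ hx
      (Flat.sum hΩ hx Finset.univ fun s : Fin (j + 3) => Flat.sum hΩ hx Finset.univ fun τ =>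
        hm τ (l 0) (Fin.tail l s) α (Function.update (Fin.tail l) s τ))
    refine key.congr hΩ hx fun u hu => ?_
    have d1 : DifferentiableAt ℝ (nablaRiemann G j α (Fin.tail l)) u :=
      differentiableAt_of_contDiffOn hΩ (hG.nablaRiemann _ _ _) hu
    have d2 : DifferentiableAt ℝ (nablaRiemann G' j α (Fin.tail l)) u :=
      differentiableAt_of_contDiffOn hΩ (hG'.nablaRiemann _ _ _) hu
    have d3 : DifferentiableAt ℝ (iterPd j (linRiem c D α (Fin.tail l ⟨j, by omega⟩)
        (Fin.tail l ⟨j + 1, by omega⟩) (Fin.tail l ⟨j + 2, by omega⟩))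
        (fun i => Fin.tail l (Fin.castAdd 3 i))) u :=
      differentiableAt_of_contDiffOn hΩ (contDiffOn_iterPd hΩ (hlin _ _ _ _).contDiffOn _ _) hu
    have e : iterPd (j + 1) (linRiem c D α (l ⟨j + 1, by omega⟩) (l ⟨j + 1 + 1, by omega⟩)
        (l ⟨j + 1 + 2, by omega⟩)) (fun i => l (Fin.castAdd 3 i)) u =
        pd (l 0) (iterPd j (linRiem c D α (Fin.tail l ⟨j, by omega⟩)
        (Fin.tail l ⟨j + 1, by omega⟩) (Fin.tail l ⟨j + 2, by omega⟩))
        (fun i => Fin.tail l (Fin.castAdd 3 i))) u := rfl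
    rw [e]
    simp only [nablaRiemann]
    rw [pd_sub_sub d2 d1 d3]
    simp only [Finset.sum_sub_distrib]
    ring

/-- The change of the covariant derivatives of a scalar is the change of its partial
derivatives, up to an error of higher order. For `j ≥ 2` the Christoffel symbols enter, so the
metrics too have to agree below order `K`. -/
lemma flat_nablaScalar_sub_sub {φ φ' : Model n → ℝ}
    (hδ : ∀ μ ν, Flat Ω x K (fun u => G' u μ ν - G u μ ν)) (hφ : ContDiffOn ℝ ∞ φ Ω)
    (hφ' : ContDiffOn ℝ ∞ φ' Ω) (hφφ' : Flat Ω x K (fun u => φ' u - φ u))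
    (j : ℕ) (l : Fin j → Fin n) :
    Flat Ω x (K + 1 - j) (fun u => nablaScalar G' φ' j l u - nablaScalar G φ j l u -
      iterPd j (fun u => φ' u - φ u) l u) := by
  have hΩ := hG.isOpen
  induction j with
  | zero =>
    exact (flat_zero hx hΩ _).congr hΩ hx fun u _ => sub_self _
  | succ j ih =>
    have hdiff : ∀ (l : Fin j → Fin n), Flat Ω x (K - j)
        (fun u => nablaScalar G' φ' j l u - nablaScalar G φ j l u) := by
      intro l
      exact (((ih l).mono (by omega)).add hΩ hx (hφφ'.iterPd hΩ j l)).congr hΩ hx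
        fun u _ => by ring
    have hm : ∀ (_ : Fin j) a b d (l : Fin j → Fin n), Flat Ω x (K - j)
        (fun u => christoffel G' a b d u * nablaScalar G' φ' j l u
          - christoffel G a b d u * nablaScalar G φ j l u) := by
      intro s a b d l
      refine flat_mul_sub_mul hG hx (hG.christoffel _ _ _) (hG'.nablaScalar hφ' _ _) ?_
        (hdiff _)
      -- For `K = 0` only the smoothness of the difference is claimed.
      rcases Nat.eq_zero_or_pos K with hK | hK
      · subst hK
        rw [Nat.zero_sub]
        exact (hG'.christoffel _ _ _).sub (hG.christoffel _ _ _)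
      · obtain ⟨K, rfl⟩ := Nat.exists_eq_succ_of_ne_zero hK.ne'
        exact (flat_christoffel_sub hG hG' hx hδ a b d).mono (by have := s.2; omega)
    rw [show K + 1 - (j + 1) = K - j by omega]
    have h0 := (ih (Fin.tail l)).pd_sub_one hΩ (l 0)
    rw [show K + 1 - j - 1 = K - j by omega] at h0
    have key := h0.sub hΩ hx
      (Flat.sum hΩ hx Finset.univ fun s : Fin j => Flat.sum hΩ hx Finset.univ fun τ =>
        hm s τ (l 0) (Fin.tail l s) (Function.update (Fin.tail l) s τ))
    refine key.congr hΩ hx fun u hu => ?_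
    have d1 : DifferentiableAt ℝ (nablaScalar G φ j (Fin.tail l)) u :=
      differentiableAt_of_contDiffOn hΩ (hG.nablaScalar hφ _ _) hu
    have d2 : DifferentiableAt ℝ (nablaScalar G' φ' j (Fin.tail l)) u :=
      differentiableAt_of_contDiffOn hΩ (hG'.nablaScalar hφ' _ _) hu
    have d3 : DifferentiableAt ℝ (iterPd j (fun u => φ' u - φ u) (Fin.tail l)) u :=
      differentiableAt_of_contDiffOn hΩ (contDiffOn_iterPd hΩ hφφ'.contDiffOn _ _) hu
    have e : iterPd (j + 1) (fun u => φ' u - φ u) l u =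
        pd (l 0) (iterPd j (fun u => φ' u - φ u) (Fin.tail l)) u := rfl
    rw [e]
    simp only [nablaScalar]
    rw [pd_sub_sub d2 d1 d3]
    simp only [Finset.sum_sub_distrib]
    ring

end Symbol

/-! ### Inversion of the leading part -/

section Inversion

variable {n : ℕ}

lemma differentiableAt_polyEval {k : ℕ} (T : (Fin k → Fin n) → ℝ) (ξ : Model n) :
    DifferentiableAt ℝ (polyEval T) ξ := (contDiff_polyEval T).differentiable (by simp) ξ

lemma differentiableAt_coord (a : Fin n) (ξ : Model n) :
    DifferentiableAt ℝ (fun v : Model n => v a) ξ := by fun_prop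

lemma contDiff_pd {f : Model n → ℝ} (hf : ContDiff ℝ ∞ f) (μ : Fin n) : ContDiff ℝ ∞ (pd μ f) := by
  rw [← contDiffOn_univ] at *
  exact contDiffOn_pd isOpen_univ hf μ

lemma differentiableAt_pd_polyEval {k : ℕ} (T : (Fin k → Fin n) → ℝ) (a : Fin n) (ξ : Model n) :
    DifferentiableAt ℝ (pd a (polyEval T)) ξ :=
  (contDiff_pd (contDiff_polyEval T) a).differentiable (by simp) ξ

/-- `∂_c (∑ ξ^b f_b) = f_c + ∑ ξ^b ∂_c f_b`. -/
lemma pd_sum_coord_mul {f : Fin n → Model n → ℝ} {ξ : Model n}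
    (hf : ∀ b, DifferentiableAt ℝ (f b) ξ) (c : Fin n) :
    pd c (fun ξ => ∑ b, ξ b * f b ξ) ξ = f c ξ + ∑ b, ξ b * pd c (f b) ξ := by
  rw [pd_sum (f := fun b ξ => ξ b * f b ξ) fun b _ => (differentiableAt_coord b ξ).mul (hf b)]
  simp only [pd_mul (differentiableAt_coord _ ξ) (hf _), pd_coord, Finset.sum_add_distrib]
  simp [kron]

/-- Euler's relation for homogeneous polynomials. -/
lemma sum_coord_mul_pd_polyEval {k : ℕ} {T : (Fin (k + 1) → Fin n) → ℝ} (hT : Sym T)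
    (ξ : Model n) : ∑ c, ξ c * pd c (polyEval T) ξ = (k + 1) * polyEval T ξ := by
  rw [polyEval_succ, Finset.mul_sum]
  refine Finset.sum_congr rfl fun c _ => ?_
  rw [pd_polyEval hT]; ring

/-- The lowered leading part of the `S`-coordinates, as polynomials: for metric derivatives
`p_{ab, l}` with polynomials `P_{ab}`, this is `∑ ξ^b P_{ba} - (1 / 2(k + 1)) ∑ ξ^b ξ^c ∂_a P_{bc}`. -/
def symbolS {k : ℕ} (p : Fin n → Fin n → (Fin (k + 1) → Fin n) → ℝ) (a : Fin n) (ξ : Model n) : ℝ :=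
  ∑ μ, ξ μ * polyEval (p μ a) ξ -
    1 / (2 * (k + 1)) * ∑ β, ξ β * ∑ μ, ξ μ * pd a (polyEval (p β μ)) ξ

/-- The lowered leading part of the curvature coordinates, as polynomials, multiplied by `2 k`.
Here `k + 1` is the number of derivatives of the metric, so that the case `k = 0`, without curvature,
is included with the value zero. -/
def symbolQ {k : ℕ} (p : Fin n → Fin n → (Fin (k + 1) → Fin n) → ℝ) (a c : Fin n) (ξ : Model n) :
    ℝ :=
  k * polyEval (p a c) ξ + 1 / (k + 1) * ∑ β, ξ β * ∑ μ, ξ μ * pd c (pd a (polyEval (p β μ))) ξ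
    - k / (k + 1) * (∑ β, ξ β * pd a (polyEval (p β c)) ξ + ∑ β, ξ β * pd c (polyEval (p β a)) ξ)

/-- The metric derivatives of order `k + 1` in terms of the lowered leading parts `s`, `q` of the
`S`-coordinates and of the curvature coordinates. -/
def metricOfSymbol {k : ℕ} (s : Fin n → (Fin (k + 2) → Fin n) → ℝ)
    (q : Fin n → Fin n → (Fin (k + 1) → Fin n) → ℝ) (a c : Fin n) (l : Fin (k + 1) → Fin n) : ℝ :=
  s a (Fin.cons (α := fun _ => Fin n) c l) + s c (Fin.cons (α := fun _ => Fin n) a l)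
    + 2 * k / (k + 2) * q a c l

variable {k : ℕ} {p : Fin n → Fin n → (Fin (k + 1) → Fin n) → ℝ}
  {s : Fin n → (Fin (k + 2) → Fin n) → ℝ} {q : Fin n → Fin n → (Fin (k + 1) → Fin n) → ℝ}

lemma sym_metricOfSymbol (hs : ∀ a, Sym (s a)) (hq : ∀ a c, Sym (q a c)) (a c : Fin n) :
    Sym (metricOfSymbol s q a c) :=
  (((hs a).cons c).add ((hs c).cons a)).add ((hq a c).const_mul _)

/-- The polynomials of `metricOfSymbol`: fixing one slot of a symmetric array is
differentiation of its polynomial. -/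
lemma polyEval_metricOfSymbol (hs : ∀ a, Sym (s a)) (a c : Fin n) (ξ : Model n) :
    polyEval (metricOfSymbol s q a c) ξ =
      1 / (k + 2) * (pd c (polyEval (s a)) ξ + pd a (polyEval (s c)) ξ)
        + 2 * k / (k + 2) * polyEval (q a c) ξ := by
  have : ((k : ℝ) + 2) ≠ 0 := by positivity
  have e : ∀ a c, polyEval (fun l => s a (Fin.cons (α := fun _ => Fin n) c l)) ξ =
      1 / (k + 2) * pd c (polyEval (s a)) ξ := fun a c => by
    rw [pd_polyEval (hs a)]; push_cast; field_simp; ring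
  unfold metricOfSymbol
  rw [polyEval_add (fun l => s a (Fin.cons (α := fun _ => Fin n) c l) +
    s c (Fin.cons (α := fun _ => Fin n) a l)), polyEval_add, polyEval_const_mul, e, e]
  ring

/-- The metric derivatives are recovered from their symbols. -/
lemma metricOfSymbol_symbol (hp : ∀ a b, Sym (p a b)) (hpp : ∀ a b l, p a b l = p b a l)
    (hs : ∀ a, Sym (s a)) (hq : ∀ a c, Sym (q a c))
    (hS : ∀ a ξ, polyEval (s a) ξ = symbolS p a ξ)
    (hQ : ∀ a c ξ, 2 * k * polyEval (q a c) ξ = symbolQ p a c ξ) (a c : Fin n) :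
    metricOfSymbol s q a c = p a c := by
  refine (sym_metricOfSymbol hs hq a c).ext_polyEval (hp a c) fun ξ => ?_
  have hpp' : ∀ a b, polyEval (p a b) = polyEval (p b a) := fun a b => by
    congr 1; exact funext (hpp a b)
  have hk : ((k : ℝ) + 2) ≠ 0 := by positivity
  have hk1 : ((k : ℝ) + 1) ≠ 0 := by positivity
  have dP := fun a b => differentiableAt_polyEval (p a b) ξ
  have dP' := fun a b d => differentiableAt_pd_polyEval (p a b) d ξ
  -- the derivatives of `symbolS p a`, which equals the polynomial of `s a` by `hS`
  have e : ∀ a c, pd c (polyEval (s a)) ξ = polyEval (p c a) ξ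
      + ∑ b, ξ b * pd c (polyEval (p b a)) ξ - 1 / (2 * (k + 1)) *
        (2 * ∑ b, ξ b * pd a (polyEval (p b c)) ξ
          + ∑ β, ξ β * ∑ μ, ξ μ * pd c (pd a (polyEval (p β μ))) ξ) := by
    intro a c
    have d1 : ∀ β, DifferentiableAt ℝ (fun ξ : Model n =>
        ∑ μ, ξ μ * pd a (polyEval (p β μ)) ξ) ξ := fun β =>
      DifferentiableAt.fun_sum fun μ _ => (differentiableAt_coord μ ξ).mul (dP' β μ a)
    have d2 : DifferentiableAt ℝ (fun ξ : Model n =>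
        ∑ β, ξ β * ∑ μ, ξ μ * pd a (polyEval (p β μ)) ξ) ξ :=
      DifferentiableAt.fun_sum fun β _ => (differentiableAt_coord β ξ).mul (d1 β)
    have d3 : DifferentiableAt ℝ (fun ξ : Model n => ∑ μ, ξ μ * polyEval (p μ a) ξ) ξ :=
      DifferentiableAt.fun_sum fun μ _ => (differentiableAt_coord μ ξ).mul (dP μ a)
    rw [show polyEval (s a) = fun ξ => symbolS p a ξ from funext (hS a)]
    unfold symbolS
    rw [pd_sub d3 (d2.const_mul _), pd_const_mul d2, pd_sum_coord_mul (fun b => dP b a),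
      pd_sum_coord_mul d1]
    simp only [pd_sum_coord_mul (fun b => dP' _ b a), mul_add, Finset.sum_add_distrib]
    have : ∑ i, ξ i * pd a (polyEval (p i c)) ξ = ∑ i, ξ i * pd a (polyEval (p c i)) ξ :=
      Finset.sum_congr rfl fun i _ => by rw [hpp' i c]
    rw [this]
    ring
  have hB : ∑ β, ξ β * ∑ μ, ξ μ * pd a (pd c (polyEval (p β μ))) ξ =
      ∑ β, ξ β * ∑ μ, ξ μ * pd c (pd a (polyEval (p β μ))) ξ := by
    refine Finset.sum_congr rfl fun β _ => ?_
    congr 1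
    refine Finset.sum_congr rfl fun μ _ => ?_
    rw [pd_comm (contDiff_polyEval _).contDiffAt]
  have hQ' := hQ a c ξ
  rw [polyEval_metricOfSymbol hs, e, e, hB, hpp' c a,
    show 2 * (k : ℝ) / (k + 2) * polyEval (q a c) ξ =
      1 / (k + 2) * (2 * k * polyEval (q a c) ξ) by ring, hQ', symbolQ]
  field_simp
  ring

/-- The symbol of the `S`-coordinates takes prescribed values on the metric derivatives built
from them. -/
lemma symbolS_metricOfSymbol (hs : ∀ a, Sym (s a))
    (hqq : ∀ a c l, q a c l = q c a l) (hq0 : ∀ a ξ, ∑ c, ξ c * polyEval (q a c) ξ = 0)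
    (a : Fin n) (ξ : Model n) : symbolS (metricOfSymbol s q) a ξ = polyEval (s a) ξ := by
  have hk : ((k : ℝ) + 2) ≠ 0 := by positivity
  have hk1 : ((k : ℝ) + 1) ≠ 0 := by positivity
  set p := metricOfSymbol s q with hpdef
  have dσ := fun a ξ => differentiableAt_polyEval (s a) ξ
  have dσ' := fun a c ξ => differentiableAt_pd_polyEval (s a) c ξ
  have euler : ∀ a ξ, ∑ c, ξ c * pd c (polyEval (s a)) ξ = (k + 2) * polyEval (s a) ξ := by
    intro a ξ
    rw [sum_coord_mul_pd_polyEval (hs a)]; push_cast; ring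
  -- The contractions of `p` with `ξ` are expressed through `v = ∑ ξ^c s_c` and its derivatives.
  set v : Model n → ℝ := fun ξ => ∑ c, ξ c * polyEval (s c) ξ with hv
  have hpdv : ∀ a ξ, pd a v ξ = polyEval (s a) ξ + ∑ c, ξ c * pd a (polyEval (s c)) ξ :=
    fun a ξ => pd_sum_coord_mul (fun b => dσ b ξ) a
  have hw : ∀ a ξ, ∑ μ, ξ μ * polyEval (p μ a) ξ =
      (k + 1) / (k + 2) * polyEval (s a) ξ + 1 / (k + 2) * pd a v ξ := by
    intro a ξ
    have h0 : ∑ μ, ξ μ * polyEval (q μ a) ξ = 0 := by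
      rw [← hq0 a ξ]
      refine Finset.sum_congr rfl fun μ _ => ?_
      rw [show q μ a = q a μ from funext (hqq μ a)]
    have e1 : ∀ μ, ξ μ * polyEval (p μ a) ξ =
        1 / (k + 2) * (ξ μ * pd a (polyEval (s μ)) ξ) + 1 / (k + 2) * (ξ μ * pd μ (polyEval (s a)) ξ)
          + 2 * k / (k + 2) * (ξ μ * polyEval (q μ a) ξ) := fun μ => by
      rw [hpdef, polyEval_metricOfSymbol hs]; ring
    simp only [e1, Finset.sum_add_distrib, ← Finset.mul_sum]
    rw [h0, euler, hpdv]
    field_simp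
    ring
  have hV : ∀ ξ : Model n, ∑ β, ξ β * ∑ μ, ξ μ * polyEval (p β μ) ξ = 2 * v ξ := by
    intro ξ
    have : ∑ β, ξ β * ∑ μ, ξ μ * polyEval (p β μ) ξ =
        ∑ μ, ξ μ * ∑ β, ξ β * polyEval (p β μ) ξ := by
      simp only [Finset.mul_sum]
      rw [Finset.sum_comm]
      exact Finset.sum_congr rfl fun μ _ => Finset.sum_congr rfl fun β _ => by ring
    rw [this]
    simp only [hw, mul_add, Finset.sum_add_distrib]
    have e2 : ∑ i, ξ i * (1 / (k + 2) * pd i v ξ) = 1 / (k + 2) * ((k + 3) * v ξ) := by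
      have : ∀ i, ξ i * (1 / ((k : ℝ) + 2) * pd i v ξ) = 1 / (k + 2) * (ξ i * pd i v ξ) :=
        fun i => by ring
      rw [Finset.sum_congr rfl fun i _ => this i, ← Finset.mul_sum]
      simp only [hpdv, mul_add, Finset.sum_add_distrib]
      have e3 : ∑ i, ξ i * ∑ c, ξ c * pd i (polyEval (s c)) ξ = (k + 2) * v ξ := by
        simp only [Finset.mul_sum]
        rw [Finset.sum_comm, hv, Finset.mul_sum]
        refine Finset.sum_congr rfl fun c _ => ?_
        have : ∀ i, ξ i * (ξ c * pd i (polyEval (s c)) ξ) = ξ c * (ξ i * pd i (polyEval (s c)) ξ) :=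
          fun i => by ring
        simp only [this, ← Finset.mul_sum, euler]
        ring
      rw [e3]
      simp only [hv]
      ring
    have e4 : ∑ i, ξ i * ((k + 1) / (k + 2) * polyEval (s i) ξ) = (k + 1) / (k + 2) * v ξ := by
      rw [hv, Finset.mul_sum]
      exact Finset.sum_congr rfl fun i _ => by ring
    rw [e2, e4]
    field_simp
    ring
  have dP := fun a b ξ => differentiableAt_polyEval (p a b) ξ
  have dv : ∀ ξ, DifferentiableAt ℝ v ξ := fun ξ =>
    DifferentiableAt.fun_sum fun c _ => (differentiableAt_coord c ξ).mul (dσ c ξ)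
  -- differentiating `∑ ξ^b ξ^c P_{bc} = 2 v`
  have hdV : 2 * ∑ μ, ξ μ * polyEval (p μ a) ξ
      + ∑ β, ξ β * ∑ μ, ξ μ * pd a (polyEval (p β μ)) ξ = 2 * pd a v ξ := by
    have d1 : ∀ β, DifferentiableAt ℝ (fun ξ : Model n => ∑ μ, ξ μ * polyEval (p β μ) ξ) ξ :=
      fun β => DifferentiableAt.fun_sum fun μ _ => (differentiableAt_coord μ ξ).mul (dP β μ ξ)
    have h1 := pd_sum_coord_mul d1 a
    rw [show (fun ξ : Model n => ∑ β, ξ β * ∑ μ, ξ μ * polyEval (p β μ) ξ) = fun ξ => 2 * v ξ from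
      funext hV, pd_const_mul (dv ξ)] at h1
    simp only [pd_sum_coord_mul (fun b => dP _ b ξ), mul_add, Finset.sum_add_distrib] at h1
    have hpp : ∀ μ, polyEval (p a μ) = polyEval (p μ a) := fun μ => by
      congr 1
      funext l
      simp only [hpdef, metricOfSymbol, hqq a μ]
      ring
    simp only [hpp] at h1
    linarith
  have h2 : ∑ β, ξ β * ∑ μ, ξ μ * pd a (polyEval (p β μ)) ξ =
      2 * pd a v ξ - 2 * ∑ μ, ξ μ * polyEval (p μ a) ξ := by linarith
  unfold symbolS
  rw [h2, hw]
  field_simp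
  ring

end Inversion

/-! ### The symbols of the covariant coordinates -/

section SymbolComputation

variable {n : ℕ} {Ω : Set (Model n)} {x : Model n} {D : Model n → Fin n → Fin n → ℝ}

lemma iterPd_linChr (hΩ : IsOpen Ω) (hx : x ∈ Ω) (hD : ∀ a b, ContDiffOn ℝ ∞ (fun u => D u a b) Ω)
    (c : Fin n → Fin n → ℝ) (α μ ν : Fin n) (k : ℕ) (l : Fin k → Fin n) :
    iterPd k (linChr c D α μ ν) l x = 1 / 2 * ∑ γ, c α γ *
      (iterPd (k + 1) (fun u => D u ν γ) (Fin.snoc (α := fun _ => Fin n) l μ) x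
        + iterPd (k + 1) (fun u => D u γ μ) (Fin.snoc (α := fun _ => Fin n) l ν) x
        - iterPd (k + 1) (fun u => D u μ ν) (Fin.snoc (α := fun _ => Fin n) l γ) x) := by
  have h : ∀ a b d, ContDiffOn ℝ ∞ (pd a (fun u => D u b d)) Ω := fun a b d =>
    contDiffOn_pd hΩ (hD b d) a
  have h2 : ∀ γ, ContDiffOn ℝ ∞ (fun u => pd μ (fun v => D v ν γ) u + pd ν (fun v => D v γ μ) u
      - pd γ (fun v => D v μ ν) u) Ω := fun γ => ((h _ _ _).add (h _ _ _)).sub (h _ _ _)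
  have h3 : ∀ γ, ContDiffOn ℝ ∞ (fun u => c α γ * (pd μ (fun v => D v ν γ) u
      + pd ν (fun v => D v γ μ) u - pd γ (fun v => D v μ ν) u)) Ω := fun γ =>
    contDiffOn_const.mul (h2 γ)
  change iterPd k (fun u => 1 / 2 * ∑ γ, c α γ * (pd μ (fun v => D v ν γ) u
      + pd ν (fun v => D v γ μ) u - pd γ (fun v => D v μ ν) u)) l x = _
  rw [iterPd_const_mul hΩ (ContDiffOn.sum fun γ _ => h3 γ) _ _ _ hx]
  dsimp only
  rw [iterPd_sum hΩ _ (fun γ _ => h3 γ) _ _ hx]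
  dsimp only
  congr 1
  refine Finset.sum_congr rfl fun γ _ => ?_
  rw [iterPd_const_mul hΩ (h2 γ) _ _ _ hx]
  dsimp only
  rw [iterPd_sub hΩ ((h _ _ _).add (h _ _ _)) (h _ _ _) _ _ hx]
  dsimp only
  rw [iterPd_add hΩ (h _ _ _) (h _ _ _) _ _ hx]
  simp only [iterPd_snoc]

lemma contDiffOn_linChr (hΩ : IsOpen Ω) (hD : ∀ a b, ContDiffOn ℝ ∞ (fun u => D u a b) Ω)
    (c : Fin n → Fin n → ℝ) (α μ ν : Fin n) : ContDiffOn ℝ ∞ (linChr c D α μ ν) Ω := by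
  have h : ∀ a b d, ContDiffOn ℝ ∞ (pd a (fun u => D u b d)) Ω := fun a b d =>
    contDiffOn_pd hΩ (hD b d) a
  exact contDiffOn_const.mul (ContDiffOn.sum fun γ _ => contDiffOn_const.mul
    (((h _ _ _).add (h _ _ _)).sub (h _ _ _)))

lemma iterPd_linRiem (hΩ : IsOpen Ω) (hx : x ∈ Ω)
    (hD : ∀ a b, ContDiffOn ℝ ∞ (fun u => D u a b) Ω)
    (c : Fin n → Fin n → ℝ) (α β μ ν : Fin n) (k : ℕ) (l : Fin k → Fin n) :
    iterPd k (linRiem c D α β μ ν) l x =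
      iterPd (k + 1) (linChr c D α β ν) (Fin.snoc (α := fun _ => Fin n) l μ) x -
      iterPd (k + 1) (linChr c D α β μ) (Fin.snoc (α := fun _ => Fin n) l ν) x := by
  have h : ∀ a b d e, ContDiffOn ℝ ∞ (pd a (linChr c D b d e)) Ω := fun a b d e =>
    contDiffOn_pd hΩ (contDiffOn_linChr hΩ hD c b d e) a
  change iterPd k (fun u => pd μ (linChr c D α β ν) u - pd ν (linChr c D α β μ) u) l x = _
  rw [iterPd_sub hΩ (h _ _ _ _) (h _ _ _ _) _ _ hx]
  simp only [iterPd_snoc]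

lemma snoc_snoc_apply {k : ℕ} {α : Type*} (l : Fin k → α) (a b : α) :
    (Fin.snoc (α := fun _ => α) (Fin.snoc (α := fun _ => α) l a : Fin (k + 1) → α) b : Fin (k + 2) → α)
      (Fin.natAdd k (0 : Fin 2)) = a ∧
    (Fin.snoc (α := fun _ => α) (Fin.snoc (α := fun _ => α) l a : Fin (k + 1) → α) b : Fin (k + 2) → α)
      (Fin.natAdd k (1 : Fin 2)) = b ∧
    (fun i => (Fin.snoc (α := fun _ => α) (Fin.snoc (α := fun _ => α) l a : Fin (k + 1) → α) b :
      Fin (k + 2) → α) (Fin.castAdd 2 i)) = l := by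
  refine ⟨?_, ?_, ?_⟩
  · have : (Fin.natAdd k (0 : Fin 2) : Fin (k + 2)) = (Fin.last k).castSucc := Fin.ext (by simp)
    rw [this, Fin.snoc_castSucc, Fin.snoc_last]
  · have : (Fin.natAdd k (1 : Fin 2) : Fin (k + 2)) = Fin.last (k + 1) := Fin.ext (by simp)
    rw [this, Fin.snoc_last]
  · funext i
    have : (Fin.castAdd 2 i : Fin (k + 2)) = i.castSucc.castSucc := Fin.ext (by simp)
    rw [this, Fin.snoc_castSucc, Fin.snoc_castSucc]

lemma snoc_snoc_snoc_apply {k : ℕ} {α : Type*} (l : Fin k → α) (a b c : α) :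
    (Fin.snoc (α := fun _ => α) (Fin.snoc (α := fun _ => α) (Fin.snoc (α := fun _ => α) l a :
      Fin (k + 1) → α) b : Fin (k + 2) → α) c : Fin (k + 3) → α) ⟨k, by omega⟩ = a ∧
    (Fin.snoc (α := fun _ => α) (Fin.snoc (α := fun _ => α) (Fin.snoc (α := fun _ => α) l a :
      Fin (k + 1) → α) b : Fin (k + 2) → α) c : Fin (k + 3) → α) ⟨k + 1, by omega⟩ = b ∧
    (Fin.snoc (α := fun _ => α) (Fin.snoc (α := fun _ => α) (Fin.snoc (α := fun _ => α) l a :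
      Fin (k + 1) → α) b : Fin (k + 2) → α) c : Fin (k + 3) → α) ⟨k + 2, by omega⟩ = c ∧
    (fun i => (Fin.snoc (α := fun _ => α) (Fin.snoc (α := fun _ => α) (Fin.snoc (α := fun _ => α) l a :
      Fin (k + 1) → α) b : Fin (k + 2) → α) c : Fin (k + 3) → α) (Fin.castAdd 3 i)) = l := by
  refine ⟨?_, ?_, ?_, ?_⟩
  · have : (⟨k, by omega⟩ : Fin (k + 3)) = (Fin.last k).castSucc.castSucc := Fin.ext (by simp)
    rw [this, Fin.snoc_castSucc, Fin.snoc_castSucc, Fin.snoc_last]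
  · have : (⟨k + 1, by omega⟩ : Fin (k + 3)) = (Fin.last (k + 1)).castSucc := Fin.ext (by simp)
    rw [this, Fin.snoc_castSucc, Fin.snoc_last]
  · have : (⟨k + 2, by omega⟩ : Fin (k + 3)) = Fin.last (k + 2) := Fin.ext (by simp)
    rw [this, Fin.snoc_last]
  · funext i
    have : (Fin.castAdd 3 i : Fin (k + 3)) = i.castSucc.castSucc.castSucc := Fin.ext (by simp)
    rw [this, Fin.snoc_castSucc, Fin.snoc_castSucc, Fin.snoc_castSucc]

variable (hΩ : IsOpen Ω) (hx : x ∈ Ω) (hD : ∀ a b, ContDiffOn ℝ ∞ (fun u => D u a b) Ω)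
  (hDD : ∀ u ∈ Ω, ∀ a b, D u a b = D u b a)
include hΩ hx hD hDD

omit hD in
lemma iterPd_symm (k : ℕ) (l : Fin k → Fin n) (a b : Fin n) :
    iterPd k (fun u => D u a b) l x = iterPd k (fun u => D u b a) l x :=
  iterPd_congr hΩ (fun u hu => hDD u hu a b) k l hx

/-- The lowered linearized `S`-coordinates are given by `symbolS`. -/
lemma polyEval_linChr {g c : Fin n → Fin n → ℝ} (hgc : ∀ a b, ∑ e, g a e * c e b = kron a b)
    (k : ℕ) (a : Fin n) (ξ : Model n) :
    ∑ α, g a α * polyEval (fun l : Fin (k + 2) → Fin n => iterPd k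
      (linChr c D α (l (Fin.natAdd k (0 : Fin 2))) (l (Fin.natAdd k (1 : Fin 2)))) (fun i => l (Fin.castAdd 2 i)) x) ξ
    = symbolS (fun a b l => iterPd (k + 1) (fun u => D u a b) l x) a ξ := by
  set p : Fin n → Fin n → (Fin (k + 1) → Fin n) → ℝ :=
    fun a b l => iterPd (k + 1) (fun u => D u a b) l x with hp
  have hps : ∀ a b, Sym (p a b) := fun a b => sym_iterPd hΩ (hD a b) _ hx
  have hpp : ∀ a b, p a b = p b a := fun a b => funext fun l => iterPd_symm hΩ hx hDD _ l a b
  have hk1 : ((k : ℝ) + 1) ≠ 0 := by positivity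
  set P' : Fin n → Fin n → Fin n → ℝ := fun a b m =>
    polyEval (fun l => p a b (Fin.snoc (α := fun _ => Fin n) l m)) ξ with hP'
  have h1 : ∀ α, polyEval (fun l : Fin (k + 2) → Fin n => iterPd k
      (linChr c D α (l (Fin.natAdd k (0 : Fin 2))) (l (Fin.natAdd k (1 : Fin 2)))) (fun i => l (Fin.castAdd 2 i)) x) ξ =
      ∑ γ, c α γ * (1 / 2 * ∑ μ, ξ μ * ∑ β, ξ β * (P' μ γ β + P' γ β μ - P' β μ γ)) := by
    intro α
    rw [polyEval_succ_last]
    simp only [polyEval_succ_last (k := k), (snoc_snoc_apply _ _ _).1, (snoc_snoc_apply _ _ _).2.1,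
      (snoc_snoc_apply _ _ _).2.2]
    have h2 : ∀ β μ, polyEval (fun l : Fin k → Fin n => iterPd k (linChr c D α β μ) l x) ξ =
        1 / 2 * ∑ γ, c α γ * (P' μ γ β + P' γ β μ - P' β μ γ) := by
      intro β μ
      simp only [iterPd_linChr hΩ hx hD]
      rw [polyEval_const_mul, polyEval_sum]
      congr 1
      refine Finset.sum_congr rfl fun γ _ => ?_
      rw [polyEval_const_mul, polyEval_sub, polyEval_add]
    simp only [h2, Finset.mul_sum]
    have : ∀ μ : Fin n, ∑ β, ∑ γ, ξ μ * (ξ β * (1 / 2 * (c α γ * (P' μ γ β + P' γ β μ - P' β μ γ))))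
        = ∑ γ, ∑ β, ξ μ * (ξ β * (1 / 2 * (c α γ * (P' μ γ β + P' γ β μ - P' β μ γ)))) := fun μ =>
      Finset.sum_comm
    simp only [this]
    rw [Finset.sum_comm]
    refine Finset.sum_congr rfl fun γ _ => ?_
    refine Finset.sum_congr rfl fun μ _ => Finset.sum_congr rfl fun β _ => by ring
  simp only [h1, Finset.mul_sum (s := Finset.univ) (f := fun γ => c _ γ * _)]
  rw [Finset.sum_comm]
  simp only [← mul_assoc (g a _) (c _ _), ← Finset.sum_mul, hgc]
  have h3 : ∀ γ : Fin n, ∑ μ, ξ μ * ∑ β, ξ β * (P' μ γ β + P' γ β μ - P' β μ γ) =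
      2 * ∑ μ, ξ μ * polyEval (p μ γ) ξ - ∑ μ, ξ μ * ∑ β, ξ β * P' β μ γ := by
    intro γ
    have e : ∀ a b, polyEval (p a b) ξ = ∑ m, ξ m * P' a b m := fun a b => polyEval_succ_last _ _
    simp only [mul_sub, mul_add, Finset.sum_add_distrib, Finset.sum_sub_distrib]
    have e2 : ∑ μ, ξ μ * ∑ β, ξ β * P' γ β μ = ∑ μ, ξ μ * polyEval (p μ γ) ξ := by
      simp only [e, Finset.mul_sum]
      rw [Finset.sum_comm]
      refine Finset.sum_congr rfl fun β _ => Finset.sum_congr rfl fun μ _ => ?_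
      simp only [hP', hpp γ β]; ring
    rw [e2]
    simp only [← e]; ring
  have h4 : ∀ β μ, P' β μ a = 1 / (k + 1) * pd a (polyEval (p β μ)) ξ := by
    intro β μ
    simp only [hP', (hps β μ).snoc_eq_cons]
    rw [pd_polyEval (hps β μ)]; field_simp
  simp only [h3, kron, ite_mul, one_mul, zero_mul, Finset.sum_ite_eq, Finset.mem_univ, if_true, h4]
  unfold symbolS
  have h5 : ∑ μ, ξ μ * ∑ β, ξ β * (1 / (k + 1) * pd a (polyEval (p β μ)) ξ) =
      1 / (k + 1) * ∑ β, ξ β * ∑ μ, ξ μ * pd a (polyEval (p β μ)) ξ := by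
    simp only [Finset.mul_sum]
    rw [Finset.sum_comm]
    exact Finset.sum_congr rfl fun β _ => Finset.sum_congr rfl fun μ _ => by ring
  rw [h5]
  field_simp

/-- The lowered linearized curvature coordinates are given by `symbolQ`. -/
lemma polyEval_linRiem {g c : Fin n → Fin n → ℝ} (hgc : ∀ a b, ∑ e, g a e * c e b = kron a b)
    (k : ℕ) (a ν : Fin n) (ξ : Model n) :
    2 * ((k + 1 : ℕ) : ℝ) * ∑ α, g a α * polyEval (fun l : Fin (k + 2) → Fin n =>
      (fun l : Fin (k + 3) → Fin n => iterPd k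
      (linRiem c D α (l ⟨k, by omega⟩) (l ⟨k + 1, by omega⟩) (l ⟨k + 2, by omega⟩))
      (fun i => l (Fin.castAdd 3 i)) x) (Fin.snoc (α := fun _ => Fin n) l ν)) ξ
    = symbolQ (k := k + 1) (fun a b l => iterPd (k + 2) (fun u => D u a b) l x) a ν ξ := by
  set p : Fin n → Fin n → (Fin (k + 2) → Fin n) → ℝ :=
    fun a b l => iterPd (k + 2) (fun u => D u a b) l x with hp
  have hps : ∀ a b, Sym (p a b) := fun a b => sym_iterPd hΩ (hD a b) _ hx
  have hpp : ∀ a b, p a b = p b a := fun a b => funext fun l => iterPd_symm hΩ hx hDD _ l a b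
  have hk1 : ((k : ℝ) + 1) ≠ 0 := by positivity
  have hk2 : ((k : ℝ) + 2) ≠ 0 := by positivity
  set P' : Fin n → Fin n → Fin n → ℝ := fun a b m =>
    polyEval (fun l => p a b (Fin.snoc (α := fun _ => Fin n) l m)) ξ with hP'
  set P'' : Fin n → Fin n → Fin n → Fin n → ℝ := fun a b m m' =>
    polyEval (fun l : Fin k → Fin n => p a b (Fin.snoc (α := fun _ => Fin n)
      (Fin.snoc (α := fun _ => Fin n) l m : Fin (k + 1) → Fin n) m')) ξ with hP''
  have hP''s : ∀ a b m m', P'' a b m m' = P'' a b m' m := by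
    intro a b m m'
    simp only [hP'', (hps a b).snoc_eq_cons]
    simp only [((hps a b).cons _).snoc_eq_cons]
    simp only [(hps a b).cons_cons m m']
  have eP' : ∀ a b m', P' a b m' = ∑ m, ξ m * P'' a b m m' := fun a b m' => polyEval_succ_last _ _
  have eP : ∀ a b, polyEval (p a b) ξ = ∑ m, ξ m * P' a b m := fun a b => polyEval_succ_last _ _
  have h1 : ∀ α, polyEval (fun l : Fin (k + 2) → Fin n =>
      (fun l : Fin (k + 3) → Fin n => iterPd k
      (linRiem c D α (l ⟨k, by omega⟩) (l ⟨k + 1, by omega⟩) (l ⟨k + 2, by omega⟩))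
      (fun i => l (Fin.castAdd 3 i)) x) (Fin.snoc (α := fun _ => Fin n) l ν)) ξ =
      ∑ γ, c α γ * (1 / 2 * ∑ μ, ξ μ * ∑ β, ξ β *
        (P'' ν γ μ β - P'' β ν μ γ - P'' μ γ ν β + P'' β μ ν γ)) := by
    intro α
    rw [polyEval_succ_last]
    simp only [polyEval_succ_last (k := k), (snoc_snoc_snoc_apply _ _ _ _).1,
      (snoc_snoc_snoc_apply _ _ _ _).2.1, (snoc_snoc_snoc_apply _ _ _ _).2.2.1,
      (snoc_snoc_snoc_apply _ _ _ _).2.2.2]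
    have h2 : ∀ β μ, polyEval (fun l : Fin k → Fin n => iterPd k (linRiem c D α β μ ν) l x) ξ =
        1 / 2 * ∑ γ, c α γ * (P'' ν γ μ β - P'' β ν μ γ - P'' μ γ ν β + P'' β μ ν γ) := by
      intro β μ
      simp only [iterPd_linRiem hΩ hx hD, iterPd_linChr hΩ hx hD]
      rw [polyEval_sub, polyEval_const_mul, polyEval_const_mul, polyEval_sum, polyEval_sum,
        ← mul_sub, ← Finset.sum_sub_distrib]
      congr 1
      refine Finset.sum_congr rfl fun γ _ => ?_
      rw [polyEval_const_mul, polyEval_const_mul, polyEval_sub, polyEval_add, polyEval_sub,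
        polyEval_add, ← mul_sub]
      change c α γ * (P'' ν γ μ β + P'' γ β μ ν - P'' β ν μ γ -
        (P'' μ γ ν β + P'' γ β ν μ - P'' β μ ν γ)) = _
      rw [hP''s γ β μ ν]; ring
    simp only [h2, Finset.mul_sum]
    have : ∀ μ : Fin n, ∑ β, ∑ γ, ξ μ * (ξ β * (1 / 2 * (c α γ *
          (P'' ν γ μ β - P'' β ν μ γ - P'' μ γ ν β + P'' β μ ν γ))))
        = ∑ γ, ∑ β, ξ μ * (ξ β * (1 / 2 * (c α γ *
          (P'' ν γ μ β - P'' β ν μ γ - P'' μ γ ν β + P'' β μ ν γ)))) := fun μ =>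
      Finset.sum_comm
    simp only [this]
    rw [Finset.sum_comm]
    refine Finset.sum_congr rfl fun γ _ => ?_
    refine Finset.sum_congr rfl fun μ _ => Finset.sum_congr rfl fun β _ => by ring
  simp only [h1, Finset.mul_sum (s := Finset.univ) (f := fun γ => c _ γ * _)]
  have hswap : ∑ α, ∑ γ, g a α * (c α γ * (1 / 2 * ∑ μ, ξ μ * ∑ β, ξ β *
        (P'' ν γ μ β - P'' β ν μ γ - P'' μ γ ν β + P'' β μ ν γ))) =
      1 / 2 * ∑ μ, ξ μ * ∑ β, ξ β *
        (P'' ν a μ β - P'' β ν μ a - P'' μ a ν β + P'' β μ ν a) := by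
    rw [Finset.sum_comm]
    simp only [← mul_assoc (g a _) (c _ _), ← Finset.sum_mul, hgc]
    simp [kron]
  rw [hswap]
  have h3 : ∑ μ, ξ μ * ∑ β, ξ β * (P'' ν a μ β - P'' β ν μ a - P'' μ a ν β + P'' β μ ν a) =
      polyEval (p ν a) ξ - ∑ β, ξ β * P' β ν a - ∑ μ, ξ μ * P' μ a ν
        + ∑ μ, ξ μ * ∑ β, ξ β * P'' β μ ν a := by
    simp only [mul_sub, mul_add, Finset.sum_add_distrib, Finset.sum_sub_distrib]
    congr 2
    · congr 1
      · simp only [eP, eP', Finset.mul_sum]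
        rw [Finset.sum_comm]
        exact Finset.sum_congr rfl fun β _ => Finset.sum_congr rfl fun μ _ => by ring
      · simp only [eP', Finset.mul_sum]
        rw [Finset.sum_comm]
        exact Finset.sum_congr rfl fun β _ => Finset.sum_congr rfl fun μ _ => by ring
    · simp only [eP']
      exact Finset.sum_congr rfl fun β _ => by simp only [hP''s _ _ ν]
  have h4 : ∀ β μ m, P' β μ m = 1 / (k + 2) * pd m (polyEval (p β μ)) ξ := by
    intro β μ m
    simp only [hP', (hps β μ).snoc_eq_cons]
    rw [pd_polyEval (hps β μ)]; push_cast; field_simp; ring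
  have h5 : ∀ β μ m m', P'' β μ m m' = 1 / ((k + 1) * (k + 2)) *
      pd m (pd m' (polyEval (p β μ))) ξ := by
    intro β μ m m'
    simp only [hP'', (hps β μ).snoc_eq_cons]
    simp only [((hps β μ).cons _).snoc_eq_cons]
    have e1 : pd m' (polyEval (p β μ)) = fun ξ => ((k : ℝ) + 2) *
        polyEval (fun l => p β μ (Fin.cons (α := fun _ => Fin n) m' l)) ξ := by
      funext ξ
      rw [pd_polyEval (hps β μ)]; push_cast; ring
    rw [e1, pd_const_mul (differentiableAt_polyEval _ _), pd_polyEval ((hps β μ).cons _)]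
    field_simp
  rw [h3]
  simp only [h4, h5]
  unfold symbolQ
  have h6 : ∑ μ, ξ μ * ∑ β, ξ β * (1 / (((k : ℝ) + 1) * (k + 2)) *
      pd ν (pd a (polyEval (p β μ))) ξ) = 1 / ((k + 1) * (k + 2)) *
      ∑ β, ξ β * ∑ μ, ξ μ * pd ν (pd a (polyEval (p β μ))) ξ := by
    simp only [Finset.mul_sum]
    rw [Finset.sum_comm]
    exact Finset.sum_congr rfl fun β _ => Finset.sum_congr rfl fun μ _ => by ring
  have h7 : ∀ b m, ∑ β, ξ β * (1 / ((k : ℝ) + 2) * pd m (polyEval (p β b)) ξ) =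
      1 / (k + 2) * ∑ β, ξ β * pd m (polyEval (p β b)) ξ := by
    intro b m
    rw [Finset.mul_sum]
    exact Finset.sum_congr rfl fun β _ => by ring
  rw [h6, h7, h7, hpp ν a]
  push_cast
  field_simp
  ring

omit hΩ hx hD hDD in
/-- For first derivatives the curvature symbol vanishes. -/
lemma symbolQ_zero (p : Fin n → Fin n → (Fin (0 + 1) → Fin n) → ℝ) (a c : Fin n) (ξ : Model n) :
    symbolQ (k := 0) p a c ξ = 0 := by
  have h : ∀ β μ, pd c (pd a (polyEval (p β μ))) ξ = 0 := by
    intro β μ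
    have : pd a (polyEval (p β μ)) = fun _ =>
        p β μ (Fin.cons (α := fun _ => Fin n) a Fin.elim0) := by
      funext ξ
      rw [pd_polyEval (sym_of_le_one le_rfl _), polyEval_zero_slots]; simp
    rw [this, pd_const]
  simp [symbolQ, h]

end SymbolComputation

/-! ### Symmetries of the curvature -/

section Curvature

variable {n : ℕ} {Ω : Set (Model n)} {G : Model n → Fin n → Fin n → ℝ}

lemma MetricOn.pd_symm (hG : MetricOn Ω G) {u : Model n} (hu : u ∈ Ω) (a b c : Fin n) :
    pd a (fun v => G v b c) u = pd a (fun v => G v c b) u :=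
  eqOn_pd hG.isOpen (fun v hv => hG.symm v hv b c) a hu

lemma MetricOn.christoffel_symm (hG : MetricOn Ω G) {u : Model n} (hu : u ∈ Ω) (α μ ν : Fin n) :
    BackgroundJets.christoffel G α μ ν u = BackgroundJets.christoffel G α ν μ u := by
  simp only [christoffel_eq]
  congr 1
  refine Finset.sum_congr rfl fun β _ => ?_
  rw [hG.pd_symm hu μ ν β, hG.pd_symm hu ν β μ, hG.pd_symm hu β μ ν]
  ring

/-- The Christoffel symbols of the first kind. -/
def chrLow (G : Model n → Fin n → Fin n → ℝ) (α μ ν : Fin n) (u : Model n) : ℝ :=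
  1 / 2 * (pd μ (fun v => G v ν α) u + pd ν (fun v => G v α μ) u - pd α (fun v => G v μ ν) u)

lemma MetricOn.sum_mul_christoffel (hG : MetricOn Ω G) {u : Model n} (hu : u ∈ Ω) (α μ ν : Fin n) :
    ∑ ρ, G u α ρ * BackgroundJets.christoffel G ρ μ ν u = chrLow G α μ ν u := by
  have e : ∀ ρ, G u α ρ * BackgroundJets.christoffel G ρ μ ν u =
      ∑ β, (G u α ρ * ginv (G u) ρ β) * chrLow G β μ ν u := by
    intro ρ
    rw [christoffel_eq, Finset.mul_sum, Finset.mul_sum]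
    exact Finset.sum_congr rfl fun β _ => by rw [chrLow]; ring
  simp only [e]
  rw [Finset.sum_comm]
  simp only [← Finset.sum_mul, sum_mul_ginv (hG.det_ne u hu)]
  simp [kron]

/-- The metric is covariantly constant. -/
lemma MetricOn.pd_metric (hG : MetricOn Ω G) {u : Model n} (hu : u ∈ Ω) (m α β : Fin n) :
    pd m (fun v => G v α β) u = ∑ ρ, G u α ρ * BackgroundJets.christoffel G ρ m β u
      + ∑ ρ, G u β ρ * BackgroundJets.christoffel G ρ m α u := by
  rw [hG.sum_mul_christoffel hu, hG.sum_mul_christoffel hu, chrLow, chrLow,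
    hG.pd_symm hu m β α, hG.pd_symm hu β m α, hG.pd_symm hu α β m]
  ring

lemma riemann_antisymm (α β μ ν : Fin n) (u : Model n) :
    riemann G α β μ ν u = - riemann G α β ν μ u := by
  unfold riemann; ring

lemma MetricOn.sum_mul_riemann (hG : MetricOn Ω G) {u : Model n} (hu : u ∈ Ω) (α β μ ν : Fin n) :
    ∑ ρ, G u α ρ * BackgroundJets.riemann G ρ β μ ν u =
      (pd μ (chrLow G α β ν) u
        - ∑ ρ, chrLow G ρ α μ u * BackgroundJets.christoffel G ρ β ν u)
      - (pd ν (chrLow G α β μ) u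
        - ∑ ρ, chrLow G ρ α ν u * BackgroundJets.christoffel G ρ β μ u) := by
  have hΩ := hG.isOpen
  have dG := fun a b => differentiableAt_of_contDiffOn hΩ (hG.smooth a b) hu
  have dΓ := fun a b c => differentiableAt_of_contDiffOn hΩ (hG.christoffel a b c) hu
  -- `∂_μ Γ_{αβν}` by the product rule and metric compatibility
  have key : ∀ μ ν, ∑ ρ, G u α ρ * (pd μ (BackgroundJets.christoffel G ρ β ν) u
      + ∑ σ, BackgroundJets.christoffel G ρ σ μ u * BackgroundJets.christoffel G σ β ν u) =
      pd μ (chrLow G α β ν) u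
        - ∑ ρ, chrLow G ρ α μ u * BackgroundJets.christoffel G ρ β ν u := by
    intro μ ν
    have e1 : pd μ (chrLow G α β ν) u =
        ∑ ρ, (pd μ (fun v => G v α ρ) u * BackgroundJets.christoffel G ρ β ν u
          + G u α ρ * pd μ (BackgroundJets.christoffel G ρ β ν) u) := by
      rw [← eqOn_pd hΩ (fun v hv => hG.sum_mul_christoffel hv α β ν) μ hu,
        pd_sum (f := fun ρ v => G v α ρ * BackgroundJets.christoffel G ρ β ν v)
          (fun ρ _ => (dG α ρ).mul (dΓ ρ β ν))]
      exact Finset.sum_congr rfl fun ρ _ => pd_mul (dG α ρ) (dΓ ρ β ν) μ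
    have e2 : ∀ ρ, pd μ (fun v => G v α ρ) u = chrLow G α ρ μ u + chrLow G ρ α μ u := by
      intro ρ
      rw [hG.pd_metric hu, ← hG.sum_mul_christoffel hu, ← hG.sum_mul_christoffel hu]
      simp only [hG.christoffel_symm hu _ μ]
    rw [e1]
    simp only [e2, add_mul, mul_add, Finset.sum_add_distrib]
    have e3 : ∑ ρ, G u α ρ * ∑ σ, BackgroundJets.christoffel G ρ σ μ u *
        BackgroundJets.christoffel G σ β ν u =
        ∑ ρ, chrLow G α ρ μ u * BackgroundJets.christoffel G ρ β ν u := by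
      simp only [← hG.sum_mul_christoffel hu, Finset.mul_sum, Finset.sum_mul]
      rw [Finset.sum_comm]
      exact Finset.sum_congr rfl fun σ _ => Finset.sum_congr rfl fun ρ _ => by ring
    rw [e3]
    ring
  rw [← key, ← key, ← Finset.sum_sub_distrib]
  refine Finset.sum_congr rfl fun ρ _ => ?_
  unfold BackgroundJets.riemann
  ring

/-- The pair symmetry of the Riemann tensor, combined with its two antisymmetries:
`R_{αβμν} = R_{νμβα}`. -/
lemma MetricOn.riemann_flip (hG : MetricOn Ω G) {u : Model n} (hu : u ∈ Ω) (α β μ ν : Fin n) :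
    ∑ ρ, G u α ρ * BackgroundJets.riemann G ρ β μ ν u =
      ∑ ρ, G u ν ρ * BackgroundJets.riemann G ρ μ β α u := by
  have hΩ := hG.isOpen
  rw [hG.sum_mul_riemann hu, hG.sum_mul_riemann hu]
  have d : ∀ a b c, DifferentiableAt ℝ (pd a (fun v => G v b c)) u := fun a b c =>
    differentiableAt_of_contDiffOn hΩ (contDiffOn_pd hΩ (hG.smooth b c) a) hu
  have e : ∀ a b c m, pd m (chrLow G a b c) u = 1 / 2 * (pd m (pd b (fun v => G v c a)) u
      + pd m (pd c (fun v => G v a b)) u - pd m (pd a (fun v => G v b c)) u) := by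
    intro a b c m
    unfold chrLow
    rw [pd_const_mul (f := fun u => pd b (fun v => G v c a) u + pd c (fun v => G v a b) u
        - pd a (fun v => G v b c) u) (((d _ _ _).add (d _ _ _)).sub (d _ _ _)),
      pd_sub (f := fun v => pd b (fun v => G v c a) v + pd c (fun v => G v a b) v)
        ((d _ _ _).add (d _ _ _)) (d _ _ _), pd_add (d _ _ _) (d _ _ _)]
  have ec : ∀ a b c m, pd m (pd a (fun v => G v b c)) u = pd a (pd m (fun v => G v b c)) u :=
    fun a b c m => pd_comm ((hG.smooth b c).contDiffAt (hΩ.mem_nhds hu)) m a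
  have es : ∀ a b c m, pd m (pd a (fun v => G v b c)) u = pd m (pd a (fun v => G v c b)) u :=
    fun a b c m => eqOn_pd hΩ (fun v hv => hG.pd_symm hv a b c) m hu
  have h1 : ∑ ρ, chrLow G ρ α μ u * BackgroundJets.christoffel G ρ β ν u =
      ∑ ρ, chrLow G ρ ν β u * BackgroundJets.christoffel G ρ μ α u := by
    simp only [← hG.sum_mul_christoffel hu, Finset.sum_mul]
    rw [Finset.sum_comm]
    refine Finset.sum_congr rfl fun σ _ => Finset.sum_congr rfl fun ρ _ => ?_
    rw [hG.symm u hu ρ σ, hG.christoffel_symm hu σ α μ, hG.christoffel_symm hu ρ β ν]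
    ring
  have h2 : ∑ ρ, chrLow G ρ α ν u * BackgroundJets.christoffel G ρ β μ u =
      ∑ ρ, chrLow G ρ ν α u * BackgroundJets.christoffel G ρ μ β u := by
    simp only [← hG.sum_mul_christoffel hu]
    simp only [hG.christoffel_symm hu _ α ν, hG.christoffel_symm hu _ β μ]
  rw [h1, h2]
  simp only [e]
  linear_combination 1 / 2 * ((ec β ν α μ).trans (es μ ν α β) + ec ν α β μ - ec α β ν μ
    - ec β μ α ν + (ec α β μ ν).trans (es ν β μ α) - ec α ν μ β)

/-- The Riemann tensor and its covariant derivatives with the upper index lowered. -/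
def nablaRiemannLow (G : Model n → Fin n → Fin n → ℝ) (k : ℕ) (α : Fin n) (l : Fin (k + 3) → Fin n)
    (u : Model n) : ℝ := ∑ ρ, G u α ρ * nablaRiemann G k ρ l u

lemma MetricOn.nablaRiemannLow_succ (hG : MetricOn Ω G) {u : Model n} (hu : u ∈ Ω) (k : ℕ)
    (α m : Fin n) (l : Fin (k + 3) → Fin n) :
    nablaRiemannLow G (k + 1) α (Fin.cons (α := fun _ => Fin n) m l) u =
      pd m (nablaRiemannLow G k α l) u
        - ∑ τ, BackgroundJets.christoffel G τ m α u * nablaRiemannLow G k τ l u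
        - ∑ s, ∑ τ, BackgroundJets.christoffel G τ m (l s) u *
            nablaRiemannLow G k α (Function.update l s τ) u := by
  have hΩ := hG.isOpen
  have dG := fun a b => differentiableAt_of_contDiffOn hΩ (hG.smooth a b) hu
  have dT := fun a => differentiableAt_of_contDiffOn hΩ (hG.nablaRiemann k a l) hu
  have e1 : pd m (nablaRiemannLow G k α l) u =
      ∑ ρ, (pd m (fun v => G v α ρ) u * BackgroundJets.nablaRiemann G k ρ l u
        + G u α ρ * pd m (BackgroundJets.nablaRiemann G k ρ l) u) := by
    unfold nablaRiemannLow
    rw [pd_sum (f := fun ρ v => G v α ρ * BackgroundJets.nablaRiemann G k ρ l v)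
          (fun ρ _ => (dG α ρ).mul (dT ρ))]
    exact Finset.sum_congr rfl fun ρ _ => pd_mul (dG α ρ) (dT ρ) m
  have e2 : nablaRiemannLow G (k + 1) α (Fin.cons (α := fun _ => Fin n) m l) u =
      ∑ ρ, G u α ρ * (pd m (BackgroundJets.nablaRiemann G k ρ l) u
        + ∑ τ, BackgroundJets.christoffel G ρ m τ u * BackgroundJets.nablaRiemann G k τ l u
        - ∑ s, ∑ τ, BackgroundJets.christoffel G τ m (l s) u *
            BackgroundJets.nablaRiemann G k ρ (Function.update l s τ) u) := rfl
  rw [e1, e2]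
  simp only [hG.pd_metric hu, add_mul, mul_add, mul_sub, Finset.sum_add_distrib,
    Finset.sum_sub_distrib]
  have e3 : ∑ ρ, G u α ρ * ∑ τ, BackgroundJets.christoffel G ρ m τ u *
      BackgroundJets.nablaRiemann G k τ l u =
      ∑ ρ, (∑ σ, G u α σ * BackgroundJets.christoffel G σ m ρ u) *
        BackgroundJets.nablaRiemann G k ρ l u := by
    simp only [Finset.mul_sum, Finset.sum_mul]
    rw [Finset.sum_comm]
    exact Finset.sum_congr rfl fun σ _ => Finset.sum_congr rfl fun ρ _ => by ring
  have e4 : ∑ ρ, (∑ σ, G u ρ σ * BackgroundJets.christoffel G σ m α u) *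
        BackgroundJets.nablaRiemann G k ρ l u =
      ∑ τ, BackgroundJets.christoffel G τ m α u * nablaRiemannLow G k τ l u := by
    simp only [nablaRiemannLow, Finset.mul_sum, Finset.sum_mul]
    rw [Finset.sum_comm]
    refine Finset.sum_congr rfl fun σ _ => Finset.sum_congr rfl fun ρ _ => ?_
    rw [hG.symm u hu σ ρ]; ring
  have e5 : ∑ ρ, G u α ρ * ∑ s, ∑ τ, BackgroundJets.christoffel G τ m (l s) u *
            BackgroundJets.nablaRiemann G k ρ (Function.update l s τ) u =
      ∑ s, ∑ τ, BackgroundJets.christoffel G τ m (l s) u *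
            nablaRiemannLow G k α (Function.update l s τ) u := by
    simp only [nablaRiemannLow, Finset.mul_sum]
    rw [Finset.sum_comm]
    refine Finset.sum_congr rfl fun s _ => ?_
    rw [Finset.sum_comm]
    exact Finset.sum_congr rfl fun τ _ => Finset.sum_congr rfl fun ρ _ => by ring
  rw [e3, e4, e5]
  ring

/-- The exchange of the slots `β` and `μ` of `∇_{λ₁} ⋯ ∇_{λ_k} R_{αβμν}`. -/
def midSwap (k : ℕ) : Equiv.Perm (Fin (k + 2)) :=
  Equiv.swap ⟨k, by omega⟩ ⟨k + 1, by omega⟩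

lemma midSwap_zero (k : ℕ) : midSwap (k + 1) 0 = 0 :=
  Equiv.swap_apply_of_ne_of_ne (fun h => by simpa using congrArg Fin.val h)
    (fun h => by simpa using congrArg Fin.val h)

lemma midSwap_succ (k : ℕ) (i : Fin (k + 2)) : midSwap (k + 1) i.succ = (midSwap k i).succ := by
  have h1 : (⟨k + 1, by omega⟩ : Fin (k + 3)) = Fin.succ ⟨k, by omega⟩ := rfl
  have h2 : (⟨k + 1 + 1, by omega⟩ : Fin (k + 3)) = Fin.succ ⟨k + 1, by omega⟩ := rfl
  unfold midSwap
  rw [h1, h2, Equiv.swap_apply_def, Equiv.swap_apply_def]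
  simp only [Fin.succ_inj]
  split_ifs <;> rfl

lemma cons_comp_midSwap {k : ℕ} (m : Fin n) (l : Fin (k + 2) → Fin n) :
    (Fin.cons (α := fun _ => Fin n) m l) ∘ midSwap (k + 1) =
      Fin.cons (α := fun _ => Fin n) m (l ∘ midSwap k) := by
  funext i
  refine Fin.cases ?_ (fun i => ?_) i
  · simp [midSwap_zero]
  · simp [midSwap_succ]

lemma snoc_cons {k : ℕ} (m ν : Fin n) (l : Fin k → Fin n) :
    (Fin.snoc (α := fun _ => Fin n) (Fin.cons (α := fun _ => Fin n) m l : Fin (k + 1) → Fin n) ν :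
      Fin (k + 2) → Fin n) =
    Fin.cons (α := fun _ => Fin n) m (Fin.snoc (α := fun _ => Fin n) l ν) :=
  (Fin.cons_snoc_eq_snoc_cons m l ν).symm

lemma update_comp_midSwap {k : ℕ} (l : Fin (k + 2) → Fin n) (s : Fin (k + 2)) (τ : Fin n) :
    (Function.update l s τ) ∘ midSwap k = Function.update (l ∘ midSwap k) (midSwap k s) τ := by
  have h : (midSwap k) ((midSwap k) s) = s := by simp [midSwap]
  funext i
  by_cases hi : i = midSwap k s
  · subst hi; simp [h]
  · have : midSwap k i ≠ s := fun h' => hi (by rw [← h']; simp [midSwap])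
    simp [hi, this]

/-- `∇_{λ₁} ⋯ ∇_{λ_k} R_{αβμν} = ∇_{λ₁} ⋯ ∇_{λ_k} R_{νμβα}`. -/
lemma MetricOn.nablaRiemannLow_flip (hG : MetricOn Ω G) {u : Model n} (hu : u ∈ Ω) (k : ℕ)
    (α ν : Fin n) (l : Fin (k + 2) → Fin n) :
    nablaRiemannLow G k α (Fin.snoc (α := fun _ => Fin n) l ν) u =
      nablaRiemannLow G k ν (Fin.snoc (α := fun _ => Fin n) (l ∘ midSwap k) α) u := by
  induction k generalizing α ν u with
  | zero =>
    have := hG.riemann_flip hu α (l 0) (l 1) ν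
    have e1 : (midSwap 0) 0 = 1 := Equiv.swap_apply_left _ _
    have e2 : (midSwap 0) 1 = 0 := Equiv.swap_apply_right _ _
    have e3 : ∀ ρ (l : Fin 2 → Fin n) a, BackgroundJets.nablaRiemann G 0 ρ
      (Fin.snoc (α := fun _ => Fin n) l a) u = BackgroundJets.riemann G ρ (l 0) (l 1) a u :=
      fun _ _ _ => rfl
    simpa only [nablaRiemannLow, e3, Function.comp_apply, e1, e2] using this
  | succ k ih =>
    obtain ⟨m, l, rfl⟩ : ∃ m l', l = Fin.cons (α := fun _ => Fin n) m l' :=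
      ⟨l 0, Fin.tail l, (Fin.cons_self_tail l).symm⟩
    have eT : pd m (nablaRiemannLow G k α (Fin.snoc (α := fun _ => Fin n) l ν)) u =
        pd m (nablaRiemannLow G k ν (Fin.snoc (α := fun _ => Fin n) (l ∘ midSwap k) α)) u :=
      eqOn_pd hG.isOpen (fun v hv => ih hv α ν l) m hu
    rw [cons_comp_midSwap, snoc_cons, snoc_cons, hG.nablaRiemannLow_succ hu,
      hG.nablaRiemannLow_succ hu, eT, Fin.sum_univ_castSucc (n := k + 2),
      Fin.sum_univ_castSucc (n := k + 2)]
    simp only [Fin.snoc_castSucc, Fin.snoc_last]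
    have h1 : ∀ τ, nablaRiemannLow G k τ (Fin.snoc (α := fun _ => Fin n) l ν) u =
        nablaRiemannLow G k ν (Function.update
          (Fin.snoc (α := fun _ => Fin n) (l ∘ midSwap k) α) (Fin.last _) τ) u := by
      intro τ
      rw [ih hu, Fin.update_snoc_last]
    have h2 : ∀ τ, nablaRiemannLow G k α (Function.update
          (Fin.snoc (α := fun _ => Fin n) l ν) (Fin.last _) τ) u =
        nablaRiemannLow G k τ (Fin.snoc (α := fun _ => Fin n) (l ∘ midSwap k) α) u := by
      intro τ
      rw [Fin.update_snoc_last, ih hu]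
    have h3 : ∀ (s : Fin (k + 2)) τ, nablaRiemannLow G k α (Function.update
          (Fin.snoc (α := fun _ => Fin n) l ν) s.castSucc τ) u =
        nablaRiemannLow G k ν (Function.update (Fin.snoc (α := fun _ => Fin n) (l ∘ midSwap k) α)
          (midSwap k s).castSucc τ) u := by
      intro s τ
      rw [← Fin.snoc_update, ← Fin.snoc_update, ih hu, update_comp_midSwap]
    have h4 : ∑ s : Fin (k + 2), ∑ τ, BackgroundJets.christoffel G τ m (l s) u *
          nablaRiemannLow G k ν (Function.update (Fin.snoc (α := fun _ => Fin n) (l ∘ midSwap k) α)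
          (midSwap k s).castSucc τ) u =
        ∑ s : Fin (k + 2), ∑ τ, BackgroundJets.christoffel G τ m ((l ∘ midSwap k) s) u *
          nablaRiemannLow G k ν (Function.update (Fin.snoc (α := fun _ => Fin n) (l ∘ midSwap k) α)
          s.castSucc τ) u := by
      refine Fintype.sum_equiv (midSwap k) _ _ fun s => ?_
      have : (midSwap k) ((midSwap k) s) = s := by simp [midSwap]
      simp only [Function.comp_apply, this]
    simp only [h1, h2, h3, h4]
    ring

/-- The exchange of the last two slots of `∇_{λ₁} ⋯ ∇_{λ_k} R^α_{βμν}`. -/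
def endSwap (k : ℕ) : Equiv.Perm (Fin (k + 3)) :=
  Equiv.swap ⟨k + 1, by omega⟩ ⟨k + 2, by omega⟩

lemma endSwap_zero (k : ℕ) : endSwap (k + 1) 0 = 0 :=
  Equiv.swap_apply_of_ne_of_ne (fun h => by simpa using congrArg Fin.val h)
    (fun h => by simpa using congrArg Fin.val h)

lemma endSwap_succ (k : ℕ) (i : Fin (k + 3)) : endSwap (k + 1) i.succ = (endSwap k i).succ := by
  have h1 : (⟨k + 1 + 1, by omega⟩ : Fin (k + 4)) = Fin.succ ⟨k + 1, by omega⟩ := rfl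
  have h2 : (⟨k + 1 + 2, by omega⟩ : Fin (k + 4)) = Fin.succ ⟨k + 2, by omega⟩ := rfl
  unfold endSwap
  rw [h1, h2, Equiv.swap_apply_def, Equiv.swap_apply_def]
  simp only [Fin.succ_inj]
  split_ifs <;> rfl

/-- The covariant derivatives of the Riemann tensor are antisymmetric in the last two indices. -/
lemma MetricOn.nablaRiemann_endSwap (hG : MetricOn Ω G) {u : Model n} (hu : u ∈ Ω) (k : ℕ)
    (α : Fin n) (l : Fin (k + 3) → Fin n) :
    BackgroundJets.nablaRiemann G k α (l ∘ endSwap k) u =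
      - BackgroundJets.nablaRiemann G k α l u := by
  induction k generalizing α u with
  | zero =>
    have e0 : (endSwap 0) 0 = 0 := Equiv.swap_apply_of_ne_of_ne (by simp)
      (by simp)
    have e1 : (endSwap 0) 1 = 2 := Equiv.swap_apply_left _ _
    have e2 : (endSwap 0) 2 = 1 := Equiv.swap_apply_right _ _
    simp only [BackgroundJets.nablaRiemann, Function.comp_apply, e0, e1, e2]
    exact riemann_antisymm _ _ _ _ _
  | succ k ih =>
    have ht : Fin.tail (l ∘ endSwap (k + 1)) = Fin.tail l ∘ endSwap k := by
      funext i; simp [Fin.tail, endSwap_succ]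
    have h0 : (l ∘ endSwap (k + 1)) 0 = l 0 := by simp [endSwap_zero]
    have hd : DifferentiableAt ℝ (BackgroundJets.nablaRiemann G k α (Fin.tail l)) u :=
      differentiableAt_of_contDiffOn hG.isOpen (hG.nablaRiemann _ _ _) hu
    have e1 : pd (l 0) (BackgroundJets.nablaRiemann G k α (Fin.tail l ∘ endSwap k)) u =
        - pd (l 0) (BackgroundJets.nablaRiemann G k α (Fin.tail l)) u := by
      rw [eqOn_pd hG.isOpen (g := fun v => (-1) * BackgroundJets.nablaRiemann G k α (Fin.tail l) v)
        (fun v hv => by rw [ih hv]; ring) _ hu, pd_const_mul hd]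
      ring
    have hinv : ∀ s, (endSwap k) ((endSwap k) s) = s := fun s => by simp [endSwap]
    have e2 : ∀ s τ, Function.update (Fin.tail l ∘ endSwap k) s τ =
        (Function.update (Fin.tail l) (endSwap k s) τ) ∘ endSwap k := by
      intro s τ
      funext i
      by_cases hi : i = s
      · subst hi; simp
      · have : endSwap k i ≠ endSwap k s := fun h => hi ((endSwap k).injective h)
        simp [hi, this]
    simp only [BackgroundJets.nablaRiemann]
    rw [ht, h0, e1]
    simp only [e2, ih hu, mul_neg, Finset.sum_neg_distrib, Function.comp_apply]
    rw [Fintype.sum_equiv (endSwap k)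
      (fun s => ∑ τ, BackgroundJets.christoffel G τ (l 0) (Fin.tail l (endSwap k s)) u *
        BackgroundJets.nablaRiemann G k α (Function.update (Fin.tail l) (endSwap k s) τ) u)
      (fun s => ∑ τ, BackgroundJets.christoffel G τ (l 0) (Fin.tail l s) u *
        BackgroundJets.nablaRiemann G k α (Function.update (Fin.tail l) s τ) u) fun s => rfl]
    ring

lemma symFirst_comp_perm {k m : ℕ} {T : (Fin k → Fin n) → ℝ} {t : Equiv.Perm (Fin k)}
    (ht : t ∈ permsFirst m k) (l : Fin k → Fin n) :
    symFirst m (fun l => T (l ∘ t)) l = symFirst m T l := by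
  unfold symFirst
  congr 1
  exact sum_permsFirst_mul_right ht (fun s => T (l ∘ s))

/-- The lowered symmetrized curvature arrays are symmetric in `α, ν`. -/
lemma MetricOn.curvature_symm (hG : MetricOn Ω G) {u : Model n} (hu : u ∈ Ω) (k : ℕ)
    (α ν : Fin n) (l : Fin (k + 2) → Fin n) :
    ∑ ρ, G u α ρ * symFirst (k + 2) (fun l => BackgroundJets.nablaRiemann G k ρ l u)
        (Fin.snoc (α := fun _ => Fin n) l ν) =
      ∑ ρ, G u ν ρ * symFirst (k + 2) (fun l => BackgroundJets.nablaRiemann G k ρ l u)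
        (Fin.snoc (α := fun _ => Fin n) l α) := by
  have h : ∀ α ν, ∑ ρ, G u α ρ * symFirst (k + 2) (fun l => BackgroundJets.nablaRiemann G k ρ l u)
        (Fin.snoc (α := fun _ => Fin n) l ν) =
      symFirst (k + 2) (fun l => nablaRiemannLow G k α (Fin.snoc (α := fun _ => Fin n) l ν) u) l := by
    intro α ν
    simp only [symFirst_snoc]
    unfold nablaRiemannLow
    rw [symFirst_sum]
    exact Finset.sum_congr rfl fun ρ _ => (symFirst_const_mul _ _ _).symm
  rw [h, h]
  have e : (fun l : Fin (k + 2) → Fin n =>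
      nablaRiemannLow G k α (Fin.snoc (α := fun _ => Fin n) l ν) u) = fun l =>
      (fun l : Fin (k + 2) → Fin n =>
        nablaRiemannLow G k ν (Fin.snoc (α := fun _ => Fin n) l α) u) (l ∘ midSwap k) :=
    funext fun l => hG.nablaRiemannLow_flip hu k α ν l
  rw [e]
  exact symFirst_comp_perm (k := k + 2) (m := k + 2) (t := midSwap k)
    (T := fun l : Fin (k + 2) → Fin n =>
        nablaRiemannLow G k ν (Fin.snoc (α := fun _ => Fin n) l α) u) (mem_permsFirst.2 fun i hi => absurd i.2 (by omega)) l

/-- The total symmetrization of the curvature arrays vanishes. -/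
lemma MetricOn.curvature_symFirst_eq_zero (hG : MetricOn Ω G) {u : Model n} (hu : u ∈ Ω) (k : ℕ)
    (α : Fin n) (l : Fin (k + 3) → Fin n) :
    symFirst (k + 3) (symFirst (k + 2) fun l => BackgroundJets.nablaRiemann G k α l u) l = 0 := by
  rw [symFirst_symFirst (by omega) le_rfl]
  exact symFirst_eq_zero_of_antisymm (t := endSwap k)
    (mem_permsFirst.2 fun i hi => absurd i.2 (by omega))
    (fun l => hG.nablaRiemann_endSwap hu k α l) l

end Curvature

/-! ### Coordinates of the jets of component functions -/

section Coordinates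

variable {n : ℕ} {Ω : Set (Model n)} {x : Model n} {G G' : Model n → Fin n → Fin n → ℝ}

/-- The `S`-coordinates at `x` of a metric with components `G`. -/
def sOf (r : ℕ) (G : Model n → Fin n → Fin n → ℝ) (x : Model n) : SArrays n r :=
  fun k α => symFirst ((k : ℕ) + 2) fun l => dChristoffel G k α l x

/-- The covariant derivatives of the Riemann tensor at `x`, symmetrized over the derivative
indices and the next `w` indices; the cases of interest are `w = 2` and `w = 0`. -/
def curvOf (w r : ℕ) (G : Model n → Fin n → Fin n → ℝ) (x : Model n) : RArrays n r :=
  fun k α => symFirst ((k : ℕ) + w) fun l => nablaRiemann G k α l x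

/-- The symmetrized covariant derivatives at `x` of a scalar. -/
def scalarOf (r : ℕ) (G : Model n → Fin n → Fin n → ℝ) (φ : Model n → ℝ) (x : Model n) :
    ScalarArrays n r :=
  fun k => symFirst (k : ℕ) fun l => nablaScalar G φ k l x

/-- The tensorial coordinates at `x` of component functions `G`, `m`, `κ`. -/
def tensorOf (w r : ℕ) (G : Model n → Fin n → Fin n → ℝ) (m κ : Model n → ℝ) (x : Model n) :
    TensorCoord n r :=
  (G x, curvOf w r G x, scalarOf r G m x, scalarOf r G κ x)

/-- The covariant coordinates at `x` of component functions `G`, `m`, `κ`. -/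
def covOf (w r : ℕ) (G : Model n → Fin n → Fin n → ℝ) (m κ : Model n → ℝ) (x : Model n) :
    CovCoord n r := (x, sOf r G x, tensorOf w r G m κ x)

/-- The canonical jet coordinates at `x` of component functions `G`, `m`, `κ`. -/
def jetOf (r : ℕ) (G : Model n → Fin n → Fin n → ℝ) (m κ : Model n → ℝ) (x : Model n) :
    JetCoord n r :=
  (x, fun k l μ ν => iterPd k (fun u => G u μ ν) l x, fun k l => iterPd k m l x,
    fun k l => iterPd k κ l x)

variable (hG : MetricOn Ω G) (hG' : MetricOn Ω G') (hx : x ∈ Ω)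
include hG hG' hx

omit hG' in
lemma iterPd_sub_eq {f g d : Model n → ℝ} {K j : ℕ} (hf : ContDiffOn ℝ ∞ f Ω)
    (hg : ContDiffOn ℝ ∞ g Ω) (hd : ContDiffOn ℝ ∞ d Ω)
    (h : Flat Ω x K (fun u => f u - g u - d u)) (hj : j < K) (l : Fin j → Fin n) :
    iterPd j f l x - iterPd j g l x = iterPd j d l x := by
  have hΩ := hG.isOpen
  have h1 := h.iterPd_eq_zero hj l
  rw [iterPd_sub hΩ (hf.sub hg) hd _ _ hx] at h1
  dsimp only at h1
  rw [iterPd_sub hΩ hf hg _ _ hx] at h1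
  dsimp only at h1
  linarith

/-- The leading part of the derivatives of order `k` of the Christoffel symbols. -/
lemma dChristoffel_sub {k : ℕ} (hδ : ∀ μ ν, Flat Ω x (k + 1) (fun u => G' u μ ν - G u μ ν))
    (α : Fin n) (l : Fin (k + 2) → Fin n) :
    dChristoffel G' k α l x - dChristoffel G k α l x =
      iterPd k (linChr (ginv (G x)) (fun u μ ν => G' u μ ν - G u μ ν) α
        (l (Fin.natAdd k (0 : Fin 2))) (l (Fin.natAdd k (1 : Fin 2))))
        (fun i => l (Fin.castAdd 2 i)) x :=
  iterPd_sub_eq hG hx (hG'.christoffel _ _ _) (hG.christoffel _ _ _)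
    (contDiffOn_linChr hG.isOpen (fun a b => (hG'.smooth a b).sub (hG.smooth a b)) _ _ _ _)
    (flat_christoffel_sub_sub hG hG' hx hδ _ _ _) (Nat.lt_succ_self k) _

lemma dChristoffel_eq {K k : ℕ} (hk : k + 1 < K)
    (hδ : ∀ μ ν, Flat Ω x K (fun u => G' u μ ν - G u μ ν)) (α : Fin n) (l : Fin (k + 2) → Fin n) :
    dChristoffel G' k α l x = dChristoffel G k α l x := by
  have hΩ := hG.isOpen
  obtain ⟨K, rfl⟩ := Nat.exists_eq_succ_of_ne_zero (by omega : K ≠ 0)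
  have h1 := (flat_christoffel_sub hG hG' hx hδ α (l (Fin.natAdd k (0 : Fin 2)))
    (l (Fin.natAdd k (1 : Fin 2)))).iterPd_eq_zero (j := k) (by omega)
    (fun i => l (Fin.castAdd 2 i))
  rw [iterPd_sub hΩ (hG'.christoffel _ _ _) (hG.christoffel _ _ _) _ _ hx] at h1
  exact sub_eq_zero.1 h1

/-- The leading part of the `k`-th covariant derivatives of the curvature. -/
lemma nablaRiemann_sub {k : ℕ} (hδ : ∀ μ ν, Flat Ω x (k + 2) (fun u => G' u μ ν - G u μ ν))
    (α : Fin n) (l : Fin (k + 3) → Fin n) :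
    nablaRiemann G' k α l x - nablaRiemann G k α l x =
      iterPd k (linRiem (ginv (G x)) (fun u μ ν => G' u μ ν - G u μ ν) α
        (l ⟨k, by omega⟩) (l ⟨k + 1, by omega⟩) (l ⟨k + 2, by omega⟩))
        (fun i => l (Fin.castAdd 3 i)) x :=
  sub_eq_zero.1 ((flat_nablaRiemann_sub_sub hG hG' hx hδ k α l).apply_eq_zero (by omega))

lemma nablaRiemann_eq {K k : ℕ} (hk : k + 2 < K)
    (hδ : ∀ μ ν, Flat Ω x K (fun u => G' u μ ν - G u μ ν)) (α : Fin n) (l : Fin (k + 3) → Fin n) :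
    nablaRiemann G' k α l x = nablaRiemann G k α l x := by
  obtain ⟨K, rfl⟩ : ∃ K', K = K' + 2 := ⟨K - 2, by omega⟩
  have h1 := (flat_nablaRiemann_sub_sub hG hG' hx hδ k α l).apply_eq_zero (by omega)
  have h2 := (flat_linRiem hG hx (ginv (G x)) (D := fun u μ ν => G' u μ ν - G u μ ν) hδ α
    (l ⟨k, by omega⟩) (l ⟨k + 1, by omega⟩) (l ⟨k + 2, by omega⟩)).iterPd_eq_zero (j := k)
    (by omega) (fun i => l (Fin.castAdd 3 i))
  linarith

/-- The leading part of the `k`-th covariant derivatives of a scalar. -/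
lemma nablaScalar_sub {φ φ' : Model n → ℝ} {k : ℕ}
    (hδ : ∀ μ ν, Flat Ω x k (fun u => G' u μ ν - G u μ ν)) (hφ : ContDiffOn ℝ ∞ φ Ω)
    (hφ' : ContDiffOn ℝ ∞ φ' Ω) (hφφ' : Flat Ω x k (fun u => φ' u - φ u)) (l : Fin k → Fin n) :
    nablaScalar G' φ' k l x - nablaScalar G φ k l x = iterPd k (fun u => φ' u - φ u) l x :=
  sub_eq_zero.1 ((flat_nablaScalar_sub_sub hG hG' hx hδ hφ hφ' hφφ' k l).apply_eq_zero (by omega))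

lemma nablaScalar_eq {φ φ' : Model n → ℝ} {K k : ℕ} (hk : k < K)
    (hδ : ∀ μ ν, Flat Ω x K (fun u => G' u μ ν - G u μ ν)) (hφ : ContDiffOn ℝ ∞ φ Ω)
    (hφ' : ContDiffOn ℝ ∞ φ' Ω) (hφφ' : Flat Ω x K (fun u => φ' u - φ u)) (l : Fin k → Fin n) :
    nablaScalar G' φ' k l x = nablaScalar G φ k l x := by
  have h1 := nablaScalar_sub hG hG' hx (k := k) (fun μ ν => (hδ μ ν).mono hk.le) hφ hφ'
    (hφφ'.mono hk.le) l
  rw [hφφ'.iterPd_eq_zero hk] at h1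
  exact sub_eq_zero.1 h1

/-- The leading part of the lowered `S`-coordinates. -/
lemma polyEval_sOf_sub {r : ℕ} (k : Fin r)
    (hδ : ∀ μ ν, Flat Ω x ((k : ℕ) + 1) (fun u => G' u μ ν - G u μ ν)) (a : Fin n) (ξ : Model n) :
    polyEval (fun l => ∑ α, G x a α * (sOf r G' x k α l - sOf r G x k α l)) ξ =
      symbolS (fun a b l => iterPd ((k : ℕ) + 1) (fun u => G' u a b - G u a b) l x) a ξ := by
  rw [← polyEval_linChr hG.isOpen hx (D := fun u μ ν => G' u μ ν - G u μ ν)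
    (fun a b => (hG'.smooth a b).sub (hG.smooth a b))
    (fun u hu a b => by rw [hG.symm u hu, hG'.symm u hu]) (c := ginv (G x)) (g := G x)
    (sum_mul_ginv (hG.det_ne x hx)), polyEval_sum]
  refine Finset.sum_congr rfl fun α _ => ?_
  rw [polyEval_const_mul]
  congr 1
  simp only [sOf, ← symFirst_sub]
  change polyEval (symFirst _ _) ξ = _
  rw [polyEval_symFirst]
  congr 1
  exact funext fun l => dChristoffel_sub hG hG' hx hδ α l

/-- The leading part of the lowered curvature coordinates. -/
lemma polyEval_curvOf_sub {r : ℕ} (k : Fin (r - 1))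
    (hδ : ∀ μ ν, Flat Ω x ((k : ℕ) + 2) (fun u => G' u μ ν - G u μ ν)) (a ν : Fin n)
    (ξ : Model n) :
    2 * (((k : ℕ) + 1 : ℕ) : ℝ) * polyEval (fun l => ∑ α, G x a α *
      (curvOf 2 r G' x k α (Fin.snoc (α := fun _ => Fin n) l ν)
        - curvOf 2 r G x k α (Fin.snoc (α := fun _ => Fin n) l ν))) ξ =
      symbolQ (k := (k : ℕ) + 1)
        (fun a b l => iterPd ((k : ℕ) + 2) (fun u => G' u a b - G u a b) l x) a ν ξ := by
  rw [← polyEval_linRiem hG.isOpen hx (D := fun u μ ν => G' u μ ν - G u μ ν)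
    (fun a b => (hG'.smooth a b).sub (hG.smooth a b))
    (fun u hu a b => by rw [hG.symm u hu, hG'.symm u hu]) (c := ginv (G x)) (g := G x)
    (sum_mul_ginv (hG.det_ne x hx)), polyEval_sum]
  congr 1
  refine Finset.sum_congr rfl fun α _ => ?_
  rw [polyEval_const_mul]
  congr 1
  simp only [curvOf, symFirst_snoc]
  simp only [← symFirst_sub]
  change polyEval (symFirst _ _) ξ = _
  rw [polyEval_symFirst]
  congr 1
  exact funext fun l => nablaRiemann_sub hG hG' hx hδ α _

/-- The leading part of the symmetrized covariant derivatives of a scalar. -/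
lemma scalarOf_sub {φ φ' : Model n → ℝ} {r : ℕ} (k : Fin (r + 1))
    (hδ : ∀ μ ν, Flat Ω x (k : ℕ) (fun u => G' u μ ν - G u μ ν)) (hφ : ContDiffOn ℝ ∞ φ Ω)
    (hφ' : ContDiffOn ℝ ∞ φ' Ω) (hφφ' : Flat Ω x (k : ℕ) (fun u => φ' u - φ u))
    (l : Fin (k : ℕ) → Fin n) :
    scalarOf r G' φ' x k l - scalarOf r G φ x k l = iterPd k (fun u => φ' u - φ u) l x := by
  simp only [scalarOf, ← symFirst_sub]
  simp only [nablaScalar_sub hG hG' hx hδ hφ hφ' hφφ']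
  rw [(sym_iterPd hG.isOpen hφφ'.contDiffOn k hx).symFirst_eq]

lemma sOf_eq {K r : ℕ} (hδ : ∀ μ ν, Flat Ω x K (fun u => G' u μ ν - G u μ ν)) (k : Fin r)
    (hk : (k : ℕ) + 1 < K) : sOf r G' x k = sOf r G x k := by
  funext α
  simp only [sOf, dChristoffel_eq hG hG' hx hk hδ]

lemma curvOf_eq {K w r : ℕ} (hδ : ∀ μ ν, Flat Ω x K (fun u => G' u μ ν - G u μ ν))
    (k : Fin (r - 1)) (hk : (k : ℕ) + 2 < K) : curvOf w r G' x k = curvOf w r G x k := by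
  funext α
  simp only [curvOf, nablaRiemann_eq hG hG' hx hk hδ]

lemma scalarOf_eq {φ φ' : Model n → ℝ} {K r : ℕ}
    (hδ : ∀ μ ν, Flat Ω x K (fun u => G' u μ ν - G u μ ν)) (hφ : ContDiffOn ℝ ∞ φ Ω)
    (hφ' : ContDiffOn ℝ ∞ φ' Ω) (hφφ' : Flat Ω x K (fun u => φ' u - φ u)) (k : Fin (r + 1))
    (hk : (k : ℕ) < K) : scalarOf r G' φ' x k = scalarOf r G φ x k := by
  simp only [scalarOf, nablaScalar_eq hG hG' hx hk hδ hφ hφ' hφφ']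

/-- The covariant coordinates depend only on the `r`-jet. -/
lemma covOf_eq_of_flat {m κ m' κ' : Model n → ℝ} (w r : ℕ)
    (hδ : ∀ μ ν, Flat Ω x (r + 1) (fun u => G' u μ ν - G u μ ν))
    (hm : ContDiffOn ℝ ∞ m Ω) (hm' : ContDiffOn ℝ ∞ m' Ω) (hκ : ContDiffOn ℝ ∞ κ Ω)
    (hκ' : ContDiffOn ℝ ∞ κ' Ω) (hmm : Flat Ω x (r + 1) (fun u => m' u - m u))
    (hκκ : Flat Ω x (r + 1) (fun u => κ' u - κ u)) :
    covOf w r G' m' κ' x = covOf w r G m κ x := by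
  have h0 : G' x = G x := by
    funext μ ν
    exact sub_eq_zero.1 ((hδ μ ν).apply_eq_zero (by omega))
  have h1 : sOf r G' x = sOf r G x :=
    funext fun k => sOf_eq hG hG' hx hδ k (by have := k.2; omega)
  have h2 : curvOf w r G' x = curvOf w r G x :=
    funext fun k => curvOf_eq hG hG' hx hδ k (by have := k.2; omega)
  have h3 : scalarOf r G' m' x = scalarOf r G m x :=
    funext fun k => scalarOf_eq hG hG' hx hδ hm hm' hmm k k.2
  have h4 : scalarOf r G' κ' x = scalarOf r G κ x :=
    funext fun k => scalarOf_eq hG hG' hx hδ hκ hκ' hκκ k k.2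
  simp only [covOf, tensorOf, h0, h1, h2, h3, h4]

end Coordinates

section Range

variable {n : ℕ} {Ω : Set (Model n)} {x : Model n} {G : Model n → Fin n → Fin n → ℝ}

lemma det_ne_zero_of_isLorentz {A : Fin n → Fin n → ℝ} (h : IsLorentzMatrix A) :
    (Matrix.of A).det ≠ 0 := by
  obtain ⟨P, hP, hA⟩ := h
  have e : Matrix.of A = P.transpose * Matrix.diagonal eta * P := by
    ext i j
    rw [Matrix.mul_assoc, Matrix.mul_apply, Matrix.of_apply, hA]
    refine Finset.sum_congr rfl fun a _ => ?_
    rw [Matrix.diagonal_mul, Matrix.transpose_apply]; ring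
  rw [e, Matrix.det_mul, Matrix.det_mul, Matrix.det_transpose, Matrix.det_diagonal]
  refine mul_ne_zero (mul_ne_zero hP.ne_zero (Finset.prod_ne_zero_iff.2 fun a _ => ?_)) hP.ne_zero
  unfold eta; split_ifs <;> norm_num

lemma isLorentz_symm {A : Fin n → Fin n → ℝ} (h : IsLorentzMatrix A) (i j : Fin n) :
    A i j = A j i := by
  obtain ⟨P, -, hA⟩ := h
  rw [hA, hA]
  exact Finset.sum_congr rfl fun a _ => by ring

/-- The covariant coordinates satisfy the algebraic constraints. -/
lemma tensorOf_mem_tensorDomain (hG : MetricOn Ω G) (hx : x ∈ Ω) (hL : IsLorentzMatrix (G x))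
    (r : ℕ) (m κ : Model n → ℝ) : tensorOf 2 r G m κ x ∈ tensorDomain n r := by
  refine ⟨hL, fun k α => isSymFirst_symFirst ((k : ℕ) + 2) fun l => nablaRiemann G k α l x,
    fun k α ν l => hG.curvature_symm hx k α ν l,
    fun k α l => hG.curvature_symFirst_eq_zero hx k α l,
    fun k => isSymFirst_symFirst (k : ℕ) fun l => nablaScalar G m k l x,
    fun k => isSymFirst_symFirst (k : ℕ) fun l => nablaScalar G κ k l x⟩

lemma covOf_mem_covDomain (hG : MetricOn Ω G) (hx : x ∈ Ω) (hL : IsLorentzMatrix (G x))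
    (r : ℕ) (m κ : Model n → ℝ) {V : Set (Model n)} (hV : x ∈ V) :
    covOf 2 r G m κ x ∈ covDomain r V :=
  ⟨hV, fun k α => isSymFirst_symFirst ((k : ℕ) + 2) fun l => dChristoffel G k α l x,
    tensorOf_mem_tensorDomain hG hx hL r m κ⟩

end Range

/-! ### Polynomial representatives of jets -/

section Representatives

variable {n r : ℕ}

/-- The metric arrays, extended by zero to all orders. -/
def metricExt (a : MetricArrays n r) (μ ν : Fin n) (k : ℕ) (l : Fin k → Fin n) : ℝ :=
  if h : k < r + 1 then a ⟨k, h⟩ l μ ν else 0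

/-- The scalar arrays, extended by zero to all orders. -/
def scalarExt (a : ScalarArrays n r) (k : ℕ) (l : Fin k → Fin n) : ℝ :=
  if h : k < r + 1 then a ⟨k, h⟩ l else 0

/-- The polynomial metric with given jet coordinates. -/
def polyMetric (c : JetCoord n r) (u : Model n) (μ ν : Fin n) : ℝ :=
  taylorPoly (r + 1) (metricExt c.2.1 μ ν) (u - c.1)

/-- The polynomial function with given jet at `x`. -/
def polyScalar (x : Model n) (a : ScalarArrays n r) (u : Model n) : ℝ :=
  taylorPoly (r + 1) (scalarExt a) (u - x)

/-- The covariant coordinates as functions of the canonical jet coordinates, defined through the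
polynomial representatives of the jets. -/
def covOfJet (c : JetCoord n r) : CovCoord n r :=
  covOf 2 r (polyMetric c) (polyScalar c.1 c.2.2.1) (polyScalar c.1 c.2.2.2) c.1

lemma polyMetric_self (c : JetCoord n r) (μ ν : Fin n) :
    polyMetric c c.1 μ ν = c.2.1 0 Fin.elim0 μ ν := by
  unfold polyMetric
  rw [sub_self, taylorPoly_zero_apply (Nat.succ_pos r)]
  simp [metricExt]

lemma contDiff_taylorPoly_family {E : Type*} [NormedAddCommGroup E] [NormedSpace ℝ E] (N : ℕ)
    {p : E → (k : ℕ) → (Fin k → Fin n) → ℝ} {q : E → Model n}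
    (hp : ∀ k l, ContDiff ℝ ∞ (fun c => p c k l)) (hq : ContDiff ℝ ∞ q) :
    ContDiff ℝ ∞ (fun c => taylorPoly N (p c) (q c)) := by
  unfold taylorPoly polyEval
  refine ContDiff.sum fun k _ => ContDiff.div_const (ContDiff.sum fun l _ => (hp k l).mul ?_) _
  exact contDiff_prod fun i _ =>
    (EuclideanSpace.proj (𝕜 := ℝ) (l i) : Model n →L[ℝ] ℝ).contDiff.comp hq

lemma contDiff_metricExt (μ ν : Fin n) (k : ℕ) (l : Fin k → Fin n) :
    ContDiff ℝ ∞ (fun c : JetCoord n r => metricExt c.2.1 μ ν k l) := by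
  unfold metricExt
  split_ifs with h
  · have h' : ContDiff ℝ ∞ (fun c : JetCoord n r => c.2.1) := contDiff_fst.comp contDiff_snd
    have h1 := contDiff_pi.1 (contDiff_pi.1 h' (⟨k, h⟩ : Fin (r + 1))) l
    exact contDiff_pi.1 (contDiff_pi.1 h1 μ) ν
  · exact contDiff_const

lemma contDiff_scalarExt (k : ℕ) (l : Fin k → Fin n) :
    ContDiff ℝ ∞ (fun a : ScalarArrays n r => scalarExt a k l) := by
  unfold scalarExt
  split_ifs with h
  · have h' : ContDiff ℝ ∞ (fun a : ScalarArrays n r => a) := contDiff_id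
    exact contDiff_pi.1 (contDiff_pi.1 h' (⟨k, h⟩ : Fin (r + 1))) l
  · exact contDiff_const

/-- The pairs of a jet and a point where the polynomial representative is nondegenerate. -/
def polySet (n r : ℕ) : Set (JetCoord n r × Model n) :=
  {p | (Matrix.of (polyMetric p.1 p.2)).det ≠ 0}

lemma contDiff_polyMetric (μ ν : Fin n) :
    ContDiff ℝ ∞ (fun p : JetCoord n r × Model n => polyMetric p.1 p.2 μ ν) :=
  contDiff_taylorPoly_family (r + 1)
    (fun k l => (contDiff_metricExt μ ν k l).comp contDiff_fst)
    (contDiff_snd.sub (contDiff_fst.comp contDiff_fst))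

lemma metricFamily_polyMetric : MetricFamily (polySet n r) (polyMetric (n := n) (r := r)) where
  isOpen := by
    have h : Continuous (fun p : JetCoord n r × Model n => (Matrix.of (polyMetric p.1 p.2)).det) :=
      Continuous.matrix_det (continuous_pi fun i => continuous_pi fun j =>
        (contDiff_polyMetric i j).continuous)
    exact isOpen_ne.preimage h
  smooth μ ν := (contDiff_polyMetric μ ν).contDiffOn
  det_ne _ hp := hp

/-- The jets with nondegenerate metric. -/
def jetSet (n r : ℕ) : Set (JetCoord n r) := {c | (Matrix.of (c.2.1 0 Fin.elim0)).det ≠ 0}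

lemma mem_polySet_self {c : JetCoord n r} : (c, c.1) ∈ polySet n r ↔ c ∈ jetSet n r := by
  have : polyMetric c c.1 = c.2.1 0 Fin.elim0 := by
    funext μ ν; exact polyMetric_self c μ ν
  change (Matrix.of (polyMetric c c.1)).det ≠ 0 ↔ _
  rw [this]; rfl

lemma isOpen_jetSet : IsOpen (jetSet n r) := by
  have h : jetSet n r = (fun c : JetCoord n r => (c, c.1)) ⁻¹' polySet n r :=
    Set.ext fun c => mem_polySet_self.symm
  rw [h]
  exact metricFamily_polyMetric.isOpen.preimage (by fun_prop)

lemma SmoothFamily.contDiffOn_diag {φ : JetCoord n r → Model n → ℝ}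
    (h : SmoothFamily (polySet n r) φ) : ContDiffOn ℝ ∞ (fun c => φ c c.1) (jetSet n r) :=
  ContDiffOn.comp (g := fun p : JetCoord n r × Model n => φ p.1 p.2)
    (f := fun c : JetCoord n r => (c, c.1)) h (by fun_prop) fun _ hc => mem_polySet_self.2 hc

/-- The tensor calculus of the polynomial metric is smooth in the jet and the point jointly, in
particular along the graph of the base point. -/
lemma contDiffOn_covOfJet : ContDiffOn ℝ ∞ (covOfJet (n := n) (r := r)) (jetSet n r) := by
  have hm : SmoothFamily (polySet n r) (fun c : JetCoord n r => polyScalar c.1 c.2.2.1) :=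
    (contDiff_taylorPoly_family (r + 1)
      (fun k l => (contDiff_scalarExt k l).comp
        (contDiff_fst.comp (contDiff_snd.comp (contDiff_snd.comp contDiff_fst))))
      (contDiff_snd.sub (contDiff_fst.comp contDiff_fst))).contDiffOn
  have hκ : SmoothFamily (polySet n r) (fun c : JetCoord n r => polyScalar c.1 c.2.2.2) :=
    (contDiff_taylorPoly_family (r + 1)
      (fun k l => (contDiff_scalarExt k l).comp
        (contDiff_snd.comp (contDiff_snd.comp (contDiff_snd.comp contDiff_fst))))
      (contDiff_snd.sub (contDiff_fst.comp contDiff_fst))).contDiffOn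
  have hG := metricFamily_polyMetric (n := n) (r := r)
  refine contDiffOn_fst.prodMk (ContDiffOn.prodMk ?_ (ContDiffOn.prodMk ?_ (ContDiffOn.prodMk ?_
    (ContDiffOn.prodMk ?_ ?_))))
  · refine contDiffOn_pi.2 fun k => contDiffOn_pi.2 fun α => contDiffOn_pi.2 fun l => ?_
    exact (SmoothFamily.symFirst (φ := fun c u l => dChristoffel (polyMetric c) k α l u)
      (fun l => hG.dChristoffel k α l) (k + 2) l).contDiffOn_diag
  · exact contDiffOn_pi.2 fun μ => contDiffOn_pi.2 fun ν => (hG.smooth μ ν).contDiffOn_diag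
  · refine contDiffOn_pi.2 fun k => contDiffOn_pi.2 fun α => contDiffOn_pi.2 fun l => ?_
    exact (SmoothFamily.symFirst (φ := fun c u l => nablaRiemann (polyMetric c) k α l u)
      (fun l => hG.nablaRiemann k α l) (k + 2) l).contDiffOn_diag
  · refine contDiffOn_pi.2 fun k => contDiffOn_pi.2 fun l => ?_
    exact (SmoothFamily.symFirst
      (φ := fun c u l => nablaScalar (polyMetric c) (polyScalar c.1 c.2.2.1) k l u)
      (fun l => hG.nablaScalar hm k l) k l).contDiffOn_diag
  · refine contDiffOn_pi.2 fun k => contDiffOn_pi.2 fun l => ?_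
    exact (SmoothFamily.symFirst
      (φ := fun c u l => nablaScalar (polyMetric c) (polyScalar c.1 c.2.2.2) k l u)
      (fun l => hG.nablaScalar hκ k l) k l).contDiffOn_diag

lemma MetricOn.mono {Ω Ω' : Set (Model n)} {G : Model n → Fin n → Fin n → ℝ}
    (h : MetricOn Ω G) (hΩ' : IsOpen Ω') (hs : Ω' ⊆ Ω) : MetricOn Ω' G :=
  ⟨hΩ', fun μ ν => (h.smooth μ ν).mono hs, fun u hu => h.symm u (hs hu),
    fun u hu => h.det_ne u (hs hu)⟩

/-! Jets in the range of the canonical coordinates. -/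

variable {U : Set (Model n)} {c : JetCoord n r}

lemma sym_metricExt (hc : c ∈ jetDomain r U) (μ ν : Fin n) (k : ℕ) :
    Sym (metricExt c.2.1 μ ν k) := by
  intro s l
  unfold metricExt
  split_ifs with h
  · exact isSymFirst_self_iff.1 (hc.2.2.2.1 ⟨k, h⟩ μ ν) s l
  · rfl

lemma sym_scalarExt {a : ScalarArrays n r} (ha : SymScalar a) (k : ℕ) : Sym (scalarExt a k) := by
  intro s l
  unfold scalarExt
  split_ifs with h
  · exact isSymFirst_self_iff.1 (ha ⟨k, h⟩) s l
  · rfl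

lemma mem_jetSet (hc : c ∈ jetDomain r U) : c ∈ jetSet n r :=
  det_ne_zero_of_isLorentz (hc.2.1 Fin.elim0)

lemma metricOn_polyMetric (hc : c ∈ jetDomain r U) :
    MetricOn {u | (c, u) ∈ polySet n r} (polyMetric c) where
  isOpen := metricFamily_polyMetric.isOpen.preimage (by fun_prop)
  smooth μ ν := ((contDiff_taylorPoly _ _).comp (contDiff_id.sub contDiff_const)).contDiffOn
  symm u _ μ ν := by
    unfold polyMetric
    congr 1
    funext k l
    unfold metricExt
    split_ifs with h
    · exact hc.2.2.1 _ _ _ _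
    · rfl
  det_ne _ hu := hu

lemma contDiff_polyScalar (x : Model n) (a : ScalarArrays n r) :
    ContDiff ℝ ∞ (polyScalar x a) :=
  (contDiff_taylorPoly _ _).comp (contDiff_id.sub contDiff_const)

lemma contDiff_polyMetric_apply (c : JetCoord n r) (μ ν : Fin n) :
    ContDiff ℝ ∞ (fun u => polyMetric c u μ ν) :=
  (contDiff_taylorPoly _ _).comp (contDiff_id.sub contDiff_const)

lemma iterPd_polyMetric (hc : c ∈ jetDomain r U) (k : ℕ) (hk : k < r + 1) (l : Fin k → Fin n)
    (μ ν : Fin n) : iterPd k (fun u => polyMetric c u μ ν) l c.1 = c.2.1 ⟨k, hk⟩ l μ ν := by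
  unfold polyMetric
  rw [iterPd_taylorPoly (sym_metricExt hc μ ν) hk]
  simp [metricExt, hk]

lemma iterPd_polyScalar {a : ScalarArrays n r} (ha : SymScalar a) (x : Model n) (k : ℕ)
    (hk : k < r + 1) (l : Fin k → Fin n) : iterPd k (polyScalar x a) l x = a ⟨k, hk⟩ l := by
  unfold polyScalar
  rw [iterPd_taylorPoly (sym_scalarExt ha) hk]
  simp [scalarExt, hk]

/-- The polynomial representative has the given jet. -/
lemma jetOf_poly (hc : c ∈ jetDomain r U) :
    jetOf r (polyMetric c) (polyScalar c.1 c.2.2.1) (polyScalar c.1 c.2.2.2) c.1 = c := by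
  refine Prod.ext rfl (Prod.ext ?_ (Prod.ext ?_ ?_))
  · funext k l μ ν
    exact iterPd_polyMetric hc k k.2 l μ ν
  · funext k l
    exact iterPd_polyScalar hc.2.2.2.2.1 c.1 k k.2 l
  · funext k l
    exact iterPd_polyScalar hc.2.2.2.2.2 c.1 k k.2 l

lemma jetOf_mem_jetDomain {Ω : Set (Model n)} {x : Model n} {G : Model n → Fin n → Fin n → ℝ}
    {m κ : Model n → ℝ} (hG : MetricOn Ω G) (hL : IsLorentzMatrix (G x)) (hx : x ∈ Ω)
    (hm : ContDiffOn ℝ ∞ m Ω) (hκ : ContDiffOn ℝ ∞ κ Ω) (hU : x ∈ U) :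
    jetOf r G m κ x ∈ jetDomain r U := by
  refine ⟨hU, fun l => hL, fun k l μ ν => ?_, fun k μ ν => ?_, fun k => ?_, fun k => ?_⟩
  · exact iterPd_congr hG.isOpen (fun u hu => hG.symm u hu μ ν) _ _ hx
  · exact isSymFirst_self_iff.2 (sym_iterPd hG.isOpen (hG.smooth μ ν) _ hx)
  · exact isSymFirst_self_iff.2 (sym_iterPd hG.isOpen hm _ hx)
  · exact isSymFirst_self_iff.2 (sym_iterPd hG.isOpen hκ _ hx)

/-- `covOfJet` computes the covariant coordinates of all sections with the given jet. -/
lemma covOfJet_jetOf {Ω : Set (Model n)} {x : Model n} {G : Model n → Fin n → Fin n → ℝ}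
    {m κ : Model n → ℝ} (hG : MetricOn Ω G) (hL : IsLorentzMatrix (G x)) (hx : x ∈ Ω)
    (hm : ContDiffOn ℝ ∞ m Ω) (hκ : ContDiffOn ℝ ∞ κ Ω) :
    covOfJet (jetOf r G m κ x) = covOf 2 r G m κ x := by
  set c := jetOf r G m κ x with hcdef
  have hc : c ∈ jetDomain r Set.univ := jetOf_mem_jetDomain hG hL hx hm hκ trivial
  have hG' := metricOn_polyMetric hc
  have hxΩ' : x ∈ {u | (c, u) ∈ polySet n r} := mem_polySet_self.2 (mem_jetSet hc)
  set Ω' := Ω ∩ {u | (c, u) ∈ polySet n r}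
  have hΩ' : IsOpen Ω' := hG.isOpen.inter hG'.isOpen
  have h1 := hG.mono hΩ' Set.inter_subset_left
  have h2 := hG'.mono hΩ' Set.inter_subset_right
  have hx' : x ∈ Ω' := ⟨hx, hxΩ'⟩
  have key : ∀ {f g : Model n → ℝ}, ContDiffOn ℝ ∞ f Ω' → ContDiffOn ℝ ∞ g Ω' →
      (∀ j < r + 1, ∀ l : Fin j → Fin n, iterPd j f l x = iterPd j g l x) →
      Flat Ω' x (r + 1) (fun u => f u - g u) := by
    intro f g hf hg h
    refine flat_of_iterPd hΩ' (hf.sub hg) fun j hj l => ?_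
    rw [iterPd_sub hΩ' hf hg _ _ hx']
    simp only [h j hj l, sub_self]
  refine covOf_eq_of_flat h1 h2 hx' 2 r (fun μ ν => key (h2.smooth μ ν) (h1.smooth μ ν)
    fun j hj l => iterPd_polyMetric hc j hj l μ ν) (hm.mono Set.inter_subset_left)
    (contDiff_polyScalar _ _).contDiffOn (hκ.mono Set.inter_subset_left)
    (contDiff_polyScalar _ _).contDiffOn
    (key (contDiff_polyScalar _ _).contDiffOn (hm.mono Set.inter_subset_left)
      fun j hj l => iterPd_polyScalar hc.2.2.2.2.1 x j hj l)
    (key (contDiff_polyScalar _ _).contDiffOn (hκ.mono Set.inter_subset_left)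
      fun j hj l => iterPd_polyScalar hc.2.2.2.2.2 x j hj l)

lemma covOfJet_mem (hL : c ∈ jetDomain r U) : covOfJet c ∈ covDomain r U := by
  refine covOf_mem_covDomain (metricOn_polyMetric hL) (mem_polySet_self.2 (mem_jetSet hL)) ?_ r _ _
    hL.1
  have : polyMetric c c.1 = c.2.1 0 Fin.elim0 := by
    funext μ ν; exact polyMetric_self c μ ν
  rw [this]
  exact hL.2.1 _

end Representatives

/-! ### Inverting the covariant coordinates -/

section Compare

variable {n r : ℕ} {U : Set (Model n)} {c c' : JetCoord n r}

lemma covOfJet_fst (c : JetCoord n r) : (covOfJet c).1 = c.1 := rfl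

lemma covOfJet_metric (c : JetCoord n r) : (covOfJet c).2.2.1 = c.2.1 0 Fin.elim0 := by
  funext μ ν; exact polyMetric_self c μ ν

/-- Two jets over the same point that agree to order `K`: their polynomial representatives on a
common domain. -/
lemma exists_polyMetric_pair (hc : c ∈ jetDomain r U) (hc' : c' ∈ jetDomain r U)
    (h1 : c'.1 = c.1) {K : ℕ} (hK : K ≤ r + 1)
    (h : ∀ k : Fin (r + 1), (k : ℕ) < K → c'.2.1 k = c.2.1 k) :
    ∃ Ω : Set (Model n), MetricOn Ω (polyMetric c) ∧ MetricOn Ω (polyMetric c') ∧ c.1 ∈ Ω ∧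
      (∀ μ ν, Flat Ω c.1 K (fun u => polyMetric c' u μ ν - polyMetric c u μ ν)) ∧
      ∀ j (hj : j < r + 1) l μ ν,
        iterPd j (fun u => polyMetric c' u μ ν - polyMetric c u μ ν) l c.1 =
          c'.2.1 ⟨j, hj⟩ l μ ν - c.2.1 ⟨j, hj⟩ l μ ν := by
  have hG := metricOn_polyMetric hc
  have hG' := metricOn_polyMetric hc'
  have hΩ := hG.isOpen.inter hG'.isOpen
  have m1 := hG.mono hΩ Set.inter_subset_left
  have m2 := hG'.mono hΩ Set.inter_subset_right
  have hx : c.1 ∈ {u | (c, u) ∈ polySet n r} ∩ {u | (c', u) ∈ polySet n r} :=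
    ⟨mem_polySet_self.2 (mem_jetSet hc), h1 ▸ mem_polySet_self.2 (mem_jetSet hc')⟩
  have e : ∀ j (hj : j < r + 1) l μ ν,
      iterPd j (fun u => polyMetric c' u μ ν - polyMetric c u μ ν) l c.1 =
        c'.2.1 ⟨j, hj⟩ l μ ν - c.2.1 ⟨j, hj⟩ l μ ν := by
    intro j hj l μ ν
    rw [iterPd_sub hΩ (m2.smooth μ ν) (m1.smooth μ ν) _ _ hx]
    dsimp only
    rw [iterPd_polyMetric hc j hj, ← iterPd_polyMetric hc' j hj, h1]
  refine ⟨_, m1, m2, hx, fun μ ν => flat_of_iterPd hΩ ((m2.smooth μ ν).sub (m1.smooth μ ν))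
    fun j hj l => ?_, e⟩
  rw [e j (by omega), h ⟨j, by omega⟩ hj, sub_self]

lemma iterPd_polyScalar_sub {a a' : ScalarArrays n r} (ha : SymScalar a) (ha' : SymScalar a')
    (x : Model n) (j : ℕ) (hj : j < r + 1) (l : Fin j → Fin n) :
    iterPd j (fun u => polyScalar x a' u - polyScalar x a u) l x = a' ⟨j, hj⟩ l - a ⟨j, hj⟩ l := by
  rw [iterPd_sub isOpen_univ (contDiff_polyScalar x a').contDiffOn
    (contDiff_polyScalar x a).contDiffOn _ _ (Set.mem_univ x)]
  dsimp only
  rw [iterPd_polyScalar ha, iterPd_polyScalar ha']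

lemma flat_polyScalar_sub {a a' : ScalarArrays n r} (ha : SymScalar a) (ha' : SymScalar a')
    {Ω : Set (Model n)} (hΩ : IsOpen Ω) (x : Model n) {K : ℕ} (hK : K ≤ r + 1)
    (h : ∀ k : Fin (r + 1), (k : ℕ) < K → a' k = a k) :
    Flat Ω x K (fun u => polyScalar x a' u - polyScalar x a u) := by
  refine flat_of_iterPd hΩ ((contDiff_polyScalar x a').contDiffOn.sub
    (contDiff_polyScalar x a).contDiffOn) fun j hj l => ?_
  rw [iterPd_polyScalar_sub ha ha' x j (by omega), h ⟨j, by omega⟩ hj, sub_self]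

/-- The covariant coordinates of order less than `K` agree. The order is that of the highest
derivatives involved: it is `k + 1` for `∂ᵏΓ`, `k + 2` for `∇ᵏR` and `k` for `∇ᵏm²` and `∇ᵏκ`. -/
structure AgreeBelow (K : ℕ) (d d' : CovCoord n r) : Prop where
  s : ∀ k : Fin r, (k : ℕ) + 1 < K → d'.2.1 k = d.2.1 k
  q : ∀ k : Fin (r - 1), (k : ℕ) + 2 < K → d'.2.2.2.1 k = d.2.2.2.1 k
  m : ∀ k : Fin (r + 1), (k : ℕ) < K → d'.2.2.2.2.1 k = d.2.2.2.2.1 k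
  κ : ∀ k : Fin (r + 1), (k : ℕ) < K → d'.2.2.2.2.2 k = d.2.2.2.2.2 k

variable (hc : c ∈ jetDomain r U) (hc' : c' ∈ jetDomain r U) (h1 : c'.1 = c.1) {K : ℕ}
  (hK : K ≤ r + 1) (h : ∀ k : Fin (r + 1), (k : ℕ) < K → c'.2.1 k = c.2.1 k)
  (hm : ∀ k : Fin (r + 1), (k : ℕ) < K → c'.2.2.1 k = c.2.2.1 k)
  (hκ : ∀ k : Fin (r + 1), (k : ℕ) < K → c'.2.2.2 k = c.2.2.2 k)
include hc hc' h1 hK h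

/-- The covariant coordinates are triangular in the order of the jet. -/
lemma agreeBelow_covOfJet
    (hm : ∀ k : Fin (r + 1), (k : ℕ) < K → c'.2.2.1 k = c.2.2.1 k)
    (hκ : ∀ k : Fin (r + 1), (k : ℕ) < K → c'.2.2.2 k = c.2.2.2 k) :
    AgreeBelow K (covOfJet c) (covOfJet c') := by
  obtain ⟨Ω, m1, m2, hx, hf, -⟩ := exists_polyMetric_pair hc hc' h1 hK h
  unfold covOfJet
  rw [h1]
  exact ⟨fun k hk => sOf_eq m1 m2 hx hf k hk, fun k hk => curvOf_eq m1 m2 hx hf k hk,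
    fun k hk => scalarOf_eq m1 m2 hx hf (contDiff_polyScalar _ _).contDiffOn
      (contDiff_polyScalar _ _).contDiffOn
      (flat_polyScalar_sub hc.2.2.2.2.1 hc'.2.2.2.2.1 m1.isOpen _ hK hm) k hk,
    fun k hk => scalarOf_eq m1 m2 hx hf (contDiff_polyScalar _ _).contDiffOn
      (contDiff_polyScalar _ _).contDiffOn
      (flat_polyScalar_sub hc.2.2.2.2.2 hc'.2.2.2.2.2 m1.isOpen _ hK hκ) k hk⟩

/-- For jets that agree below order `K = k + 1`, the leading part of the `S`-coordinates of
order `k`. -/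
lemma polyEval_covOfJet_s_sub (k : Fin r) (hk : (k : ℕ) + 1 = K) (a : Fin n) (ξ : Model n) :
    polyEval (fun l => ∑ α, c.2.1 0 Fin.elim0 a α *
      ((covOfJet c').2.1 k α l - (covOfJet c).2.1 k α l)) ξ =
      symbolS (fun a b l => c'.2.1 ⟨(k : ℕ) + 1, by omega⟩ l a b
        - c.2.1 ⟨(k : ℕ) + 1, by omega⟩ l a b) a ξ := by
  obtain ⟨Ω, m1, m2, hx, hf, he⟩ := exists_polyMetric_pair hc hc' h1 hK h
  subst hk
  have := polyEval_sOf_sub m1 m2 hx k hf a ξ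
  simp only [he _ (show (k : ℕ) + 1 < r + 1 by omega)] at this
  rw [← this, ← covOfJet_metric]
  unfold covOfJet
  rw [h1]
  rfl

/-- For jets that agree below order `K = k + 2`, the leading part of the curvature coordinates
of order `k`. -/
lemma polyEval_covOfJet_q_sub (k : Fin (r - 1)) (hk : (k : ℕ) + 2 = K) (a ν : Fin n)
    (ξ : Model n) :
    2 * (((k : ℕ) + 1 : ℕ) : ℝ) * polyEval (fun l => ∑ α, c.2.1 0 Fin.elim0 a α *
      ((covOfJet c').2.2.2.1 k α (Fin.snoc (α := fun _ => Fin n) l ν)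
        - (covOfJet c).2.2.2.1 k α (Fin.snoc (α := fun _ => Fin n) l ν))) ξ =
      symbolQ (k := (k : ℕ) + 1) (fun a b l => c'.2.1 ⟨(k : ℕ) + 2, by omega⟩ l a b
        - c.2.1 ⟨(k : ℕ) + 2, by omega⟩ l a b) a ν ξ := by
  obtain ⟨Ω, m1, m2, hx, hf, he⟩ := exists_polyMetric_pair hc hc' h1 hK h
  subst hk
  have := polyEval_curvOf_sub m1 m2 hx k hf a ν ξ
  simp only [he _ (show (k : ℕ) + 2 < r + 1 by omega)] at this
  rw [← this, ← covOfJet_metric]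
  unfold covOfJet
  rw [h1]
  rfl

lemma covOfJet_m_sub (hm : ∀ k : Fin (r + 1), (k : ℕ) < K → c'.2.2.1 k = c.2.2.1 k)
    (k : Fin (r + 1)) (hk : (k : ℕ) = K) (l : Fin (k : ℕ) → Fin n) :
    (covOfJet c').2.2.2.2.1 k l - (covOfJet c).2.2.2.2.1 k l = c'.2.2.1 k l - c.2.2.1 k l := by
  obtain ⟨Ω, m1, m2, hx, hf, -⟩ := exists_polyMetric_pair hc hc' h1 hK h
  subst hk
  rw [← iterPd_polyScalar_sub hc.2.2.2.2.1 hc'.2.2.2.2.1 c.1 k k.2,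
    ← scalarOf_sub m1 m2 hx k hf (contDiff_polyScalar _ _).contDiffOn
      (contDiff_polyScalar _ _).contDiffOn
      (flat_polyScalar_sub hc.2.2.2.2.1 hc'.2.2.2.2.1 m1.isOpen _ hK hm) l]
  unfold covOfJet
  rw [h1]
  rfl

lemma covOfJet_κ_sub (hκ : ∀ k : Fin (r + 1), (k : ℕ) < K → c'.2.2.2 k = c.2.2.2 k)
    (k : Fin (r + 1)) (hk : (k : ℕ) = K) (l : Fin (k : ℕ) → Fin n) :
    (covOfJet c').2.2.2.2.2 k l - (covOfJet c).2.2.2.2.2 k l = c'.2.2.2 k l - c.2.2.2 k l := by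
  obtain ⟨Ω, m1, m2, hx, hf, -⟩ := exists_polyMetric_pair hc hc' h1 hK h
  subst hk
  rw [← iterPd_polyScalar_sub hc.2.2.2.2.2 hc'.2.2.2.2.2 c.1 k k.2,
    ← scalarOf_sub m1 m2 hx k hf (contDiff_polyScalar _ _).contDiffOn
      (contDiff_polyScalar _ _).contDiffOn
      (flat_polyScalar_sub hc.2.2.2.2.2 hc'.2.2.2.2.2 m1.isOpen _ hK hκ) l]
  unfold covOfJet
  rw [h1]
  rfl

end Compare

section Injectivity

variable {n r : ℕ} {U : Set (Model n)}

lemma arrays_zero_eq {c : JetCoord n r} (l : Fin ((0 : Fin (r + 1)) : ℕ) → Fin n) :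
    c.2.1 0 l = c.2.1 0 Fin.elim0 := by
  rw [show l = Fin.elim0 from funext fun i => Fin.elim0 i]

/-- Jets with the same covariant coordinates are equal, order by order. -/
lemma injOn_covOfJet : Set.InjOn (covOfJet (n := n) (r := r)) (jetDomain r U) := by
  intro c' hc' c hc hcc
  have h1 : c'.1 = c.1 := by rw [← covOfJet_fst, hcc, covOfJet_fst]
  have key : ∀ K ≤ r + 1, ∀ k : Fin (r + 1), (k : ℕ) < K →
      c'.2.1 k = c.2.1 k ∧ c'.2.2.1 k = c.2.2.1 k ∧ c'.2.2.2 k = c.2.2.2 k := by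
    intro K
    induction K with
    | zero => intro _ k hk; omega
    | succ K ih =>
      intro hK k hk
      rcases Nat.lt_succ_iff_lt_or_eq.1 hk with hk | hk
      · exact ih (by omega) k hk
      have ih := ih (by omega)
      have hg := fun k hk => (ih k hk).1
      have hKr : K ≤ r + 1 := by omega
      refine ⟨?_, ?_, ?_⟩
      · rcases K with _ | j
        · obtain rfl : k = 0 := Fin.ext hk
          funext l
          rw [arrays_zero_eq, arrays_zero_eq, ← covOfJet_metric, ← covOfJet_metric, hcc]
        · obtain ⟨k, hkr⟩ := k
          dsimp only at hk
          subst hk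
          -- Both symbols of the difference of the metric derivatives of order `j + 1` vanish.
          have hS := fun a ξ => polyEval_covOfJet_s_sub hc hc' h1 hKr hg ⟨j, by omega⟩ rfl a ξ
          simp only [hcc, sub_self, mul_zero, Finset.sum_const_zero] at hS
          have hQ : ∀ a b ξ, 2 * (j : ℝ) * polyEval (fun _ : Fin (j + 1) → Fin n => (0 : ℝ)) ξ =
              symbolQ (k := j) (fun a b l => c'.2.1 ⟨j + 1, by omega⟩ l a b
                - c.2.1 ⟨j + 1, by omega⟩ l a b) a b ξ := by
            intro a b ξ
            -- there are no curvature coordinates at first order, where `symbolQ` vanishes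
            rcases j with _ | i
            · rw [symbolQ_zero]; simp
            · have hQ := polyEval_covOfJet_q_sub hc hc' h1 hKr hg ⟨i, by omega⟩ rfl a b ξ
              simp only [hcc, sub_self, mul_zero, Finset.sum_const_zero] at hQ
              exact hQ
          funext l a b
          have := congrFun (metricOfSymbol_symbol
            (p := fun a b l => c'.2.1 ⟨j + 1, by omega⟩ l a b - c.2.1 ⟨j + 1, by omega⟩ l a b)
            (s := fun _ _ => 0) (q := fun _ _ _ => 0)
            (fun a b => (isSymFirst_self_iff.1 (hc'.2.2.2.1 ⟨j + 1, hkr⟩ a b)).sub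
              (isSymFirst_self_iff.1 (hc.2.2.2.1 ⟨j + 1, hkr⟩ a b)))
            (fun a b l => by rw [hc'.2.2.1, hc.2.2.1]) (fun _ _ _ => rfl) (fun _ _ _ _ => rfl)
            hS hQ a b) l
          simp only [metricOfSymbol] at this
          linarith
      · funext l
        have := covOfJet_m_sub hc hc' h1 hKr hg (fun k hk => (ih k hk).2.1) k hk l
        rw [hcc] at this
        linarith
      · funext l
        have := covOfJet_κ_sub hc hc' h1 hKr hg (fun k hk => (ih k hk).2.2) k hk l
        rw [hcc] at this
        linarith
  have := fun k : Fin (r + 1) => key (r + 1) le_rfl k k.2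
  exact Prod.ext h1 (Prod.ext (funext fun k => (this k).1)
    (Prod.ext (funext fun k => (this k).2.1) (funext fun k => (this k).2.2)))

end Injectivity

/-! ### Inversion of the covariant coordinates by Newton's method -/

section Newton

variable {n r : ℕ}

/-- The `S`-arrays with the upper index lowered by `g`, extended by zero to all orders. -/
def lowS (g : Fin n → Fin n → ℝ) (S : SArrays n r) (k : ℕ) (a : Fin n)
    (l : Fin (k + 2) → Fin n) : ℝ :=
  if h : k < r then ∑ α, g a α * S ⟨k, h⟩ α l else 0

/-- The curvature arrays with the upper index lowered by `g`, extended by zero to all orders;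
the array of order `k` stands at the order `k + 1` of the Christoffel symbols. -/
def lowQ (g : Fin n → Fin n → ℝ) (Q : RArrays n r) :
    (k : ℕ) → Fin n → Fin n → (Fin (k + 1) → Fin n) → ℝ
  | 0, _, _, _ => 0
  | k + 1, a, c, l => if h : k < r - 1 then
      ∑ α, g a α * Q ⟨k, h⟩ α (Fin.snoc (α := fun _ => Fin n) l c) else 0

/-- The correction of the metric derivatives for given errors `S`, `Q` in the covariant coordinates:
the errors with lowered index are taken for the symbols of the correction. -/
def metricIncr (g : Fin n → Fin n → ℝ) (S : SArrays n r) (Q : RArrays n r) :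
    (k : ℕ) → (Fin k → Fin n) → Fin n → Fin n → ℝ
  | 0, _, _, _ => 0
  | k + 1, l, a, c => metricOfSymbol (lowS g S k) (lowQ g Q k) a c l

/-- One step of Newton's method for the equation `covOfJet c = d`. -/
def newtonStep (d : CovCoord n r) (c : JetCoord n r) : JetCoord n r :=
  (c.1, fun k l a b => c.2.1 k l a b + metricIncr d.2.2.1 (d.2.1 - (covOfJet c).2.1)
      (d.2.2.2.1 - (covOfJet c).2.2.2.1) k l a b,
    c.2.2.1 + (d.2.2.2.2.1 - (covOfJet c).2.2.2.2.1),
    c.2.2.2 + (d.2.2.2.2.2 - (covOfJet c).2.2.2.2.2))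

/-- The jet of the constant metric `d.g`. -/
def baseJet (d : CovCoord n r) : JetCoord n r :=
  (d.1, fun k _ a b => if (k : ℕ) = 0 then d.2.2.1 a b else 0, 0, 0)

/-- The inverse of the covariant coordinates: since the coordinates of order `k` are triangular
in the orders of the jet, Newton's method ends after `r + 1` steps. -/
def jetOfCov (d : CovCoord n r) : JetCoord n r := (newtonStep d)^[r + 1] (baseJet d)

/-- The covariant coordinates with nondegenerate metric. -/
def covSet (n r : ℕ) : Set (CovCoord n r) := {d | (Matrix.of d.2.2.1).det ≠ 0}

lemma contDiff_metric_entry (a b : Fin n) :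
    ContDiff ℝ ∞ (fun d : CovCoord n r => d.2.2.1 a b) := by
  have h : ContDiff ℝ ∞ (fun d : CovCoord n r => d.2.2.1) := by fun_prop
  exact contDiff_pi.1 (contDiff_pi.1 h a) b

lemma isOpen_covSet : IsOpen (covSet n r) := by
  have h : Continuous (fun d : CovCoord n r => (Matrix.of d.2.2.1).det) :=
    Continuous.matrix_det (continuous_pi fun i => continuous_pi fun j =>
      (contDiff_metric_entry i j).continuous)
  exact isOpen_ne.preimage h

section Smooth

variable {E : Type*} [NormedAddCommGroup E] [NormedSpace ℝ E] {s : Set E}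

lemma contDiffOn_metricIncr {g : E → Fin n → Fin n → ℝ} {S : E → SArrays n r}
    {Q : E → RArrays n r} (hg : ContDiffOn ℝ ∞ g s) (hS : ContDiffOn ℝ ∞ S s)
    (hQ : ContDiffOn ℝ ∞ Q s) (k : ℕ) (l : Fin k → Fin n) (a c : Fin n) :
    ContDiffOn ℝ ∞ (fun p => metricIncr (g p) (S p) (Q p) k l a c) s := by
  have hg' : ∀ a b, ContDiffOn ℝ ∞ (fun p => g p a b) s := fun a b =>
    contDiffOn_pi.1 (contDiffOn_pi.1 hg a) b
  have hs : ∀ k a l, ContDiffOn ℝ ∞ (fun p => lowS (g p) (S p) k a l) s := by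
    intro k a l
    unfold lowS
    split_ifs with h
    · refine ContDiffOn.sum fun α _ => (hg' a α).mul ?_
      have h1 := contDiffOn_pi.1 hS (⟨k, h⟩ : Fin r)
      exact contDiffOn_pi.1 (contDiffOn_pi.1 h1 α) l
    · exact contDiffOn_const
  have hq : ∀ k a c l, ContDiffOn ℝ ∞ (fun p => lowQ (g p) (Q p) k a c l) s := by
    intro k a c l
    rcases k with _ | k
    · exact contDiffOn_const
    · simp only [lowQ]
      split_ifs with h
      · refine ContDiffOn.sum fun α _ => (hg' a α).mul ?_
        have h1 := contDiffOn_pi.1 hQ (⟨k, h⟩ : Fin (r - 1))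
        exact contDiffOn_pi.1 (contDiffOn_pi.1 h1 α) _
      · exact contDiffOn_const
  rcases k with _ | k
  · exact contDiffOn_const
  · exact ((hs _ _ _).add (hs _ _ _)).add (contDiffOn_const.mul (hq _ _ _ _))

end Smooth

lemma newtonStep_metric_zero (d : CovCoord n r) (c : JetCoord n r)
    (l : Fin ((0 : Fin (r + 1)) : ℕ) → Fin n) : (newtonStep d c).2.1 0 l = c.2.1 0 l := by
  funext a b
  change _ + (0 : ℝ) = _
  rw [add_zero]

lemma contDiffOn_newtonStep {c : CovCoord n r → JetCoord n r}
    (hc : ContDiffOn ℝ ∞ c (covSet n r)) (hcs : Set.MapsTo c (covSet n r) (jetSet n r)) :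
    ContDiffOn ℝ ∞ (fun d => newtonStep d (c d)) (covSet n r) := by
  have hΦ : ContDiffOn ℝ ∞ (fun d => covOfJet (c d)) (covSet n r) :=
    contDiffOn_covOfJet.comp hc hcs
  have hE : ContDiffOn ℝ ∞ (fun d => d - covOfJet (c d)) (covSet n r) := contDiffOn_id.sub hΦ
  refine hc.fst.prodMk (ContDiffOn.prodMk ?_ (ContDiffOn.prodMk ?_ ?_))
  · refine contDiffOn_pi.2 fun k => contDiffOn_pi.2 fun l => contDiffOn_pi.2 fun a =>
      contDiffOn_pi.2 fun b => ContDiffOn.add ?_ ?_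
    · have h1 := contDiffOn_pi.1 hc.snd.fst k
      exact contDiffOn_pi.1 (contDiffOn_pi.1 (contDiffOn_pi.1 h1 l) a) b
    · exact contDiffOn_metricIncr (contDiffOn_id.snd.snd.fst) hE.snd.fst hE.snd.snd.snd.fst k l a b
  · exact hc.snd.snd.fst.add hE.snd.snd.snd.snd.fst
  · exact hc.snd.snd.snd.add hE.snd.snd.snd.snd.snd

lemma iterate_newtonStep_metric_zero (d : CovCoord n r) (K : ℕ)
    (l : Fin ((0 : Fin (r + 1)) : ℕ) → Fin n) :
    ((newtonStep d)^[K] (baseJet d)).2.1 0 l = d.2.2.1 := by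
  induction K with
  | zero => rfl
  | succ K ih => rw [Function.iterate_succ_apply', newtonStep_metric_zero, ih]

/-- Every iterate of Newton's method is smooth wherever the metric is nondegenerate, since the
metric itself is never corrected. -/
lemma contDiffOn_jetOfCov : ContDiffOn ℝ ∞ (jetOfCov (n := n) (r := r)) (covSet n r) := by
  have key : ∀ K, ContDiffOn ℝ ∞ (fun d : CovCoord n r => (newtonStep d)^[K] (baseJet d))
      (covSet n r) := by
    intro K
    induction K with
    | zero =>
      refine contDiffOn_fst.prodMk (ContDiffOn.prodMk ?_ contDiffOn_const)
      refine contDiffOn_pi.2 fun k => contDiffOn_pi.2 fun l => contDiffOn_pi.2 fun a =>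
        contDiffOn_pi.2 fun b => ?_
      split_ifs
      · exact (contDiff_metric_entry a b).contDiffOn
      · exact contDiffOn_const
    | succ K ih =>
      simp only [Function.iterate_succ_apply']
      refine contDiffOn_newtonStep ih fun d hd => ?_
      have h0 := iterate_newtonStep_metric_zero d K Fin.elim0
      exact (congrArg (fun A => (Matrix.of A).det ≠ 0) h0).mpr hd
  exact key (r + 1)

variable {g : Fin n → Fin n → ℝ}

lemma sym_lowS {S : SArrays n r} (hS : SymS S) (k : ℕ) (a : Fin n) : Sym (lowS g S k a) := by
  intro s l
  unfold lowS
  split_ifs with h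
  · exact Finset.sum_congr rfl fun α _ => by
      rw [isSymFirst_self_iff.1 (hS ⟨k, h⟩ α) s l]
  · rfl

lemma sym_lowQ {Q : RArrays n r} (hQ : ∀ (k : Fin (r - 1)) α, IsSymFirst ((k : ℕ) + 2) (Q k α)) (k : ℕ)
    (a c : Fin n) : Sym (lowQ g Q k a c) := by
  intro s l
  rcases k with _ | k
  · rfl
  · simp only [lowQ]
    split_ifs with h
    · exact Finset.sum_congr rfl fun α _ =>
        congrArg (g a α * ·) (isSymFirst_succ_iff.1 (hQ ⟨k, h⟩ α) c s l)
    · rfl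

lemma lowQ_symm {Q : RArrays n r} (hQ : ∀ (k : Fin (r - 1)) (α ν : Fin n)
      (l : Fin ((k : ℕ) + 2) → Fin n),
      ∑ ρ, g α ρ * Q k ρ (Fin.snoc (α := fun _ => Fin n) l ν)
        = ∑ ρ, g ν ρ * Q k ρ (Fin.snoc (α := fun _ => Fin n) l α)) (k : ℕ)
    (a c : Fin n) (l : Fin (k + 1) → Fin n) : lowQ g Q k a c l = lowQ g Q k c a l := by
  rcases k with _ | k
  · rfl
  · simp only [lowQ]
    split_ifs with h
    · exact hQ ⟨k, h⟩ a c l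
    · rfl

/-- The vanishing of the total symmetrization, in terms of polynomials: contraction of the
last slot with `ξ` gives zero. -/
lemma sum_coord_mul_polyEval_lowQ {Q : RArrays n r} (hQ : ∀ (k : Fin (r - 1)) (α : Fin n)
      (l : Fin ((k : ℕ) + 3) → Fin n), symFirst ((k : ℕ) + 3) (Q k α) l = 0) (k : ℕ) (a : Fin n)
    (ξ : Model n) : ∑ c, ξ c * polyEval (lowQ g Q k a c) ξ = 0 := by
  rcases k with _ | k
  · simp [lowQ, polyEval]
  · by_cases h : k < r - 1
    · have e : ∀ c, lowQ g Q (k + 1) a c = fun l =>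
          ∑ α, g a α * Q ⟨k, h⟩ α (Fin.snoc (α := fun _ => Fin n) l c) := fun c => by
        funext l; simp [lowQ, h]
      have h0 : ∀ α, polyEval (Q ⟨k, h⟩ α) ξ = 0 := fun α => by
        rw [← polyEval_symFirst, show symFirst (k + 3) (Q ⟨k, h⟩ α) = fun _ => 0 from
          funext (hQ ⟨k, h⟩ α)]
        simp [polyEval]
      simp only [e, polyEval_sum, polyEval_const_mul, Finset.mul_sum]
      rw [Finset.sum_comm]
      refine Finset.sum_eq_zero fun α _ => ?_
      have := polyEval_succ_last (Q ⟨k, h⟩ α) ξ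
      rw [h0] at this
      rw [← mul_zero (g a α), this, Finset.mul_sum]
      exact Finset.sum_congr rfl fun c _ => by ring
    · simp [lowQ, h, polyEval]

/-- The lowered index can be raised again. -/
lemma eq_of_sum_mul_eq (hg : (Matrix.of g).det ≠ 0) {v w : Fin n → ℝ}
    (h : ∀ a, ∑ α, g a α * v α = ∑ α, g a α * w α) : v = w := by
  have h1 : (Matrix.of g).mulVec v = (Matrix.of g).mulVec w := funext h
  have hinv := Matrix.nonsing_inv_mul (Matrix.of g) (Ne.isUnit hg)
  have := congrArg ((Matrix.of g)⁻¹.mulVec) h1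
  rwa [Matrix.mulVec_mulVec, Matrix.mulVec_mulVec, hinv, Matrix.one_mulVec,
    Matrix.one_mulVec] at this

end Newton

section NewtonCorrect

variable {n r : ℕ} {U : Set (Model n)} {d : CovCoord n r} {c : JetCoord n r}

/-- The difference of two points with the same metric satisfies the linear constraints on the
curvature arrays. -/
lemma tensorDomain_sub {t t' : TensorCoord n r} (ht : t ∈ tensorDomain n r)
    (ht' : t' ∈ tensorDomain n r) (h : t'.1 = t.1) :
    (∀ (k : Fin (r - 1)) (α : Fin n), IsSymFirst ((k : ℕ) + 2) ((t.2.1 - t'.2.1) k α)) ∧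
    (∀ (k : Fin (r - 1)) (α ν : Fin n) (l : Fin ((k : ℕ) + 2) → Fin n),
      ∑ ρ, t.1 α ρ * (t.2.1 - t'.2.1) k ρ (Fin.snoc (α := fun _ => Fin n) l ν)
        = ∑ ρ, t.1 ν ρ * (t.2.1 - t'.2.1) k ρ (Fin.snoc (α := fun _ => Fin n) l α)) ∧
    (∀ (k : Fin (r - 1)) (α : Fin n) (l : Fin ((k : ℕ) + 3) → Fin n),
      symFirst ((k : ℕ) + 3) ((t.2.1 - t'.2.1) k α) l = 0) := by
  refine ⟨fun k α s hs l => ?_, fun k α ν l => ?_, fun k α l => ?_⟩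
  · simp only [Pi.sub_apply, ht.2.1 k α s hs l, ht'.2.1 k α s hs l]
  · have h1 := ht.2.2.1 k α ν l
    have h2 := ht'.2.2.1 k α ν l
    rw [h] at h2
    simp only [Pi.sub_apply, mul_sub, Finset.sum_sub_distrib, h1, h2]
  · have := symFirst_sub (m := (k : ℕ) + 3) (t.2.1 k α) (t'.2.1 k α) l
    rw [ht.2.2.2.1, ht'.2.2.2.1, sub_zero] at this
    exact this

/-- The correction has the symmetries of metric derivatives, because the errors satisfy the
constraints on the covariant coordinates. -/
lemma newtonStep_mem (hd : d ∈ covDomain r U) (hc : c ∈ jetDomain r U)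
    (hg : c.2.1 0 Fin.elim0 = d.2.2.1) : newtonStep d c ∈ jetDomain r U := by
  have hΦ := covOfJet_mem hc
  have hg' : (covOfJet c).2.2.1 = d.2.2.1 := by rw [covOfJet_metric, hg]
  obtain ⟨q1, q2, -⟩ := tensorDomain_sub hd.2.2 hΦ.2.2 hg'
  have s1 : SymS (d.2.1 - (covOfJet c).2.1) := fun k α s hs l => by
    simp only [Pi.sub_apply, hd.2.1 k α s hs l, hΦ.2.1 k α s hs l]
  refine ⟨hc.1, fun l => ?_, fun k l a b => ?_, fun k a b => ?_, fun k => ?_, fun k => ?_⟩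
  · rw [newtonStep_metric_zero]; exact hc.2.1 l
  · change c.2.1 k l a b + metricIncr _ _ _ _ l a b = c.2.1 k l b a + metricIncr _ _ _ _ l b a
    rw [hc.2.2.1]
    obtain ⟨k, hk⟩ := k
    rcases k with _ | k
    · rfl
    · dsimp only [metricIncr, metricOfSymbol]
      rw [lowQ_symm q2 k a b]
      ring
  · refine isSymFirst_self_iff.2 ((isSymFirst_self_iff.1 (hc.2.2.2.1 k a b)).add ?_)
    obtain ⟨k, hk⟩ := k
    rcases k with _ | k
    · exact sym_of_le_one zero_le_one _
    · exact sym_metricOfSymbol (fun a => sym_lowS s1 k a) (fun a c => sym_lowQ q1 k a c) a b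
  · refine isSymFirst_self_iff.2 ((isSymFirst_self_iff.1 (hc.2.2.2.2.1 k)).add
      ((isSymFirst_self_iff.1 (hd.2.2.2.2.2.2.1 k)).sub
        (isSymFirst_self_iff.1 (hΦ.2.2.2.2.2.2.1 k))))
  · refine isSymFirst_self_iff.2 ((isSymFirst_self_iff.1 (hc.2.2.2.2.2 k)).add
      ((isSymFirst_self_iff.1 (hd.2.2.2.2.2.2.2 k)).sub
        (isSymFirst_self_iff.1 (hΦ.2.2.2.2.2.2.2 k))))

/-- A Newton step gains one order. -/
lemma agreeBelow_newtonStep (hd : d ∈ covDomain r U) (hc : c ∈ jetDomain r U)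
    (hg : c.2.1 0 Fin.elim0 = d.2.2.1) {K : ℕ} (hK : K ≤ r)
    (h : AgreeBelow K (covOfJet c) d) : AgreeBelow (K + 1) (covOfJet (newtonStep d c)) d := by
  have hΦ := covOfJet_mem hc
  have hg' : (covOfJet c).2.2.1 = d.2.2.1 := by rw [covOfJet_metric, hg]
  obtain ⟨q1, q2, q3⟩ := tensorDomain_sub hd.2.2 hΦ.2.2 hg'
  have s1 : SymS (d.2.1 - (covOfJet c).2.1) := fun k α s hs l => by
    simp only [Pi.sub_apply, hd.2.1 k α s hs l, hΦ.2.1 k α s hs l]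
  have hc' := newtonStep_mem hd hc hg
  have hΦ' := covOfJet_mem hc'
  set c' := newtonStep d c with hc'def
  have h1 : c'.1 = c.1 := rfl
  have hdet : (Matrix.of d.2.2.1).det ≠ 0 := det_ne_zero_of_isLorentz hd.2.2.1
  -- Below order `K` there is no error, and hence no correction.
  have hlow : ∀ k : Fin (r + 1), (k : ℕ) < K → c'.2.1 k = c.2.1 k := by
    intro k hk
    funext l a b
    change c.2.1 k l a b + metricIncr _ _ _ _ l a b = _
    rw [add_eq_left]
    obtain ⟨k, hkr⟩ := k
    rcases k with _ | k
    · rfl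
    · dsimp only at hk
      have e1 : ∀ a l, lowS d.2.2.1 (d.2.1 - (covOfJet c).2.1) k a l = 0 := by
        intro a l
        have := h.s ⟨k, by omega⟩ hk
        simp [lowS, this]
      have e2 : ∀ a b l, lowQ d.2.2.1 (d.2.2.2.1 - (covOfJet c).2.2.2.1) k a b l = 0 := by
        intro a b l
        rcases k with _ | k
        · rfl
        · have := h.q ⟨k, by omega⟩ hk
          simp [lowQ, this]
      simp [metricIncr, metricOfSymbol, e1, e2]
  have hmlow : ∀ k : Fin (r + 1), (k : ℕ) < K → c'.2.2.1 k = c.2.2.1 k := by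
    intro k hk
    change c.2.2.1 k + (d.2.2.2.2.1 k - (covOfJet c).2.2.2.2.1 k) = _
    rw [h.m k hk, sub_self, add_zero]
  have hκlow : ∀ k : Fin (r + 1), (k : ℕ) < K → c'.2.2.2 k = c.2.2.2 k := by
    intro k hk
    change c.2.2.2 k + (d.2.2.2.2.2 k - (covOfJet c).2.2.2.2.2 k) = _
    rw [h.κ k hk, sub_self, add_zero]
  have hb := agreeBelow_covOfJet hc hc' h1 (by omega) hlow hmlow hκlow
  -- The correction is built so that its `S`-symbol is the error of the `S`-coordinates.
  have hincr : ∀ (k : ℕ) (hk : k + 1 < r + 1), (fun a b l => c'.2.1 ⟨k + 1, hk⟩ l a b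
      - c.2.1 ⟨k + 1, hk⟩ l a b) = metricOfSymbol (lowS d.2.2.1 (d.2.1 - (covOfJet c).2.1) k)
        (lowQ d.2.2.1 (d.2.2.2.1 - (covOfJet c).2.2.2.1) k) := by
    intro k hk
    funext a b l
    change c.2.1 ⟨k + 1, hk⟩ l a b + metricIncr _ _ _ _ l a b - _ = _
    rw [add_sub_cancel_left]
    rfl
  have hsym : ∀ (k : ℕ) (a : Fin n) (ξ : Model n), symbolS (metricOfSymbol
      (lowS d.2.2.1 (d.2.1 - (covOfJet c).2.1) k)
      (lowQ d.2.2.1 (d.2.2.2.1 - (covOfJet c).2.2.2.1) k)) a ξ =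
        polyEval (lowS d.2.2.1 (d.2.1 - (covOfJet c).2.1) k a) ξ := fun k a ξ =>
    symbolS_metricOfSymbol (fun a => sym_lowS s1 k a) (lowQ_symm q2 k)
      (sum_coord_mul_polyEval_lowQ q3 k) a ξ
  refine ⟨fun k hk => ?_, fun k hk => ?_, fun k hk => ?_, fun k hk => ?_⟩
  · rcases Nat.lt_succ_iff_lt_or_eq.1 hk with hk | hk
    · rw [hb.s k hk, h.s k hk]
    have e := polyEval_covOfJet_s_sub hc hc' h1 (by omega) hlow k hk
    rw [hincr, hg] at e
    have e2 : ∀ a, (fun l => ∑ α, d.2.2.1 a α * ((covOfJet c').2.1 k α l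
        - (covOfJet c).2.1 k α l)) = lowS d.2.2.1 (d.2.1 - (covOfJet c).2.1) k a := by
      intro a
      refine Sym.ext_polyEval (Sym.sum fun α => Sym.const_mul
        ((isSymFirst_self_iff.1 (hΦ'.2.1 k α)).sub (isSymFirst_self_iff.1 (hΦ.2.1 k α))) _)
        (sym_lowS s1 k a) fun ξ => ?_
      rw [e, hsym]
    have e3 : ∀ l, (fun α => (covOfJet c').2.1 k α l - (covOfJet c).2.1 k α l) =
        fun α => (d.2.1 - (covOfJet c).2.1) k α l := fun l =>
      eq_of_sum_mul_eq hdet fun a => by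
        have := congrFun (e2 a) l
        simpa [lowS] using this
    funext α l
    have := congrFun (e3 l) α
    simp only [Pi.sub_apply] at this
    linarith
  · rcases Nat.lt_succ_iff_lt_or_eq.1 hk with hk | hk
    · rw [hb.q k hk, h.q k hk]
    have e := polyEval_covOfJet_q_sub hc hc' h1 (by omega) hlow k hk
    have hkr : (k : ℕ) + 1 + 1 < r + 1 := by omega
    have hi := hincr ((k : ℕ) + 1) hkr
    set p := fun a b l => c'.2.1 ⟨(k : ℕ) + 1 + 1, hkr⟩ l a b
      - c.2.1 ⟨(k : ℕ) + 1 + 1, hkr⟩ l a b with hp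
    set q : Fin n → Fin n → (Fin ((k : ℕ) + 2) → Fin n) → ℝ := fun a ν l =>
      ∑ α, c.2.1 0 Fin.elim0 a α *
        ((covOfJet c').2.2.2.1 k α (Fin.snoc (α := fun _ => Fin n) l ν)
          - (covOfJet c).2.2.2.1 k α (Fin.snoc (α := fun _ => Fin n) l ν)) with hq
    have hqs : ∀ a ν, Sym (q a ν) := fun a ν => Sym.sum fun α => Sym.const_mul
      ((isSymFirst_succ_iff.1 (hΦ'.2.2.2.1 k α) ν).sub
        (isSymFirst_succ_iff.1 (hΦ.2.2.2.1 k α) ν)) _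
    -- The increment `p` is recovered from its own symbols, and was built from the errors; the
    -- `S`-parts of the two expressions agree, so the curvature parts agree too, their common coefficient
    -- `2 (k + 1) / (k + 3)` being nonzero.
    have e2 := metricOfSymbol_symbol (p := p) (q := q)
      (s := lowS d.2.2.1 (d.2.1 - (covOfJet c).2.1) ((k : ℕ) + 1))
      (fun a b => (isSymFirst_self_iff.1 (hc'.2.2.2.1 ⟨(k : ℕ) + 1 + 1, hkr⟩ a b)).sub
              (isSymFirst_self_iff.1 (hc.2.2.2.1 ⟨(k : ℕ) + 1 + 1, hkr⟩ a b)))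
      (fun a b l => by simp only [hp]; rw [hc'.2.2.1, hc.2.2.1]) (fun a => sym_lowS s1 _ a) hqs
      (fun a ξ => by rw [hi, hsym]) (fun a c ξ => e a c ξ)
    have e3 : ∀ l, (fun α => (covOfJet c').2.2.2.1 k α l - (covOfJet c).2.2.2.1 k α l) =
        fun α => (d.2.2.2.1 - (covOfJet c).2.2.2.1) k α l := fun l =>
      eq_of_sum_mul_eq hdet fun a => by
        have h5 := congrFun (e2 a (l (Fin.last _))) (Fin.init l)
        rw [hi] at h5
        simp only [metricOfSymbol] at h5
        have h6 : (2 * (((k : ℕ) + 1 : ℕ) : ℝ) / ((((k : ℕ) + 1 : ℕ) : ℝ) + 2)) ≠ 0 := by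
          positivity
        have h7 := mul_left_cancel₀ h6 (add_left_cancel h5)
        simp only [hq, lowQ, hg, Fin.snoc_init_self, k.2, dif_pos] at h7
        exact h7
    funext α l
    have := congrFun (e3 l) α
    simp only [Pi.sub_apply] at this
    linarith
  · rcases Nat.lt_succ_iff_lt_or_eq.1 hk with hk | hk
    · rw [hb.m k hk, h.m k hk]
    funext l
    have e := covOfJet_m_sub hc hc' h1 (by omega) hlow hmlow k hk l
    have : c'.2.2.1 k l = c.2.2.1 k l + (d.2.2.2.2.1 k l - (covOfJet c).2.2.2.2.1 k l) := rfl
    linarith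
  · rcases Nat.lt_succ_iff_lt_or_eq.1 hk with hk | hk
    · rw [hb.κ k hk, h.κ k hk]
    funext l
    have e := covOfJet_κ_sub hc hc' h1 (by omega) hlow hκlow k hk l
    have : c'.2.2.2 k l = c.2.2.2 k l + (d.2.2.2.2.2 k l - (covOfJet c).2.2.2.2.2 k l) := rfl
    linarith

lemma baseJet_mem (hd : d ∈ covDomain r U) : baseJet d ∈ jetDomain r U := by
  refine ⟨hd.1, fun l => hd.2.2.1, fun k l a b => ?_, fun k a b s _ l => rfl, fun k s _ l => rfl,
    fun k s _ l => rfl⟩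
  simp only [baseJet, isLorentz_symm hd.2.2.1 a b]

/-- `jetOfCov` is a right inverse of `covOfJet`: after `K` steps, the coordinates of order less
than `K` are correct. -/
lemma jetOfCov_spec (hd : d ∈ covDomain r U) :
    jetOfCov d ∈ jetDomain r U ∧ covOfJet (jetOfCov d) = d := by
  have key : ∀ K ≤ r + 1, (newtonStep d)^[K] (baseJet d) ∈ jetDomain r U ∧
      AgreeBelow K (covOfJet ((newtonStep d)^[K] (baseJet d))) d ∧
      ((newtonStep d)^[K] (baseJet d)).1 = d.1 := by
    intro K
    induction K with
    | zero =>
      exact fun _ => ⟨baseJet_mem hd, ⟨fun _ h => by omega, fun _ h => by omega,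
        fun _ h => by omega, fun _ h => by omega⟩, rfl⟩
    | succ K ih =>
      intro hK
      obtain ⟨h1, h2, h3⟩ := ih (by omega)
      rw [Function.iterate_succ_apply']
      have hg := iterate_newtonStep_metric_zero d K Fin.elim0
      exact ⟨newtonStep_mem hd h1 hg, agreeBelow_newtonStep hd h1 hg (by omega) h2, h3⟩
  obtain ⟨h1, h2, h3⟩ := key (r + 1) le_rfl
  refine ⟨h1, ?_⟩
  have e1 : (covOfJet (jetOfCov d)).1 = d.1 := by rw [covOfJet_fst]; exact h3
  have e2 : (covOfJet (jetOfCov d)).2.2.1 = d.2.2.1 := by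
    rw [covOfJet_metric]; exact iterate_newtonStep_metric_zero d (r + 1) Fin.elim0
  exact Prod.ext e1 (Prod.ext (funext fun k => (h2.s k (by omega)).symm) (Prod.ext e2
    (Prod.ext (funext fun k => (h2.q k (by omega)).symm)
      (Prod.ext (funext fun k => (h2.m k k.2).symm) (funext fun k => (h2.κ k k.2).symm)))))

end NewtonCorrect

/-! ### Lorentzian matrices form an open set of symmetric matrices -/

section Lorentz

variable {n : ℕ}

lemma eta_mul_self (a : Fin n) : eta a * eta a = 1 := by
  unfold eta; split_ifs <;> norm_num

/-- Near a Lorentzian matrix, every symmetric matrix is Lorentzian. At `X = P`, where the value is the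
given matrix `Pᵀ η P`, the map `X ↦ Xᵀ η X + (Pᵀ η X - Xᵀ η P)` is a submersion;
its values that are symmetric are of the form `Xᵀ η X`. -/
lemma eventually_isLorentzMatrix {A : Fin n → Fin n → ℝ} (hA : IsLorentzMatrix A) :
    ∀ᶠ B in 𝓝 A, (∀ i j, B i j = B j i) → IsLorentzMatrix B := by
  obtain ⟨P₀, hP, hPA⟩ := hA
  obtain ⟨P, rfl⟩ : ∃ P : Fin n → Fin n → ℝ, Matrix.of P = P₀ := ⟨P₀, rfl⟩
  simp only [Matrix.of_apply] at hPA
  set f : (Fin n → Fin n → ℝ) → (Fin n → Fin n → ℝ) := fun X i j =>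
    ∑ a, eta a * (X a i * X a j + P a i * X a j - X a i * P a j) with hf
  have hent : ∀ a i, ContDiff ℝ ∞ (fun X : Fin n → Fin n → ℝ => X a i) := fun a i =>
    contDiff_pi.1 (contDiff_pi.1 contDiff_id a) i
  have hsm : ContDiff ℝ ∞ f := contDiff_pi.2 fun i => contDiff_pi.2 fun j =>
    ContDiff.sum fun a _ => contDiff_const.mul
      ((((hent a i).mul (hent a j)).add (contDiff_const.mul (hent a j))).sub
        ((hent a i).mul contDiff_const))
  have hstrict : HasStrictFDerivAt f (fderiv ℝ f P) P :=
    hsm.contDiffAt.hasStrictFDerivAt (by simp)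
  -- the derivative at `P` is `Z ↦ 2 Pᵀ η Z`
  have hline : ∀ Z : Fin n → Fin n → ℝ,
      fderiv ℝ f P Z = fun i j => ∑ a, 2 * (eta a * P a i * Z a j) := by
    intro Z
    have h1 : HasDerivAt (fun t : ℝ => f (P + t • Z)) (fderiv ℝ f P Z) 0 := by
      have hl : HasDerivAt (fun t : ℝ => P + t • Z) Z 0 := by
        simpa using ((hasDerivAt_id (0 : ℝ)).smul_const Z).const_add P
      have hf0 : HasFDerivAt f (fderiv ℝ f P) (P + (0 : ℝ) • Z) := by
        simpa using hstrict.hasFDerivAt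
      exact hf0.comp_hasDerivAt 0 hl
    refine h1.unique (hasDerivAt_pi.2 fun i => hasDerivAt_pi.2 fun j =>
      HasDerivAt.fun_sum fun a _ => ?_)
    have e : ∀ i, HasDerivAt (fun t : ℝ => P a i + t * Z a i) (Z a i) 0 := fun i => by
      simpa using ((hasDerivAt_id (0 : ℝ)).mul_const (Z a i)).const_add (P a i)
    have h2 := (((e i).mul (e j)).add ((e j).const_mul (P a i))).sub ((e i).mul_const (P a j))
    refine (h2.const_mul (eta a)).congr_deriv ?_
    simp
    ring
  have hsurj : ((fderiv ℝ f P : (Fin n → Fin n → ℝ) →L[ℝ] (Fin n → Fin n → ℝ))).range = ⊤ := by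
    refine LinearMap.range_eq_top.2 fun B => ?_
    refine ⟨fun a j => 1 / 2 * (eta a * ((Matrix.of P).transpose⁻¹ * Matrix.of B) a j), ?_⟩
    change fderiv ℝ f P _ = _
    rw [hline]
    funext i j
    have h3 : ∀ a, 2 * (eta a * P a i * (1 / 2 * (eta a * ((Matrix.of P).transpose⁻¹ * Matrix.of B) a j))) =
        (Matrix.of P).transpose i a * ((Matrix.of P).transpose⁻¹ * Matrix.of B) a j := fun a => by
      rw [Matrix.transpose_apply, Matrix.of_apply]
      linear_combination (P a i * ((Matrix.of P).transpose⁻¹ * Matrix.of B) a j) * eta_mul_self a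
    simp only [h3]
    rw [← Matrix.mul_apply, Matrix.mul_nonsing_inv_cancel_left _ _ (by rwa [Matrix.det_transpose])]
    rfl
  have hmap := hstrict.map_nhds_eq_of_surj hsurj
  have hfP : f P = A := by
    funext i j
    rw [hPA]
    exact Finset.sum_congr rfl fun a _ => by ring
  rw [← hfP, ← hmap, Filter.eventually_map]
  have hdet : ∀ᶠ X : Fin n → Fin n → ℝ in 𝓝 P, (Matrix.of X).det ≠ 0 := by
    have hc : Continuous fun X : Fin n → Fin n → ℝ => (Matrix.of X).det :=
      Continuous.matrix_det continuous_id
    exact hc.continuousAt.eventually_ne hP.ne_zero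
  filter_upwards [hdet] with X hX hs
  refine ⟨Matrix.of X, hX.isUnit, fun i j => ?_⟩
  have h4 := hs i j
  -- the symmetric part of `f X` is `Xᵀ η X`
  have h5 : f X i j + f X j i = 2 * ∑ a, eta a * X a i * X a j := by
    simp only [hf, ← Finset.sum_add_distrib, Finset.mul_sum]
    exact Finset.sum_congr rfl fun a _ => by ring
  simp only [Matrix.of_apply]
  linarith

end Lorentz

/-! ### Sections in charts -/

section Charts

variable {n : ℕ} {M : Type*} [TopologicalSpace M] [ChartedSpace (Model n) M]
  {e : OpenPartialHomeomorph M (Model n)}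

lemma mdifferentiable_of_mem_maximalAtlas (he : e ∈ IsManifold.maximalAtlas (𝓡 n) ∞ M) :
    e.MDifferentiable (𝓡 n) (𝓡 n) :=
  ⟨(contMDiffOn_of_mem_maximalAtlas he).mdifferentiableOn (by simp),
    (contMDiffOn_symm_of_mem_maximalAtlas he).mdifferentiableOn (by simp)⟩

lemma eq_sum_single (v : Model n) : v = ∑ a, v a • EuclideanSpace.single a (1 : ℝ) := by
  ext i
  simp [Finset.sum_apply, Pi.single_apply]

lemma bilin_eq_sum (B : Model n →L[ℝ] Model n →L[ℝ] ℝ) (v w : Model n) :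
    B v w = ∑ a, ∑ b, B (EuclideanSpace.single a 1) (EuclideanSpace.single b 1) * v a * w b := by
  conv_lhs => rw [eq_sum_single v, eq_sum_single w]
  simp only [map_sum, map_smul, _root_.sum_apply, _root_.smul_apply,
    smul_eq_mul, Finset.mul_sum]
  rw [Finset.sum_comm]
  exact Finset.sum_congr rfl fun a _ => Finset.sum_congr rfl fun b _ => by ring

/-- The derivative of a chart, with values in `ℝⁿ`. -/
def chartDeriv (e : OpenPartialHomeomorph M (Model n)) (y : M) :
    TangentSpace (𝓡 n) y →L[ℝ] Model n := mfderiv (𝓡 n) (𝓡 n) e y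

/-- A bilinear form in terms of its components in a chart. -/
lemma apply_eq_sum_metricComp (he : e ∈ IsManifold.maximalAtlas (𝓡 n) ∞ M)
    (g : ∀ y : M, TangentSpace (𝓡 n) y →L[ℝ] TangentSpace (𝓡 n) y →L[ℝ] ℝ) {y : M}
    (hy : y ∈ e.source) (v w : TangentSpace (𝓡 n) y) :
    g y v w = ∑ a, ∑ b, metricComp e g (e y) a b *
      chartDeriv e y v a * chartDeriv e y w b := by
  have hd := mdifferentiable_of_mem_maximalAtlas he
  have h1 := hd.symm_comp_deriv hy
  have h2 : ∀ v, (mfderiv (𝓡 n) (𝓡 n) e.symm (e y)) ((mfderiv (𝓡 n) (𝓡 n) e y) v) = v :=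
    fun v => DFunLike.congr_fun h1 v
  have key : ∀ z, z = y → ∀ (D : Model n →L[ℝ] Model n) (v w : Model n),
      (g y : Model n →L[ℝ] Model n →L[ℝ] ℝ) (D v) (D w) =
      ∑ a, ∑ b, (g z : Model n →L[ℝ] Model n →L[ℝ] ℝ) (D (EuclideanSpace.single a 1))
        (D (EuclideanSpace.single b 1)) * v a * w b := by
    rintro z rfl D v w
    exact bilin_eq_sum ((g z : Model n →L[ℝ] Model n →L[ℝ] ℝ).bilinearComp D D) v w
  have h3 := key (e.symm (e y)) (e.left_inv hy) (mfderiv (𝓡 n) (𝓡 n) e.symm (e y))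
    (mfderiv (𝓡 n) (𝓡 n) e y v) (mfderiv (𝓡 n) (𝓡 n) e y w)
  refine Eq.trans ?_ h3
  congr 1
  · congr 1
    exact (h2 v).symm
  · exact (h2 w).symm

/-- The part of a chart over which a section is defined. -/
def LocalGeometry.region (e : OpenPartialHomeomorph M (Model n)) {x : M}
    (h : LocalGeometry (n := n) x) : Set (Model n) := e.target ∩ e.symm ⁻¹' h.dom

variable {x : M} (h : LocalGeometry (n := n) x)

lemma LocalGeometry.isOpen_region : IsOpen (h.region e) :=
  e.isOpen_inter_preimage_symm h.isOpen_dom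

lemma LocalGeometry.mem_region (hx : x ∈ e.source) : e x ∈ h.region e :=
  ⟨e.map_source hx, by simpa [e.left_inv hx] using h.mem_dom⟩

lemma LocalGeometry.isLorentz (he : e ∈ IsManifold.maximalAtlas (𝓡 n) ∞ M) {u : Model n}
    (hu : u ∈ h.region e) : IsLorentzMatrix (metricComp e h.g u) := by
  obtain ⟨b, hb⟩ := h.lorentz (e.symm u) hu.2
  have hd := mdifferentiable_of_mem_maximalAtlas he
  have h1 := hd.comp_symm_deriv hu.1
  set D : Model n →L[ℝ] TangentSpace (𝓡 n) (e.symm u) := mfderiv (𝓡 n) (𝓡 n) e.symm u with hD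
  set D' : TangentSpace (𝓡 n) (e.symm u) →L[ℝ] Model n :=
    mfderiv (𝓡 n) (𝓡 n) e (e.symm u) with hD'
  set B := (EuclideanSpace.basisFun (Fin n) ℝ).toBasis with hB
  set P := LinearMap.toMatrix B b (D : Model n →ₗ[ℝ] TangentSpace (𝓡 n) (e.symm u)) with hP
  refine ⟨P, ?_, fun i j => ?_⟩
  · refine Matrix.isUnit_det_of_left_inverse
      (B := LinearMap.toMatrix b B (D' : TangentSpace (𝓡 n) (e.symm u) →ₗ[ℝ] Model n)) ?_
    rw [hP, ← LinearMap.toMatrix_comp, ← LinearMap.toMatrix_id (v₁ := B)]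
    congr 1
    ext1 v
    exact DFunLike.congr_fun h1 v
  · have h2 : ∀ i, D (EuclideanSpace.single i 1) = ∑ a, P a i • b a := by
      intro i
      rw [← b.sum_repr (D (EuclideanSpace.single i 1))]
      refine Finset.sum_congr rfl fun a _ => ?_
      simp [hP, LinearMap.toMatrix_apply, hB]
    change h.g (e.symm u) (D (EuclideanSpace.single i 1)) (D (EuclideanSpace.single j 1)) = _
    rw [h2, h2]
    simp only [map_sum, map_smul, _root_.sum_apply, _root_.smul_apply,
      smul_eq_mul, hb]
    refine Finset.sum_congr rfl fun a _ => ?_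
    simp
    ring

lemma LocalGeometry.metricOn (he : e ∈ IsManifold.maximalAtlas (𝓡 n) ∞ M) :
    MetricOn (h.region e) (metricComp e h.g) where
  isOpen := h.isOpen_region
  smooth μ ν := contDiffOn_pi.1 (contDiffOn_pi.1 (h.smooth_g e he) μ) ν
  symm _ hu := isLorentz_symm (h.isLorentz he hu)
  det_ne _ hu := det_ne_zero_of_isLorentz (h.isLorentz he hu)

lemma contDiffOn_comp_symm (he : e ∈ IsManifold.maximalAtlas (𝓡 n) ∞ M) {φ : M → ℝ} {s : Set M}
    (hφ : ContMDiffOn (𝓡 n) 𝓘(ℝ, ℝ) ∞ φ s) :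
    ContDiffOn ℝ ∞ (φ ∘ e.symm) (e.target ∩ e.symm ⁻¹' s) :=
  contMDiffOn_iff_contDiffOn.1 (hφ.comp ((contMDiffOn_symm_of_mem_maximalAtlas he).mono
    Set.inter_subset_left) fun _ hu => hu.2)

lemma LocalGeometry.contDiffOn_msq (he : e ∈ IsManifold.maximalAtlas (𝓡 n) ∞ M) :
    ContDiffOn ℝ ∞ (h.msq ∘ e.symm) (h.region e) := contDiffOn_comp_symm he h.smooth_msq

lemma LocalGeometry.contDiffOn_kappa (he : e ∈ IsManifold.maximalAtlas (𝓡 n) ∞ M) :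
    ContDiffOn ℝ ∞ (h.kappa ∘ e.symm) (h.region e) := contDiffOn_comp_symm he h.smooth_kappa

/-- The bilinear form on a tangent space with given components in a chart. -/
def formOfChart (e : OpenPartialHomeomorph M (Model n)) (G : Model n → Fin n → Fin n → ℝ) (y : M) :
    TangentSpace (𝓡 n) y →L[ℝ] TangentSpace (𝓡 n) y →L[ℝ] ℝ :=
  ∑ a, ∑ b, G (e y) a b •
    ((EuclideanSpace.proj (𝕜 := ℝ) a : Model n →L[ℝ] ℝ).comp (chartDeriv e y)).smulRight
      ((EuclideanSpace.proj (𝕜 := ℝ) b : Model n →L[ℝ] ℝ).comp (chartDeriv e y))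

lemma formOfChart_apply (G : Model n → Fin n → Fin n → ℝ) (y : M) (v w : TangentSpace (𝓡 n) y) :
    formOfChart e G y v w = ∑ a, ∑ b, G (e y) a b *
      chartDeriv e y v a * chartDeriv e y w b := by
  simp only [formOfChart, _root_.sum_apply]
  refine Finset.sum_congr rfl fun a _ => Finset.sum_congr rfl fun b _ => ?_
  rw [mul_assoc]
  rfl

lemma metricComp_formOfChart (he : e ∈ IsManifold.maximalAtlas (𝓡 n) ∞ M)
    (G : Model n → Fin n → Fin n → ℝ) {e' : OpenPartialHomeomorph M (Model n)}
    (he' : e' ∈ IsManifold.maximalAtlas (𝓡 n) ∞ M) {u : Model n} (hu : u ∈ e'.target)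
    (hu' : e'.symm u ∈ e.source) (μ ν : Fin n) :
    metricComp e' (formOfChart e G) u μ ν = ∑ a, ∑ b, G (e (e'.symm u)) a b *
      (fderiv ℝ (e ∘ e'.symm) u (EuclideanSpace.single μ 1)) a *
      (fderiv ℝ (e ∘ e'.symm) u (EuclideanSpace.single ν 1)) b := by
  have h1 : mfderiv (𝓡 n) (𝓡 n) (e ∘ e'.symm) u =
      (mfderiv (𝓡 n) (𝓡 n) e (e'.symm u)).comp (mfderiv (𝓡 n) (𝓡 n) e'.symm u) :=
    mfderiv_comp (I' := 𝓡 n) (M' := M) u ((mdifferentiable_of_mem_maximalAtlas he).mdifferentiableAt hu')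
      ((mdifferentiable_of_mem_maximalAtlas he').mdifferentiableAt_symm hu)
  have h2 : fderiv ℝ (e ∘ e'.symm) u = mfderiv (𝓡 n) (𝓡 n) (e ∘ e'.symm) u := by
    rw [mfderiv_eq_fderiv]
  rw [h2, h1]
  exact formOfChart_apply G _ _ _

lemma metricComp_formOfChart_self (he : e ∈ IsManifold.maximalAtlas (𝓡 n) ∞ M)
    (G : Model n → Fin n → Fin n → ℝ) {u : Model n} (hu : u ∈ e.target) :
    metricComp e (formOfChart e G) u = G u := by
  funext μ ν
  rw [metricComp_formOfChart he G he hu (e.map_target hu), e.right_inv hu]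
  have h1 : fderiv ℝ (e ∘ e.symm) u = ContinuousLinearMap.id ℝ (Model n) := by
    have : (e ∘ e.symm) =ᶠ[𝓝 u] id :=
      Filter.eventuallyEq_of_mem (e.open_target.mem_nhds hu) fun v hv => e.right_inv hv
    rw [this.fderiv_eq, fderiv_id]
  rw [h1]
  simp

/-- The section with given component functions on an open part of a chart. -/
def LocalGeometry.ofChart (he : e ∈ IsManifold.maximalAtlas (𝓡 n) ∞ M) (hx : x ∈ e.source)
    (G : Model n → Fin n → Fin n → ℝ) (m κ : Model n → ℝ) (Ω : Set (Model n)) (hΩ : IsOpen Ω)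
    (hxΩ : e x ∈ Ω) (hG : ∀ μ ν, ContDiffOn ℝ ∞ (fun u => G u μ ν) Ω)
    (hL : ∀ u ∈ Ω, IsLorentzMatrix (G u)) (hm : ContDiffOn ℝ ∞ m Ω) (hκ : ContDiffOn ℝ ∞ κ Ω) :
    LocalGeometry (n := n) x where
  dom := e.source ∩ e ⁻¹' Ω
  isOpen_dom := e.isOpen_inter_preimage hΩ
  mem_dom := ⟨hx, hxΩ⟩
  g := formOfChart e G
  msq := m ∘ e
  kappa := κ ∘ e
  lorentz := by
    intro y hy
    obtain ⟨P, hP, hPG⟩ := hL (e y) hy.2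
    have hd := mdifferentiable_of_mem_maximalAtlas he
    set B := (EuclideanSpace.basisFun (Fin n) ℝ).toBasis with hB
    have hP' : IsUnit (P⁻¹).det := by
      rw [Matrix.det_nonsing_inv]; exact hP.ringInverse
    set D : TangentSpace (𝓡 n) y ≃L[ℝ] Model n := hd.mfderiv hy.1 with hD
    refine ⟨(B.map (Matrix.toLinearEquiv B P⁻¹ hP')).map D.symm.toLinearEquiv, fun i j => ?_⟩
    have h1 : ∀ i a, chartDeriv e y
        (((B.map (Matrix.toLinearEquiv B P⁻¹ hP')).map D.symm.toLinearEquiv) i) a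
          = P⁻¹ a i := by
      intro i a
      have h2 : D (D.symm (Matrix.toLin B B P⁻¹ (B i))) = Matrix.toLin B B P⁻¹ (B i) :=
        D.apply_symm_apply _
      change (D (D.symm (Matrix.toLin B B P⁻¹ (B i)))) a = _
      rw [h2, Matrix.toLin_self]
      simp [hB, Pi.single_apply]
    rw [formOfChart_apply]
    simp only [h1, hPG, Finset.sum_mul]
    have h3 : ∀ c i, ∑ a, P c a * P⁻¹ a i = if c = i then 1 else 0 := by
      intro c i
      rw [← Matrix.mul_apply, Matrix.mul_nonsing_inv _ hP, Matrix.one_apply]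
    calc ∑ a, ∑ b, ∑ c, eta c * P c a * P c b * P⁻¹ a i * P⁻¹ b j
        = ∑ c, eta c * (∑ a, P c a * P⁻¹ a i) * ∑ b, P c b * P⁻¹ b j := by
          rw [Finset.sum_congr rfl fun a _ => Finset.sum_comm, Finset.sum_comm]
          refine Finset.sum_congr rfl fun c _ => ?_
          simp only [Finset.mul_sum, Finset.sum_mul]
          rw [Finset.sum_comm]
          exact Finset.sum_congr rfl fun a _ => Finset.sum_congr rfl fun b _ => by ring
      _ = _ := by
          simp only [h3]
          rcases eq_or_ne i j with rfl | hij
          · simp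
          · simp [hij, hij.symm]
  smooth_g := by
    intro e' he'
    have hτ : ContDiffOn ℝ ∞ (e ∘ e'.symm) (e'.target ∩ e'.symm ⁻¹' e.source) :=
      contMDiffOn_iff_contDiffOn.1 ((contMDiffOn_of_mem_maximalAtlas he).comp
        ((contMDiffOn_symm_of_mem_maximalAtlas he').mono Set.inter_subset_left) fun _ hu => hu.2)
    have hopen : IsOpen (e'.target ∩ e'.symm ⁻¹' e.source) :=
      e'.isOpen_inter_preimage_symm e.open_source
    have hsub : e'.target ∩ e'.symm ⁻¹' (e.source ∩ e ⁻¹' Ω) ⊆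
        e'.target ∩ e'.symm ⁻¹' e.source := fun u hu => ⟨hu.1, hu.2.1⟩
    refine contDiffOn_pi.2 fun μ => contDiffOn_pi.2 fun ν => ContDiffOn.congr ?_ fun u hu =>
      metricComp_formOfChart he G he' hu.1 hu.2.1 μ ν
    have hJ : ∀ (a μ : Fin n), ContDiffOn ℝ ∞ (fun u =>
        (fderiv ℝ (e ∘ e'.symm) u (EuclideanSpace.single μ 1)) a)
        (e'.target ∩ e'.symm ⁻¹' (e.source ∩ e ⁻¹' Ω)) := fun a μ =>
      ((EuclideanSpace.proj (𝕜 := ℝ) a : Model n →L[ℝ] ℝ).contDiff.comp_contDiffOn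
        ((hτ.fderiv_of_isOpen hopen (by simp)).clm_apply contDiffOn_const)).mono hsub
    exact ContDiffOn.sum fun a _ => ContDiffOn.sum fun b _ =>
      (((hG a b).comp (hτ.mono hsub) fun u hu => hu.2.2).mul (hJ a μ)).mul (hJ b ν)
  smooth_msq := (contMDiffOn_iff_contDiffOn.2 hm).comp
    ((contMDiffOn_of_mem_maximalAtlas he).mono Set.inter_subset_left) fun _ hy => hy.2
  smooth_kappa := (contMDiffOn_iff_contDiffOn.2 hκ).comp
    ((contMDiffOn_of_mem_maximalAtlas he).mono Set.inter_subset_left) fun _ hy => hy.2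

lemma jetCoord_mem_jetDomain (r : ℕ) (he : e ∈ IsManifold.maximalAtlas (𝓡 n) ∞ M)
    (hx : x ∈ e.source) : jetCoord r e h ∈ jetDomain r e.target :=
  jetOf_mem_jetDomain (h.metricOn he) (h.isLorentz he (h.mem_region hx)) (h.mem_region hx)
    (h.contDiffOn_msq he) (h.contDiffOn_kappa he) (e.map_source hx)

/-- `covOfJet` is the transition from the canonical to the covariant coordinates. -/
lemma covOfJet_jetCoord (r : ℕ) (he : e ∈ IsManifold.maximalAtlas (𝓡 n) ∞ M)
    (hx : x ∈ e.source) : covOfJet (jetCoord r e h) = covCoord r e h :=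
  covOfJet_jetOf (h.metricOn he) (h.isLorentz he (h.mem_region hx)) (h.mem_region hx)
    (h.contDiffOn_msq he) (h.contDiffOn_kappa he)

/-- The covariant coordinates at a point depend only on the component functions near the point. -/
lemma covOf_congr {Ω : Set (Model n)} {u : Model n} {G G' : Model n → Fin n → Fin n → ℝ}
    {m m' κ κ' : Model n → ℝ} (w r : ℕ) (hG : MetricOn Ω G) (hu : u ∈ Ω)
    (hm : ContDiffOn ℝ ∞ m Ω) (hκ : ContDiffOn ℝ ∞ κ Ω) (hGG : ∀ v ∈ Ω, G' v = G v)
    (hmm : ∀ v ∈ Ω, m' v = m v) (hκκ : ∀ v ∈ Ω, κ' v = κ v) :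
    covOf w r G' m' κ' u = covOf w r G m κ u := by
  have hΩ := hG.isOpen
  have hG' : MetricOn Ω G' := ⟨hΩ, fun μ ν => (hG.smooth μ ν).congr fun v hv => by rw [hGG v hv],
    fun v hv => by rw [hGG v hv]; exact hG.symm v hv, fun v hv => by
      rw [hGG v hv]; exact hG.det_ne v hv⟩
  exact covOf_eq_of_flat hG hG' hu w r
    (fun μ ν => (flat_zero hu hΩ _).congr hΩ hu fun v hv => by simp [hGG v hv]) hm
    (hm.congr hmm) hκ (hκ.congr hκκ)
    ((flat_zero hu hΩ _).congr hΩ hu fun v hv => by simp [hmm v hv])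
    ((flat_zero hu hΩ _).congr hΩ hu fun v hv => by simp [hκκ v hv])

lemma metricOn_of_isLorentz {G : Model n → Fin n → Fin n → ℝ} {Ω : Set (Model n)} (hΩ : IsOpen Ω)
    (hG : ∀ μ ν, ContDiffOn ℝ ∞ (fun u => G u μ ν) Ω) (hL : ∀ u ∈ Ω, IsLorentzMatrix (G u)) :
    MetricOn Ω G :=
  ⟨hΩ, hG, fun u hu => isLorentz_symm (hL u hu), fun u hu => det_ne_zero_of_isLorentz (hL u hu)⟩

section OfChart

variable (he : e ∈ IsManifold.maximalAtlas (𝓡 n) ∞ M) (hx : x ∈ e.source)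
    {G : Model n → Fin n → Fin n → ℝ} {m κ : Model n → ℝ} {Ω : Set (Model n)} (hΩ : IsOpen Ω)
    (hxΩ : e x ∈ Ω) (hG : ∀ μ ν, ContDiffOn ℝ ∞ (fun u => G u μ ν) Ω)
    (hL : ∀ u ∈ Ω, IsLorentzMatrix (G u)) (hm : ContDiffOn ℝ ∞ m Ω) (hκ : ContDiffOn ℝ ∞ κ Ω)
include he hx hΩ hxΩ hG hL hm hκ

/-- The coordinates of a section given in a chart. -/
lemma covOf_ofChart (w r : ℕ) :
    covOf w r (metricComp e (LocalGeometry.ofChart he hx G m κ Ω hΩ hxΩ hG hL hm hκ).g)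
      ((LocalGeometry.ofChart he hx G m κ Ω hΩ hxΩ hG hL hm hκ).msq ∘ e.symm)
      ((LocalGeometry.ofChart he hx G m κ Ω hΩ hxΩ hG hL hm hκ).kappa ∘ e.symm) (e x) =
    covOf w r G m κ (e x) := by
  have hΩ' := hΩ.inter e.open_target
  refine covOf_congr w r ((metricOn_of_isLorentz hΩ hG hL).mono hΩ'
    Set.inter_subset_left) ⟨hxΩ, e.map_source hx⟩ (hm.mono Set.inter_subset_left)
    (hκ.mono Set.inter_subset_left) (fun v hv => metricComp_formOfChart_self he G hv.2)
    (fun v hv => ?_) (fun v hv => ?_)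
  · exact congrArg m (e.right_inv hv.2)
  · exact congrArg κ (e.right_inv hv.2)

lemma jetCoord_ofChart (r : ℕ) :
    jetCoord r e (LocalGeometry.ofChart he hx G m κ Ω hΩ hxΩ hG hL hm hκ) =
      jetOf r G m κ (e x) := by
  have hΩ' := hΩ.inter e.open_target
  have hx' : e x ∈ Ω ∩ e.target := ⟨hxΩ, e.map_source hx⟩
  refine Prod.ext rfl (Prod.ext ?_ (Prod.ext ?_ ?_))
  · funext k l μ ν
    exact iterPd_congr hΩ' (fun v hv => congrFun (congrFun
      (metricComp_formOfChart_self he G hv.2) μ) ν) _ _ hx'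
  · funext k l
    exact iterPd_congr hΩ' (fun v hv => congrArg m (e.right_inv hv.2)) _ _ hx'
  · funext k l
    exact iterPd_congr hΩ' (fun v hv => congrArg κ (e.right_inv hv.2)) _ _ hx'

end OfChart

/-- Every element of the range of the jet coordinates is the jet of a section. -/
lemma exists_jetCoord_eq {r : ℕ} (he : e ∈ IsManifold.maximalAtlas (𝓡 n) ∞ M) {c : JetCoord n r}
    (hc : c ∈ jetDomain r e.target) :
    ∃ x ∈ e.source, ∃ h : LocalGeometry (n := n) x, jetCoord r e h = c := by
  have hx : e.symm c.1 ∈ e.source := e.map_target hc.1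
  have hex : e (e.symm c.1) = c.1 := e.right_inv hc.1
  have hL0 : IsLorentzMatrix (polyMetric c c.1) := by
    have : polyMetric c c.1 = c.2.1 0 Fin.elim0 := by
      funext μ ν; exact polyMetric_self c μ ν
    rw [this]; exact hc.2.1 _
  have hcont : ContinuousAt (polyMetric c) c.1 :=
    continuousAt_pi.2 fun μ => continuousAt_pi.2 fun ν =>
      (contDiff_polyMetric_apply c μ ν).continuous.continuousAt
  have hmet := metricOn_polyMetric hc
  -- the polynomial representative is Lorentzian near the base point, though not everywhere
  have hev : ∀ᶠ u in 𝓝 c.1, IsLorentzMatrix (polyMetric c u) := by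
    filter_upwards [hcont.eventually (eventually_isLorentzMatrix hL0),
      hmet.isOpen.mem_nhds (mem_polySet_self.2 (mem_jetSet hc))] with u hu hu'
    exact hu (hmet.symm u hu')
  obtain ⟨Ω, hΩs, hΩ, hxΩ⟩ := mem_nhds_iff.1 hev
  refine ⟨e.symm c.1, hx, LocalGeometry.ofChart he hx (polyMetric c) (polyScalar c.1 c.2.2.1)
    (polyScalar c.1 c.2.2.2) Ω hΩ (by rwa [hex])
    (fun μ ν => (contDiff_polyMetric_apply c μ ν).contDiffOn) (fun u hu => hΩs hu)
    (contDiff_polyScalar _ _).contDiffOn (contDiff_polyScalar _ _).contDiffOn, ?_⟩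
  rw [jetCoord_ofChart, hex]
  exact jetOf_poly hc

end Charts

/-! ### Transformation laws under local diffeomorphisms -/

section Jacobian

variable {n : ℕ}

/-- The Jacobian matrix `∂X^a / ∂u^μ`. -/
def jac (X : Model n → Model n) (a μ : Fin n) (u : Model n) : ℝ := pd μ (fun v => X v a) u

/-- A smooth map between open sets with invertible derivative. -/
structure LocalDiffeo (Ω' Ω : Set (Model n)) (X : Model n → Model n) : Prop where
  isOpen : IsOpen Ω'
  smooth : ContDiffOn ℝ ∞ X Ω'
  mapsTo : Set.MapsTo X Ω' Ω
  det_ne : ∀ u ∈ Ω', (Matrix.of fun a μ => jac X a μ u).det ≠ 0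

/-- The pulled back metric `(X^* G)_{μν} = ∂_μ X^a ∂_ν X^b G_{ab} ∘ X`. -/
def pullMetric (X : Model n → Model n) (G : Model n → Fin n → Fin n → ℝ) (u : Model n)
    (μ ν : Fin n) : ℝ := ∑ a, ∑ b, jac X a μ u * jac X b ν u * G (X u) a b

variable {Ω Ω' : Set (Model n)} {X : Model n → Model n} {G : Model n → Fin n → Fin n → ℝ}
  {u : Model n}

lemma LocalDiffeo.contDiffOn_coord (hX : LocalDiffeo Ω' Ω X) (a : Fin n) :
    ContDiffOn ℝ ∞ (fun v => X v a) Ω' :=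
  (EuclideanSpace.proj (𝕜 := ℝ) a : Model n →L[ℝ] ℝ).contDiff.comp_contDiffOn hX.smooth

lemma LocalDiffeo.contDiffOn_jac (hX : LocalDiffeo Ω' Ω X) (a μ : Fin n) :
    ContDiffOn ℝ ∞ (jac X a μ) Ω' := contDiffOn_pd hX.isOpen (hX.contDiffOn_coord a) μ

lemma LocalDiffeo.contDiffOn_comp (hX : LocalDiffeo Ω' Ω X) {f : Model n → ℝ}
    (hf : ContDiffOn ℝ ∞ f Ω) : ContDiffOn ℝ ∞ (fun v => f (X v)) Ω' :=
  hf.comp hX.smooth hX.mapsTo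

lemma LocalDiffeo.differentiableAt_jac (hX : LocalDiffeo Ω' Ω X) (hu : u ∈ Ω') (a μ : Fin n) :
    DifferentiableAt ℝ (jac X a μ) u :=
  differentiableAt_of_contDiffOn hX.isOpen (hX.contDiffOn_jac a μ) hu

lemma LocalDiffeo.differentiableAt_comp (hX : LocalDiffeo Ω' Ω X) (hu : u ∈ Ω') {f : Model n → ℝ}
    (hf : ContDiffOn ℝ ∞ f Ω) : DifferentiableAt ℝ (fun v => f (X v)) u :=
  differentiableAt_of_contDiffOn hX.isOpen (hX.contDiffOn_comp hf) hu

lemma LocalDiffeo.pd_comp (hX : LocalDiffeo Ω' Ω X) (hΩ : IsOpen Ω) (hu : u ∈ Ω')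
    {f : Model n → ℝ} (hf : ContDiffOn ℝ ∞ f Ω) (μ : Fin n) :
    pd μ (fun v => f (X v)) u = ∑ a, jac X a μ u * pd a f (X u) :=
  BackgroundJets.pd_comp (differentiableAt_of_contDiffOn hΩ hf (hX.mapsTo hu))
    (differentiableAt_of_contDiffOn hX.isOpen hX.smooth hu) μ

lemma LocalDiffeo.pd_jac_symm (hX : LocalDiffeo Ω' Ω X) (hu : u ∈ Ω') (a μ ν : Fin n) :
    pd μ (jac X a ν) u = pd ν (jac X a μ) u :=
  pd_comm ((hX.contDiffOn_coord a).contDiffAt (hX.isOpen.mem_nhds hu)) μ ν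

lemma MetricOn.pull (hX : LocalDiffeo Ω' Ω X) (hG : MetricOn Ω G) :
    MetricOn Ω' (pullMetric X G) where
  isOpen := hX.isOpen
  smooth μ ν := ContDiffOn.sum fun a _ => ContDiffOn.sum fun b _ =>
    ((hX.contDiffOn_jac a μ).mul (hX.contDiffOn_jac b ν)).mul
      (hX.contDiffOn_comp (hG.smooth a b))
  symm u hu μ ν := by
    unfold pullMetric
    rw [Finset.sum_comm]
    refine Finset.sum_congr rfl fun a _ => Finset.sum_congr rfl fun b _ => ?_
    rw [hG.symm _ (hX.mapsTo hu) b a]; ring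
  det_ne u hu := by
    have e : Matrix.of (pullMetric X G u) = (Matrix.of fun a μ => jac X a μ u).transpose *
        Matrix.of (G (X u)) * Matrix.of fun a μ => jac X a μ u := by
      ext μ ν
      simp only [Matrix.of_apply, pullMetric, Matrix.mul_apply, Matrix.transpose_apply,
        Finset.sum_mul]
      rw [Finset.sum_comm]
      exact Finset.sum_congr rfl fun a _ => Finset.sum_congr rfl fun b _ => by ring
    rw [e, Matrix.det_mul, Matrix.det_mul, Matrix.det_transpose]
    exact mul_ne_zero (mul_ne_zero (hX.det_ne u hu) (hG.det_ne _ (hX.mapsTo hu)))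
      (hX.det_ne u hu)

lemma isLorentz_pull (hX : LocalDiffeo Ω' Ω X) (hu : u ∈ Ω') (h : IsLorentzMatrix (G (X u))) :
    IsLorentzMatrix (pullMetric X G u) := by
  obtain ⟨P, hP, hPG⟩ := h
  refine ⟨P * Matrix.of fun a μ => jac X a μ u, ?_, fun i j => ?_⟩
  · rw [Matrix.det_mul]
    exact hP.mul (hX.det_ne u hu).isUnit
  · simp only [pullMetric, hPG, Matrix.mul_apply, Matrix.of_apply, Finset.mul_sum,
      Finset.sum_mul]
    rw [Finset.sum_congr rfl fun a _ => Finset.sum_comm, Finset.sum_comm]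
    refine Finset.sum_congr rfl fun c _ => ?_
    rw [Finset.sum_comm]
    exact Finset.sum_congr rfl fun a _ => Finset.sum_congr rfl fun b _ => by ring

variable (hX : LocalDiffeo Ω' Ω X) (hG : MetricOn Ω G) (hu : u ∈ Ω')
include hX hG hu

/-- The Christoffel symbols of the first kind of the pulled back metric. -/
lemma chrLow_pull (β μ ν : Fin n) :
    chrLow (pullMetric X G) β μ ν u = ∑ b, jac X b β u * (∑ τ, G (X u) b τ * pd μ (jac X τ ν) u
      + ∑ c, ∑ d, jac X c μ u * jac X d ν u * chrLow G b c d (X u)) := by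
  set J : Fin n → Fin n → ℝ := fun a μ => jac X a μ u with hJ
  set H : Fin n → Fin n → Fin n → ℝ := fun a μ ν => pd μ (jac X a ν) u with hH
  set S₁ : Fin n → Fin n → Fin n → ℝ := fun μ ν β => ∑ a, ∑ b, H a μ ν * J b β * G (X u) a b
    with hS₁
  set S₂ : Fin n → Fin n → Fin n → ℝ := fun μ ν β =>
    ∑ a, ∑ b, ∑ c, J c μ * J a ν * J b β * pd c (fun v => G v a b) (X u) with hS₂
  have hs1 : ∀ μ ν β, S₁ μ ν β = S₁ ν μ β := fun μ ν β => by
    simp only [hS₁, hH, hX.pd_jac_symm hu _ μ ν]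
  have hGs := hG.symm _ (hX.mapsTo hu)
  have hpd : ∀ μ ν β, pd μ (fun v => pullMetric X G v ν β) u = S₁ μ ν β + S₁ μ β ν + S₂ μ ν β := by
    intro μ ν β
    have d1 := fun a μ => hX.differentiableAt_jac hu a μ
    have d2 := fun a b => hX.differentiableAt_comp hu (hG.smooth a b)
    have d3 : ∀ a b, DifferentiableAt ℝ
        (fun v => jac X a ν v * jac X b β v * G (X v) a b) u := fun a b =>
      ((d1 a ν).mul (d1 b β)).mul (d2 a b)
    unfold pullMetric
    rw [pd_sum (f := fun a v => ∑ b, jac X a ν v * jac X b β v * G (X v) a b)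
      fun a _ => DifferentiableAt.fun_sum fun b _ => d3 a b]
    have e : S₁ μ β ν = ∑ a, ∑ b, J a ν * H b μ β * G (X u) a b := by
      simp only [hS₁]
      rw [Finset.sum_comm]
      refine Finset.sum_congr rfl fun a _ => Finset.sum_congr rfl fun b _ => ?_
      rw [hGs a b]; ring
    rw [e]
    simp only [hS₁, hS₂, ← Finset.sum_add_distrib]
    refine Finset.sum_congr rfl fun a _ => ?_
    rw [pd_sum (f := fun b v => jac X a ν v * jac X b β v * G (X v) a b) fun b _ => d3 a b]
    refine Finset.sum_congr rfl fun b _ => ?_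
    rw [pd_mul (f := fun v => jac X a ν v * jac X b β v) ((d1 a ν).mul (d1 b β)) (d2 a b),
      pd_mul (d1 a ν) (d1 b β), hX.pd_comp hG.isOpen hu (hG.smooth a b), Finset.mul_sum, add_mul]
    congr 1
    exact Finset.sum_congr rfl fun c _ => by simp only [hJ]; ring
  have e0 : ∑ b, J b β * ∑ τ, G (X u) b τ * H τ μ ν = S₁ μ ν β := by
    simp only [hS₁, Finset.mul_sum]
    rw [Finset.sum_comm]
    refine Finset.sum_congr rfl fun a _ => Finset.sum_congr rfl fun b _ => ?_
    rw [hGs a b]; ring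
  have e1 : S₂ μ ν β = ∑ b, ∑ c, ∑ d, J b β * J c μ * J d ν * pd c (fun v => G v d b) (X u) := by
    simp only [hS₂]
    rw [Finset.sum_comm]
    refine Finset.sum_congr rfl fun b _ => ?_
    rw [Finset.sum_comm]
    exact Finset.sum_congr rfl fun c _ => Finset.sum_congr rfl fun d _ => by ring
  have e2 : S₂ ν β μ = ∑ b, ∑ c, ∑ d, J b β * J c μ * J d ν * pd d (fun v => G v b c) (X u) :=
    Finset.sum_congr rfl fun b _ => Finset.sum_congr rfl fun c _ =>
      Finset.sum_congr rfl fun d _ => by ring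
  have e3 : S₂ β μ ν = ∑ b, ∑ c, ∑ d, J b β * J c μ * J d ν * pd b (fun v => G v c d) (X u) := by
    simp only [hS₂]
    rw [Finset.sum_congr rfl fun a _ => Finset.sum_comm, Finset.sum_comm]
  have e4 : ∑ b, J b β * ∑ c, ∑ d, J c μ * J d ν * chrLow G b c d (X u) =
      1 / 2 * (S₂ μ ν β + S₂ ν β μ - S₂ β μ ν) := by
    rw [e1, e2, e3]
    simp only [← Finset.sum_add_distrib, ← Finset.sum_sub_distrib, Finset.mul_sum, chrLow]
    exact Finset.sum_congr rfl fun b _ => Finset.sum_congr rfl fun c _ =>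
      Finset.sum_congr rfl fun d _ => by ring
  change _ = ∑ b, J b β * (∑ τ, G (X u) b τ * H τ μ ν
      + ∑ c, ∑ d, J c μ * J d ν * chrLow G b c d (X u))
  simp only [mul_add, Finset.sum_add_distrib]
  rw [e0, e4, chrLow, hpd, hpd, hpd, hs1 ν μ β, hs1 β ν μ, hs1 β μ ν]
  ring

omit hu in
/-- The transformation law of the Christoffel symbols. -/
lemma christoffel_pull (u : Model n) (hu : u ∈ Ω') (τ μ ν : Fin n) :
    ∑ α, jac X τ α u * christoffel (pullMetric X G) α μ ν u =
      pd μ (jac X τ ν) u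
        + ∑ c, ∑ d, jac X c μ u * jac X d ν u * christoffel G τ c d (X u) := by
  have hG' := hG.pull hX
  refine congrFun (eq_of_sum_mul_eq (hG.det_ne _ (hX.mapsTo hu)) (v := fun τ =>
    ∑ α, jac X τ α u * christoffel (pullMetric X G) α μ ν u) (w := fun τ => pd μ (jac X τ ν) u
        + ∑ c, ∑ d, jac X c μ u * jac X d ν u * christoffel G τ c d (X u)) fun b => ?_) τ
  refine congrFun (eq_of_sum_mul_eq (g := fun β c => jac X c β u) ?_ (v := fun b => ∑ τ,
    G (X u) b τ * ∑ α, jac X τ α u * christoffel (pullMetric X G) α μ ν u)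
    (w := fun b => ∑ τ, G (X u) b τ * (pd μ (jac X τ ν) u
        + ∑ c, ∑ d, jac X c μ u * jac X d ν u * christoffel G τ c d (X u))) fun β => ?_) b
  · have := hX.det_ne u hu
    rwa [← Matrix.det_transpose] at this
  · have e1 : ∑ b, jac X b β u * ∑ τ, G (X u) b τ *
        ∑ α, jac X τ α u * christoffel (pullMetric X G) α μ ν u =
        chrLow (pullMetric X G) β μ ν u := by
      rw [← hG'.sum_mul_christoffel hu]
      simp only [pullMetric, Finset.mul_sum, Finset.sum_mul]
      rw [Finset.sum_congr rfl fun a _ => Finset.sum_comm, Finset.sum_comm]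
      exact Finset.sum_congr rfl fun b _ => Finset.sum_congr rfl fun c _ =>
        Finset.sum_congr rfl fun d _ => by ring
    rw [e1, chrLow_pull hX hG hu]
    refine Finset.sum_congr rfl fun b _ => ?_
    congr 1
    simp only [mul_add, Finset.sum_add_distrib, ← hG.sum_mul_christoffel (hX.mapsTo hu),
      Finset.mul_sum]
    congr 1
    rw [Finset.sum_congr rfl fun a _ => Finset.sum_comm, Finset.sum_comm]
    exact Finset.sum_congr rfl fun c _ => Finset.sum_congr rfl fun d _ =>
      Finset.sum_congr rfl fun e _ => by ring

/-- The transformation law of the Riemann tensor: if `J Γ'_μ = ∂_μ J + A_μ J` with `A = X^* Γ`,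
then the curvatures of `Γ'` and `A` are conjugate by `J`. -/
lemma riemann_pull (τ β μ ν : Fin n) :
    ∑ α, jac X τ α u * riemann (pullMetric X G) α β μ ν u =
      ∑ b, ∑ c, ∑ d, jac X b β u * jac X c μ u * jac X d ν u * riemann G τ b c d (X u) := by
  have hΩ := hG.isOpen
  have hG' := hG.pull hX
  have dJ := fun a μ => hX.differentiableAt_jac hu a μ
  have dΓ' := fun a b c => differentiableAt_of_contDiffOn hX.isOpen (hG'.christoffel a b c) hu
  have dΓ := fun a b c => hX.differentiableAt_comp hu (hG.christoffel a b c)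
  set A : Fin n → Fin n → Fin n → Model n → ℝ := fun μ τ b v =>
    ∑ c, jac X c μ v * christoffel G τ b c (X v) with hA
  have dA : ∀ μ τ b, DifferentiableAt ℝ (A μ τ b) u := fun μ τ b =>
    DifferentiableAt.fun_sum fun c _ => (dJ c μ).mul (dΓ τ b c)
  have law : ∀ v ∈ Ω', ∀ τ β μ, ∑ α, jac X τ α v * christoffel (pullMetric X G) α β μ v =
      pd μ (jac X τ β) v + ∑ b, A μ τ b v * jac X b β v := by
    intro v hv τ β μ
    rw [christoffel_pull hX hG v hv, hX.pd_jac_symm hv]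
    congr 1
    simp only [hA, Finset.sum_mul]
    exact Finset.sum_congr rfl fun b _ => Finset.sum_congr rfl fun c _ => by ring
  -- the matrices of the argument
  set J : Matrix (Fin n) (Fin n) ℝ := Matrix.of fun a μ => jac X a μ u with hJ
  set Γ' : Fin n → Matrix (Fin n) (Fin n) ℝ := fun μ =>
    Matrix.of fun α β => christoffel (pullMetric X G) α β μ u with hΓ'
  set dΓm : Fin n → Fin n → Matrix (Fin n) (Fin n) ℝ := fun μ ν =>
    Matrix.of fun α β => pd μ (christoffel (pullMetric X G) α β ν) u with hdΓm
  set Am : Fin n → Matrix (Fin n) (Fin n) ℝ := fun μ => Matrix.of fun τ b => A μ τ b u with hAm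
  set dAm : Fin n → Fin n → Matrix (Fin n) (Fin n) ℝ := fun μ ν =>
    Matrix.of fun τ b => pd μ (A ν τ b) u with hdAm
  set dJm : Fin n → Matrix (Fin n) (Fin n) ℝ := fun μ =>
    Matrix.of fun τ β => pd μ (jac X τ β) u with hdJm
  set ddJm : Fin n → Fin n → Matrix (Fin n) (Fin n) ℝ := fun μ ν =>
    Matrix.of fun τ β => pd μ (pd ν (jac X τ β)) u with hddJm
  have h1 : ∀ μ, J * Γ' μ = dJm μ + Am μ * J := by
    intro μ
    ext τ β
    exact law u hu τ β μ
  have h2 : ∀ μ ν, dJm μ * Γ' ν + J * dΓm μ ν = ddJm μ ν + (dAm μ ν * J + Am ν * dJm μ) := by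
    intro μ ν
    ext τ β
    have h := eqOn_pd hX.isOpen (fun v hv => law v hv τ β ν) μ hu
    rw [pd_sum (f := fun α v => jac X τ α v * christoffel (pullMetric X G) α β ν v)
      (fun α _ => (dJ τ α).mul (dΓ' α β ν)), pd_add (f := pd ν (jac X τ β))
      (g := fun v => ∑ b, A ν τ b v * jac X b β v)
      (differentiableAt_of_contDiffOn hX.isOpen (contDiffOn_pd hX.isOpen
        (hX.contDiffOn_jac τ β) ν) hu)
      (DifferentiableAt.fun_sum fun b _ => (dA ν τ b).mul (dJ b β)),
      pd_sum (f := fun b v => A ν τ b v * jac X b β v)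
        (fun b _ => (dA ν τ b).mul (dJ b β))] at h
    simp only [pd_mul (dJ _ _) (dΓ' _ _ _), pd_mul (dA _ _ _) (dJ _ _),
      Finset.sum_add_distrib] at h
    simp only [Matrix.add_apply, Matrix.mul_apply]
    exact h
  have h3 : ddJm μ ν = ddJm ν μ := by
    ext τ β
    exact pd_comm ((hX.contDiffOn_jac τ β).contDiffAt (hX.isOpen.mem_nhds hu)) μ ν
  have h4 : J * (dΓm μ ν + Γ' μ * Γ' ν - dΓm ν μ - Γ' ν * Γ' μ) =
      (dAm μ ν + Am μ * Am ν - dAm ν μ - Am ν * Am μ) * J := by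
    linear_combination (norm := (simp only [h3]; noncomm_ring)) h2 μ ν - h2 ν μ + h1 μ * Γ' ν
      - h1 ν * Γ' μ + Am μ * h1 ν - Am ν * h1 μ
  have h5 : ∀ τ b, (dAm μ ν + Am μ * Am ν - dAm ν μ - Am ν * Am μ) τ b =
      ∑ c, ∑ d, jac X c μ u * jac X d ν u * riemann G τ b c d (X u) := by
    intro τ b
    have e1 : ∀ μ ν, pd μ (A ν τ b) u = ∑ d, pd μ (jac X d ν) u * christoffel G τ b d (X u)
        + ∑ c, ∑ d, jac X c μ u * jac X d ν u * pd c (christoffel G τ b d) (X u) := by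
      intro μ ν
      simp only [hA]
      rw [pd_sum (f := fun c v => jac X c ν v * christoffel G τ b c (X v))
        (fun c _ => (dJ c ν).mul (dΓ τ b c))]
      rw [Finset.sum_comm (γ := Fin n), ← Finset.sum_add_distrib]
      refine Finset.sum_congr rfl fun d _ => ?_
      rw [pd_mul (dJ d ν) (dΓ τ b d), hX.pd_comp hΩ hu (hG.christoffel τ b d), Finset.mul_sum]
      congr 1
      exact Finset.sum_congr rfl fun c _ => by ring
    have e2 : ∀ μ ν, (Am μ * Am ν) τ b = ∑ c, ∑ d, jac X c μ u * jac X d ν u *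
        ∑ σ, christoffel G τ σ c (X u) * christoffel G σ b d (X u) := by
      intro μ ν
      simp only [Matrix.mul_apply, hAm, hA, Matrix.of_apply, Finset.sum_mul, Finset.mul_sum]
      rw [Finset.sum_congr rfl fun a _ => Finset.sum_comm, Finset.sum_comm,
        Finset.sum_congr rfl fun a _ => Finset.sum_comm]
      exact Finset.sum_congr rfl fun c _ => Finset.sum_congr rfl fun d _ =>
        Finset.sum_congr rfl fun e _ => by ring
    have e3 : ∀ F : Fin n → Fin n → ℝ, ∑ c, ∑ d, jac X c ν u * jac X d μ u * F c d =
        ∑ c, ∑ d, jac X c μ u * jac X d ν u * F d c := by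
      intro F
      rw [Finset.sum_comm]
      exact Finset.sum_congr rfl fun c _ => Finset.sum_congr rfl fun d _ => by ring
    have e4 : ∑ d, pd μ (jac X d ν) u * christoffel G τ b d (X u) =
        ∑ d, pd ν (jac X d μ) u * christoffel G τ b d (X u) :=
      Finset.sum_congr rfl fun d _ => by rw [hX.pd_jac_symm hu]
    change pd μ (A ν τ b) u + (Am μ * Am ν) τ b - pd ν (A μ τ b) u - (Am ν * Am μ) τ b = _
    rw [e1, e1, e2, e2, e3, e3, e4]
    simp only [riemann, mul_add, mul_sub, Finset.sum_add_distrib, Finset.sum_sub_distrib]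
    ring
  have h6 := congrFun (congrFun h4 τ) β
  rw [Matrix.mul_apply, Matrix.mul_apply] at h6
  have h7 : ∀ α, (dΓm μ ν + Γ' μ * Γ' ν - dΓm ν μ - Γ' ν * Γ' μ) α β =
      riemann (pullMetric X G) α β μ ν u := fun α => rfl
  simp only [h5, h7] at h6
  refine h6.trans (Finset.sum_congr rfl fun b _ => ?_)
  rw [Finset.sum_mul]
  refine Finset.sum_congr rfl fun c _ => ?_
  rw [Finset.sum_mul]
  exact Finset.sum_congr rfl fun d _ => by simp only [hJ, Matrix.of_apply]; ring

end Jacobian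

/-! ### Tensoriality of covariant derivatives -/

section Tensoriality

variable {n : ℕ}

lemma pd_prod {k : ℕ} {f : Fin k → Model n → ℝ} {u : Model n}
    (hf : ∀ s, DifferentiableAt ℝ (f s) u) (μ : Fin n) :
    pd μ (fun v => ∏ s, f s v) u = ∑ s, (∏ s' ∈ Finset.univ.erase s, f s' u) * pd μ (f s) u := by
  unfold pd
  rw [(HasFDerivAt.finsetProd fun s _ => (hf s).hasFDerivAt).fderiv]
  simp

/-- Exchange of a summation variable with the entry of a multi-index. -/
lemma sum_update_swap {k : ℕ} (s : Fin k) (f : (Fin k → Fin n) → Fin n → ℝ) :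
    ∑ p, ∑ d, f p d = ∑ p, ∑ d, f (Function.update p s d) (p s) := by
  rw [← Fintype.sum_prod_type', ← Fintype.sum_prod_type'
    (f := fun p d => f (Function.update p s d) (p s))]
  have hinv : Function.Involutive (fun q : (Fin k → Fin n) × Fin n =>
      (Function.update q.1 s q.2, q.1 s)) := fun q => by simp
  exact (Fintype.sum_equiv hinv.toPerm _ _ fun q => rfl).symm

lemma prod_update_erase {k : ℕ} (J : Fin n → Fin n → ℝ) (s : Fin k) (p l : Fin k → Fin n)
    (d : Fin n) : ∏ s' ∈ Finset.univ.erase s, J (Function.update p s d s') (l s') =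
      ∏ s' ∈ Finset.univ.erase s, J (p s') (l s') :=
  Finset.prod_congr rfl fun s' hs' => by rw [Function.update_of_ne (Finset.ne_of_mem_erase hs')]

lemma prod_update_erase' {k : ℕ} (J : Fin n → Fin n → ℝ) (s : Fin k) (p l : Fin k → Fin n)
    (d : Fin n) : ∏ s', J (p s') (Function.update l s d s') =
      J (p s) d * ∏ s' ∈ Finset.univ.erase s, J (p s') (l s') := by
  rw [← Finset.mul_prod_erase Finset.univ _ (Finset.mem_univ s), Function.update_self]
  congr 1
  exact Finset.prod_congr rfl fun s' hs' => by
    rw [Function.update_of_ne (Finset.ne_of_mem_erase hs')]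

variable {Ω Ω' : Set (Model n)} {X : Model n → Model n} {G : Model n → Fin n → Fin n → ℝ}
  {u : Model n}

/-- The covariant derivative of a tensor with `k` lower slots and values in a vector bundle with
connection coefficients `θ^i_{μ j}`. -/
def covD {ι : Type*} [Fintype ι] {k : ℕ} (G : Model n → Fin n → Fin n → ℝ)
    (θ : ι → Fin n → ι → Model n → ℝ) (T : ι → (Fin k → Fin n) → Model n → ℝ) (i : ι)
    (l : Fin (k + 1) → Fin n) (u : Model n) : ℝ :=
  pd (l 0) (T i (Fin.tail l)) u + ∑ j, θ i (l 0) j u * T j (Fin.tail l) u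
    - ∑ s, ∑ τ, christoffel G τ (l 0) (Fin.tail l s) u * T i (Function.update (Fin.tail l) s τ) u

/-- Covariant differentiation preserves the tensor transformation law. The matrix `K` compares the
values of the two tensors; for the curvature it is the Jacobian matrix, acting on the upper index, and
for scalars it is trivial. The hypothesis `hθ` says that it intertwines the connections. -/
lemma covD_pull (hX : LocalDiffeo Ω' Ω X) (hG : MetricOn Ω G) {ι : Type*} [Fintype ι] {k : ℕ}
    {θ θ' : ι → Fin n → ι → Model n → ℝ} {T T' : ι → (Fin k → Fin n) → Model n → ℝ}
    {K : ι → ι → Model n → ℝ} (hT : ∀ i l, ContDiffOn ℝ ∞ (T i l) Ω)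
    (hT' : ∀ i l, ContDiffOn ℝ ∞ (T' i l) Ω') (hK : ∀ i j, ContDiffOn ℝ ∞ (K i j) Ω')
    (hθ : ∀ u ∈ Ω', ∀ i μ j, ∑ i', K i i' u * θ' i' μ j u =
      pd μ (K i j) u + ∑ c, ∑ j', jac X c μ u * θ i c j' (X u) * K j' j u)
    (h : ∀ u ∈ Ω', ∀ i l, ∑ i', K i i' u * T' i' l u =
      ∑ p : Fin k → Fin n, (∏ s, jac X (p s) (l s) u) * T i p (X u))
    (hu : u ∈ Ω') (i : ι) (l : Fin (k + 1) → Fin n) :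
    ∑ i', K i i' u * covD (pullMetric X G) θ' T' i' l u =
      ∑ p : Fin (k + 1) → Fin n, (∏ s, jac X (p s) (l s) u) * covD G θ T i p (X u) := by
  have dJ := fun a μ => hX.differentiableAt_jac hu a μ
  have dT := fun i l => hX.differentiableAt_comp hu (hT i l)
  have dT' := fun i l => differentiableAt_of_contDiffOn hX.isOpen (hT' i l) hu
  have dK := fun i j => differentiableAt_of_contDiffOn hX.isOpen (hK i j) hu
  set μ := l 0 with hμ
  set m := Fin.tail l with hm
  set E : Fin k → (Fin k → Fin n) → ℝ := fun s p =>
    ∏ s' ∈ Finset.univ.erase s, jac X (p s') (m s') u with hE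
  set Pr : (Fin k → Fin n) → ℝ := fun p => ∏ s, jac X (p s) (m s) u with hPr
  have dPr : ∀ p : Fin k → Fin n,
      DifferentiableAt ℝ (fun v => ∏ s, jac X (p s) (m s) v) u := fun p =>
    (HasFDerivAt.finsetProd fun s _ => (dJ (p s) (m s)).hasFDerivAt).differentiableAt
  -- the derivative of the transformation law of `T`
  have h1 : ∑ i', pd μ (K i i') u * T' i' m u + ∑ i', K i i' u * pd μ (T' i' m) u =
      ∑ p, (∑ s, E s p * pd μ (jac X (p s) (m s)) u) * T i p (X u)
        + ∑ p, Pr p * ∑ c, jac X c μ u * pd c (T i p) (X u) := by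
    have e := eqOn_pd hX.isOpen (fun v hv => h v hv i m) μ hu
    rw [pd_sum (f := fun i' v => K i i' v * T' i' m v) (fun i' _ => (dK i i').mul (dT' i' m)),
      pd_sum (f := fun p v => (∏ s, jac X (p s) (m s) v) * T i p (X v))
        (fun p _ => (dPr p).mul (dT i p))] at e
    rw [← Finset.sum_add_distrib, ← Finset.sum_add_distrib]
    refine Eq.trans (Finset.sum_congr rfl fun i' _ => (pd_mul (dK i i') (dT' i' m) μ).symm)
      (e.trans (Finset.sum_congr rfl fun p _ => ?_))
    rw [pd_mul (dPr p) (dT i p), pd_prod (fun s => dJ (p s) (m s)),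
      hX.pd_comp hG.isOpen hu (hT i p)]
  -- the connection terms of the values
  have h2 : ∑ i', K i i' u * ∑ j, θ' i' μ j u * T' j m u = ∑ j, pd μ (K i j) u * T' j m u
      + ∑ p, Pr p * ∑ c, jac X c μ u * ∑ j, θ i c j (X u) * T j p (X u) := by
    have e1 : ∑ i', K i i' u * ∑ j, θ' i' μ j u * T' j m u =
        ∑ j, (∑ i', K i i' u * θ' i' μ j u) * T' j m u := by
      simp only [Finset.mul_sum, Finset.sum_mul]
      rw [Finset.sum_comm]
      exact Finset.sum_congr rfl fun _ _ => Finset.sum_congr rfl fun _ _ => by ring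
    rw [e1]
    simp only [hθ u hu, add_mul, Finset.sum_add_distrib]
    congr 1
    have e2 : ∑ j, (∑ c, ∑ j', jac X c μ u * θ i c j' (X u) * K j' j u) * T' j m u =
        ∑ c, ∑ j', jac X c μ u * θ i c j' (X u) * ∑ j, K j' j u * T' j m u := by
      simp only [Finset.mul_sum, Finset.sum_mul]
      rw [Finset.sum_comm]
      refine Finset.sum_congr rfl fun c _ => ?_
      rw [Finset.sum_comm]
      exact Finset.sum_congr rfl fun _ _ => Finset.sum_congr rfl fun _ _ => by ring
    rw [e2]
    simp only [h u hu, Finset.mul_sum]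
    rw [Finset.sum_congr rfl fun c _ => Finset.sum_comm, Finset.sum_comm]
    exact Finset.sum_congr rfl fun p _ => Finset.sum_congr rfl fun c _ =>
      Finset.sum_congr rfl fun j _ => by simp only [hPr]; ring
  -- the connection terms of the slots: the second derivatives of `X` cancel against those in `h1`
  have h3 : ∑ i', K i i' u * ∑ s, ∑ τ, christoffel (pullMetric X G) τ μ (m s) u *
        T' i' (Function.update m s τ) u =
      ∑ p, (∑ s, E s p * pd μ (jac X (p s) (m s)) u) * T i p (X u)
        + ∑ p, Pr p * ∑ c, jac X c μ u * ∑ s, ∑ τ, christoffel G τ c (p s) (X u) *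
          T i (Function.update p s τ) (X u) := by
    have e1 : ∑ i', K i i' u * ∑ s, ∑ τ, christoffel (pullMetric X G) τ μ (m s) u *
        T' i' (Function.update m s τ) u = ∑ s, ∑ τ, christoffel (pullMetric X G) τ μ (m s) u *
          ∑ i', K i i' u * T' i' (Function.update m s τ) u := by
      simp only [Finset.mul_sum]
      rw [Finset.sum_comm]
      refine Finset.sum_congr rfl fun s _ => ?_
      rw [Finset.sum_comm]
      exact Finset.sum_congr rfl fun _ _ => Finset.sum_congr rfl fun _ _ => by ring
    have e2 : ∀ s : Fin k, ∑ τ, christoffel (pullMetric X G) τ μ (m s) u *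
        ∑ i', K i i' u * T' i' (Function.update m s τ) u =
        ∑ p, E s p * (pd μ (jac X (p s) (m s)) u + ∑ c, ∑ d, jac X c μ u * jac X d (m s) u *
          christoffel G (p s) c d (X u)) * T i p (X u) := by
      intro s
      simp only [h u hu, ← christoffel_pull hX hG u hu]
      simp only [prod_update_erase' (fun a b => jac X a b u), Finset.mul_sum, Finset.sum_mul]
      rw [Finset.sum_comm]
      exact Finset.sum_congr rfl fun _ _ => Finset.sum_congr rfl fun _ _ => by
        simp only [hE]; ring
    have e3 : ∀ (s : Fin k) (c : Fin n), ∑ p, ∑ d, E s p * jac X d (m s) u *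
        christoffel G (p s) c d (X u) * T i p (X u) =
        ∑ p, ∑ τ, Pr p * (christoffel G τ c (p s) (X u) * T i (Function.update p s τ) (X u)) := by
      intro s c
      rw [sum_update_swap s]
      refine Finset.sum_congr rfl fun p _ => Finset.sum_congr rfl fun τ _ => ?_
      simp only [hE, hPr, prod_update_erase (fun a b => jac X a b u), Function.update_self]
      rw [← Finset.mul_prod_erase Finset.univ (fun s => jac X (p s) (m s) u) (Finset.mem_univ s)]
      ring
    rw [e1, Finset.sum_congr rfl fun s _ => e2 s]
    have e4 : ∑ p, Pr p * ∑ c, jac X c μ u * ∑ s, ∑ τ, christoffel G τ c (p s) (X u) *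
          T i (Function.update p s τ) (X u) =
        ∑ s, ∑ c, jac X c μ u * ∑ p, ∑ τ, Pr p * (christoffel G τ c (p s) (X u) *
          T i (Function.update p s τ) (X u)) := by
      simp only [Finset.mul_sum]
      rw [Finset.sum_congr rfl fun p _ => Finset.sum_comm, Finset.sum_comm,
        Finset.sum_congr rfl fun p _ => Finset.sum_comm]
      exact Finset.sum_congr rfl fun s _ => Finset.sum_congr rfl fun c _ =>
        Finset.sum_congr rfl fun p _ => Finset.sum_congr rfl fun d _ => by ring
    rw [e4]
    simp only [← e3, mul_add, add_mul, Finset.sum_add_distrib, Finset.sum_mul, Finset.mul_sum]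
    congr 1
    · rw [Finset.sum_comm]
    · refine Finset.sum_congr rfl fun s _ => ?_
      rw [Finset.sum_comm]
      exact Finset.sum_congr rfl fun c _ => Finset.sum_congr rfl fun p _ =>
        Finset.sum_congr rfl fun d _ => by ring
  -- the right-hand side, with the first slot split off
  have h4 : ∑ p : Fin (k + 1) → Fin n, (∏ s, jac X (p s) (l s) u) * covD G θ T i p (X u) =
      ∑ p, Pr p * ∑ c, jac X c μ u * (pd c (T i p) (X u) + ∑ j, θ i c j (X u) * T j p (X u)
        - ∑ s, ∑ τ, christoffel G τ c (p s) (X u) * T i (Function.update p s τ) (X u)) := by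
    rw [sum_cons, Finset.sum_comm]
    refine Finset.sum_congr rfl fun p _ => ?_
    rw [Finset.mul_sum]
    refine Finset.sum_congr rfl fun c _ => ?_
    rw [Fin.prod_univ_succ]
    simp only [covD, Fin.cons_zero, Fin.cons_succ, Fin.tail_cons]
    simp only [hPr, hm, hμ, Fin.tail]
    ring
  rw [h4]
  simp only [covD, mul_add, mul_sub, Finset.sum_add_distrib, Finset.sum_sub_distrib]
  rw [h2, h3]
  linarith [h1]

lemma nablaRiemann_pull (hX : LocalDiffeo Ω' Ω X) (hG : MetricOn Ω G) (k : ℕ) (hu : u ∈ Ω')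
    (τ : Fin n) (l : Fin (k + 3) → Fin n) :
    ∑ α, jac X τ α u * nablaRiemann (pullMetric X G) k α l u =
      ∑ p : Fin (k + 3) → Fin n, (∏ s, jac X (p s) (l s) u) * nablaRiemann G k τ p (X u) := by
  induction k generalizing u τ with
  | zero =>
    change ∑ α, jac X τ α u * riemann (pullMetric X G) α (l 0) (l 1) (l 2) u = _
    rw [riemann_pull hX hG hu, sum_cons]
    refine Finset.sum_congr rfl fun b _ => ?_
    rw [sum_cons]
    refine Finset.sum_congr rfl fun c _ => ?_
    rw [sum_cons]
    refine Finset.sum_congr rfl fun d _ => ?_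
    rw [Fintype.sum_unique, Fin.prod_univ_three]
    rfl
  | succ k ih =>
    refine covD_pull (θ := fun i μ j => christoffel G i μ j)
      (θ' := fun i μ j => christoffel (pullMetric X G) i μ j) (K := fun a b => jac X a b)
      (T := nablaRiemann G k) (T' := nablaRiemann (pullMetric X G) k) hX hG
      (hG.nablaRiemann k) ((hG.pull hX).nablaRiemann k) hX.contDiffOn_jac (fun u hu τ μ ν => ?_)
      (fun u hu τ l => ih hu τ l) hu τ l
    rw [christoffel_pull hX hG u hu]
    congr 1
    exact Finset.sum_congr rfl fun c _ => Finset.sum_congr rfl fun d _ => by ring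

lemma nablaScalar_pull (hX : LocalDiffeo Ω' Ω X) (hG : MetricOn Ω G) {φ : Model n → ℝ}
    (hφ : ContDiffOn ℝ ∞ φ Ω) (k : ℕ) (hu : u ∈ Ω') (l : Fin k → Fin n) :
    nablaScalar (pullMetric X G) (fun v => φ (X v)) k l u =
      ∑ p : Fin k → Fin n, (∏ s, jac X (p s) (l s) u) * nablaScalar G φ k p (X u) := by
  induction k generalizing u with
  | zero => simp [nablaScalar]
  | succ k ih =>
    have h := covD_pull (ι := Unit) (θ := fun _ _ _ _ => 0) (θ' := fun _ _ _ _ => 0)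
      (K := fun _ _ _ => 1) (T := fun _ => nablaScalar G φ k)
      (T' := fun _ => nablaScalar (pullMetric X G) (fun v => φ (X v)) k) hX hG
      (fun _ l => hG.nablaScalar hφ k l)
      (fun _ l => (hG.pull hX).nablaScalar (hX.contDiffOn_comp hφ) k l)
      (fun _ _ => contDiffOn_const) (fun u hu _ μ _ => by simp [pd_const])
      (fun u hu _ l => by simpa using ih hu l) hu () l
    simpa [covD, nablaScalar] using h

/-- Symmetrization commutes with the transformation law. -/
lemma sum_prod_mul_symFirst {k m : ℕ} (J : Fin n → Fin n → ℝ) (T : (Fin k → Fin n) → ℝ)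
    (l : Fin k → Fin n) :
    symFirst m (fun l => ∑ p : Fin k → Fin n, (∏ s, J (p s) (l s)) * T p) l =
      ∑ p : Fin k → Fin n, (∏ s, J (p s) (l s)) * symFirst m T p := by
  simp only [symFirst, mul_div_assoc', Finset.mul_sum, ← Finset.sum_div]
  congr 1
  rw [Finset.sum_comm (s := Finset.univ)]
  refine Finset.sum_congr rfl fun σ _ => ?_
  refine Fintype.sum_equiv (Equiv.arrowCongr σ (Equiv.refl _)) _ _ fun p => ?_
  have e : (Equiv.arrowCongr σ (Equiv.refl (Fin n))) p = p ∘ σ.symm := rfl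
  rw [e]
  have e1 : (p ∘ σ.symm) ∘ σ = p := by funext i; simp
  rw [e1]
  congr 1
  refine Fintype.prod_equiv σ _ _ fun s => ?_
  simp

variable (hX : LocalDiffeo Ω' Ω X) (hG : MetricOn Ω G) (hu : u ∈ Ω')
include hX hG hu

/-- The tensorial coordinates transform by the tensor action of the Jacobian matrix. -/
lemma tensorOf_pull (w r : ℕ) {m κ : Model n → ℝ} (hm : ContDiffOn ℝ ∞ m Ω)
    (hκ : ContDiffOn ℝ ∞ κ Ω) :
    tensorOf w r (pullMetric X G) (fun v => m (X v)) (fun v => κ (X v)) u =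
      glAct (Matrix.of fun a μ => jac X a μ u) (tensorOf w r G m κ (X u)) := by
  have hs : ∀ {φ : Model n → ℝ}, ContDiffOn ℝ ∞ φ Ω →
      scalarOf r (pullMetric X G) (fun v => φ (X v)) u =
        fun (k : Fin (r + 1)) (l : Fin (k : ℕ) → Fin n) => ∑ p : Fin (k : ℕ) → Fin n, (∏ s, jac X (p s) (l s) u) * scalarOf r G φ (X u) k p := by
    intro φ hφ
    funext k l
    simp only [scalarOf, nablaScalar_pull hX hG hφ k hu]
    exact sum_prod_mul_symFirst (fun a b => jac X a b u) _ l
  refine Prod.ext rfl (Prod.ext ?_ (Prod.ext (hs hm) (hs hκ)))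
  funext k α l
  set J : Matrix (Fin n) (Fin n) ℝ := Matrix.of fun a μ => jac X a μ u with hJ
  have h1 : ∀ τ, ∑ α, J τ α * curvOf w r (pullMetric X G) u k α l =
      ∑ p : Fin ((k : ℕ) + 3) → Fin n, (∏ s, J (p s) (l s)) * curvOf w r G (X u) k τ p := by
    intro τ
    have e := symFirst_sum (m := (k : ℕ) + w) Finset.univ
      (fun α l => J τ α * nablaRiemann (pullMetric X G) k α l u) l
    simp only [symFirst_const_mul] at e
    simp only [curvOf]
    rw [← sum_prod_mul_symFirst (fun a b => J a b), ← e]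
    congr 1
    funext l
    exact nablaRiemann_pull hX hG k hu τ l
  have h2 : curvOf w r (pullMetric X G) u k α l =
      ∑ τ, J⁻¹ α τ * ∑ β, J τ β * curvOf w r (pullMetric X G) u k β l := by
    have h3 := congrFun (congrArg (fun A : Matrix (Fin n) (Fin n) ℝ => A.mulVec
      fun β => curvOf w r (pullMetric X G) u k β l)
      (Matrix.nonsing_inv_mul J (hX.det_ne u hu).isUnit)) α
    simp only [Matrix.one_mulVec, ← Matrix.mulVec_mulVec] at h3
    exact h3.symm
  change curvOf w r (pullMetric X G) u k α l = ∑ τ, ∑ p : Fin ((k : ℕ) + 3) → Fin n,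
    J⁻¹ α τ * (∏ s, J (p s) (l s)) * curvOf w r G (X u) k τ p
  rw [h2]
  simp only [h1, Finset.mul_sum, mul_assoc]

end Tensoriality

/-! ### Diffeomorphisms tangent to the identity -/

section Tangent

variable {n : ℕ} {Ω Ω' : Set (Model n)} {X : Model n → Model n} {G : Model n → Fin n → Fin n → ℝ}
  {u : Model n} {K : ℕ}

lemma sum_kron_mul (f : Fin n → ℝ) (b : Fin n) : ∑ a, kron a b * f a = f b := by
  simp [kron]

lemma apply_eq_of_flat (hp : ∀ a, Flat Ω' u (K + 1) (fun v => X v a - v a)) : X u = u := by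
  ext a
  exact sub_eq_zero.1 (hp a).2.1

lemma LocalDiffeo.jac_eq (hX : LocalDiffeo Ω' Ω X) {v : Model n} (hv : v ∈ Ω') (a μ : Fin n) :
    jac X a μ v = pd μ (fun v => X v a - v a) v + kron a μ := by
  rw [pd_sub (differentiableAt_of_contDiffOn hX.isOpen (hX.contDiffOn_coord a) hv)
    (differentiableAt_coord a v), pd_coord, jac]
  ring

variable (hX : LocalDiffeo Ω' Ω X) (hu : u ∈ Ω')
include hX hu

/-- Composition with a diffeomorphism that agrees with the identity below order `K` does not
change the Taylor coefficients of order below `K`. -/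
lemma flat_comp_sub (hΩ : IsOpen Ω) (hs : Ω' ⊆ Ω)
    (hp : ∀ a, Flat Ω' u K (fun v => X v a - v a)) {f : Model n → ℝ} (hf : ContDiffOn ℝ ∞ f Ω) :
    Flat Ω' u K (fun v => f (X v) - f v) := by
  have hΩ' := hX.isOpen
  induction K generalizing f with
  | zero => exact (hX.contDiffOn_comp hf).sub (hf.mono hs)
  | succ K ih =>
    refine ⟨(hX.contDiffOn_comp hf).sub (hf.mono hs), by simp [apply_eq_of_flat hp], fun μ => ?_⟩
    have h1 : ∀ a, Flat Ω' u K (fun v => pd μ (fun v => X v a - v a) v * pd a f (X v)) := fun a =>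
      ((hp a).2.2 μ).mul_smooth hΩ' hu (hX.contDiffOn_comp (contDiffOn_pd hΩ hf a))
    have h2 := ih (fun a => (hp a).mono (Nat.le_succ K)) (contDiffOn_pd hΩ hf μ)
    refine ((Flat.sum hΩ' hu Finset.univ h1).add hΩ' hu h2).congr hΩ' hu fun v hv => ?_
    rw [pd_sub (f := fun v => f (X v)) (hX.differentiableAt_comp hv hf)
      (differentiableAt_of_contDiffOn hΩ hf (hs hv)), hX.pd_comp hΩ hv hf]
    simp only [hX.jac_eq hv, add_mul, Finset.sum_add_distrib, sum_kron_mul]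
    ring

lemma flat_jac_sub (hp : ∀ a, Flat Ω' u (K + 1) (fun v => X v a - v a)) (a μ : Fin n) :
    Flat Ω' u K (fun v => jac X a μ v - kron a μ) :=
  ((hp a).2.2 μ).congr hX.isOpen hu fun v hv => by
    rw [hX.jac_eq hv]
    ring

/-- The lowest order change of the Christoffel symbols under a diffeomorphism that agrees with
the identity below order `K + 2`. -/
lemma flat_christoffel_pull (hG : MetricOn Ω G) (hs : Ω' ⊆ Ω)
    (hp : ∀ a, Flat Ω' u (K + 2) (fun v => X v a - v a)) (τ μ ν : Fin n) :
    Flat Ω' u (K + 1) (fun v => christoffel (pullMetric X G) τ μ ν v - christoffel G τ μ ν v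
      - pd μ (pd ν (fun v => X v τ - v τ)) v) := by
  have hΩ := hG.isOpen
  have hΩ' := hX.isOpen
  have hG' := hG.pull hX
  have hJ := fun a μ => flat_jac_sub hX hu hp a μ
  have h1 : Flat Ω' u (K + 1) (fun v => ∑ α, (jac X τ α v - kron τ α) *
      christoffel (pullMetric X G) α μ ν v) :=
    Flat.sum hΩ' hu _ fun α => (hJ τ α).mul_smooth hΩ' hu (hG'.christoffel _ _ _)
  have h2 : Flat Ω' u (K + 1) (fun v => ∑ c, (jac X c μ v - kron c μ) *
      ∑ d, jac X d ν v * christoffel G τ c d (X v)) :=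
    Flat.sum hΩ' hu _ fun c => (hJ c μ).mul_smooth hΩ' hu (ContDiffOn.sum fun d _ =>
      (hX.contDiffOn_jac d ν).mul (hX.contDiffOn_comp (hG.christoffel τ c d)))
  have h3 : Flat Ω' u (K + 1) (fun v => ∑ d, (jac X d ν v - kron d ν) *
      christoffel G τ μ d (X v)) :=
    Flat.sum hΩ' hu _ fun d => (hJ d ν).mul_smooth hΩ' hu
      (hX.contDiffOn_comp (hG.christoffel τ μ d))
  have h4 := flat_comp_sub hX hu hΩ hs (fun a => (hp a).mono (Nat.le_succ _))
    (hG.christoffel τ μ ν)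
  refine ((((h2.add hΩ' hu h3).add hΩ' hu h4).sub hΩ' hu h1)).congr hΩ' hu fun v hv => ?_
  have e1 := christoffel_pull hX hG v hv τ μ ν
  have e2 : pd μ (jac X τ ν) v = pd μ (pd ν (fun v => X v τ - v τ)) v := by
    have := eqOn_pd hΩ' (fun w hw => hX.jac_eq hw τ ν) μ hv
    rw [this, pd_add (differentiableAt_of_contDiffOn hΩ' (contDiffOn_pd hΩ' (hp τ).contDiffOn ν) hv)
      (differentiableAt_const _), pd_const, add_zero]
  rw [e2] at e1
  have e3 : ∀ f : Fin n → ℝ, ∑ α, kron τ α * f α = f τ := fun f => by simp [kron]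
  have e4 : ∑ c, ∑ d, jac X c μ v * jac X d ν v * christoffel G τ c d (X v) =
      ∑ c, jac X c μ v * ∑ d, jac X d ν v * christoffel G τ c d (X v) := by
    simp only [Finset.mul_sum, mul_assoc]
  simp only [sub_mul, Finset.sum_sub_distrib, sum_kron_mul, e3]
  rw [e4] at e1
  linarith

/-- The change of the derivatives of the Christoffel symbols. -/
lemma dChristoffel_pull (hG : MetricOn Ω G) (hs : Ω' ⊆ Ω)
    (hp : ∀ a, Flat Ω' u (K + 2) (fun v => X v a - v a)) {j : ℕ} (hj : j ≤ K) (τ : Fin n)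
    (l : Fin (j + 2) → Fin n) :
    dChristoffel (pullMetric X G) j τ l u =
      dChristoffel G j τ l u + iterPd (j + 2) (fun v => X v τ - v τ) l u := by
  have hΩ' := hX.isOpen
  have hG' := hG.pull hX
  set μ := l (Fin.natAdd j (0 : Fin 2)) with hμ
  set ν := l (Fin.natAdd j (1 : Fin 2)) with hν
  set m : Fin j → Fin n := fun i => l (Fin.castAdd 2 i) with hm
  have hl : l = Fin.snoc (α := fun _ => Fin n) (Fin.snoc (α := fun _ => Fin n) m μ) ν := by
    funext i
    refine Fin.lastCases ?_ (fun i => ?_) i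
    · rw [Fin.snoc_last]; rfl
    · rw [Fin.snoc_castSucc]
      refine Fin.lastCases ?_ (fun i => ?_) i
      · rw [Fin.snoc_last]; rfl
      · rw [Fin.snoc_castSucc]; rfl
  have h1 := (flat_christoffel_pull hX hu hG hs hp τ μ ν).iterPd_eq_zero (j := j) (by omega) m
  have d1 := hG'.christoffel τ μ ν
  have d2 := (hG.christoffel τ μ ν).mono hs
  have d3 : ContDiffOn ℝ ∞ (pd μ (pd ν (fun v => X v τ - v τ))) Ω' :=
    contDiffOn_pd hΩ' (contDiffOn_pd hΩ' (hp τ).contDiffOn ν) μ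
  rw [iterPd_sub hΩ' (d1.sub d2) d3 _ _ hu] at h1
  dsimp only at h1
  rw [iterPd_sub hΩ' d1 d2 _ _ hu] at h1
  dsimp only at h1
  have h2 : iterPd (j + 2) (fun v => X v τ - v τ) l u =
      iterPd j (pd μ (pd ν (fun v => X v τ - v τ))) m u := by
    rw [hl, iterPd_snoc, iterPd_snoc]
  rw [h2]
  change iterPd j (christoffel (pullMetric X G) τ μ ν) m u =
    iterPd j (christoffel G τ μ ν) m u + _
  linarith

lemma sOf_pull_of_lt (hG : MetricOn Ω G) (hs : Ω' ⊆ Ω) {r : ℕ}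
    (hp : ∀ a, Flat Ω' u (K + 2) (fun v => X v a - v a)) (j : Fin r) (hj : (j : ℕ) < K) :
    sOf r (pullMetric X G) u j = sOf r G u j := by
  funext τ
  simp only [sOf, dChristoffel_pull hX hu hG hs hp hj.le,
    (hp τ).iterPd_eq_zero (j := (j : ℕ) + 2) (by omega), add_zero]

/-- A diffeomorphism that agrees with the identity below order `k + 2` shifts the
`S`-coordinates of order `k` by its derivatives of order `k + 2`. -/
lemma sOf_pull (hG : MetricOn Ω G) (hs : Ω' ⊆ Ω) {r : ℕ} (k : Fin r)
    (hp : ∀ a, Flat Ω' u ((k : ℕ) + 2) (fun v => X v a - v a)) (τ : Fin n)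
    (l : Fin ((k : ℕ) + 2) → Fin n) :
    sOf r (pullMetric X G) u k τ l =
      sOf r G u k τ l + iterPd ((k : ℕ) + 2) (fun v => X v τ - v τ) l u := by
  simp only [sOf, dChristoffel_pull hX hu hG hs hp le_rfl, symFirst_add]
  rw [(sym_iterPd hX.isOpen (hp τ).contDiffOn _ hu).symFirst_eq]

end Tangent

/-! ### The tensor action -/

section Action

variable {n r : ℕ}

/-- The action of a matrix on arrays with lower indices. -/
def lowAct {k : ℕ} (A : Matrix (Fin n) (Fin n) ℝ) (T : (Fin k → Fin n) → ℝ) (l : Fin k → Fin n) :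
    ℝ := ∑ p : Fin k → Fin n, (∏ s, A (p s) (l s)) * T p

lemma lowAct_one {k : ℕ} (T : (Fin k → Fin n) → ℝ) (l : Fin k → Fin n) : lowAct 1 T l = T l := by
  have h : ∀ p : Fin k → Fin n, (∏ s, (1 : Matrix (Fin n) (Fin n) ℝ) (p s) (l s)) =
      if p = l then 1 else 0 := by
    intro p
    simp only [Matrix.one_apply, Finset.prod_ite_zero, Finset.prod_const_one, Finset.mem_univ,
      true_implies, funext_iff]
  simp [lowAct, h]

lemma lowAct_mul {k : ℕ} (A B : Matrix (Fin n) (Fin n) ℝ) (T : (Fin k → Fin n) → ℝ)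
    (l : Fin k → Fin n) : lowAct (A * B) T l = lowAct B (lowAct A T) l := by
  simp only [lowAct, Matrix.mul_apply, Finset.prod_univ_sum, Fintype.piFinset_univ,
    Finset.prod_mul_distrib, Finset.sum_mul, Finset.mul_sum]
  rw [Finset.sum_comm]
  exact Finset.sum_congr rfl fun q _ => Finset.sum_congr rfl fun p _ => by ring

lemma symFirst_lowAct {k m : ℕ} (A : Matrix (Fin n) (Fin n) ℝ) (T : (Fin k → Fin n) → ℝ) :
    symFirst m (lowAct A T) = lowAct A (symFirst m T) :=
  funext fun l => sum_prod_mul_symFirst (fun a b => A a b) T l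

lemma IsSymFirst.lowAct {k m : ℕ} (hm : m ≤ k) {A : Matrix (Fin n) (Fin n) ℝ}
    {T : (Fin k → Fin n) → ℝ} (hT : IsSymFirst m T) : IsSymFirst m (lowAct A T) := by
  rw [← symFirst_of_isSymFirst hm hT, ← symFirst_lowAct]
  exact isSymFirst_symFirst _ _

lemma lowAct_snoc {k : ℕ} (A : Matrix (Fin n) (Fin n) ℝ) (T : (Fin (k + 1) → Fin n) → ℝ)
    (l : Fin k → Fin n) (ν : Fin n) :
    lowAct A T (Fin.snoc (α := fun _ => Fin n) l ν) =
      ∑ b, A b ν * lowAct A (fun p => T (Fin.snoc (α := fun _ => Fin n) p b)) l := by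
  simp only [lowAct, sum_snoc (k := k), Fin.prod_univ_castSucc, Fin.snoc_castSucc, Fin.snoc_last,
    Finset.mul_sum]
  exact Finset.sum_congr rfl fun b _ => Finset.sum_congr rfl fun p _ => by ring

lemma glAct_eq (A : Matrix (Fin n) (Fin n) ℝ) (t : TensorCoord n r) :
    glAct A t = (fun μ ν => ∑ a, ∑ b, A a μ * A b ν * t.1 a b,
      fun k α l => ∑ τ, A⁻¹ α τ * lowAct A (t.2.1 k τ) l,
      fun k => lowAct A (t.2.2.1 k), fun k => lowAct A (t.2.2.2 k)) := by
  refine Prod.ext rfl (Prod.ext ?_ rfl)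
  funext k α l
  simp only [glAct, lowAct, Finset.mul_sum, mul_assoc]

lemma glAct_one (t : TensorCoord n r) : glAct 1 t = t := by
  rw [glAct_eq]
  refine Prod.ext ?_ (Prod.ext ?_ (Prod.ext ?_ ?_))
  · funext μ ν
    simp [Matrix.one_apply]
  · funext k α l
    simp [lowAct_one, Matrix.one_apply]
  · funext k l
    exact lowAct_one _ _
  · funext k l
    exact lowAct_one _ _

lemma lowAct_sum_mul {k : ℕ} {ι : Type*} (s : Finset ι) (A : Matrix (Fin n) (Fin n) ℝ) (c : ι → ℝ)
    (T : ι → (Fin k → Fin n) → ℝ) (l : Fin k → Fin n) :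
    lowAct A (fun l => ∑ i ∈ s, c i * T i l) l = ∑ i ∈ s, c i * lowAct A (T i) l := by
  simp only [lowAct, Finset.mul_sum]
  rw [Finset.sum_comm]
  exact Finset.sum_congr rfl fun _ _ => Finset.sum_congr rfl fun _ _ => by ring

lemma sum_mul_mul_eq (A : Matrix (Fin n) (Fin n) ℝ) (g : Fin n → Fin n → ℝ) (μ ν : Fin n) :
    ∑ a, ∑ b, A a μ * A b ν * g a b = (A.transpose * Matrix.of g * A) μ ν := by
  simp only [Matrix.mul_apply, Matrix.transpose_apply, Matrix.of_apply, Finset.sum_mul]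
  rw [Finset.sum_comm]
  exact Finset.sum_congr rfl fun _ _ => Finset.sum_congr rfl fun _ _ => by ring

/-- The tensor action is a right action. -/
lemma glAct_mul (A B : Matrix (Fin n) (Fin n) ℝ) (t : TensorCoord n r) :
    glAct (A * B) t = glAct B (glAct A t) := by
  simp only [glAct_eq]
  refine Prod.ext ?_ (Prod.ext ?_ (Prod.ext ?_ ?_))
  · funext μ ν
    refine (sum_mul_mul_eq (A * B) t.1 μ ν).trans
      (Eq.trans ?_ (sum_mul_mul_eq B (glAct A t).1 μ ν).symm)
    have e : Matrix.of (glAct A t).1 = A.transpose * Matrix.of t.1 * A :=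
      Matrix.ext fun i j => sum_mul_mul_eq A t.1 i j
    rw [e, Matrix.transpose_mul]
    simp only [Matrix.mul_assoc]
  · funext k α l
    dsimp only
    simp only [lowAct_sum_mul, lowAct_mul, Matrix.mul_inv_rev, Matrix.mul_apply, Finset.sum_mul,
      Finset.mul_sum]
    rw [Finset.sum_comm]
    exact Finset.sum_congr rfl fun _ _ => Finset.sum_congr rfl fun _ _ => by ring
  · funext k l
    exact lowAct_mul _ _ _ _
  · funext k l
    exact lowAct_mul _ _ _ _

/-- The tensor action preserves the algebraic constraints. -/
lemma glAct_mem_tensorDomain {A : Matrix (Fin n) (Fin n) ℝ} (hA : IsUnit A.det)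
    {t : TensorCoord n r} (ht : t ∈ tensorDomain n r) : glAct A t ∈ tensorDomain n r := by
  obtain ⟨⟨P, hP, hPG⟩, h1, h2, h3, h4, h5⟩ := ht
  rw [glAct_eq]
  refine ⟨⟨P * A, by rw [Matrix.det_mul]; exact hP.mul hA, fun i j => ?_⟩, fun k α => ?_,
    fun k α ν l => ?_, fun k α l => ?_, fun k => (h4 k).lowAct le_rfl, fun k =>
    (h5 k).lowAct le_rfl⟩
  · simp only [hPG, Matrix.mul_apply, Finset.mul_sum, Finset.sum_mul]
    rw [Finset.sum_congr rfl fun a _ => Finset.sum_comm, Finset.sum_comm]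
    refine Finset.sum_congr rfl fun c _ => ?_
    rw [Finset.sum_comm]
    exact Finset.sum_congr rfl fun a _ => Finset.sum_congr rfl fun b _ => by ring
  · intro s hs l
    change ∑ τ, A⁻¹ α τ * lowAct A (t.2.1 k τ) (l ∘ s) = ∑ τ, A⁻¹ α τ * lowAct A (t.2.1 k τ) l
    exact Finset.sum_congr rfl fun τ _ => by
      rw [IsSymFirst.lowAct (by omega) (h1 k τ) s hs l]
  · have e1 : ∀ α ν, ∑ ρ, (∑ a, ∑ b, A a α * A b ρ * t.1 a b) *
        ∑ τ, A⁻¹ ρ τ * lowAct A (t.2.1 k τ) (Fin.snoc (α := fun _ => Fin n) l ν) =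
        ∑ a, ∑ b, A a α * A b ν * lowAct A (fun p => ∑ τ, t.1 a τ *
          t.2.1 k τ (Fin.snoc (α := fun _ => Fin n) p b)) l := by
      intro α ν
      set L : Fin n → ℝ := fun τ =>
        lowAct A (t.2.1 k τ) (Fin.snoc (α := fun _ => Fin n) l ν) with hL
      calc _ = ((A.transpose * Matrix.of t.1 * A).mulVec (A⁻¹.mulVec L)) α := by
            simp only [sum_mul_mul_eq]
            rfl
        _ = (A.transpose * Matrix.of t.1).mulVec L α := by
            rw [Matrix.mulVec_mulVec, Matrix.mul_assoc, Matrix.mul_nonsing_inv _ hA, mul_one]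
        _ = ∑ a, ∑ b, A a α * t.1 a b * L b := by
            simp only [Matrix.mulVec, dotProduct, Matrix.mul_apply, Matrix.transpose_apply,
              Matrix.of_apply, Finset.sum_mul]
            exact Finset.sum_comm
        _ = _ := by
            simp only [hL, lowAct_sum_mul, lowAct_snoc, Finset.mul_sum]
            refine Finset.sum_congr rfl fun a _ => ?_
            rw [Finset.sum_comm]
            exact Finset.sum_congr rfl fun _ _ => Finset.sum_congr rfl fun _ _ => by ring
    dsimp only
    rw [e1, e1, Finset.sum_comm]
    refine Finset.sum_congr rfl fun a _ => Finset.sum_congr rfl fun b _ => ?_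
    simp only [h2 k b a]
    ring
  · have e := symFirst_sum (m := (k : ℕ) + 3) Finset.univ
      (fun τ l => A⁻¹ α τ * lowAct A (t.2.1 k τ) l) l
    simp only [symFirst_const_mul] at e
    refine e.trans (Finset.sum_eq_zero fun τ _ => ?_)
    rw [symFirst_lowAct, show symFirst ((k : ℕ) + 3) (t.2.1 k τ) = fun _ => 0 from
      funext (h3 k τ)]
    simp [lowAct]

end Action

/-! ### Diffeomorphisms supported in a chart -/

section Perturbation

variable {E : Type*} [NormedAddCommGroup E] [NormedSpace ℝ E]

lemma injective_id_add_of_norm_lt_one {D : E →L[ℝ] E} (hD : ‖D‖ < 1) {v : E} (hv : v + D v = 0) :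
    v = 0 := by
  by_contra h
  have h1 : ‖v‖ = ‖D v‖ := by rw [← norm_neg, ← eq_neg_of_add_eq_zero_right hv]
  have h2 := D.le_opNorm v
  have h3 : 0 < ‖v‖ := norm_pos_iff.2 h
  nlinarith

/-- A smooth perturbation of the identity by a contraction is a diffeomorphism. -/
lemma exists_homeomorph_id_add [CompleteSpace E] {W : E → E} (hW : ContDiff ℝ ∞ W) {c : NNReal}
    (hc : c < 1) (hL : LipschitzWith c W) :
    ∃ Φ : E ≃ₜ E, (∀ u, Φ u = u + W u) ∧ ContDiff ℝ ∞ Φ ∧ ContDiff ℝ ∞ Φ.symm := by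
  have hA : ApproximatesLinearOn (fun u => u + W u)
      (ContinuousLinearEquiv.refl ℝ E : E →L[ℝ] E) Set.univ c := by
    intro x _ y _
    have : x + W x - (y + W y) - (ContinuousLinearEquiv.refl ℝ E : E →L[ℝ] E) (x - y) =
        W x - W y := by
      simp only [ContinuousLinearEquiv.coe_refl, ContinuousLinearMap.coe_id', id]
      abel
    rw [this]
    exact hL.norm_sub_le x y
  have hN : Subsingleton E ∨
      c < ‖((ContinuousLinearEquiv.refl ℝ E).symm : E →L[ℝ] E)‖₊⁻¹ := by
    rcases subsingleton_or_nontrivial E with h | h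
    · exact Or.inl h
    · right
      have : ‖((ContinuousLinearEquiv.refl ℝ E).symm : E →L[ℝ] E)‖₊ = 1 := by
        ext
        simp
      simpa [this] using hc
  set Φ := hA.toHomeomorph _ hN with hΦ
  have hΦu : ∀ u, Φ u = u + W u := fun u => rfl
  have hs : ContDiff ℝ ∞ Φ := (contDiff_id.add hW :)
  have hlt : ∀ a, ‖-(fderiv ℝ W a)‖ < 1 := fun a => by
    rw [norm_neg]
    exact lt_of_le_of_lt (norm_fderiv_le_of_lipschitz ℝ hL) (by exact_mod_cast hc)
  refine ⟨Φ, hΦu, hs, Φ.contDiff_symm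
    (f₀' := fun a => ContinuousLinearEquiv.unitsEquiv ℝ E (Units.oneSub _ (hlt a))) (fun a => ?_) hs⟩
  have h1 : HasFDerivAt (fun u => u + W u) (ContinuousLinearMap.id ℝ E + fderiv ℝ W a) a :=
    (hasFDerivAt_id a).add ((hW.differentiable (by simp) a).hasFDerivAt)
  refine h1.congr_fderiv ?_
  ext v
  simp [Units.oneSub]

end Perturbation

/-- `W` is a smooth contraction with compact support in `O`. -/
structure SmallPerturbation {n : ℕ} (O : Set (Model n)) (W : Model n → Model n) : Prop where
  smooth : ContDiff ℝ ∞ W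
  contracting : ∃ c : NNReal, c < 1 ∧ LipschitzWith c W
  support : ∃ K, IsCompact K ∧ K ⊆ O ∧ ∀ u ∉ K, W u = 0

section ChartConj

variable {n : ℕ} {M : Type*} [TopologicalSpace M] {e : OpenPartialHomeomorph M (Model n)}

open Classical in
/-- The map that reads `X` in the chart `e`, and is the identity outside the chart. -/
def chartConj (e : OpenPartialHomeomorph M (Model n)) (X : Model n → Model n) (y : M) : M :=
  if y ∈ e.source then e.symm (X (e y)) else y

lemma chartConj_of_mem {X : Model n → Model n} {y : M} (hy : y ∈ e.source) :
    chartConj e X y = e.symm (X (e y)) := if_pos hy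

lemma chartConj_of_notMem {X : Model n → Model n} {y : M} (hy : y ∉ e.source) :
    chartConj e X y = y := if_neg hy

lemma chartConj_comp {X Y : Model n → Model n} (hX : Set.MapsTo X e.target e.target)
    (hYX : ∀ u, Y (X u) = u) (y : M) : chartConj e Y (chartConj e X y) = y := by
  by_cases hy : y ∈ e.source
  · have h1 := hX (e.map_source hy)
    rw [chartConj_of_mem hy, chartConj_of_mem (e.map_target h1), e.right_inv h1, hYX, e.left_inv hy]
  · rw [chartConj_of_notMem hy, chartConj_of_notMem hy]

variable [ChartedSpace (Model n) M]

/-- A map of `ℝⁿ` supported in a compact part of a chart induces a smooth map of the manifold: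
near the complement of the chart it is the identity, because compact sets are closed. -/
lemma contMDiff_chartConj [T2Space M] [IsManifold (𝓡 n) ∞ M]
    (he : e ∈ IsManifold.maximalAtlas (𝓡 n) ∞ M) {X : Model n → Model n} (hX : ContDiff ℝ ∞ X)
    (hXe : Set.MapsTo X e.target e.target) {K : Set (Model n)} (hK : IsCompact K)
    (hKe : K ⊆ e.target) (hXK : ∀ u ∉ K, X u = u) :
    ContMDiff (𝓡 n) (𝓡 n) ∞ (chartConj e X) := by
  have hK' : IsClosed (e.symm '' K) :=
    (hK.image_of_continuousOn (e.continuousOn_symm.mono hKe)).isClosed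
  intro y
  by_cases hy : y ∈ e.source
  · have h1 : ContMDiffOn (𝓡 n) (𝓡 n) ∞ (fun y => e.symm (X (e y))) e.source :=
      (contMDiffOn_symm_of_mem_maximalAtlas he).comp
        (hX.contMDiff.comp_contMDiffOn (contMDiffOn_of_mem_maximalAtlas he))
        fun z hz => hXe (e.map_source hz)
    exact (h1.congr fun z hz => chartConj_of_mem hz).contMDiffAt (e.open_source.mem_nhds hy)
  · have h1 : y ∉ e.symm '' K := by
      rintro ⟨u, hu, rfl⟩
      exact hy (e.map_target (hKe hu))
    have h2 : chartConj e X =ᶠ[𝓝 y] id := by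
      filter_upwards [hK'.isOpen_compl.mem_nhds h1] with z hz
      by_cases hze : z ∈ e.source
      · rw [chartConj_of_mem hze, hXK _ fun h => hz ⟨_, h, e.left_inv hze⟩, e.left_inv hze]
        rfl
      · exact chartConj_of_notMem hze
    exact contMDiffAt_id.congr_of_eventuallyEq h2

/-- A contraction supported in a compact part of a chart gives a diffeomorphism of the manifold
that reads `u ↦ u + W u` in the chart. -/
lemma exists_diffeomorph [T2Space M] [IsManifold (𝓡 n) ∞ M]
    (he : e ∈ IsManifold.maximalAtlas (𝓡 n) ∞ M) {W : Model n → Model n}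
    (hW : SmallPerturbation e.target W) :
    ∃ χ : M ≃ₘ^∞⟮𝓡 n, 𝓡 n⟯ M, ∀ u ∈ e.target,
      u + W u ∈ e.target ∧ χ (e.symm u) = e.symm (u + W u) := by
  obtain ⟨c, hc, hL⟩ := hW.contracting
  obtain ⟨K, hK, hKe, hWK⟩ := hW.support
  obtain ⟨Φ, hΦ, hs, hs'⟩ := exists_homeomorph_id_add hW.smooth hc hL
  have h1 : ∀ u ∉ K, Φ u = u := fun u hu => by rw [hΦ, hWK u hu, add_zero]
  have h2 : ∀ u ∉ K, Φ.symm u = u := fun u hu => by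
    conv_lhs => rw [← h1 u hu]
    exact Φ.symm_apply_apply u
  -- A bijection that fixes all points outside of `K` preserves every set that contains `K`.
  have key : ∀ Ψ : Model n ≃ₜ Model n, (∀ u ∉ K, Ψ u = u) → Set.MapsTo Ψ e.target e.target := by
    intro Ψ hΨ u hu
    by_cases huK : Ψ u ∈ K
    · exact hKe huK
    · rwa [← Ψ.injective (hΨ _ huK).symm]
  refine ⟨⟨⟨chartConj e Φ, chartConj e Φ.symm, chartConj_comp (key Φ h1) Φ.symm_apply_apply,
    chartConj_comp (key Φ.symm h2) Φ.apply_symm_apply⟩,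
    contMDiff_chartConj he hs (key Φ h1) hK hKe h1,
    contMDiff_chartConj he hs' (key Φ.symm h2) hK hKe h2⟩, fun u hu => ⟨?_, ?_⟩⟩
  · rw [← hΦ]; exact key Φ h1 hu
  · change chartConj e Φ (e.symm u) = _
    rw [chartConj_of_mem (e.map_target hu), e.right_inv hu, hΦ]

end ChartConj

section LocalModels

variable {n : ℕ}

lemma jac_id_add {W : Model n → Model n} {u : Model n} (hW : DifferentiableAt ℝ W u)
    (a μ : Fin n) : jac (fun v => v + W v) a μ u =
      kron a μ + fderiv ℝ W u (EuclideanSpace.single μ 1) a := by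
  have h1 : HasFDerivAt (fun v => (W v) a)
      ((EuclideanSpace.proj (𝕜 := ℝ) a : Model n →L[ℝ] ℝ).comp (fderiv ℝ W u)) u :=
    (EuclideanSpace.proj (𝕜 := ℝ) a : Model n →L[ℝ] ℝ).hasFDerivAt.comp u hW.hasFDerivAt
  have h2 := pd_add (differentiableAt_coord a u) h1.differentiableAt μ
  rw [pd_coord] at h2
  have h3 : pd μ (fun v => (W v) a) u = fderiv ℝ W u (EuclideanSpace.single μ 1) a := by
    rw [pd, h1.fderiv]; rfl
  rw [h3] at h2
  exact h2

/-- The derivative `1 + DW` is invertible because `‖DW‖ < 1`. -/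
lemma SmallPerturbation.localDiffeo {O : Set (Model n)} {W : Model n → Model n}
    (hW : SmallPerturbation O W) {Ω' Ω : Set (Model n)} (hΩ' : IsOpen Ω')
    (hm : Set.MapsTo (fun u => u + W u) Ω' Ω) : LocalDiffeo Ω' Ω (fun u => u + W u) where
  isOpen := hΩ'
  smooth := (contDiff_id.add hW.smooth).contDiffOn
  mapsTo := hm
  det_ne u _ := by
    intro h
    obtain ⟨c, hc, hL⟩ := hW.contracting
    obtain ⟨v, hv, hv0⟩ := Matrix.exists_mulVec_eq_zero_iff.2 h
    have hd := hW.smooth.differentiable (by simp) u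
    have h1 : ‖fderiv ℝ W u‖ < 1 :=
      lt_of_le_of_lt (norm_fderiv_le_of_lipschitz ℝ hL) (by exact_mod_cast hc)
    have h2 : WithLp.toLp 2 v + fderiv ℝ W u (WithLp.toLp 2 v) = 0 := by
      ext a
      have h3 := congrFun hv0 a
      simp only [Matrix.mulVec, dotProduct, Matrix.of_apply, jac_id_add hd, Pi.zero_apply, add_mul,
        Finset.sum_add_distrib] at h3
      have h4 : ∑ μ, kron a μ * v μ = v a := by simp [kron]
      rw [h4] at h3
      have h5 : fderiv ℝ W u (WithLp.toLp 2 v) =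
          ∑ μ, v μ • fderiv ℝ W u (EuclideanSpace.single μ 1) := by
        conv_lhs => rw [eq_sum_single (WithLp.toLp 2 v)]
        simp
      rw [h5]
      simpa [mul_comm] using h3
    exact hv (congrArg WithLp.ofLp (injective_id_add_of_norm_lt_one h1 h2))

lemma exists_bump {O : Set (Model n)} (hO : IsOpen O) {u₀ : Model n} (hu₀ : u₀ ∈ O) :
    ∃ ρ : Model n → ℝ, ContDiff ℝ ∞ ρ ∧ HasCompactSupport ρ ∧ tsupport ρ ⊆ O ∧
      ∀ᶠ u in 𝓝 u₀, ρ u = 1 := by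
  obtain ⟨ε, hε, hεO⟩ := Metric.isOpen_iff.1 hO u₀ hu₀
  let ρ : ContDiffBump u₀ := ⟨ε / 4, ε / 2, by linarith, by linarith⟩
  refine ⟨ρ, ρ.contDiff, ρ.hasCompactSupport, ?_, ρ.eventuallyEq_one⟩
  rw [ρ.tsupport_eq]
  exact (Metric.closedBall_subset_ball (half_lt_self hε)).trans hεO

/-- Near the identity, every affine map is realized locally by a small perturbation of the
identity. -/
lemma eventually_exists_affine {O : Set (Model n)} (hO : IsOpen O) {u₀ : Model n} (hu₀ : u₀ ∈ O) :
    ∀ᶠ p : Model n × Matrix (Fin n) (Fin n) ℝ in 𝓝 (u₀, 1), ∃ W, SmallPerturbation O W ∧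
      ∀ᶠ u in 𝓝 p.1, u + W u = u₀ + Matrix.toEuclideanCLM (𝕜 := ℝ) p.2 (u - p.1) := by
  obtain ⟨ρ, hρ, hρc, hρO, hρ1⟩ := exists_bump hO hu₀
  have hφ : ContDiff ℝ ∞ fun u => ρ u • (u - u₀) := hρ.smul (contDiff_id.sub contDiff_const)
  obtain ⟨C₁, hC₁⟩ := ContDiff.lipschitzWith_of_hasCompactSupport
    (hρc.smul_right (f' := fun u => u - u₀)) hφ (by simp)
  obtain ⟨C₂, hC₂⟩ := ContDiff.lipschitzWith_of_hasCompactSupport hρc hρ (by simp)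
  set T : Matrix (Fin n) (Fin n) ℝ → Model n →L[ℝ] Model n :=
    fun A => Matrix.toEuclideanCLM (𝕜 := ℝ) A with hT
  have hTc : Continuous T := LinearMap.continuous_of_finiteDimensional
    (⟨⟨T, fun A B => map_add _ A B⟩, fun c A => map_smul _ c A⟩ :
      Matrix (Fin n) (Fin n) ℝ →ₗ[ℝ] Model n →L[ℝ] Model n)
  have hT1 : T 1 = 1 := map_one _
  -- With the cut-off `ρ`, take `W u = (A - 1) (ρ u • (u - u₀)) + ρ u • A (u₀ - u')`. The following is a
  -- Lipschitz constant of `W`, continuous in `(u', A)`; it vanishes at `(u₀, 1)`.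
  have hcont : Continuous fun p : Model n × Matrix (Fin n) (Fin n) ℝ =>
      ‖T p.2 - 1‖₊ * C₁ + ‖T p.2 (u₀ - p.1)‖₊ * C₂ := by
    have h1 : Continuous fun p : Model n × Matrix (Fin n) (Fin n) ℝ => T p.2 :=
      hTc.comp continuous_snd
    exact ((h1.sub continuous_const).nnnorm.mul continuous_const).add
      ((h1.clm_apply (continuous_const.sub continuous_fst)).nnnorm.mul continuous_const)
  have hsmall := hcont.continuousAt.eventually_lt (continuousAt_const (y := (1 : NNReal)))
    (x₀ := (u₀, 1)) (by simp [hT1])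
  have hnear : ∀ᶠ p : Model n × Matrix (Fin n) (Fin n) ℝ in 𝓝 (u₀, 1), ∀ᶠ u in 𝓝 p.1, ρ u = 1 :=
    (continuous_fst.continuousAt (x := (u₀, (1 : Matrix (Fin n) (Fin n) ℝ)))).eventually
      hρ1.eventually_nhds
  filter_upwards [hsmall, hnear] with p hp hpρ
  refine ⟨fun u => (T p.2 - 1) (ρ u • (u - u₀)) + ρ u • T p.2 (u₀ - p.1),
    ⟨((T p.2 - 1).contDiff.comp hφ).add (hρ.smul contDiff_const), ⟨_, hp, ?_⟩,
      ⟨tsupport ρ, hρc, hρO, fun u hu => by simp [image_eq_zero_of_notMem_tsupport hu]⟩⟩, ?_⟩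
  · refine ((T p.2 - 1).lipschitz.comp hC₁).add (LipschitzWith.of_dist_le_mul fun u v => ?_)
    rw [dist_eq_norm, ← sub_smul, norm_smul, ← dist_eq_norm, mul_comm]
    push_cast
    rw [mul_assoc]
    exact mul_le_mul_of_nonneg_left (hC₂.dist_le_mul u v) (norm_nonneg _)
  · filter_upwards [hpρ] with u hu
    have : u - p.1 = (u - u₀) + (u₀ - p.1) := by abel
    change u + ((T p.2 - 1) (ρ u • (u - u₀)) + ρ u • T p.2 (u₀ - p.1)) = u₀ + T p.2 (u - p.1)
    rw [this, map_add, hu, one_smul, one_smul]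
    simp only [_root_.sub_apply, one_apply_eq_self]
    abel

lemma polyEval_smul {k : ℕ} (T : (Fin k → Fin n) → ℝ) (c : ℝ) (ξ : Model n) :
    polyEval T (c • ξ) = c ^ k * polyEval T ξ := by
  unfold polyEval
  rw [Finset.mul_sum]
  refine Finset.sum_congr rfl fun l _ => ?_
  simp only [PiLp.smul_apply, smul_eq_mul, Finset.prod_mul_distrib, Finset.prod_const,
    Finset.card_univ, Fintype.card_fin]
  ring

/-- A homogeneous polynomial map of degree at least two is realized locally by a small perturbation
of the identity: cut off at radius `ε`, its Lipschitz constant tends to zero with `ε`. -/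
lemma exists_polynomial_perturbation {O : Set (Model n)} (hO : IsOpen O) {u₀ : Model n}
    (hu₀ : u₀ ∈ O) {k : ℕ} (T : Fin n → (Fin (k + 2) → Fin n) → ℝ) :
    ∃ W, SmallPerturbation O W ∧ ∀ᶠ u in 𝓝 u₀, ∀ α, W u α = polyEval (T α) (u - u₀) := by
  obtain ⟨ρ, hρ, hρc, -, hρ1⟩ := exists_bump isOpen_univ (Set.mem_univ (0 : Model n))
  set P : Model n → Model n := fun ξ => WithLp.toLp 2 fun α => polyEval (T α) ξ with hP
  have hPs : ContDiff ℝ ∞ P := contDiff_euclidean.2 fun α => contDiff_polyEval (T α)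
  have hPh : ∀ (c : ℝ) ξ, P (c • ξ) = c ^ (k + 2) • P ξ := fun c ξ => by
    ext α
    simp [hP, polyEval_smul]
  set W₁ : Model n → Model n := fun ξ => ρ ξ • P ξ with hW₁
  have hW₁s : ContDiff ℝ ∞ W₁ := hρ.smul hPs
  obtain ⟨C, hC⟩ := ContDiff.lipschitzWith_of_hasCompactSupport (hρc.smul_right (f' := P)) hW₁s
    (by simp)
  obtain ⟨R, hR⟩ := hρc.isBounded.subset_closedBall (0 : Model n)
  obtain ⟨δ, hδ, hδO⟩ := Metric.isOpen_iff.1 hO u₀ hu₀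
  have hlim : ∀ᶠ ε in 𝓝[>] (0 : ℝ), ε * (C + |R|) < min 1 δ ∧ ε < 1 := by
    have h1 : ContinuousAt (fun ε : ℝ => ε * (C + |R|)) 0 := by fun_prop
    have h2 := h1.eventually_lt (continuousAt_const (y := min 1 δ)) (by simpa using hδ)
    exact nhdsWithin_le_nhds (h2.and (eventually_lt_nhds one_pos))
  obtain ⟨ε, ⟨hε1, hεl⟩, hε0⟩ := (hlim.and self_mem_nhdsWithin).exists
  have hε : 0 < ε := hε0
  have hεC : ε * C < 1 := lt_of_le_of_lt
    (mul_le_mul_of_nonneg_left (by linarith [abs_nonneg R]) hε.le) (hε1.trans_le (min_le_left _ _))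
  have hεR : ε * |R| < δ := lt_of_le_of_lt
    (mul_le_mul_of_nonneg_left (by linarith [C.coe_nonneg]) hε.le) (hε1.trans_le (min_le_right _ _))
  have hsm : ContDiff ℝ ∞ fun u => ε ^ (k + 2) • W₁ (ε⁻¹ • (u - u₀)) := by
    have : ContDiff ℝ ∞ fun u => W₁ (ε⁻¹ • (u - u₀)) := hW₁s.comp (by fun_prop)
    exact this.const_smul _
  refine ⟨fun u => ε ^ (k + 2) • W₁ (ε⁻¹ • (u - u₀)), ⟨hsm,
    ⟨⟨ε * C, by positivity⟩, hεC, ?_⟩, ⟨Metric.closedBall u₀ (ε * |R|), isCompact_closedBall _ _,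
    (Metric.closedBall_subset_ball hεR).trans hδO, fun u hu => ?_⟩⟩, ?_⟩
  · refine LipschitzWith.of_dist_le_mul fun u v => ?_
    have h1 : dist (W₁ (ε⁻¹ • (u - u₀))) (W₁ (ε⁻¹ • (v - u₀))) ≤ C * (ε⁻¹ * dist u v) := by
      refine (hC.dist_le_mul _ _).trans (mul_le_mul_of_nonneg_left (le_of_eq ?_) C.coe_nonneg)
      rw [dist_smul₀, dist_sub_right, Real.norm_of_nonneg (inv_nonneg.2 hε.le)]
    change dist _ _ ≤ ε * C * dist u v
    rw [dist_smul₀, Real.norm_of_nonneg (by positivity)]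
    calc ε ^ (k + 2) * dist (W₁ (ε⁻¹ • (u - u₀))) (W₁ (ε⁻¹ • (v - u₀)))
        ≤ ε ^ 2 * (C * (ε⁻¹ * dist u v)) :=
          mul_le_mul (pow_le_pow_of_le_one hε.le hεl.le (by omega)) h1 dist_nonneg (by positivity)
      _ = ε * C * dist u v := by field_simp
  · have h1 : ε⁻¹ • (u - u₀) ∉ tsupport ρ := fun h => hu <| by
      have h2 := hR h
      rw [mem_closedBall_zero_iff, norm_smul, norm_inv, Real.norm_of_nonneg hε.le,
        inv_mul_le_iff₀ hε] at h2
      rw [mem_closedBall_iff_norm]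
      exact h2.trans (mul_le_mul_of_nonneg_left (le_abs_self R) hε.le)
    simp [hW₁, image_eq_zero_of_notMem_tsupport h1]
  · have h1 : Filter.Tendsto (fun u : Model n => ε⁻¹ • (u - u₀)) (𝓝 u₀) (𝓝 0) := by
      have : Continuous fun u : Model n => ε⁻¹ • (u - u₀) := by fun_prop
      simpa using this.tendsto u₀
    filter_upwards [h1.eventually hρ1] with u hu α
    have h2 : u - u₀ = ε • (ε⁻¹ • (u - u₀)) := by rw [smul_smul, mul_inv_cancel₀ hε.ne', one_smul]
    have h3 : ε ^ (k + 2) • W₁ (ε⁻¹ • (u - u₀)) = P (u - u₀) := by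
      conv_rhs => rw [h2, hPh]
      simp only [hW₁, hu, one_smul]
    rw [h3]

end LocalModels

/-! ### Consequences of covariance for the coordinates of a jet -/

section Covariance

variable {n r : ℕ} {M : Type*} [TopologicalSpace M] [ChartedSpace (Model n) M]
  {e : OpenPartialHomeomorph M (Model n)} {f : JetBundle n M r → ℝ}

/-- The covariant coordinates of a section in the chart `e`; the whole curvature tensors are
symmetrized over the derivative indices and the next `w` indices. -/
def covAt (w r : ℕ) (e : OpenPartialHomeomorph M (Model n)) {x : M}
    (h : LocalGeometry (n := n) x) : CovCoord n r :=
  covOf w r (metricComp e h.g) (h.msq ∘ e.symm) (h.kappa ∘ e.symm) (e x)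

lemma LocalDiffeo.mono {Ω' Ω'' Ω : Set (Model n)} {X : Model n → Model n}
    (hX : LocalDiffeo Ω' Ω X) (hΩ : IsOpen Ω'') (hs : Ω'' ⊆ Ω') : LocalDiffeo Ω'' Ω X :=
  ⟨hΩ, hX.smooth.mono hs, hX.mapsTo.mono_left hs, fun u hu => hX.det_ne u (hs hu)⟩

/-- The derivative is given by the Jacobian matrix. -/
lemma fderiv_apply_eq_sum_jac {X : Model n → Model n} {u : Model n} (hX : DifferentiableAt ℝ X u)
    (v : Model n) (a : Fin n) : fderiv ℝ X u v a = ∑ μ, jac X a μ u * v μ := by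
  have h1 : HasFDerivAt (fun v => (X v) a)
      ((EuclideanSpace.proj (𝕜 := ℝ) a : Model n →L[ℝ] ℝ).comp (fderiv ℝ X u)) u :=
    (EuclideanSpace.proj (𝕜 := ℝ) a : Model n →L[ℝ] ℝ).hasFDerivAt.comp u hX.hasFDerivAt
  have h2 := fderiv_eq_sum_pd (f := fun v => (X v) a) (u := u) v
  rw [h1.fderiv] at h2
  refine Eq.trans h2 (Finset.sum_congr rfl fun μ _ => ?_)
  rw [mul_comm]
  rfl

/-- Pulling back by a diffeomorphism supported in a chart: the coordinates of the pulled back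
section, on which a covariant function takes the same value. -/
lemma exists_pullback [T2Space M] [IsManifold (𝓡 n) ∞ M]
    (he : e ∈ IsManifold.maximalAtlas (𝓡 n) ∞ M) (hf : DiffCovariant f) {x : M}
    (hx : x ∈ e.source) (h : LocalGeometry (n := n) x) {W : Model n → Model n}
    (hW : SmallPerturbation e.target W) {u : Model n} (hu : u ∈ e.target)
    (hux : u + W u = e x) :
    ∃ Ω', LocalDiffeo Ω' (h.region e) (fun v => v + W v) ∧ u ∈ Ω' ∧
      ∃ h' : LocalGeometry (n := n) (e.symm u), f (jet r h') = f (jet r h) ∧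
        ∀ w, covAt w r e h' = covOf w r (pullMetric (fun v => v + W v) (metricComp e h.g))
          (fun v => (h.msq ∘ e.symm) (v + W v)) (fun v => (h.kappa ∘ e.symm) (v + W v)) u := by
  obtain ⟨χ, hχ⟩ := exists_diffeomorph he hW
  set X : Model n → Model n := fun v => v + W v with hXdef
  have hXs : ContDiff ℝ ∞ X := contDiff_id.add hW.smooth
  have hXd : ∀ v, DifferentiableAt ℝ X v := fun v => hXs.differentiable (by simp) v
  set Ω' := e.target ∩ X ⁻¹' h.region e with hΩ'
  have hΩ'o : IsOpen Ω' := e.open_target.inter (h.isOpen_region.preimage hXs.continuous)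
  have hX : LocalDiffeo Ω' (h.region e) X := hW.localDiffeo hΩ'o fun v hv => hv.2
  have huΩ' : u ∈ Ω' := ⟨hu, by
    change u + W u ∈ h.region e
    rw [hux]; exact h.mem_region hx⟩
  have hχu : χ (e.symm u) = x := by rw [(hχ u hu).2, hux, e.left_inv hx]
  have hG := h.metricOn he
  have hG' := hG.pull hX
  have hm' := hX.contDiffOn_comp (h.contDiffOn_msq he)
  have hκ' := hX.contDiffOn_comp (h.contDiffOn_kappa he)
  have hxu : e.symm u ∈ e.source := e.map_target hu
  have heu : e (e.symm u) = u := e.right_inv hu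
  have huΩ'' : e (e.symm u) ∈ Ω' := by rwa [heu]
  subst hχu
  refine ⟨Ω', hX, huΩ', LocalGeometry.ofChart he hxu (pullMetric X (metricComp e h.g))
    (fun v => (h.msq ∘ e.symm) (X v)) (fun v => (h.kappa ∘ e.symm) (X v)) Ω' hΩ'o huΩ''
    hG'.smooth (fun v hv => isLorentz_pull hX hv (h.isLorentz he (hX.mapsTo hv))) hm' hκ',
    hf χ (e.symm u) h _ ?_, fun w => ?_⟩
  · have hnear : ∀ᶠ y in 𝓝 (e.symm u), y ∈ e.source ∩ e ⁻¹' Ω' :=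
      (e.isOpen_inter_preimage hΩ'o).mem_nhds ⟨hxu, huΩ''⟩
    -- In the chart, `χ` is `X`; comparing derivatives of `e ∘ χ = X ∘ e` identifies the pulled back metric
    -- with `pullMetric X`.
    have hexp : ∀ y ∈ e.source, χ y = e.symm (X (e y)) ∧ X (e y) ∈ e.target := fun y hy => by
      have h1 := hχ (e y) (e.map_source hy)
      rw [e.left_inv hy] at h1
      exact ⟨h1.2, h1.1⟩
    filter_upwards [hnear] with y hy
    obtain ⟨hyχ, hyX⟩ := hexp y hy.1
    have hχs : χ y ∈ e.source := by rw [hyχ]; exact e.map_target hyX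
    have heχ : e (χ y) = X (e y) := by rw [hyχ, e.right_inv hyX]
    refine ⟨fun v w => ?_, ?_, ?_⟩
    · have hd := mdifferentiable_of_mem_maximalAtlas he
      have h1 : (e ∘ χ : M → Model n) =ᶠ[𝓝 y] X ∘ e :=
        Filter.eventuallyEq_of_mem (e.open_source.mem_nhds hy.1) fun z hz => by
          obtain ⟨h1, h2⟩ := hexp z hz
          change e (χ z) = X (e z)
          rw [h1, e.right_inv h2]
      have h2 : mfderiv (𝓡 n) (𝓡 n) (e ∘ χ) y =
          (mfderiv (𝓡 n) (𝓡 n) e (χ y)).comp (mfderiv (𝓡 n) (𝓡 n) χ y) :=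
        mfderiv_comp (I' := 𝓡 n) (M' := M) y (hd.mdifferentiableAt hχs)
          (χ.mdifferentiable (by simp) y)
      have h3 : mfderiv (𝓡 n) (𝓡 n) (X ∘ e) y =
          (mfderiv (𝓡 n) (𝓡 n) X (e y)).comp (mfderiv (𝓡 n) (𝓡 n) e y) :=
        mfderiv_comp (I' := 𝓡 n) (M' := Model n) y (hXd _).mdifferentiableAt
          (hd.mdifferentiableAt hy.1)
      have h4 : ∀ (v : TangentSpace (𝓡 n) y) a,
          chartDeriv e (χ y) (mfderiv (𝓡 n) (𝓡 n) χ y v) a =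
          ∑ μ, jac X a μ (e y) * chartDeriv e y v μ := by
        intro v a
        rw [← fderiv_apply_eq_sum_jac (hXd _)]
        have h5 := DFunLike.congr_fun ((h2.symm.trans h1.mfderiv_eq).trans h3) v
        rw [mfderiv_eq_fderiv] at h5
        exact congrArg (fun z : Model n => z a) h5
      rw [apply_eq_sum_metricComp he h.g hχs]
      refine (formOfChart_apply _ y v w).trans ?_
      simp only [h4, heχ, pullMetric, Finset.sum_mul, Finset.mul_sum]
      rw [Finset.sum_congr rfl fun a _ => Finset.sum_comm, Finset.sum_comm]
      refine Finset.sum_congr rfl fun a _ => ?_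
      rw [Finset.sum_congr rfl fun μ _ => Finset.sum_comm, Finset.sum_comm]
      refine Finset.sum_congr rfl fun b _ => ?_
      rw [Finset.sum_comm]
      exact Finset.sum_congr rfl fun _ _ => Finset.sum_congr rfl fun _ _ => by ring
    · change h.msq (e.symm (X (e y))) = _
      rw [hyχ]
    · change h.kappa (e.symm (X (e y))) = _
      rw [hyχ]
  · refine (covOf_ofChart he hxu hΩ'o huΩ'' hG'.smooth _ hm' hκ' w r).trans ?_
    rw [heu]

/-- A homogeneous polynomial as a Taylor polynomial with a single nonzero coefficient array. -/
lemma polyEval_eq_taylorPoly {k : ℕ} (T : (Fin k → Fin n) → ℝ) (ξ : Model n) :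
    polyEval (fun l => (k.factorial : ℝ)⁻¹ * T l) ξ =
      taylorPoly (k + 1) (Function.update (fun _ _ => 0) k T) ξ := by
  rw [taylorPoly, Finset.sum_range_succ, Finset.sum_eq_zero, polyEval_const_mul,
    Function.update_self, zero_add, div_eq_inv_mul]
  intro j hj
  rw [Function.update_of_ne (Finset.mem_range.1 hj).ne]
  simp [polyEval]

/-- The derivatives up to order `k` at `x` of `(1 / k!) T (v - x)`: all vanish but the last, which is `T`. -/
lemma iterPd_polyEval_sub {k : ℕ} {T : (Fin k → Fin n) → ℝ} (hT : Sym T) {j : ℕ} (hj : j ≤ k)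
    (x : Model n) (l : Fin j → Fin n) :
    iterPd j (fun v => polyEval (fun l => (k.factorial : ℝ)⁻¹ * T l) (v - x)) l x =
      Function.update (fun j (_ : Fin j → Fin n) => (0 : ℝ)) k T j l := by
  simp only [polyEval_eq_taylorPoly]
  refine iterPd_taylorPoly (fun i => ?_) (Nat.lt_succ_of_le hj) x l
  rcases eq_or_ne i k with rfl | hi
  · rwa [Function.update_self]
  · rw [Function.update_of_ne hi]
    exact fun _ _ => rfl

variable [T2Space M] [IsManifold (𝓡 n) ∞ M] (he : e ∈ IsManifold.maximalAtlas (𝓡 n) ∞ M)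
  (hf : DiffCovariant f)
include he hf

/-- The diffeomorphisms that read affine maps in the chart move the point and act on the
tensorial coordinates. -/
lemma eventually_exists_glAct {x : M} (hx : x ∈ e.source) (h : LocalGeometry (n := n) x) :
    ∀ᶠ p : Model n × Matrix (Fin n) (Fin n) ℝ in 𝓝 (e x, 1), p.1 ∈ e.target ∧
      ∃ h' : LocalGeometry (n := n) (e.symm p.1), f (jet r h') = f (jet r h) ∧
        ∀ w, (covAt w r e h').2.2 = glAct p.2 (covAt w r e h).2.2 := by
  have hmem : ∀ᶠ p : Model n × Matrix (Fin n) (Fin n) ℝ in 𝓝 (e x, 1), p.1 ∈ e.target :=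
    (continuous_fst.continuousAt (x := (e x, (1 : Matrix (Fin n) (Fin n) ℝ)))).eventually
      (e.open_target.mem_nhds (e.map_source hx))
  filter_upwards [hmem, eventually_exists_affine e.open_target (e.map_source hx)]
    with p hp ⟨W, hW, hWp⟩
  refine ⟨hp, ?_⟩
  have hux : p.1 + W p.1 = e x := by simpa using hWp.self_of_nhds
  obtain ⟨Ω', hX, hu, h', hfh, hc⟩ := exists_pullback he hf hx h hW hp hux
  refine ⟨h', hfh, fun w => ?_⟩
  rw [hc]
  refine (tensorOf_pull hX (h.metricOn he) hu w r (h.contDiffOn_msq he)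
    (h.contDiffOn_kappa he)).trans ?_
  have hj : (Matrix.of fun a μ => jac (fun v => v + W v) a μ p.1) = p.2 := by
    ext a μ
    have h1 : HasFDerivAt (fun u => e x + Matrix.toEuclideanCLM (𝕜 := ℝ) p.2 (u - p.1))
        (Matrix.toEuclideanCLM (𝕜 := ℝ) p.2) p.1 := by
      have := (Matrix.toEuclideanCLM (𝕜 := ℝ) p.2).hasFDerivAt.comp p.1
        ((hasFDerivAt_id p.1).sub_const p.1)
      exact this.const_add _
    have h2 := h1.congr_of_eventuallyEq hWp
    have h3 := fderiv_apply_eq_sum_jac h2.differentiableAt (EuclideanSpace.single μ 1) a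
    rw [h2.fderiv] at h3
    simpa [Matrix.ofLp_toEuclideanCLM] using h3.symm
  rw [hj]
  change glAct p.2 (tensorOf w r _ _ _ (p.1 + W p.1)) = _
  rw [hux]
  rfl

/-- The diffeomorphisms that are tangent to the identity at a point change the `S`-coordinates
arbitrarily, and none of the others. -/
lemma exists_sCoord_eq {u : Model n} (hu : u ∈ e.target)
    (h : LocalGeometry (n := n) (e.symm u)) {S : SArrays n r} (hS : SymS S) :
    ∃ h' : LocalGeometry (n := n) (e.symm u), f (jet r h') = f (jet r h) ∧
      ∀ w, covAt w r e h' = (u, S, (covAt w r e h).2.2) := by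
  have hx : e.symm u ∈ e.source := e.map_target hu
  have heu : e (e.symm u) = u := e.right_inv hu
  -- The `S`-coordinates are adjusted order by order.
  suffices H : ∀ N ≤ r, ∃ h' : LocalGeometry (n := n) (e.symm u), f (jet r h') = f (jet r h) ∧
      (∀ k : Fin r, (k : ℕ) < N → sOf r (metricComp e h'.g) u k = S k) ∧
      ∀ w, (covAt w r e h').2.2 = (covAt w r e h).2.2 by
    obtain ⟨h', h1, h2, h3⟩ := H r le_rfl
    refine ⟨h', h1, fun w => Prod.ext heu (Prod.ext ?_ (h3 w))⟩
    change sOf r _ (e (e.symm u)) = S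
    rw [heu]
    exact funext fun k => h2 k k.2
  intro N
  induction N with
  | zero => exact fun _ => ⟨h, rfl, fun k hk => absurd hk (Nat.not_lt_zero _), fun _ => rfl⟩
  | succ N ih =>
    intro hN
    obtain ⟨h₁, hf₁, hS₁, ht₁⟩ := ih (by omega)
    set G := metricComp e h₁.g with hGdef
    have hG : MetricOn (h₁.region e) G := h₁.metricOn he
    -- the required shift at order `N`
    set T : Fin n → (Fin (N + 2) → Fin n) → ℝ :=
      fun α l => S ⟨N, hN⟩ α l - sOf r G u ⟨N, hN⟩ α l with hT
    have hTs : ∀ α, Sym (T α) := fun α => by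
      have h1 : Sym (S ⟨N, hN⟩ α) := isSymFirst_self_iff.1 (hS ⟨N, hN⟩ α)
      have h2 : Sym (sOf r G u ⟨N, hN⟩ α) := isSymFirst_self_iff.1 (isSymFirst_symFirst _ _)
      exact h1.sub h2
    obtain ⟨W, hW, hWT⟩ := exists_polynomial_perturbation e.open_target hu
      (fun α l => ((N + 2).factorial : ℝ)⁻¹ * T α l)
    have hWu : W u = 0 := by
      ext α
      rw [hWT.self_of_nhds α, sub_self, polyEval_succ]
      simp
    obtain ⟨Ω', hX', huΩ', h', hfh, hc⟩ :=
      exists_pullback he hf hx h₁ hW hu (by rw [hWu, add_zero, heu])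
    obtain ⟨V, hVW, hVo, huV⟩ := mem_nhds_iff.1 hWT
    set Ω := Ω' ∩ h₁.region e ∩ V with hΩ
    have hX : LocalDiffeo Ω (h₁.region e) (fun v => v + W v) :=
      hX'.mono ((hX'.isOpen.inter h₁.isOpen_region).inter hVo) fun v hv => hv.1.1
    have huΩ : u ∈ Ω := ⟨⟨huΩ', by simpa [heu] using h₁.mem_region hx⟩, huV⟩
    have hs : Ω ⊆ h₁.region e := fun v hv => hv.1.2
    have hWe : ∀ α, Set.EqOn (fun v => (v + W v) α - v α)
        (fun v => polyEval (fun l => ((N + 2).factorial : ℝ)⁻¹ * T α l) (v - u)) Ω := by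
      intro α v hv
      have := hVW hv.2 α
      simp only [PiLp.add_apply, add_sub_cancel_left]
      exact this
    have hflat : ∀ α, Flat Ω u (N + 2) (fun v => (v + W v) α - v α) := fun α =>
      flat_of_iterPd hX.isOpen ((hX.contDiffOn_coord α).sub
        (EuclideanSpace.proj (𝕜 := ℝ) α : Model n →L[ℝ] ℝ).contDiff.contDiffOn)
        fun j hj l => by
          rw [iterPd_congr hX.isOpen (hWe α) j l huΩ, iterPd_polyEval_sub (hTs α) hj.le,
            Function.update_of_ne hj.ne]
    refine ⟨h', hfh.trans hf₁, fun k hk => ?_, fun w => ?_⟩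
    · have h1 : sOf r (metricComp e h'.g) u = sOf r (pullMetric (fun v => v + W v) G) u := by
        have := congrArg (fun c : CovCoord n r => c.2.1) (hc 0)
        change sOf r _ (e (e.symm u)) = _ at this
        rwa [heu] at this
      rw [h1]
      rcases Nat.lt_succ_iff_lt_or_eq.1 hk with hk | rfl
      · rw [sOf_pull_of_lt hX huΩ hG hs hflat k hk, hS₁ k hk]
      · funext α l
        rw [sOf_pull hX huΩ hG hs k hflat, iterPd_congr hX.isOpen (hWe α) _ l huΩ,
          iterPd_polyEval_sub (hTs α) le_rfl, Function.update_self]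
        exact add_sub_cancel _ _
    · rw [hc, ← ht₁]
      refine (tensorOf_pull hX hG huΩ w r (h₁.contDiffOn_msq he)
        (h₁.contDiffOn_kappa he)).trans ?_
      have hj : (Matrix.of fun a μ => jac (fun v => v + W v) a μ u) = 1 := by
        ext a μ
        have h1 := (flat_jac_sub (K := N + 1) hX huΩ hflat a μ).2.1
        dsimp only at h1
        rw [Matrix.of_apply, sub_eq_zero.1 h1, kron, Matrix.one_apply]
      rw [hj, glAct_one]
      change tensorOf w r _ _ _ (u + W u) = tensorOf w r _ _ _ (e (e.symm u))
      rw [hWu, add_zero, heu]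

/-- The coordinates that can be reached from a given section without changing the value of a
covariant function. -/
lemma eventually_exists_covAt_eq {x : M} (hx : x ∈ e.source) (h : LocalGeometry (n := n) x) :
    ∀ᶠ p : Model n × Matrix (Fin n) (Fin n) ℝ in 𝓝 (e x, 1), p.1 ∈ e.target ∧
      ∀ S : SArrays n r, SymS S → ∃ h' : LocalGeometry (n := n) (e.symm p.1),
        f (jet r h') = f (jet r h) ∧
          ∀ w, covAt w r e h' = (p.1, S, glAct p.2 (covAt w r e h).2.2) := by
  filter_upwards [eventually_exists_glAct he hf hx h] with p ⟨hp, h₁, hf₁, hc₁⟩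
  refine ⟨hp, fun S hS => ?_⟩
  obtain ⟨h₂, hf₂, hc₂⟩ := exists_sCoord_eq he hf hp h₁ hS
  exact ⟨h₂, hf₂.trans hf₁, fun w => by rw [hc₂, hc₁]⟩

end Covariance

/-! ### The infinitesimal tensor action -/

section Infinitesimal

variable {n r : ℕ} (ρ σ : Fin n)

lemma single_apply_eq_kron (a b : Fin n) :
    Matrix.single ρ σ (1 : ℝ) a b = kron a ρ * kron σ b := by
  by_cases h1 : a = ρ <;> by_cases h2 : σ = b <;>
    simp [kron, h1, h2, eq_comm (a := ρ) (b := a)]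

/-- The one-parameter family `1 + τ E` of matrices, `E` having `1` as its entry in row `ρ` and
column `σ`, and `0` elsewhere. -/
def elemCurve (τ : ℝ) : Matrix (Fin n) (Fin n) ℝ := 1 + τ • Matrix.single ρ σ (1 : ℝ)

lemma elemCurve_apply (τ : ℝ) (a b : Fin n) :
    elemCurve ρ σ τ a b = kron a b + τ * (kron a ρ * kron σ b) := by
  rw [elemCurve, Matrix.add_apply, Matrix.smul_apply, single_apply_eq_kron, Matrix.one_apply]
  rfl

lemma elemCurve_zero : elemCurve ρ σ 0 = 1 := by simp [elemCurve]

lemma hasDerivAt_elemCurve (a b : Fin n) :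
    HasDerivAt (fun τ => elemCurve ρ σ τ a b) (kron a ρ * kron σ b) 0 := by
  simp only [elemCurve_apply]
  simpa using ((hasDerivAt_id (0 : ℝ)).mul_const (kron a ρ * kron σ b)).const_add (kron a b)

/-- `E² = δ E`, where `δ = 1` if the row and the column of the entry coincide, and `δ = 0` otherwise. -/
lemma elemCurve_inv {τ : ℝ} (h : 1 + τ * kron σ ρ ≠ 0) :
    (elemCurve ρ σ τ)⁻¹ = 1 - (τ / (1 + τ * kron σ ρ)) • Matrix.single ρ σ (1 : ℝ) := by
  refine Matrix.inv_eq_right_inv ?_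
  have h1 : (Matrix.single ρ σ (1 : ℝ)) * Matrix.single ρ σ (1 : ℝ) =
      kron σ ρ • Matrix.single ρ σ (1 : ℝ) := by
    by_cases hσ : σ = ρ
    · subst hσ; simp [kron]
    · simp [kron, hσ]
  have h2 : τ - τ / (1 + τ * kron σ ρ) - τ * (τ / (1 + τ * kron σ ρ)) * kron σ ρ = 0 := by
    field_simp
    ring
  rw [elemCurve, mul_sub, mul_one, mul_smul_comm, add_mul, one_mul, smul_mul_assoc, h1]
  have h3 : (1 : Matrix (Fin n) (Fin n) ℝ) + τ • Matrix.single ρ σ 1 -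
      (τ / (1 + τ * kron σ ρ)) • (Matrix.single ρ σ 1 + τ • kron σ ρ • Matrix.single ρ σ 1) =
      1 + (τ - τ / (1 + τ * kron σ ρ) - τ * (τ / (1 + τ * kron σ ρ)) * kron σ ρ) •
        Matrix.single ρ σ 1 := by
    module
  rw [h3, h2, zero_smul, add_zero]

lemma hasDerivAt_elemCurve_inv (a b : Fin n) :
    HasDerivAt (fun τ => (elemCurve ρ σ τ)⁻¹ a b) (-(kron a ρ * kron σ b)) 0 := by
  have hne : ∀ᶠ τ : ℝ in 𝓝 0, 1 + τ * kron σ ρ ≠ 0 := by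
    have : ContinuousAt (fun τ : ℝ => 1 + τ * kron σ ρ) 0 := by fun_prop
    exact this.eventually_ne (by simp)
  have h1 : HasDerivAt (fun τ : ℝ => τ / (1 + τ * kron σ ρ)) 1 0 := by
    simpa using (hasDerivAt_id' (0 : ℝ)).fun_div
      (((hasDerivAt_id' (0 : ℝ)).mul_const (kron σ ρ)).const_add 1) (by simp)
  have h2 := (h1.mul_const (kron a ρ * kron σ b)).const_sub (kron a b)
  rw [one_mul] at h2
  refine h2.congr_of_eventuallyEq ?_
  filter_upwards [hne] with τ hτ
  rw [elemCurve_inv ρ σ hτ]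
  rw [Matrix.sub_apply, Matrix.smul_apply, single_apply_eq_kron, Matrix.one_apply]
  rfl

/-- The product rule: only the multi-indices that differ from `l` in at most one slot
contribute. -/
lemma hasDerivAt_lowAct {k : ℕ} (T : (Fin k → Fin n) → ℝ) (l : Fin k → Fin n) :
    HasDerivAt (fun τ => lowAct (elemCurve ρ σ τ) T l)
      (∑ s, kron σ (l s) * T (Function.update l s ρ)) 0 := by
  have h1 : ∀ p : Fin k → Fin n, HasDerivAt
      (fun τ => (∏ s, elemCurve ρ σ τ (p s) (l s)) * T p)
      ((∑ s, (∏ j ∈ Finset.univ.erase s, elemCurve ρ σ 0 (p j) (l j)) •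
        (kron (p s) ρ * kron σ (l s))) * T p) 0 := fun p =>
    (HasDerivAt.fun_finsetProd fun s _ => hasDerivAt_elemCurve ρ σ (p s) (l s)).mul_const (T p)
  refine (HasDerivAt.fun_sum fun p _ => h1 p).congr_deriv ?_
  simp only [Finset.sum_mul]
  rw [Finset.sum_comm]
  refine Finset.sum_congr rfl fun s _ => ?_
  -- The factors other than `s` are Kronecker symbols at `τ = 0`.
  rw [Finset.sum_eq_single (Function.update l s ρ)]
  · rw [Finset.prod_eq_one]
    · simp [kron]
    · intro j hj
      rw [Function.update_of_ne (Finset.ne_of_mem_erase hj), elemCurve_apply]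
      simp [kron]
  · intro p _ hp
    by_cases h2 : p s = ρ
    · obtain ⟨j, hj⟩ : ∃ j, p j ≠ Function.update l s ρ j := Function.ne_iff.1 hp
      have hjs : j ≠ s := by
        rintro rfl
        exact hj (by rw [Function.update_self, h2])
      rw [Function.update_of_ne hjs] at hj
      rw [Finset.prod_eq_zero (Finset.mem_erase.2 ⟨hjs, Finset.mem_univ j⟩)]
      · simp
      · rw [elemCurve_apply]
        simp [kron, hj]
    · simp [kron, h2]
  · exact fun h => absurd (Finset.mem_univ _) h

/-- The derivative of the tensor action at the identity, in the direction of an elementary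
matrix. -/
def glDeriv (t : TensorCoord n r) : TensorCoord n r :=
  (fun μ ν => kron σ μ * t.1 ρ ν + kron σ ν * t.1 μ ρ,
   fun k α l => -(kron α ρ * t.2.1 k σ l) +
     ∑ s, kron σ (l s) * t.2.1 k α (Function.update l s ρ),
   fun k l => ∑ s, kron σ (l s) * t.2.2.1 k (Function.update l s ρ),
   fun k l => ∑ s, kron σ (l s) * t.2.2.2 k (Function.update l s ρ))

lemma hasDerivAt_glAct (t : TensorCoord n r) :
    HasDerivAt (fun τ => glAct (elemCurve ρ σ τ) t) (glDeriv ρ σ t) 0 := by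
  simp only [glAct_eq]
  refine HasDerivAt.prodMk ?_ (HasDerivAt.prodMk ?_ (HasDerivAt.prodMk ?_ ?_))
  · refine hasDerivAt_pi.2 fun μ => hasDerivAt_pi.2 fun ν => ?_
    have h1 : ∀ a b, HasDerivAt (fun τ => elemCurve ρ σ τ a μ * elemCurve ρ σ τ b ν * t.1 a b)
        ((kron a ρ * kron σ μ * kron b ν + kron a μ * (kron b ρ * kron σ ν)) * t.1 a b) 0 := by
      intro a b
      have := ((hasDerivAt_elemCurve ρ σ a μ).mul (hasDerivAt_elemCurve ρ σ b ν)).mul_const (t.1 a b)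
      simpa [elemCurve_apply] using this
    refine (HasDerivAt.fun_sum fun a _ => HasDerivAt.fun_sum fun b _ => h1 a b).congr_deriv ?_
    simp [kron, add_mul, Finset.sum_add_distrib]
  · refine hasDerivAt_pi.2 fun k => hasDerivAt_pi.2 fun α => hasDerivAt_pi.2 fun l => ?_
    have h1 : ∀ τ', HasDerivAt (fun τ => (elemCurve ρ σ τ)⁻¹ α τ' *
        lowAct (elemCurve ρ σ τ) (t.2.1 k τ') l)
        (-(kron α ρ * kron σ τ') * t.2.1 k τ' l + kron α τ' *
          ∑ s, kron σ (l s) * t.2.1 k τ' (Function.update l s ρ)) 0 := by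
      intro τ'
      have := (hasDerivAt_elemCurve_inv ρ σ α τ').mul (hasDerivAt_lowAct ρ σ (t.2.1 k τ') l)
      rw [elemCurve_zero, inv_one, lowAct_one, Matrix.one_apply] at this
      exact this
    refine (HasDerivAt.fun_sum fun τ' _ => h1 τ').congr_deriv ?_
    simp [kron, Finset.sum_add_distrib]
  · exact hasDerivAt_pi.2 fun k => hasDerivAt_pi.2 fun l => hasDerivAt_lowAct ρ σ _ l
  · exact hasDerivAt_pi.2 fun k => hasDerivAt_pi.2 fun l => hasDerivAt_lowAct ρ σ _ l

end Infinitesimal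

/-! ### The covariance identities -/

section Identities

lemma apply_eq_sum_single {ι : Type*} [Fintype ι] [DecidableEq ι] {V : ι → Type*}
    [∀ i, AddCommGroup (V i)] [∀ i, Module ℝ (V i)] (L : (∀ i, V i) →ₗ[ℝ] ℝ) (v : ∀ i, V i) :
    L v = ∑ i, (L ∘ₗ LinearMap.single ℝ V i) (v i) := by
  conv_lhs => rw [← Finset.univ_sum_single v, map_sum]
  rfl

lemma apply_eq_sum_mul {ι : Type*} [Fintype ι] [DecidableEq ι] (L : (ι → ℝ) →ₗ[ℝ] ℝ) (v : ι → ℝ) :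
    L v = ∑ i, L (Pi.single i 1) * v i := by
  rw [apply_eq_sum_single]
  refine Finset.sum_congr rfl fun i _ => ?_
  have h1 : v i = v i • 1 := by simp
  conv_lhs => rw [h1, map_smul, smul_eq_mul, mul_comm]
  rfl

/-- The derivative in a tensorial direction, as the sum over the components. -/
lemma fderiv_tensor_eq_sum {n r : ℕ} (F : CovCoord n r → ℝ) (c : CovCoord n r)
    (t : TensorCoord n r) : fderiv ℝ F c (0, 0, t) =
      (∑ μ, ∑ ν, dMetric F c μ ν * t.1 μ ν) + (∑ k, ∑ α, ∑ l, dCurv F c k α l * t.2.1 k α l)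
      + (∑ k, ∑ l, dMass F c k l * t.2.2.1 k l) + (∑ k, ∑ l, dKappa F c k l * t.2.2.2 k l) := by
  set L := (fderiv ℝ F c : CovCoord n r →ₗ[ℝ] ℝ) ∘ₗ LinearMap.inr ℝ _ _ ∘ₗ LinearMap.inr ℝ _ _
    with hL
  have h1 : fderiv ℝ F c (0, 0, t) = (L ∘ₗ LinearMap.inl ℝ _ _) t.1 +
      (L ∘ₗ LinearMap.inr ℝ _ _ ∘ₗ LinearMap.inl ℝ _ _) t.2.1 +
      (L ∘ₗ LinearMap.inr ℝ _ _ ∘ₗ LinearMap.inr ℝ _ _ ∘ₗ LinearMap.inl ℝ _ _) t.2.2.1 +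
      (L ∘ₗ LinearMap.inr ℝ _ _ ∘ₗ LinearMap.inr ℝ _ _ ∘ₗ LinearMap.inr ℝ _ _) t.2.2.2 := by
    simp only [LinearMap.comp_apply, ← map_add]
    simp [hL]
  rw [h1]
  refine congrArg₂ (· + ·) (congrArg₂ (· + ·) (congrArg₂ (· + ·) ?_ ?_) ?_) ?_
  · rw [apply_eq_sum_single]
    exact Finset.sum_congr rfl fun μ _ => apply_eq_sum_mul _ _
  · rw [apply_eq_sum_single]
    refine Finset.sum_congr rfl fun k _ => ?_
    rw [apply_eq_sum_single]
    exact Finset.sum_congr rfl fun α _ => apply_eq_sum_mul _ _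
  · rw [apply_eq_sum_single]
    exact Finset.sum_congr rfl fun μ _ => apply_eq_sum_mul _ _
  · rw [apply_eq_sum_single]
    exact Finset.sum_congr rfl fun μ _ => apply_eq_sum_mul _ _

/-- The derivative in the direction of a curve along which the function is constant. -/
lemma fderiv_eq_zero_of_curve {V : Type*} [NormedAddCommGroup V] [NormedSpace ℝ V] {F : V → ℝ}
    {c v : V} (hF : DifferentiableAt ℝ F c) {γ : ℝ → V} (hγ : HasDerivAt γ v 0) (h0 : γ 0 = c)
    (hc : ∀ᶠ τ in 𝓝 0, F (γ τ) = F c) : fderiv ℝ F c v = 0 := by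
  subst h0
  exact (hF.hasFDerivAt.comp_hasDerivAt 0 hγ).unique
    ((hasDerivAt_const (0 : ℝ) (F (γ 0))).congr_of_eventuallyEq hc)

variable {n r : ℕ} {M : Type*} [TopologicalSpace M] [ChartedSpace (Model n) M]
  {e : OpenPartialHomeomorph M (Model n)} {f : JetBundle n M r → ℝ}

lemma symS_covAt (w : ℕ) {x : M} (h : LocalGeometry (n := n) x) :
    SymS (covAt w r e h).2.1 := fun k α =>
  isSymFirst_symFirst ((k : ℕ) + 2) fun l => dChristoffel (metricComp e h.g) k α l (e x)

lemma differentiableAt_covAt {w : ℕ} {F : CovCoord n r → ℝ}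
    (hF : Represents e f (covAt w r e) F) {x : M} (hx : x ∈ e.source)
    (h : LocalGeometry (n := n) x) : DifferentiableAt ℝ F (covAt w r e h) := by
  obtain ⟨U, hUo, hFU, hU⟩ := hF
  exact (hFU.contDiffAt (hUo.mem_nhds (hU x hx h).1)).differentiableAt (by simp)

variable [T2Space M] [IsManifold (𝓡 n) ∞ M] (he : e ∈ IsManifold.maximalAtlas (𝓡 n) ∞ M)
  (hf : DiffCovariant f) {w : ℕ} {F : CovCoord n r → ℝ} (hF : Represents e f (covAt w r e) F)
  {x : M} (hx : x ∈ e.source) (h : LocalGeometry (n := n) x)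
include he hf hF hx

/-- The finite form of covariance, near the identity. -/
lemma eventually_apply_eq :
    ∀ᶠ p : Model n × Matrix (Fin n) (Fin n) ℝ in 𝓝 (e x, 1), ∀ S : SArrays n r, SymS S →
      F (p.1, S, glAct p.2 (covAt w r e h).2.2) = F (covAt w r e h) := by
  obtain ⟨U, -, -, hU⟩ := hF
  filter_upwards [eventually_exists_covAt_eq he hf hx h] with p ⟨hp, hS⟩ S hSs
  obtain ⟨h', hf', hc'⟩ := hS S hSs
  rw [← hc' w, ← (hU x hx h).2, ← hf']
  exact ((hU _ (e.map_target hp) h').2).symm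

/-- The derivative of the finite form of covariance when the point moves. -/
lemma noPointDependence : NoPointDependence F (covAt w r e h) := by
  intro σ
  have hγ : HasDerivAt (fun τ : ℝ => ((e x + τ • EuclideanSpace.single σ (1 : ℝ) : Model n),
      (covAt w r e h).2)) (EuclideanSpace.single σ 1, 0) 0 := by
    refine HasDerivAt.prodMk ?_ (hasDerivAt_const _ _)
    simpa using ((hasDerivAt_id (0 : ℝ)).smul_const
      (EuclideanSpace.single σ (1 : ℝ) : Model n)).const_add (e x)
  refine fderiv_eq_zero_of_curve (differentiableAt_covAt hF hx h) hγ (by simp; rfl) ?_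
  have hlim : Filter.Tendsto (fun τ : ℝ => ((e x + τ • EuclideanSpace.single σ (1 : ℝ) : Model n),
      (1 : Matrix (Fin n) (Fin n) ℝ))) (𝓝 0) (𝓝 (e x, 1)) := by
    have : Continuous fun τ : ℝ => ((e x + τ • EuclideanSpace.single σ (1 : ℝ) : Model n),
      (1 : Matrix (Fin n) (Fin n) ℝ)) := by fun_prop
    simpa using this.tendsto 0
  filter_upwards [hlim.eventually (eventually_apply_eq he hf hF hx h)] with τ hτ
  have := hτ _ (symS_covAt (e := e) w h)
  rwa [glAct_one] at this

/-- The derivative of the finite form of covariance along symmetric changes of the `S`-coordinates. -/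
lemma noSDependence : NoSDependence F (covAt w r e h) := by
  intro T hT
  have hγ : HasDerivAt (fun τ : ℝ => (e x, (covAt w r e h).2.1 + τ • T, (covAt w r e h).2.2))
      (0, T, 0) 0 := by
    refine HasDerivAt.prodMk (hasDerivAt_const _ _)
      (HasDerivAt.prodMk ?_ (hasDerivAt_const _ _))
    simpa using ((hasDerivAt_id (0 : ℝ)).smul_const T).const_add (covAt w r e h).2.1
  refine fderiv_eq_zero_of_curve (differentiableAt_covAt hF hx h) hγ (by simp; rfl) ?_
  refine Filter.Eventually.of_forall fun τ => ?_
  have := (eventually_apply_eq he hf hF hx h).self_of_nhds ((covAt w r e h).2.1 + τ • T)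
    fun k α s hs l => by
      change (covAt w r e h).2.1 k α (l ∘ s) + τ * T k α (l ∘ s) = _
      rw [symS_covAt (e := e) w h k α s hs l, hT k α s hs l]
      rfl
  rwa [glAct_one] at this

/-- The derivative of the finite form of covariance along the one-parameter families
`1 + τ E` of matrices. -/
lemma glIdentity : GLIdentity F (covAt w r e h) := by
  intro σ ρ
  refine (fderiv_tensor_eq_sum F (covAt w r e h) (glDeriv ρ σ (covAt w r e h).2.2)).symm.trans ?_
  have hγ : HasDerivAt (fun τ : ℝ => (e x, (covAt w r e h).2.1,
      glAct (elemCurve ρ σ τ) (covAt w r e h).2.2)) (0, 0, glDeriv ρ σ (covAt w r e h).2.2) 0 :=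
    HasDerivAt.prodMk (hasDerivAt_const _ _)
      (HasDerivAt.prodMk (hasDerivAt_const _ _) (hasDerivAt_glAct ρ σ _))
  refine fderiv_eq_zero_of_curve (differentiableAt_covAt hF hx h) hγ
    (by rw [elemCurve_zero, glAct_one]; rfl) ?_
  have hlim : Filter.Tendsto (fun τ : ℝ => (e x, elemCurve ρ σ τ)) (𝓝 0) (𝓝 (e x, 1)) := by
    have : Continuous fun τ : ℝ => (e x, elemCurve ρ σ τ) := by
      unfold elemCurve
      fun_prop
    simpa [elemCurve_zero] using this.tendsto 0
  filter_upwards [hlim.eventually (eventually_apply_eq he hf hF hx h)] with τ hτ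
  exact hτ _ (symS_covAt (e := e) w h)

end Identities

/-! ### Connectedness of the matrices with positive determinant -/

section Connected

variable {ι : Type*} [Fintype ι] [DecidableEq ι]

/-- The matrix that changes the signs of two coordinates is the square of a product of three
transvections (a quarter turn). -/
lemma diagonal_neg_pair {i j : ι} (hij : i ≠ j) :
    Matrix.diagonal (fun k => if k = i ∨ k = j then (-1 : ℝ) else 1) =
      (Matrix.transvection i j (-1) * Matrix.transvection j i 1 * Matrix.transvection i j (-1)) *
      (Matrix.transvection i j (-1) * Matrix.transvection j i 1 *
        Matrix.transvection i j (-1)) := by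
  set a : Matrix ι ι ℝ := Matrix.single i j 1 with ha
  set b : Matrix ι ι ℝ := Matrix.single j i 1 with hb
  have h1 : Matrix.transvection i j (-1 : ℝ) = 1 - a := by
    rw [Matrix.transvection, sub_eq_add_neg, ha, ← Matrix.single_neg]
  have h2 : Matrix.transvection j i (1 : ℝ) = 1 + b := rfl
  have haa : a * a = 0 := by simp [ha, hij.symm]
  have hbb : b * b = 0 := by simp [hb, hij]
  have haba : a * b * a = a := by simp [ha, hb]
  have hJ : (1 - a) * (1 + b) * (1 - a) = 1 + b - a - a * b - b * a := by
    linear_combination (norm := noncomm_ring) haa + haba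
  have hbab : b * a * b = b := by simp [ha, hb]
  have hd : Matrix.diagonal (fun k => if k = i ∨ k = j then (-1 : ℝ) else 1) =
      1 - (2 : ℝ) • (a * b) - (2 : ℝ) • (b * a) := by
    ext k l
    rcases eq_or_ne k l with rfl | hkl
    · by_cases h3 : k = i
      · subst h3
        simp [ha, hb, hij.symm]
        norm_num
      · by_cases h4 : k = j
        · subst h4
          simp [ha, hb, hij]
          norm_num
        · simp [ha, hb, h3, h4, Ne.symm h3, Ne.symm h4]
    · have h5 : ∀ m, ¬ (m = k ∧ m = l) := fun m h => hkl (h.1.symm.trans h.2)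
      simp [ha, hb, hkl, h5]
  rw [h1, h2, hJ, hd, two_smul, two_smul]
  have e1 : a * b * (a * b) = a * b := by rw [← mul_assoc, haba]
  have e2 : b * a * (b * a) = b * a := by rw [← mul_assoc, hbab]
  have e3 : a * b * (b * a) = 0 := by rw [mul_assoc, ← mul_assoc b, hbb, zero_mul, mul_zero]
  have e4 : b * a * (a * b) = 0 := by rw [mul_assoc, ← mul_assoc a, haa, zero_mul, mul_zero]
  have e5 : a * (b * a) = a := by rw [← mul_assoc, haba]
  have e6 : b * (a * b) = b := by rw [← mul_assoc, hbab]
  have e7 : a * (a * b) = 0 := by rw [← mul_assoc, haa, zero_mul]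
  have e8 : b * (b * a) = 0 := by rw [← mul_assoc, hbb, zero_mul]
  have e9 : b * a * a = 0 := by rw [mul_assoc, haa, mul_zero]
  have e10 : a * b * b = 0 := by rw [mul_assoc, hbb, mul_zero]
  simp only [mul_sub, mul_add, sub_mul, add_mul, mul_one, one_mul, haa, hbb, haba, hbab, e1, e2, e3,
    e4, e5, e6, e7, e8, e9, e10]
  abel

/-- A property of matrices that is multiplicative, and holds at the end of every segment of
invertible matrices issuing from the identity, holds for all matrices with positive determinant. -/
lemma matrix_induction_of_det_pos (P : Matrix ι ι ℝ → Prop)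
    (hseg : ∀ E : Matrix ι ι ℝ, (∀ s ∈ Set.Icc (0 : ℝ) 1, (1 + s • E).det ≠ 0) → P (1 + E))
    (hmul : ∀ A B : Matrix ι ι ℝ, A.det ≠ 0 → B.det ≠ 0 → P A → P B → P (A * B))
    {A : Matrix ι ι ℝ} (hA : 0 < A.det) : P A := by
  have htr : ∀ (i j : ι) (c : ℝ), i ≠ j → P (Matrix.transvection i j c) := fun i j c hij => by
    refine hseg _ fun s _ => ?_
    have h1 : (1 : Matrix ι ι ℝ) + s • Matrix.single i j c = Matrix.transvection i j (s * c) := by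
      rw [Matrix.transvection, Matrix.smul_single, smul_eq_mul]
    rw [h1, Matrix.det_transvection_of_ne i j hij]
    exact one_ne_zero
  -- Diagonal matrices, by induction on the number of negative entries. These occur in pairs since the
  -- product is positive, and two of them are made positive by `diagonal_neg_pair`.
  have hdiag : ∀ (N : ℕ) (D : ι → ℝ), (Finset.univ.filter fun k => D k < 0).card = N →
      0 < ∏ k, D k → P (Matrix.diagonal D) := by
    intro N
    induction N using Nat.strong_induction_on with
    | _ N ih =>
      intro D hN hD
      have hD0 : ∀ k, D k ≠ 0 := fun k => Finset.prod_ne_zero_iff.1 hD.ne' k (Finset.mem_univ k)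
      by_cases hneg : ∃ i, D i < 0
      · obtain ⟨i, hi⟩ := hneg
        obtain ⟨j, hji, hj⟩ : ∃ j, j ≠ i ∧ D j < 0 := by
          by_contra! hno
          have h1 : 0 ≤ ∏ k ∈ Finset.univ.erase i, D k :=
            Finset.prod_nonneg fun k hk => hno k (Finset.ne_of_mem_erase hk)
          rw [← Finset.mul_prod_erase _ _ (Finset.mem_univ i)] at hD
          nlinarith
        set ε : ι → ℝ := fun k => if k = i ∨ k = j then -1 else 1 with hε
        have hεε : ∀ k, ε k * ε k = 1 := fun k => by
          simp only [hε]; split_ifs <;> norm_num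
        have hpair := diagonal_neg_pair (ι := ι) hji.symm
        have hεd : ∏ k, ε k = 1 := by
          rw [← Matrix.det_diagonal, hpair]
          simp [Matrix.det_mul, Matrix.det_transvection_of_ne _ _ hji,
            Matrix.det_transvection_of_ne _ _ hji.symm]
        have hε1 : P (Matrix.diagonal ε) := by
          rw [hpair]
          have d1 := Matrix.det_transvection_of_ne (R := ℝ) i j hji.symm (-1)
          have d2 := Matrix.det_transvection_of_ne (R := ℝ) j i hji 1
          have t1 := htr i j (-1) hji.symm
          have t2 := htr j i 1 hji
          have t3 := hmul _ _ (by simp [d1]) (by simp [d2]) t1 t2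
          have t4 := hmul _ _ (by simp [Matrix.det_mul, d1, d2]) (by simp [d1]) t3 t1
          exact hmul _ _ (by simp [Matrix.det_mul, d1, d2]) (by simp [Matrix.det_mul, d1, d2]) t4 t4
        have hprod : ∏ k, D k * ε k = ∏ k, D k := by
          rw [Finset.prod_mul_distrib, hεd, mul_one]
        have hlt : (Finset.univ.filter fun k => D k * ε k < 0).card < N := by
          rw [← hN]
          refine Finset.card_lt_card (Finset.ssubset_iff_of_subset ?_ |>.2 ⟨i, by simp [hi], ?_⟩)
          · intro k hk
            simp only [Finset.mem_filter, Finset.mem_univ, true_and] at hk ⊢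
            by_cases h1 : k = i ∨ k = j
            · rcases h1 with rfl | rfl <;> assumption
            · simpa [hε, h1] using hk
          · simp only [Finset.mem_filter, Finset.mem_univ, true_and, hε, true_or, if_true]
            linarith
        have h1 := ih _ hlt (fun k => D k * ε k) rfl (by rwa [hprod])
        have h2 := hmul _ _ (by rw [Matrix.det_diagonal, hprod]; exact hD.ne')
          (by rw [Matrix.det_diagonal, hεd]; exact one_ne_zero) h1 hε1
        rw [Matrix.diagonal_mul_diagonal] at h2
        simpa only [mul_assoc, hεε, mul_one] using h2
      · push Not at hneg
        -- positive entries: the segment to the identity consists of positive diagonal matrices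
        have h1 : Matrix.diagonal D = 1 + (Matrix.diagonal D - 1) := by abel
        rw [h1]
        refine hseg _ fun s hs => ?_
        have h2 : (1 : Matrix ι ι ℝ) + s • (Matrix.diagonal D - 1) =
            Matrix.diagonal fun k => 1 - s + s * D k := by
          ext k l
          rcases eq_or_ne k l with rfl | hkl
          · simp; ring
          · simp [hkl]
        rw [h2, Matrix.det_diagonal]
        refine Finset.prod_ne_zero_iff.2 fun k _ => ?_
        have h3 : 0 < D k := lt_of_le_of_ne (hneg k) (hD0 k).symm
        rcases eq_or_lt_of_le hs.1 with h4 | h4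
        · rw [← h4]; simp
        · have := mul_pos h4 h3
          linarith [hs.2]
  -- Every matrix is a product of transvections and a diagonal matrix of the same determinant.
  have h1 := Matrix.diagonal_transvection_induction (fun B => B.det ≠ 0 ∧ P B) A
    (fun D hD => ⟨by rw [hD]; exact hA.ne', hdiag _ D rfl (by
      rw [← Matrix.det_diagonal, hD]; exact hA)⟩)
    (fun t => ⟨by simp, htr t.i t.j t.c t.hij⟩)
    (fun B C hB hC => ⟨by simp [hB.1, hC.1], hmul B C hB.1 hC.1 hB.2 hC.2⟩)
  exact h1.2

/-- A function on tensorial coordinates that is invariant near the identity is invariant under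
all matrices with positive determinant. -/
lemma glAct_invariant {n r : ℕ} {Θ : TensorCoord n r → ℝ}
    (hΘ : ∀ t ∈ tensorDomain n r, ∀ᶠ A in 𝓝 (1 : Matrix (Fin n) (Fin n) ℝ), Θ (glAct A t) = Θ t)
    {A : Matrix (Fin n) (Fin n) ℝ} (hA : 0 < A.det) :
    ∀ t ∈ tensorDomain n r, Θ (glAct A t) = Θ t := by
  refine matrix_induction_of_det_pos (fun A => ∀ t ∈ tensorDomain n r, Θ (glAct A t) = Θ t)
    (fun E hE t ht => ?_) (fun A B hA _ hPA hPB t ht => ?_) hA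
  · set γ : ℝ → Matrix (Fin n) (Fin n) ℝ := fun s => 1 + s • E with hγ
    have hγc : Continuous γ := by fun_prop
    have key := isPreconnected_Icc.induction₂ (s := Set.Icc (0 : ℝ) 1)
      (fun s s' => Θ (glAct (γ s') t) = Θ (glAct (γ s) t)) (fun s hs => ?_)
      (fun _ _ _ _ _ _ h h' => h'.trans h) (fun _ _ _ _ h => h.symm)
      (Set.left_mem_Icc.2 zero_le_one) (Set.right_mem_Icc.2 zero_le_one)
    · simpa [hγ, glAct_one] using key
    · have hu : IsUnit (γ s).det := (hE s hs).isUnit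
      have h1 : Filter.Tendsto (fun s' => (γ s)⁻¹ * γ s') (𝓝 s) (𝓝 1) := by
        have : Continuous fun s' => (γ s)⁻¹ * γ s' := continuous_const.matrix_mul hγc
        simpa [Matrix.nonsing_inv_mul _ hu] using this.tendsto s
      refine nhdsWithin_le_nhds ?_
      filter_upwards [h1.eventually (hΘ _ (glAct_mem_tensorDomain hu ht))] with s' hs'
      rwa [← glAct_mul, ← mul_assoc, Matrix.mul_nonsing_inv _ hu, one_mul] at hs'
  · rw [glAct_mul, hPB _ (glAct_mem_tensorDomain hA.isUnit ht), hPA t ht]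

end Connected

/-! ### Functions of covariant scalars -/

section Final

variable {n r : ℕ} {M : Type*} [TopologicalSpace M] [ChartedSpace (Model n) M]
  {e : OpenPartialHomeomorph M (Model n)} {f : JetBundle n M r → ℝ}

lemma covDomain_subset_covSet {U : Set (Model n)} : covDomain r U ⊆ covSet n r :=
  fun _ hd => det_ne_zero_of_isLorentz hd.2.2.1

/-- The map from the whole curvature tensors to their symmetrizations. It reduces the representation
in the former to the representation in the latter. -/
def symmetrizeCurv (d : CovCoord n r) : CovCoord n r :=
  (d.1, d.2.1, d.2.2.1, fun k α => symFirst ((k : ℕ) + 2) (d.2.2.2.1 k α), d.2.2.2.2)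

lemma contDiff_symmetrizeCurv : ContDiff ℝ ∞ (symmetrizeCurv (n := n) (r := r)) := by
  have h : ContDiff ℝ ∞ (fun d : CovCoord n r => d.2.2.2.1) := by fun_prop
  refine contDiff_fst.prodMk (ContDiff.prodMk (by fun_prop) (ContDiff.prodMk (by fun_prop)
    (ContDiff.prodMk ?_ (by fun_prop))))
  refine contDiff_pi.2 fun k => contDiff_pi.2 fun α => contDiff_pi.2 fun l => ?_
  have hk := contDiff_pi.1 (contDiff_pi.1 h k) α
  exact (ContDiff.sum fun s _ => contDiff_pi.1 hk _).div_const _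

lemma symmetrizeCurv_fullCovCoord {x : M} (h : LocalGeometry (n := n) x) :
    symmetrizeCurv (fullCovCoord r e h) = covCoord r e h := by
  refine Prod.ext rfl (Prod.ext rfl (Prod.ext rfl (Prod.ext ?_ rfl)))
  funext k α
  exact symFirst_symFirst (Nat.le_add_right (k : ℕ) 2) (Nat.le_succ _)
    fun l => nablaRiemann (metricComp e h.g) k α l (e x)

/-- A change of coordinates turns a representative into a representative. -/
lemma Represents.comp {V V' : Type*} [NormedAddCommGroup V] [NormedSpace ℝ V]
    [NormedAddCommGroup V'] [NormedSpace ℝ V'] {C : ∀ {x : M}, LocalGeometry (n := n) x → V}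
    {C' : ∀ {x : M}, LocalGeometry (n := n) x → V'} {F : V → ℝ} (hF : Represents e f C F)
    {Ψ : V' → V} {D : Set V'} (hD : IsOpen D) (hΨ : ContDiffOn ℝ ∞ Ψ D)
    (hC : ∀ x ∈ e.source, ∀ h : LocalGeometry (n := n) x, C' h ∈ D ∧ Ψ (C' h) = C h) :
    Represents e f C' (F ∘ Ψ) := by
  obtain ⟨U, hU, hFU, hUC⟩ := hF
  refine ⟨D ∩ Ψ ⁻¹' U, hΨ.continuousOn.isOpen_inter_preimage hD hU,
    hFU.comp (hΨ.mono Set.inter_subset_left) fun _ h => h.2, fun x hx h => ?_⟩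
  obtain ⟨h1, h2⟩ := hC x hx h
  obtain ⟨h3, h4⟩ := hUC x hx h
  exact ⟨⟨h1, by rwa [Set.mem_preimage, h2]⟩, by rw [h4, Function.comp_apply, h2]⟩

variable (he : e ∈ IsManifold.maximalAtlas (𝓡 n) ∞ M)
include he

lemma covCoord_mem_covDomain {x : M} (hx : x ∈ e.source) (h : LocalGeometry (n := n) x) :
    covCoord r e h ∈ covDomain r e.target := by
  rw [← covOfJet_jetCoord h r he hx]
  exact covOfJet_mem (jetCoord_mem_jetDomain h r he hx)

lemma jetOfCov_covCoord {x : M} (hx : x ∈ e.source) (h : LocalGeometry (n := n) x) :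
    jetOfCov (covCoord r e h) = jetCoord r e h := by
  have h1 := jetOfCov_spec (covCoord_mem_covDomain (r := r) he hx h)
  exact injOn_covOfJet h1.1 (jetCoord_mem_jetDomain h r he hx)
    (h1.2.trans (covOfJet_jetCoord h r he hx).symm)

/-- The whole set of arrays that satisfy the constraints is attained by sections. -/
lemma exists_covCoord_eq {d : CovCoord n r} (hd : d ∈ covDomain r e.target) :
    ∃ x ∈ e.source, ∃ h : LocalGeometry (n := n) x, covCoord r e h = d := by
  obtain ⟨h1, h2⟩ := jetOfCov_spec hd
  obtain ⟨x, hx, h, h3⟩ := exists_jetCoord_eq he h1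
  exact ⟨x, hx, h, by rw [← covOfJet_jetCoord h r he hx, h3, h2]⟩

lemma exists_represents_covCoord (hs : SmoothOnJets f) : ∃ F, Represents e f (covCoord r e) F := by
  obtain ⟨F, hF⟩ := hs e he
  exact ⟨_, hF.comp isOpen_covSet contDiffOn_jetOfCov fun x hx h =>
    ⟨covDomain_subset_covSet (covCoord_mem_covDomain he hx h), jetOfCov_covCoord he hx h⟩⟩

lemma exists_represents_fullCovCoord (hs : SmoothOnJets f) :
    ∃ F, Represents e f (fullCovCoord r e) F := by
  obtain ⟨F, hF⟩ := exists_represents_covCoord he hs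
  exact ⟨_, hF.comp isOpen_univ contDiff_symmetrizeCurv.contDiffOn fun x hx h =>
    ⟨Set.mem_univ _, symmetrizeCurv_fullCovCoord h⟩⟩

variable [IsManifold (𝓡 n) ∞ M] [T2Space M]

/-- Over a connected chart, a covariant function is an invariant function of the tensorial
coordinates: evaluate it at a fixed point, with vanishing `S`-coordinates. -/
lemma exists_invariant_function (hs : SmoothOnJets f) (hf : DiffCovariant f)
    (hconn : IsPreconnected e.source) :
    ∃ (Θ : TensorCoord n r → ℝ) (W : Set (TensorCoord n r)),
      IsOpen W ∧ tensorDomain n r ⊆ W ∧ ContDiffOn ℝ ∞ Θ W ∧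
      (∀ t ∈ tensorDomain n r, ∀ A : Matrix (Fin n) (Fin n) ℝ, 0 < A.det →
        glAct A t ∈ tensorDomain n r ∧ Θ (glAct A t) = Θ t) ∧
      ∀ x ∈ e.source, ∀ h : LocalGeometry (n := n) x, f (jet r h) = Θ (tensorCoord r e h) := by
  -- Over the empty chart there is nothing to represent, and `Θ = 0` will do.
  rcases e.source.eq_empty_or_nonempty with hempty | ⟨x₀, hx₀⟩
  · refine ⟨0, Set.univ, isOpen_univ, Set.subset_univ _, contDiffOn_const, fun t ht A hA =>
      ⟨glAct_mem_tensorDomain hA.ne'.isUnit ht, rfl⟩, fun x hx => ?_⟩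
    rw [hempty] at hx
    exact absurd hx (Set.notMem_empty x)
  obtain ⟨F, hF⟩ := exists_represents_covCoord he hs
  have hloc : ∀ {u : Model n}, u ∈ e.target → ∀ {t : TensorCoord n r}, t ∈ tensorDomain n r →
      ∀ᶠ p : Model n × Matrix (Fin n) (Fin n) ℝ in 𝓝 (u, 1),
        F (p.1, 0, glAct p.2 t) = F (u, 0, t) := by
    intro u hu t ht
    obtain ⟨x, hx, h, hc⟩ := exists_covCoord_eq he (d := (u, 0, t)) ⟨hu, fun _ _ _ _ _ => rfl, ht⟩
    have hxu : e x = u := congrArg Prod.fst hc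
    have h1 := eventually_apply_eq (w := 2) he hf hF hx h
    rw [hxu] at h1
    have h2 : covAt 2 r e h = (u, 0, t) := hc
    rw [h2] at h1
    filter_upwards [h1] with p hp
    exact hp 0 fun _ _ _ _ _ => rfl
  have hpre : IsPreconnected e.target := by
    rw [← e.image_source_eq_target]
    exact hconn.image e e.continuousOn
  -- the value at `(u, 0, t)` is locally constant in `u`
  have hconst : ∀ {u : Model n}, u ∈ e.target → ∀ {t : TensorCoord n r}, t ∈ tensorDomain n r →
      F (u, 0, t) = F (e x₀, 0, t) := by
    intro u hu t ht
    refine hpre.induction₂ (fun u u' => F (u', 0, t) = F (u, 0, t)) (fun v hv => ?_)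
      (fun _ _ _ _ _ _ h h' => h'.trans h) (fun _ _ _ _ h => h.symm) (e.map_source hx₀) hu
    have h1 : Filter.Tendsto (fun v' : Model n => (v', (1 : Matrix (Fin n) (Fin n) ℝ))) (𝓝 v)
        (𝓝 (v, 1)) := (Continuous.prodMk_left _).tendsto v
    refine nhdsWithin_le_nhds ?_
    filter_upwards [h1.eventually (hloc hv ht)] with v' hv'
    rwa [glAct_one] at hv'
  obtain ⟨U, hU, hFU, hUC⟩ := id hF
  have hι : ContDiff ℝ ∞ fun t : TensorCoord n r => ((e x₀, 0, t) : CovCoord n r) :=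
    contDiff_const.prodMk (contDiff_const.prodMk contDiff_id)
  refine ⟨fun t => F (e x₀, 0, t), (fun t => (e x₀, 0, t)) ⁻¹' U, hU.preimage hι.continuous,
    fun t ht => ?_, hFU.comp hι.contDiffOn fun _ h => h, fun t ht A hA =>
    ⟨glAct_mem_tensorDomain hA.ne'.isUnit ht, ?_⟩, fun x hx h => ?_⟩
  · obtain ⟨x, hx, h, hc⟩ := exists_covCoord_eq he (d := (e x₀, 0, t))
      ⟨e.map_source hx₀, fun _ _ _ _ _ => rfl, ht⟩
    change (e x₀, 0, t) ∈ U
    rw [← hc]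
    exact (hUC x hx h).1
  · refine glAct_invariant (Θ := fun t => F (e x₀, 0, t)) (fun t ht => ?_) hA t ht
    have h1 : Filter.Tendsto (fun A : Matrix (Fin n) (Fin n) ℝ => (e x₀, A)) (𝓝 1)
        (𝓝 (e x₀, 1)) := (Continuous.prodMk_right _).tendsto 1
    exact h1.eventually (hloc (e.map_source hx₀) ht)
  · have h1 := (eventually_apply_eq (w := 2) he hf hF hx h).self_of_nhds 0 fun _ _ _ _ _ => rfl
    rw [glAct_one] at h1
    rw [(hUC x hx h).2]
    exact h1.symm.trans (hconst (e.map_source hx) (covCoord_mem_covDomain he hx h).2.2)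

end Final

end BackgroundJets

end

theorem mainTheorem7 (n r : ℕ) {M : Type*} [TopologicalSpace M] [T2Space M]
    [ChartedSpace (Model n) M] [IsManifold (𝓡 n) ∞ M] :
    -- the covariant coordinates are coordinates on the jet bundle
    (∀ e ∈ IsManifold.maximalAtlas (𝓡 n) ∞ M,
      ∃ (Φ : JetCoord n r → CovCoord n r) (Ψ : CovCoord n r → JetCoord n r)
        (U : Set (JetCoord n r)) (V : Set (CovCoord n r)),
        IsOpen U ∧ jetDomain r e.target ⊆ U ∧ ContDiffOn ℝ ∞ Φ U ∧
        IsOpen V ∧ covDomain r e.target ⊆ V ∧ ContDiffOn ℝ ∞ Ψ V ∧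
        Set.MapsTo Φ (jetDomain r e.target) (covDomain r e.target) ∧
        Set.MapsTo Ψ (covDomain r e.target) (jetDomain r e.target) ∧
        Set.InvOn Ψ Φ (jetDomain r e.target) (covDomain r e.target) ∧
        (∀ x ∈ e.source, ∀ h : LocalGeometry (n := n) x,
          jetCoord r e h ∈ jetDomain r e.target ∧ Φ (jetCoord r e h) = covCoord r e h) ∧
        (∀ c ∈ jetDomain r e.target, ∃ x ∈ e.source, ∃ h : LocalGeometry (n := n) x,
          jetCoord r e h = c)) ∧
    -- the identities satisfied by a smooth covariant function
    (∀ f : JetBundle n M r → ℝ, SmoothOnJets f → DiffCovariant f →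
      ∀ e ∈ IsManifold.maximalAtlas (𝓡 n) ∞ M,
        (∃ F, Represents e f (covCoord r e) F) ∧
        (∀ F, Represents e f (covCoord r e) F →
          ∀ x ∈ e.source, ∀ h : LocalGeometry (n := n) x,
            NoPointDependence F (covCoord r e h) ∧
            NoSDependence F (covCoord r e h) ∧
            GLIdentity F (covCoord r e h)) ∧
        (∃ F, Represents e f (fullCovCoord r e) F) ∧
        (∀ F, Represents e f (fullCovCoord r e) F →
          ∀ x ∈ e.source, ∀ h : LocalGeometry (n := n) x,
            NoPointDependence F (fullCovCoord r e h) ∧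
            NoSDependence F (fullCovCoord r e h) ∧
            GLIdentity F (fullCovCoord r e h)) ∧
        (IsPreconnected e.source →
          ∃ (Θ : TensorCoord n r → ℝ) (W : Set (TensorCoord n r)),
            IsOpen W ∧ tensorDomain n r ⊆ W ∧ ContDiffOn ℝ ∞ Θ W ∧
            (∀ t ∈ tensorDomain n r, ∀ A : Matrix (Fin n) (Fin n) ℝ, 0 < A.det →
              glAct A t ∈ tensorDomain n r ∧ Θ (glAct A t) = Θ t) ∧
            ∀ x ∈ e.source, ∀ h : LocalGeometry (n := n) x,
              f (jet r h) = Θ (tensorCoord r e h))) := by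
  refine ⟨fun e he => ⟨covOfJet, jetOfCov, jetSet n r, covSet n r, isOpen_jetSet,
    fun c hc => mem_jetSet hc, contDiffOn_covOfJet, isOpen_covSet, covDomain_subset_covSet,
    contDiffOn_jetOfCov, fun c hc => covOfJet_mem hc, fun d hd => (jetOfCov_spec hd).1,
    ⟨fun c hc => ?_, fun d hd => (jetOfCov_spec hd).2⟩, fun x hx h =>
    ⟨jetCoord_mem_jetDomain h r he hx, covOfJet_jetCoord h r he hx⟩,
    fun c hc => exists_jetCoord_eq he hc⟩, fun f hs hf e he =>
    ⟨exists_represents_covCoord he hs, fun F hF x hx h => ?_,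
      exists_represents_fullCovCoord he hs, fun F hF x hx h => ?_,
      fun hconn => exists_invariant_function he hs hf hconn⟩⟩
  · have h1 := jetOfCov_spec (covOfJet_mem hc)
    exact injOn_covOfJet h1.1 hc h1.2
  · exact ⟨noPointDependence (w := 2) he hf hF hx h, noSDependence (w := 2) he hf hF hx h,
      glIdentity (w := 2) he hf hF hx h⟩
  · exact ⟨noPointDependence (w := 0) he hf hF hx h, noSDependence (w := 0) he hf hF hx h,
      glIdentity (w := 0) he hf hF hx h⟩
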